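/- **Notation.** Let $k$ be a field and $A$ a finite dimensional Frobenius $k$-algebra: there is a non-degenerate bilinear form $\langle\ ,\ \rangle$ on $A$ with $\langle ab,c\rangle=\langle a,bc\rangle$. Let $\nu$ be its Nakayama automorphism, $\langle a,b\rangle=\langle b,\nu(a)\rangle$, and let $(u_i)$, $(v_i)$ be $k$-bases of $A$ with $\langle v_i,u_j\rangle=\delta_{ij}$. Write $\otimes=\otimes_k$, $\bar A=A/k1_A$, $\pi:A\to\bar A$, $\pi(a)=\bar a$. The normalized bar resolution is $\mathrm{Bar}_p(A)=A\otimes\bar A^{\otimes p}\otimes A$ with $$d_p(a_0\otimes\bar a_1\otimes\cdots\otimes\bar a_p\otimes a_{p+1})=\sum_{j=0}^{p}(-1)^j a_0\otimes\cdots\otimes a_ja_{j+1}\otimes\cdots\otimes a_{p+1},$$ $d_0:A\otimes A\to A$ is the multiplication, and $\overline\Omega^p(A)=\mathrm{Im}\,d_p$ (so $\overline\Omega^0(A)=A$). For a bimodule $M$, $C^s(A,M)=\mathrm{Hom}_k(\bar A^{\otimes s},M)=\mathrm{Hom}_{A^{\rm e}}(\mathrm{Bar}_s(A),M)$ with the differential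 $\delta^s=\mathrm{Hom}_{A^{\rm e}}(d_{s+1},M)$, and $\mathrm{Ext}^s_{A^{\rm e}}(A,M)$ is its cohomology. Also $C_p(A,A_{\nu^{-1}})=A\otimes\bar A^{\otimes p}$ with the differential $\partial$ of $A_{\nu^{-1}}\otimes_{A^{\rm e}}\mathrm{Bar}_\bullet(A)$, where $A_{\nu^{-1}}$ is $A$ with right action $m\cdot a=m\,\nu^{-1}(a)$. *Complete cohomology.* $\mathcal D^r=C^r(A,A)$ for $r\ge0$ and $\mathcal D^{r}=C_{-r-1}(A,A_{\nu^{-1}})$ for $r\le-1$ form a cochain complex with differentials $\delta$, $\partial$ and $\mu:\mathcal D^{-1}\to\mathcal D^0$, $\mu(a)=\sum_iu_iav_i$. Let $\widehat{\mathrm{HH}}^r(A)=H^r(\mathcal D)$; it is $\mathrm{Ext}^r_{A^{\rm e}}(A,A)$ for $r\ge1$ and $\mathrm{Tor}^{A^{\rm e}}_{-r-1}(A,A_{\nu^{-1}})$ for $r\le-2$; for $r=0$ it is $\mathrm{Ext}^0_{A^{\rm e}}(A,A)/\mathrm{Im}\,\mu$ and for $r=-1$ it is the kernel of the map induced by $\mu$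 on $\mathrm{Tor}_0^{A^{\rm e}}(A,A_{\nu^{-1}})$. Assume that $\nu$ is diagonalizable over $k$, let $A_\lambda$ denote the $\lambda$-eigenspace of $\nu$ and $\bar A_\lambda=\pi(A_\lambda)$. Let $\mathcal D_{(1)}\subseteq\mathcal D$ consist of the $f\in C^r(A,A)$ with $f(\bar A_{\lambda_1}\otimes\cdots\otimes\bar A_{\lambda_r})\subseteq A_{\lambda_1\cdots\lambda_r}$ for all $\lambda_i$, and of the chains in the span of the $A_{\lambda_0}\otimes\bar A_{\lambda_1}\otimes\cdots\otimes\bar A_{\lambda_p}$ with $\lambda_0\lambda_1\cdots\lambda_p=1$. Let $\widehat{\mathrm{HH}}^r_{(1)}(A)=H^r(\mathcal D_{(1)})$. *The bracket $\{\ ,\ \}$.* For $f\in C^m(A,A)$, $z=a_0\otimes\bar a_1\otimes\cdots\otimes\bar a_p\in C_p(A,A_{\nu^{-1}})$ with $m>p$, $N=m-p-1$, let $$(f\star z)(\bar b_1,\dots,\bar b_N)=\sum_if(\bar b_1,\dots,\bar b_N,\overline{u_i\nu(a_0)},\bar a_1,\dots,\bar a_p)\,v_i .$$ Let $\Delta^\nu:C^{r+1}(A,A)\to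 C^r(A,A)$ be given by $$\langle\Delta^\nu(f)(\bar a_1,\dots,\bar a_r),a_{r+1}\rangle=\sum_{i=1}^{r+1}(-1)^{ir}\langle f(\bar a_i,\dots,\bar a_{r+1},\overline{\nu a_1},\dots,\overline{\nu a_{i-1}}),1\rangle,$$ and let $B^{\nu^{-1}}:C_p(A,A_{\nu^{-1}})\to C_{p+1}(A,A_{\nu^{-1}})$ be $$B^{\nu^{-1}}(a_0\otimes\bar a_1\otimes\cdots\otimes\bar a_p)=\sum_{i=1}^{p+1}(-1)^{ip}\,1\otimes\bar a_i\otimes\cdots\otimes\bar a_p\otimes\bar a_0\otimes\overline{\nu^{-1}a_1}\otimes\cdots\otimes\overline{\nu^{-1}a_{i-1}}.$$ For $m>n\ge1$, $f\in\mathcal D^m$ and $z\in\mathcal D^{-n}$ put $|f|=m$, $|z|=-n$ and $$\{f,z\}=(-1)^{|f||z|+|f|+|z|}\Big((-1)^{|f|+1}\Delta^\nu(f\star z)+(-1)^{|f|}\Delta^\nu(f)\star z+(-1)^{|z|}f\star B^{\nu^{-1}}(z)\Big)\in\mathcal D^{m-n-1}.$$ *The bracket $[\ ,\ ]_{\rm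 sg}$.* For $p\ge1$ let $\pi^{(r)}=\mathrm{id}\otimes\mathrm{id}\otimes\pi:A\otimes\bar A^{\otimes p-1}\otimes A\to A\otimes\bar A^{\otimes p}$ and $\pi^{(b)}=\pi\otimes\mathrm{id}\otimes\pi:A\otimes\bar A^{\otimes p-1}\otimes A\to\bar A^{\otimes p+1}$; for $p=0$ let $\pi^{(r)}=\mathrm{id}_A$, $\pi^{(b)}=\pi$. For $f\in C^s(A,\overline\Omega^p(A))$ put $f^{(r)}=\pi^{(r)}f$, $f^{(b)}=\pi^{(b)}f$. For $f\in C^s(A,\overline\Omega^p(A))$ and $g\in C^t(A,\overline\Omega^q(A))$ with $s,t\ge1$, put $$f\bullet_ig=d_{p+q}\big((f^{(r)}\otimes\mathrm{id}^{\otimes q})(\mathrm{id}^{\otimes i-1}\otimes g^{(b)}\otimes\mathrm{id}^{\otimes s-i})\otimes1\big)\quad(1\le i\le s),$$ $$f\bullet_{-i}g=d_{p+q}\big((\mathrm{id}_A\otimes\mathrm{id}^{\otimes i-1}\otimes f^{(b)}\otimes\mathrm{id}^{\otimes q-i})(g^{(r)}\otimes\mathrm{id}^{\otimes s-1})\otimes1\big)\quad(1\le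 i\le q),$$ $$f\bullet g=\sum_{i=1}^s(-1)^{p+q+(i-1)(q-t-1)}f\bullet_ig+\sum_{i=1}^q(-1)^{p+q+i(p-s-1)}f\bullet_{-i}g,$$ $$[f,g]_{\rm sg}=f\bullet g-(-1)^{(s-p-1)(t-q-1)}g\bullet f\ \in C^{s+t-1}(A,\overline\Omega^{p+q}(A)).$$ *Tate–Hochschild cohomology.* Let $\theta_{s,p}:C^s(A,\overline\Omega^p(A))\to C^{s+1}(A,\overline\Omega^{p+1}(A))$ be $\theta_{s,p}(f)(\bar b_1,\dots,\bar b_{s+1})=(-1)^sd_{p+1}(f(\bar b_1,\dots,\bar b_s)\otimes\bar b_{s+1}\otimes1)$ (the last entry of $f(\dots)$ being replaced by its class in $\bar A$ if $p\ge1$), and let $\varphi_{s,p}=(-1)^s\theta_{s,p}$ if $s=0$ or $p=0$ and $\varphi_{s,p}=(-1)^{s-p}\theta_{s,p}$ otherwise. For $r\in\mathbb Z$ let $\underline{\mathrm{Ext}}^r_{A^{\rm e}}(A,A)$ be the direct limit over the $p\geq 0$ with $r+p\ge0$ of $\mathrm{Ext}^{r+p}_{A^{\rm e}}(A,\overline\Omega^p(A))$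 along the maps induced by $\varphi_{r+p,p}$. Let $\varphi^{n}_{s,p}=\varphi_{s+n-1,p+n-1}\cdots\varphi_{s,p}$. Finally let $\kappa_{p,1}:C_p(A,A_{\nu^{-1}})\to C^1(A,\overline\Omega^{p+2}(A))$ be $$\kappa_{p,1}(a_0\otimes\bar a_1\otimes\cdots\otimes\bar a_p)(\bar b)=\sum_jd_{p+2}\big(u_j\nu(a_0)\otimes\bar a_1\otimes\cdots\otimes\bar a_p\otimes\bar v_j\otimes\bar b\otimes1\big).$$ **Proposition.** Let $A$ be a finite dimensional Frobenius $k$-algebra whose Nakayama automorphism $\nu$ is diagonalizable over $k$, and let $m>n\ge1$ be integers. Then $\{\ ,\ \}$ induces a well-defined bilinear map $\widehat{\mathrm{HH}}^m_{(1)}(A)\times\widehat{\mathrm{HH}}^{-n}_{(1)}(A)\to\widehat{\mathrm{HH}}^{m-n-1}_{(1)}(A)$; $[\ ,\ ]_{\rm sg}$ induces well-defined bilinear maps $\mathrm{Ext}^m_{A^{\rm e}}(A,A)\times\mathrm{Ext}^1_{A^{\rm e}}(A,\overline\Omega^{n+1}(A))\to\mathrm{Ext}^m_{A^{\rm e}}(A,\overline\Omega^{n+1}(A))$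 and (through representatives in any $\mathrm{Ext}^{s}_{A^{\rm e}}(A,\overline\Omega^{p}(A))$, $\mathrm{Ext}^{t}_{A^{\rm e}}(A,\overline\Omega^{q}(A))$ with $s-p=m$, $t-q=-n$, $s,t\ge1$, $p,q\ge0$) $\underline{\mathrm{Ext}}^m_{A^{\rm e}}(A,A)\times\underline{\mathrm{Ext}}^{-n}_{A^{\rm e}}(A,A)\to\underline{\mathrm{Ext}}^{m-n-1}_{A^{\rm e}}(A,A)$; all vertical maps in the following diagram (induced by inclusion of complexes, by the identity, by $\kappa_{n-1,1}$ and $\varphi^{n+1}_{m-n-1,0}$, and the canonical maps to the direct limits) are well-defined isomorphisms; and both squares commute: $$\begin{array}{ccc} \widehat{\mathrm{HH}}^m_{(1)}(A)\otimes\widehat{\mathrm{HH}}^{-n}_{(1)}(A)&\xrightarrow{\{\ ,\ \}}&\widehat{\mathrm{HH}}^{m-n-1}_{(1)}(A)\\ \downarrow\cong&&\downarrow\cong\\ \widehat{\mathrm{HH}}^m(A)\otimes\widehat{\mathrm{HH}}^{-n}(A)&&\widehat{\mathrm{HH}}^{m-n-1}(A)\\ {\scriptstyle \mathrm{id}\otimes\kappa_{n-1,1}}\downarrow\cong&&{\scriptstyle\varphi^{n+1}_{m-n-1,0}}\downarrow\cong\\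 \mathrm{Ext}^m_{A^{\rm e}}(A,A)\otimes\mathrm{Ext}^1_{A^{\rm e}}(A,\overline\Omega^{n+1}(A))&\xrightarrow{[\ ,\ ]_{\rm sg}}&\mathrm{Ext}^m_{A^{\rm e}}(A,\overline\Omega^{n+1}(A))\\ \downarrow\cong&&\downarrow\cong\\ \underline{\mathrm{Ext}}^m_{A^{\rm e}}(A,A)\otimes\underline{\mathrm{Ext}}^{-n}_{A^{\rm e}}(A,A)&\xrightarrow{[\ ,\ ]_{\rm sg}}&\underline{\mathrm{Ext}}^{m-n-1}_{A^{\rm e}}(A,A). \end{array}$$ -/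

import Mathlib

open scoped TensorProduct DirectSum

universe u

namespace TateHH

noncomputable section

/-! ### The normalized bar resolution

`A` is an algebra over the field `k`, `Abar = A / k·1`, and `Bar_p = A ⊗ Abar^{⊗p} ⊗ A`. -/

section BarResolution

variable (k A : Type u) [Field k] [Ring A] [Algebra k A]

/-- `Abar = A / k·1`. -/
abbrev Abar : Type u := A ⧸ (Submodule.span k {(1 : A)})

/-- The canonical projection `π : A → Abar`. -/
abbrev proj : A →ₗ[k] Abar k A := (Submodule.span k {(1 : A)}).mkQ

/-- `Abar^{⊗n}`. -/
abbrev TPow (n : ℕ) : Type u := ⨂[k]^n (Abar k A)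

/-- `A ⊗ Abar^{⊗p}`. -/
abbrev LBar (p : ℕ) : Type u := A ⊗[k] TPow k A p

/-- `Bar_p = A ⊗ Abar^{⊗p} ⊗ A`. -/
abbrev Bar (p : ℕ) : Type u := LBar k A p ⊗[k] A

/-- The augmented bar resolution with a shift of the index by one: the module in position `0` is
`A`, the module in position `p + 1` is `Bar_p`. Thus the differential `d_p` goes from `Bar_p` to
`BarAug p`. -/
def BarAug : ℕ → Type u
  | 0 => A
  | p + 1 => Bar k A p

instance : ∀ p, AddCommGroup (BarAug k A p)
  | 0 => inferInstanceAs (AddCommGroup A)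
  | p + 1 => inferInstanceAs (AddCommGroup (Bar k A p))

instance : ∀ p, Module k (BarAug k A p)
  | 0 => inferInstanceAs (Module k A)
  | p + 1 => inferInstanceAs (Module k (Bar k A p))

theorem barWord_update_aux (p : ℕ) (w : Fin (p + 2) → A) (i : Fin p) (z : A) :
    (fun t : Fin p => proj k A (Function.update w i.castSucc.succ z t.succ.castSucc)) =
      Function.update (fun t : Fin p => proj k A (w t.succ.castSucc)) i (proj k A z) := by
  ext t
  by_cases h : t = i
  · subst h
    rw [Function.update_self, ← Fin.succ_castSucc, Function.update_self]
  · have h' : t.succ.castSucc ≠ i.castSucc.succ := by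
      simpa [Fin.ext_iff] using h
    rw [Function.update_of_ne h, Function.update_of_ne h']

/-- `(w₀, …, w_{p+1}) ↦ w₀ ⊗ π(w₁) ⊗ ⋯ ⊗ π(w_p) ⊗ w_{p+1}`. -/
def barWord (p : ℕ) : MultilinearMap k (fun _ : Fin (p + 2) => A) (Bar k A p) :=
  MultilinearMap.mk'
    (fun w => (w 0 ⊗ₜ PiTensorProduct.tprod k (fun i : Fin p => proj k A (w i.succ.castSucc)))
      ⊗ₜ w (Fin.last _))
    (by
      intro w i x y
      refine Fin.cases ?_ (fun i => ?_) i
      · simp [TensorProduct.add_tmul, Fin.castSucc_succ, Fin.succ_ne_zero]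
      · refine Fin.lastCases ?_ (fun i => ?_) i
        · have h0 : ∀ t : Fin p, t.succ.castSucc ≠ (Fin.last (p + 1)) := fun t =>
            (Fin.castSucc_lt_last _).ne
          have h1 : (0 : Fin (p + 2)) ≠ Fin.last (p + 1) := by simp [Fin.ext_iff]
          simp only [Fin.succ_last, Function.update_self, Function.update_of_ne h1,
            Function.update_of_ne (h0 _), TensorProduct.tmul_add]
        · have h1 : (0 : Fin (p + 2)) ≠ i.castSucc.succ := by simp [Fin.ext_iff]
          have h2 : Fin.last (p + 1) ≠ i.castSucc.succ := by
            have := i.2; simp only [ne_eq, Fin.ext_iff]; simp; omega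
          simp only [Function.update_of_ne h1, Function.update_of_ne h2, barWord_update_aux,
            map_add, MultilinearMap.map_update_add, TensorProduct.tmul_add,
            TensorProduct.add_tmul])
    (by
      intro w i c x
      refine Fin.cases ?_ (fun i => ?_) i
      · simp [TensorProduct.smul_tmul', Fin.castSucc_succ, Fin.succ_ne_zero]
      · refine Fin.lastCases ?_ (fun i => ?_) i
        · have h0 : ∀ t : Fin p, t.succ.castSucc ≠ (Fin.last (p + 1)) := fun t =>
            (Fin.castSucc_lt_last _).ne
          have h1 : (0 : Fin (p + 2)) ≠ Fin.last (p + 1) := by simp [Fin.ext_iff]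
          simp only [Fin.succ_last, Function.update_self, Function.update_of_ne h1,
            Function.update_of_ne (h0 _), TensorProduct.tmul_smul]
        · have h1 : (0 : Fin (p + 2)) ≠ i.castSucc.succ := by simp [Fin.ext_iff]
          have h2 : Fin.last (p + 1) ≠ i.castSucc.succ := by
            have := i.2; simp only [ne_eq, Fin.ext_iff]; simp; omega
          simp only [Function.update_of_ne h1, Function.update_of_ne h2, barWord_update_aux,
            map_smul, MultilinearMap.map_update_smul, TensorProduct.tmul_smul,
            TensorProduct.smul_tmul'])

theorem barWord_apply (p : ℕ) (w : Fin (p + 2) → A) :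
    barWord k A p w =
      (w 0 ⊗ₜ PiTensorProduct.tprod k (fun i : Fin p => proj k A (w i.succ.castSucc)))
        ⊗ₜ w (Fin.last _) := rfl

theorem contractNth_update {n : ℕ} (j : Fin (n + 1)) (w : Fin (n + 2) → A) (i : Fin (n + 2)) :
    ∃ (i' : Fin (n + 1)) (l : A →ₗ[k] A), ∀ x : A,
      Fin.contractNth j.castSucc (· * ·) (Function.update w i x) =
        Function.update (Fin.contractNth j.castSucc (· * ·) w) i' (l x) := by
  rcases lt_trichotomy (i : ℕ) (j : ℕ) with h | h | h
  · refine ⟨⟨i, by omega⟩, LinearMap.id, fun x => ?_⟩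
    ext t
    simp only [Fin.contractNth, Function.update_apply, Fin.ext_iff, Fin.val_castSucc,
      Fin.val_succ, LinearMap.id_apply]
    grind
  · refine ⟨j, LinearMap.mulRight k (w j.succ), fun x => ?_⟩
    ext t
    by_cases ht : t = j
    · subst ht
      simp only [Fin.contractNth, Function.update_apply, Fin.ext_iff, Fin.val_castSucc,
        Fin.val_succ, LinearMap.mulRight_apply]
      grind
    · simp only [Fin.contractNth, Function.update_apply, Fin.ext_iff, Fin.val_castSucc,
        Fin.val_succ, LinearMap.mulRight_apply] at ht ⊢
      grind
  · by_cases h' : (i : ℕ) = j + 1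
    · refine ⟨j, LinearMap.mulLeft k (w j.castSucc), fun x => ?_⟩
      ext t
      by_cases ht : t = j
      · subst ht
        simp only [Fin.contractNth, Function.update_apply, Fin.ext_iff, Fin.val_castSucc,
          Fin.val_succ, LinearMap.mulLeft_apply]
        grind
      · simp only [Fin.contractNth, Function.update_apply, Fin.ext_iff, Fin.val_castSucc,
          Fin.val_succ, LinearMap.mulLeft_apply] at ht ⊢
        grind
    · refine ⟨⟨i - 1, by omega⟩, LinearMap.id, fun x => ?_⟩
      ext t
      simp only [Fin.contractNth, Function.update_apply, Fin.ext_iff, Fin.val_castSucc,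
        Fin.val_succ, LinearMap.id_apply]
      grind

/-- The alternating sum of the faces,
`w ↦ ∑_{j=0}^{p+1} (-1)^j (w₀, …, w_j w_{j+1}, …, w_{p+2})` in `Bar_p`. -/
def faceSum (p : ℕ) : MultilinearMap k (fun _ : Fin (p + 3) => A) (Bar k A p) :=
  MultilinearMap.mk'
    (fun w => ∑ j : Fin (p + 2), (-1 : k) ^ (j : ℕ) •
      barWord k A p (Fin.contractNth j.castSucc (· * ·) w))
    (by
      intro w i x y
      rw [← Finset.sum_add_distrib]
      refine Finset.sum_congr rfl fun j _ => ?_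
      obtain ⟨i', l, h⟩ := contractNth_update k A j w i
      simp only [h, map_add, MultilinearMap.map_update_add, smul_add])
    (by
      intro w i c x
      rw [Finset.smul_sum]
      refine Finset.sum_congr rfl fun j _ => ?_
      obtain ⟨i', l, h⟩ := contractNth_update k A j w i
      simp only [h, map_smul, MultilinearMap.map_update_smul, smul_comm c])

theorem faceSum_apply (p : ℕ) (w : Fin (p + 3) → A) :
    faceSum k A p w = ∑ j : Fin (p + 2), (-1 : k) ^ (j : ℕ) •
      barWord k A p (Fin.contractNth j.castSucc (· * ·) w) := rfl

theorem barWord_eq_zero (p : ℕ) (w : Fin (p + 2) → A) (i : Fin p)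
    (hi : w i.succ.castSucc = 1) : barWord k A p w = 0 := by
  rw [barWord_apply]
  have h : PiTensorProduct.tprod k (fun i : Fin p => proj k A (w i.succ.castSucc)) = 0 := by
    apply MultilinearMap.map_coord_zero _ i
    rw [hi]
    simp
  rw [h, TensorProduct.tmul_zero, TensorProduct.zero_tmul]

theorem faceSum_eq_zero (p : ℕ) (w : Fin (p + 3) → A) (i : Fin (p + 1))
    (hi : w i.succ.castSucc = 1) : faceSum k A p w = 0 := by
  rw [faceSum_apply]
  have hne : i.castSucc ≠ i.succ := by simp [Fin.ext_iff]
  rw [Fintype.sum_eq_add i.castSucc i.succ hne]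
  · have : Fin.contractNth i.castSucc.castSucc (· * ·) w =
        Fin.contractNth i.succ.castSucc (· * ·) w := by
      ext t
      simp only [Fin.contractNth, Fin.val_castSucc, Fin.val_succ]
      rcases lt_trichotomy (t : ℕ) i with h | h | h
      · rw [if_pos h, if_pos (by omega)]
      · have e1 : t.succ = i.succ.castSucc := by ext; simp [h]
        rw [if_neg (by omega), if_pos h, if_pos (by omega), e1, hi, mul_one]
      · rw [if_neg (by omega), if_neg (by omega), if_neg (by omega)]
        split_ifs with h2
        · have e1 : t.castSucc = i.succ.castSucc := by ext; simp [h2]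
          rw [e1, hi, one_mul]
        · rfl
    rw [this, ← add_smul]
    simp [pow_succ]
  · intro j ⟨h1, h2⟩
    have h1' : (j : ℕ) ≠ i := fun h => h1 (by ext; simpa using h)
    have h2' : (j : ℕ) ≠ i + 1 := fun h => h2 (by ext; simpa using h)
    rcases lt_or_gt_of_ne h1' with h | h
    · have hi0 : 0 < (i : ℕ) := by omega
      rw [barWord_eq_zero k A p _ ⟨i - 1, by omega⟩, smul_zero]
      have e : (⟨(i : ℕ) - 1, by omega⟩ : Fin p).succ.castSucc.succ = i.succ.castSucc := by
        ext; simp; omega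
      rw [Fin.contractNth_apply_of_gt, e, hi]
      simp; omega
    · rw [barWord_eq_zero k A p _ ⟨i, by omega⟩, smul_zero]
      rw [Fin.contractNth_apply_of_lt]
      · rw [← hi]; congr 1
      · simp; omega

theorem exists_section : ∃ s : Abar k A →ₗ[k] A, proj k A ∘ₗ s = LinearMap.id :=
  (proj k A).exists_rightInverse_of_surjective
    (LinearMap.range_eq_top.2 (Submodule.mkQ_surjective _))

/-- A linear section of `π : A → Abar`. The differential of the bar resolution is written with it;
`barD_barWord_succ` shows that the choice does not matter. -/
def sec : Abar k A →ₗ[k] A := (exists_section k A).choose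

theorem proj_sec (x : Abar k A) : proj k A (sec k A x) = x :=
  LinearMap.congr_fun (exists_section k A).choose_spec x

theorem map_sec_proj {n : ℕ} {M : Type*} [AddCommMonoid M] [Module k M]
    (f : MultilinearMap k (fun _ : Fin n => A) M)
    (hf : ∀ a i, a i = 1 → f a = 0) (a : Fin n → A) :
    f (fun i => sec k A (proj k A (a i))) = f a := by
  classical
  have key : ∀ (S : Finset (Fin n)),
      f (fun i => if i ∈ S then sec k A (proj k A (a i)) else a i) = f a := by
    intro S
    induction S using Finset.induction_on with
    | empty => simp
    | insert j S hj ih =>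
      rw [← ih]
      have hx : sec k A (proj k A (a j)) - a j ∈ Submodule.span k {(1 : A)} := by
        rw [← Submodule.Quotient.eq]
        exact proj_sec k A (proj k A (a j))
      obtain ⟨c, hc⟩ := Submodule.mem_span_singleton.1 hx
      set g : Fin n → A := fun i => if i ∈ S then sec k A (proj k A (a i)) else a i with hg
      have e1 : (fun i => if i ∈ insert j S then sec k A (proj k A (a i)) else a i) =
          Function.update g j (a j + c • 1) := by
        ext i
        by_cases hij : i = j
        · subst hij; simp [hc]
        · simp [hij, hg]
      have e2 : Function.update g j (a j) = g := by
        rw [Function.update_eq_self_iff]; simp [hg, hj]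
      rw [e1, MultilinearMap.map_update_add, MultilinearMap.map_update_smul, e2,
        hf (Function.update g j 1) j (by simp), smul_zero, add_zero]
  simpa using key Finset.univ

/-- `A ⊗ Abar^{⊗0} ≅ A`. -/
def zeroEquiv : LBar k A 0 ≃ₗ[k] A :=
  (TensorProduct.congr (LinearEquiv.refl k A) (PiTensorProduct.isEmptyEquiv (Fin 0))).trans
    (TensorProduct.rid k A)

/-- `d_{p+1} : Bar_{p+1} → Bar_p`. -/
def barDSucc (p : ℕ) : Bar k A (p + 1) →ₗ[k] Bar k A p :=
  TensorProduct.lift (TensorProduct.lift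
    (PiTensorProduct.lift.toLinearMap ∘ₗ
      MultilinearMap.compLinearMapₗ (fun _ => sec k A) ∘ₗ
      (multilinearCurryRightEquiv k (fun _ : Fin (p + 2) => A) (Bar k A p)).toLinearMap ∘ₗ
      (faceSum k A p).curryLeft))

/-- The differential `d_p` of the augmented normalized bar resolution; `d_0` is the
multiplication. -/
def barD : (p : ℕ) → Bar k A p →ₗ[k] BarAug k A p
  | 0 => LinearMap.mul' k A ∘ₗ TensorProduct.map (zeroEquiv k A).toLinearMap LinearMap.id
  | p + 1 => barDSucc k A p

theorem barD_barWord_zero (w : Fin 2 → A) : barD k A 0 (barWord k A 0 w) = (w 0 * w 1 : A) := by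
  have h : (LinearMap.mul' k A ∘ₗ TensorProduct.map (zeroEquiv k A).toLinearMap LinearMap.id)
      (barWord k A 0 w) = w 0 * w 1 := by
    rw [barWord_apply, LinearMap.comp_apply, TensorProduct.map_tmul]
    simp [zeroEquiv]
  exact h

/-- The formula
`d_{p+1}(a₀ ⊗ ā₁ ⊗ ⋯ ⊗ ā_{p+1} ⊗ a_{p+2}) = ∑_j (-1)^j a₀ ⊗ ⋯ ⊗ a_j a_{j+1} ⊗ ⋯ ⊗ a_{p+2}`. -/
theorem barD_barWord_succ (p : ℕ) (w : Fin (p + 3) → A) :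
    barD k A (p + 1) (barWord k A (p + 1) w) =
      (∑ j : Fin (p + 2), (-1 : k) ^ (j : ℕ) •
        barWord k A p (Fin.contractNth j.castSucc (· * ·) w) : Bar k A p) := by
  rw [← faceSum_apply, barWord_apply]
  change barDSucc k A p _ = _
  have h := map_sec_proj k A ((faceSum k A p).curryLeft (w 0)).curryRight (n := p + 1) ?_
    (fun i => w i.succ.castSucc)
  · have h2 := LinearMap.congr_fun h (w (Fin.last _))
    simp only [barDSucc, TensorProduct.lift.tmul, LinearMap.comp_apply, LinearEquiv.coe_coe,
      PiTensorProduct.lift.tprod]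
    refine h2.trans ?_
    simp only [MultilinearMap.curryRight_apply, MultilinearMap.curryLeft_apply]
    congr 1
    have e : (Fin.snoc (fun i : Fin (p + 1) => w i.succ.castSucc) (w (Fin.last (p + 2))) :
        Fin (p + 2) → A) = Fin.tail w := by
      ext t
      refine Fin.lastCases ?_ (fun t => ?_) t
      · simp [Fin.tail]
      · simp [Fin.tail]
    rw [e, Fin.cons_self_tail]
  · intro a i hi
    ext b
    simp only [MultilinearMap.curryRight_apply, MultilinearMap.curryLeft_apply,
      LinearMap.zero_apply]
    apply faceSum_eq_zero k A p _ i
    rw [← Fin.succ_castSucc, Fin.cons_succ, Fin.snoc_castSucc, hi]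

/-- `Ωbar^p(A) = Im d_p`; in particular `Ωbar^0(A) = A`. -/
def Om (p : ℕ) : Submodule k (BarAug k A p) := LinearMap.range (barD k A p)

/-- Left multiplication `a ⊗ m ↦ a m` of the bimodules `A`, `Bar_p`. -/
def lact : (p : ℕ) → A ⊗[k] BarAug k A p →ₗ[k] BarAug k A p
  | 0 => LinearMap.mul' k A
  | p + 1 =>
      ((LinearMap.mul' k A).rTensor (TPow k A p) ∘ₗ
        (TensorProduct.assoc k A A (TPow k A p)).symm.toLinearMap).rTensor A ∘ₗ
      (TensorProduct.assoc k A (LBar k A p) A).symm.toLinearMap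

/-- Right multiplication `m ⊗ a ↦ m a` of the bimodules `A`, `Bar_p`. -/
def ract : (p : ℕ) → BarAug k A p ⊗[k] A →ₗ[k] BarAug k A p
  | 0 => LinearMap.mul' k A
  | p + 1 =>
      (LinearMap.mul' k A).lTensor (LBar k A p) ∘ₗ
      (TensorProduct.assoc k (LBar k A p) A A).toLinearMap

/-- `x ↦ 1 ⊗ x`. -/
def oneL (n : ℕ) : TPow k A n →ₗ[k] LBar k A n := TensorProduct.mk k A (TPow k A n) 1

/-- `y ↦ y ⊗ 1`. -/
def oneR (n : ℕ) : LBar k A n →ₗ[k] Bar k A n := (TensorProduct.mk k (LBar k A n) A).flip 1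

/-- `y ↦ d_n (y ⊗ 1)` for `y ∈ A ⊗ Abar^{⊗n}`. -/
def dOne (n : ℕ) : LBar k A n →ₗ[k] BarAug k A n := barD k A n ∘ₗ oneR k A n

/-- `Abar^{⊗N} ≅ Abar^{⊗a} ⊗ Abar^{⊗b}` for `N = a + b`. -/
def cut {N a b : ℕ} (h : N = a + b) : TPow k A N ≃ₗ[k] TPow k A a ⊗[k] TPow k A b :=
  (TensorPower.cast k (Abar k A) h).trans TensorPower.mulEquiv.symm

/-- `π` as a map `A → Abar^{⊗1}`. -/
def projT : A →ₗ[k] TPow k A 1 :=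
  (PiTensorProduct.subsingletonEquiv (R := k) (s := fun _ => Abar k A)
    (0 : Fin 1)).symm.toLinearMap ∘ₗ proj k A

/-- `id^{⊗a} ⊗ g ⊗ id^{⊗b}`. -/
def onMiddle {N N' n n' : ℕ} (a b : ℕ) (h : N = a + n + b) (h' : N' = a + n' + b)
    (g : TPow k A n →ₗ[k] TPow k A n') : TPow k A N →ₗ[k] TPow k A N' :=
  (cut k A h').symm.toLinearMap ∘ₗ
    ((cut k A (rfl : a + n' = a + n')).symm.toLinearMap ∘ₗ g.lTensor (TPow k A a) ∘ₗ
      (cut k A (rfl : a + n = a + n)).toLinearMap).rTensor (TPow k A b) ∘ₗ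
    (cut k A h).toLinearMap

/-- The identification `(A ⊗ Abar^{⊗p}) ⊗ Abar^{⊗q} ≅ A ⊗ Abar^{⊗P}` for `P = p + q`. -/
def appendL {P p q : ℕ} (h : P = p + q) : LBar k A p ⊗[k] TPow k A q →ₗ[k] LBar k A P :=
  (cut k A h).symm.toLinearMap.lTensor A ∘ₗ
    (TensorProduct.assoc k A (TPow k A p) (TPow k A q)).toLinearMap

/-- `π_p^{(r)} = id ⊗ id^{⊗p-1} ⊗ π : A ⊗ Abar^{⊗p-1} ⊗ A → A ⊗ Abar^{⊗p}`
(the identity of `A` for `p = 0`). -/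
def piR : (p : ℕ) → BarAug k A p →ₗ[k] LBar k A p
  | 0 => (zeroEquiv k A).symm.toLinearMap
  | p + 1 => appendL k A (rfl : p + 1 = p + 1) ∘ₗ (projT k A).lTensor (LBar k A p)

/-- `π_p^{(b)} = π ⊗ id^{⊗p-1} ⊗ π : A ⊗ Abar^{⊗p-1} ⊗ A → Abar^{⊗p+1}`
(the projection `π` for `p = 0`). -/
def piB (p : ℕ) : BarAug k A p →ₗ[k] TPow k A (p + 1) :=
  (cut k A (Nat.add_comm p 1)).symm.toLinearMap ∘ₗ (projT k A).rTensor (TPow k A p) ∘ₗ piR k A p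

end BarResolution

/-! ### Cohomology of a three-term piece of a complex -/

section Subquotient

variable {k : Type*} [Field k]

/-- The cohomology `Z / B`. -/
abbrev Coh {C : Type*} [AddCommGroup C] [Module k C] (Z B : Submodule k C) : Type _ :=
  Z ⧸ B.submoduleOf Z

/-- The class of a cocycle. -/
abbrev Coh.cls {C : Type*} [AddCommGroup C] [Module k C] (Z B : Submodule k C) :
    Z →ₗ[k] Coh Z B := (B.submoduleOf Z).mkQ

/-- `e` is the map induced on cohomology by the map `φ` of (co)chains: `φ` maps cocycles to
cocycles and `e [x] = [φ x]`. -/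
def Induces {C C' : Type*} [AddCommGroup C] [Module k C] [AddCommGroup C'] [Module k C']
    {Z B : Submodule k C} {Z' B' : Submodule k C'} (e : Coh Z B → Coh Z' B') (φ : C → C') : Prop :=
  ∀ x : Z, ∃ h : φ x ∈ Z', e (Coh.cls Z B x) = Coh.cls Z' B' ⟨φ x, h⟩

/-- `e` is the pairing induced on cohomology by the pairing `φ` of (co)chains: `φ` maps pairs of
cocycles to cocycles and `e [x] [y] = [φ x y]`. -/
def Induces₂ {C₁ C₂ C' : Type*} [AddCommGroup C₁] [Module k C₁] [AddCommGroup C₂] [Module k C₂]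
    [AddCommGroup C'] [Module k C'] {Z₁ B₁ : Submodule k C₁} {Z₂ B₂ : Submodule k C₂}
    {Z' B' : Submodule k C'} (e : Coh Z₁ B₁ →ₗ[k] Coh Z₂ B₂ →ₗ[k] Coh Z' B')
    (φ : C₁ → C₂ → C') : Prop :=
  ∀ (x : Z₁) (y : Z₂), ∃ h : φ x y ∈ Z',
    e (Coh.cls Z₁ B₁ x) (Coh.cls Z₂ B₂ y) = Coh.cls Z' B' ⟨φ x y, h⟩

end Subquotient

/-! ### `Ext^s(A, Ωbar^p(A))`, the bracket `[ , ]_sg`, and Tate-Hochschild cohomology -/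

section Singular

variable (k A : Type u) [Field k] [Ring A] [Algebra k A]

/-- `Hom_k(Abar^{⊗s}, M)` where `M = A` for `p = 0` and `M = Bar_{p-1}` for `p ≥ 1`. -/
abbrev Coch (s p : ℕ) : Type u := TPow k A s →ₗ[k] BarAug k A p

/-- The bimodule map `Bar_s → M`, `a ⊗ x ⊗ b ↦ a f(x) b`, that corresponds to `f`. -/
def bimodExt {s p : ℕ} (f : Coch k A s p) : Bar k A s →ₗ[k] BarAug k A p :=
  ract k A p ∘ₗ (lact k A p ∘ₗ f.lTensor A).rTensor A

/-- The Hochschild differential `Hom_{A^e}(d_{s+1}, M)`, under the identification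
`Hom_{A^e}(Bar_s, M) = Hom_k(Abar^{⊗s}, M)`. -/
def delta (s p : ℕ) : Coch k A s p →ₗ[k] Coch k A (s + 1) p where
  toFun f := bimodExt k A f ∘ₗ barD k A (s + 1) ∘ₗ oneR k A (s + 1) ∘ₗ oneL k A (s + 1)
  map_add' f g := by
    simp only [bimodExt, LinearMap.lTensor_add, LinearMap.comp_add, LinearMap.rTensor_add,
      LinearMap.add_comp]
  map_smul' c f := by
    simp only [bimodExt, LinearMap.lTensor_smul, LinearMap.comp_smul, LinearMap.rTensor_smul,
      LinearMap.smul_comp, RingHom.id_apply]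

/-- The cochains with values in `Ωbar^p(A)`, i.e. `C^s(A, Ωbar^p(A))`. -/
def omCoch (s p : ℕ) : Submodule k (Coch k A s p) where
  carrier := {f | ∀ x, f x ∈ Om k A p}
  add_mem' hf hg x := add_mem (hf x) (hg x)
  zero_mem' _ := zero_mem _
  smul_mem' c _ hf x := Submodule.smul_mem _ c (hf x)

/-- The cocycles of `C^s(A, Ωbar^p(A))`. -/
def extZ (s p : ℕ) : Submodule k (Coch k A s p) := LinearMap.ker (delta k A s p) ⊓ omCoch k A s p

/-- The coboundaries of `C^s(A, Ωbar^p(A))`. -/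
def extB : (s p : ℕ) → Submodule k (Coch k A s p)
  | 0, _ => ⊥
  | s + 1, p => (omCoch k A s p).map (delta k A s p)

/-- `Ext_{A^e}^s(A, Ωbar^p(A))` as the Hochschild cohomology `H^s(A, Ωbar^p(A))`. -/
abbrev ExtOm (s p : ℕ) : Type u := Coh (extZ k A s p) (extB k A s p)

variable {k A}

/-- `f •_i g` (with `i` shifted by one): `d ∘ (- ⊗ 1) ∘ (f^{(r)} ⊗ id^{⊗q}) ∘
(id^{⊗i} ⊗ g^{(b)} ⊗ id^{⊗s-1-i})`. -/
def bulletPos {s p t q N P : ℕ} (hN : N + 1 = s + t) (hP : P = p + q)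
    (f : Coch k A s p) (g : Coch k A t q) (i : Fin s) : Coch k A N P :=
  dOne k A P ∘ₗ appendL k A hP ∘ₗ (piR k A p ∘ₗ f).rTensor (TPow k A q) ∘ₗ
    (cut k A (rfl : s + q = s + q)).toLinearMap ∘ₗ
    onMiddle k A (i : ℕ) (s - 1 - i) (by omega) (by omega) (piB k A q ∘ₗ g)

/-- `f •_{-i} g` (with `i` shifted by one): `d ∘ (- ⊗ 1) ∘ (id_A ⊗ id^{⊗i} ⊗ f^{(b)} ⊗ id^{⊗q-1-i})
∘ (g^{(r)} ⊗ id^{⊗s-1})`. -/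
def bulletNeg {s p t q N P : ℕ} (hs : 1 ≤ s) (hN : N + 1 = s + t) (hP : P = p + q)
    (f : Coch k A s p) (g : Coch k A t q) (i : Fin q) : Coch k A N P :=
  dOne k A P ∘ₗ
    (onMiddle k A (i : ℕ) (q - 1 - i) (by omega) (by omega) (piB k A p ∘ₗ f)).lTensor A ∘ₗ
    appendL k A (rfl : q + (s - 1) = q + (s - 1)) ∘ₗ
    (piR k A q ∘ₗ g).rTensor (TPow k A (s - 1)) ∘ₗ
    (cut k A (by omega : N = t + (s - 1))).toLinearMap

/-- `f • g = ∑_{i=1}^s (-1)^{p+q+(i-1)(q-t-1)} f •_i g + ∑_{i=1}^q (-1)^{p+q+i(p-s-1)} f •_{-i} g`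
for `f ∈ C^s(A, Ωbar^p)`, `g ∈ C^t(A, Ωbar^q)`. (In the code the index is shifted by one, and
signs in the exponents are dropped since only the parity matters.) -/
def bullet {s p t q N P : ℕ} (hs : 1 ≤ s) (hN : N + 1 = s + t) (hP : P = p + q)
    (f : Coch k A s p) (g : Coch k A t q) : Coch k A N P :=
  (∑ i : Fin s, (-1 : k) ^ (p + q + (i : ℕ) * (q + t + 1)) • bulletPos hN hP f g i) +
    ∑ i : Fin q, (-1 : k) ^ (p + q + ((i : ℕ) + 1) * (p + s + 1)) • bulletNeg hs hN hP f g i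

/-- `[f, g]_sg = f • g - (-1)^{(s-p-1)(t-q-1)} g • f` for `f ∈ C^s(A, Ωbar^p)`,
`g ∈ C^t(A, Ωbar^q)` with `s, t ≥ 1`; it lies in `C^N(A, Ωbar^P)` for `N = s + t - 1`,
`P = p + q`. -/
def bracketSg {s p t q N P : ℕ} (hs : 1 ≤ s) (ht : 1 ≤ t) (hN : N + 1 = s + t) (hP : P = p + q)
    (f : Coch k A s p) (g : Coch k A t q) : Coch k A N P :=
  bullet hs hN hP f g - (-1 : k) ^ ((s + p + 1) * (t + q + 1)) •
    bullet ht (hN.trans (Nat.add_comm s t)) (hP.trans (Nat.add_comm p q)) g f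

variable (k A)

/-- The connecting map `θ_{s,p} : C^s(A, Ωbar^p) → C^{s+1}(A, Ωbar^{p+1})`,
`θ(f)(b₁, …, b_{s+1}) = (-1)^s d_{p+1}(f(b₁, …, b_s) ⊗ b_{s+1} ⊗ 1)`. -/
def theta (s p : ℕ) (f : Coch k A s p) : Coch k A (s + 1) (p + 1) :=
  (-1 : k) ^ s • (dOne k A (p + 1) ∘ₗ appendL k A (rfl : p + 1 = p + 1) ∘ₗ
    (piR k A p ∘ₗ f).rTensor (TPow k A 1) ∘ₗ (cut k A (rfl : s + 1 = s + 1)).toLinearMap)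

/-- The structure map `φ_{s,p}` of the inductive system of the `Ext^s(A, Ωbar^p(A))` with
`s - p = m` fixed: `φ = (-1)^s θ` at the first term of the system (which is the one with `s = 0`
or `p = 0`), and `φ = (-1)^m θ` at the others. -/
def phi (s p : ℕ) (f : Coch k A s p) : Coch k A (s + 1) (p + 1) :=
  (-1 : k) ^ (if s = 0 ∨ p = 0 then s else s + p) • theta k A s p f

/-- The composite `φ^n = φ_{s+n-1,p+n-1} ∘ ⋯ ∘ φ_{s,p}`. -/
def phiIter (s p : ℕ) (f : Coch k A s p) : (n : ℕ) → Coch k A (s + n) (p + n)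
  | 0 => f
  | n + 1 => phi k A (s + n) (p + n) (phiIter s p f n)

/-- Transport along equalities of the indices. -/
def Coch.cast {s p s' p' : ℕ} (hs : s = s') (hp : p = p') (f : Coch k A s p) : Coch k A s' p' :=
  hs ▸ hp ▸ f

/-- The index set of the inductive system with degree `r`: the pairs `(s, p)` with `s - p = r`. -/
abbrev Level (r : ℤ) : Type := {sp : ℕ × ℕ // (sp.1 : ℤ) - (sp.2 : ℤ) = r}

/-- The terms of the inductive system with degree `r`. -/
def LevelExt (r : ℤ) (i : Level r) : Type u := ExtOm k A i.1.1 i.1.2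

instance (r : ℤ) (i : Level r) : AddCommGroup (LevelExt k A r i) :=
  inferInstanceAs (AddCommGroup (ExtOm k A i.1.1 i.1.2))

instance (r : ℤ) (i : Level r) : Module k (LevelExt k A r i) :=
  inferInstanceAs (Module k (ExtOm k A i.1.1 i.1.2))

/-- The direct sum of the terms of the inductive system with degree `r`. -/
abbrev LevelSum (r : ℤ) : Type u := DirectSum (Level r) (LevelExt k A r)

/-- The relations `[f] ∼ [φ f]` of the direct limit. -/
def limRel (r : ℤ) : Submodule k (LevelSum k A r) :=
  Submodule.span k {x | ∃ (s p : ℕ) (h : (s : ℤ) - (p : ℤ) = r)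
    (h' : ((s + 1 : ℕ) : ℤ) - ((p + 1 : ℕ) : ℤ) = r)
    (f : extZ k A s p) (g : extZ k A (s + 1) (p + 1)),
    (g : Coch k A (s + 1) (p + 1)) = phi k A s p f ∧
    x = DirectSum.lof k (Level r) (LevelExt k A r) ⟨(s, p), h⟩
          (Coh.cls (extZ k A s p) (extB k A s p) f) -
        DirectSum.lof k (Level r) (LevelExt k A r) ⟨(s + 1, p + 1), h'⟩
          (Coh.cls (extZ k A (s + 1) (p + 1)) (extB k A (s + 1) (p + 1)) g)}

/-- The Tate-Hochschild cohomology in degree `r ∈ ℤ`: the direct limit over `p` of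
`Ext^{r+p}(A, Ωbar^p(A))` along the maps `φ`. -/
abbrev TateExt (r : ℤ) : Type u :=
  LevelSum k A r ⧸ limRel k A r

/-- The canonical map of `Ext^s(A, Ωbar^p(A))` to the direct limit. -/
def TateExt.of {r : ℤ} (s p : ℕ) (h : (s : ℤ) - (p : ℤ) = r) :
    ExtOm k A s p →ₗ[k] TateExt k A r :=
  (limRel k A r).mkQ ∘ₗ
    DirectSum.lof k (Level r) (LevelExt k A r) ⟨(s, p), h⟩

variable {k A}

/-- `e` is the bracket of degree `-1` on Tate-Hochschild cohomology (in degrees `a`, `b`) that is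
induced by the bracket `[ , ]_sg` of representatives, at all levels with positive exponents. -/
def InducesTate {a b c : ℤ} (e : TateExt k A a →ₗ[k] TateExt k A b →ₗ[k] TateExt k A c) : Prop :=
  ∀ (s p t q N P : ℕ) (hs : 1 ≤ s) (ht : 1 ≤ t) (hN : N + 1 = s + t) (hP : P = p + q)
    (ha : (s : ℤ) - (p : ℤ) = a) (hb : (t : ℤ) - (q : ℤ) = b) (hc : (N : ℤ) - (P : ℤ) = c)
    (f : extZ k A s p) (g : extZ k A t q),
    ∃ h : bracketSg hs ht hN hP (f : Coch k A s p) (g : Coch k A t q) ∈ extZ k A N P,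
      e (TateExt.of k A s p ha (Coh.cls (extZ k A s p) (extB k A s p) f))
          (TateExt.of k A t q hb (Coh.cls (extZ k A t q) (extB k A t q) g)) =
        TateExt.of k A N P hc (Coh.cls (extZ k A N P) (extB k A N P)
          ⟨bracketSg hs ht hN hP (f : Coch k A s p) (g : Coch k A t q), h⟩)

end Singular

/-! ### Frobenius algebras and the complete cohomology -/

/-- A Frobenius algebra structure on the finite dimensional algebra `A`: an associative
non-degenerate bilinear form `⟨ , ⟩`, with its Nakayama automorphism `ν`, given by
`⟨a, b⟩ = ⟨b, ν a⟩`, and a pair of dual bases `(u_i)`, `(v_i)`, with `⟨v_i, u_j⟩ = δ_{ij}`. -/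
structure FrobeniusData (k A ι : Type*) [Field k] [Ring A] [Algebra k A] [DecidableEq ι] where
  /-- the form `⟨ , ⟩` -/
  form : LinearMap.BilinForm k A
  form_assoc : ∀ a b c : A, form (a * b) c = form a (b * c)
  form_nondegenerate : form.Nondegenerate
  /-- the Nakayama automorphism -/
  nu : A ≃ₐ[k] A
  form_nu : ∀ a b : A, form a b = form b (nu a)
  /-- the basis `(u_i)` -/
  u : Module.Basis ι k A
  /-- the dual basis `(v_i)` -/
  v : Module.Basis ι k A
  form_v_u : ∀ i j : ι, form (v i) (u j) = if i = j then 1 else 0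

section Frobenius

variable {k A ι : Type u} [Field k] [Ring A] [Algebra k A]

/-- The map `Abar → Abar` induced by an automorphism `σ` of `A`. -/
def barMap (σ : A ≃ₐ[k] A) : Abar k A →ₗ[k] Abar k A :=
  Submodule.mapQ _ _ σ.toLinearMap (by
    rw [Submodule.span_le, Set.singleton_subset_iff]
    change σ 1 ∈ Submodule.span k {(1 : A)}
    rw [map_one]
    exact Submodule.mem_span_singleton_self 1)

/-- `a₀ ⊗ ā₁ ⊗ ⋯ ⊗ ā_p ↦ ā_{j+1} ⊗ ⋯ ⊗ ā_p ⊗ ā₀ ⊗ σ(a₁)‾ ⊗ ⋯ ⊗ σ(a_j)‾`, for `0 ≤ j ≤ p`. -/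
def rot (σ : A ≃ₐ[k] A) {M p : ℕ} (hM : M = p + 1) (j : Fin (p + 1)) :
    LBar k A p →ₗ[k] TPow k A M :=
  (cut k A (by omega : M = (p - j) + (1 + j))).symm.toLinearMap ∘ₗ
    (TensorProduct.comm k (TPow k A (1 + j)) (TPow k A (p - j))).toLinearMap ∘ₗ
    (cut k A (rfl : 1 + (j : ℕ) = 1 + j)).symm.toLinearMap.rTensor (TPow k A (p - j)) ∘ₗ
    (TensorProduct.assoc k (TPow k A 1) (TPow k A j) (TPow k A (p - j))).symm.toLinearMap ∘ₗ
    TensorProduct.map (projT k A)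
      ((PiTensorProduct.map (fun _ => barMap σ) :
        TPow k A j →ₗ[k] TPow k A j).rTensor (TPow k A (p - j)) ∘ₗ
        (cut k A (by omega : p = j + (p - j))).toLinearMap)

/-- The twisted Connes operator `B_p^σ`,
`B(a₀ ⊗ ā₁ ⊗ ⋯ ⊗ ā_p) = ∑_{i=1}^{p+1} (-1)^{ip} 1 ⊗ ā_i ⊗ ⋯ ⊗ ā_p ⊗ ā₀ ⊗ σ(a₁)‾ ⊗ ⋯ ⊗ σ(a_{i-1})‾`,
as a map `C_p → C_M`, `M = p + 1`. -/
def connes (σ : A ≃ₐ[k] A) {M p : ℕ} (hM : M = p + 1) : LBar k A p →ₗ[k] LBar k A M :=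
  ∑ j : Fin (p + 1), (-1 : k) ^ (((j : ℕ) + 1) * p) • (oneL k A M ∘ₗ rot σ hM j)

/-- `m ⊗ (a ⊗ x ⊗ b) ↦ b m σ(a) ⊗ x`, i.e. `A_σ ⊗_{A^e} Bar_p = A_σ ⊗ Abar^{⊗p}`, where `A_σ` is
`A` with the right multiplication twisted by `σ`. -/
def coinv (σ : A ≃ₐ[k] A) (p : ℕ) : A ⊗[k] Bar k A p →ₗ[k] LBar k A p :=
  (LinearMap.mul' k A ∘ₗ
    TensorProduct.map (LinearMap.mul' k A ∘ₗ (TensorProduct.comm k A A).toLinearMap)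
      σ.toLinearMap).rTensor (TPow k A p) ∘ₗ
  (TensorProduct.assoc k (A ⊗[k] A) A (TPow k A p)).symm.toLinearMap ∘ₗ
  (TensorProduct.assoc k A A (LBar k A p)).symm.toLinearMap ∘ₗ
  (TensorProduct.comm k (LBar k A p) A).toLinearMap.lTensor A

/-- The differential `id ⊗_{A^e} d_{p+1}` of the Hochschild chain complex
`C_p(A, A_σ) = A ⊗ Abar^{⊗p}`. -/
def bdry (σ : A ≃ₐ[k] A) (p : ℕ) : LBar k A (p + 1) →ₗ[k] LBar k A p :=
  coinv σ p ∘ₗ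
    (barDSucc k A p ∘ₗ oneR k A (p + 1) ∘ₗ oneL k A (p + 1)).lTensor A

variable [Fintype ι] [DecidableEq ι] (F : FrobeniusData k A ι)

namespace FrobeniusData

/-- `ν` is diagonalizable over `k`: `A` is the sum of the eigenspaces of `ν`. -/
def NuDiagonalizable : Prop :=
  ⨆ μ : k, Module.End.eigenspace (F.nu.toLinearMap : Module.End k A) μ = ⊤

/-- The element `a` of `A` as a cochain in `C^0(A, A)`. -/
def cochZero (k : Type u) {A : Type u} [Field k] [Ring A] [Algebra k A] : A →ₗ[k] Coch k A 0 0 :=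
  LinearMap.smulRightₗ (M := A) (PiTensorProduct.isEmptyEquiv (R := k) (Fin 0)).toLinearMap

/-- The map `A_{ν⁻¹} → A`, `a ↦ ∑ᵢ uᵢ a vᵢ`, from `C_0(A, A_{ν⁻¹})` to `C^0(A, A)`. -/
def normMap : LBar k A 0 →ₗ[k] Coch k A 0 0 :=
  cochZero k ∘ₗ
    (∑ i, LinearMap.mulRight k (F.v i : A) ∘ₗ LinearMap.mulLeft k (F.u i : A) : A →ₗ[k] A) ∘ₗ
    (zeroEquiv k A).toLinearMap

/-! The complete complex `D` of `A` has `D^r = C^r(A, A) = Coch k A r 0` for `r ≥ 0`,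
`D^{-p-1} = C_p(A, A_{ν⁻¹}) = LBar k A p` for `p ≥ 0`, and the differentials `delta`, `normMap`
(from degree `-1` to `0`) and `bdry`. -/

/-- The cocycles of `D` in degree `r ≥ 0`. -/
def posZ (_F : FrobeniusData k A ι) (r : ℕ) : Submodule k (Coch k A r 0) :=
  LinearMap.ker (delta k A r 0)

/-- The coboundaries of `D` in degree `r ≥ 0`. -/
def posB : (r : ℕ) → Submodule k (Coch k A r 0)
  | 0 => LinearMap.range F.normMap
  | r + 1 => LinearMap.range (delta k A r 0)

/-- The cocycles of `D` in degree `-p-1`. -/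
def negZ : (p : ℕ) → Submodule k (LBar k A p)
  | 0 => LinearMap.ker F.normMap
  | p + 1 => LinearMap.ker (bdry F.nu.symm p)

/-- The coboundaries of `D` in degree `-p-1`. -/
def negB (p : ℕ) : Submodule k (LBar k A p) := LinearMap.range (bdry F.nu.symm p)

/-- The complete cohomology in degree `r ≥ 0`; it is `Ext^r(A, A)` for `r ≥ 1`. -/
abbrev HHpos (r : ℕ) : Type u := Coh (F.posZ r) (F.posB r)

/-- The complete cohomology in degree `-p-1`; it is `Tor_p(A, A_{ν⁻¹})` for `p ≥ 1`. -/
abbrev HHneg (p : ℕ) : Type u := Coh (F.negZ p) (F.negB p)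

/-- `D_{(1)}^r = C_{(1)}^r(A, A)` for `r ≥ 0`: the cochains `f` with
`f(Abar_{μ₁} ⊗ ⋯ ⊗ Abar_{μ_r}) ⊆ A_{μ₁⋯μ_r}`, where `A_μ` is the eigenspace of `ν`. -/
def posD1 (r : ℕ) : Submodule k (Coch k A r 0) where
  carrier := {f | ∀ (μ : Fin r → k) (a : Fin r → A),
    (∀ i, a i ∈ Module.End.eigenspace (F.nu.toLinearMap : Module.End k A) (μ i)) →
    (show A from f (PiTensorProduct.tprod k (fun i => proj k A (a i)))) ∈
      Module.End.eigenspace (F.nu.toLinearMap : Module.End k A) (∏ i, μ i)}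
  add_mem' hf hg μ a ha := add_mem (hf μ a ha) (hg μ a ha)
  zero_mem' _ _ _ := zero_mem _
  smul_mem' c _ hf μ a ha := Submodule.smul_mem _ c (hf μ a ha)

/-- `D_{(1)}^{-p-1} = C_p^{(1)}(A, A_{ν⁻¹})`: the span of the
`A_{μ₀} ⊗ Abar_{μ₁} ⊗ ⋯ ⊗ Abar_{μ_p}` with `μ₀ μ₁ ⋯ μ_p = 1`. (A product of eigenvalues of `ν` is
`1` if and only if the product of their inverses, eigenvalues of `ν⁻¹`, is.) -/
def negD1 (p : ℕ) : Submodule k (LBar k A p) :=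
  Submodule.span k {z | ∃ (μ₀ : k) (μ : Fin p → k) (a₀ : A) (a : Fin p → A),
    a₀ ∈ Module.End.eigenspace (F.nu.toLinearMap : Module.End k A) μ₀ ∧
    (∀ i, a i ∈ Module.End.eigenspace (F.nu.toLinearMap : Module.End k A) (μ i)) ∧
    μ₀ * ∏ i, μ i = 1 ∧
    z = a₀ ⊗ₜ PiTensorProduct.tprod k (fun i => proj k A (a i))}

/-- The cocycles of `D_{(1)}` in degree `r ≥ 0`. -/
def posZ1 (r : ℕ) : Submodule k (Coch k A r 0) := F.posZ r ⊓ F.posD1 r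

/-- The coboundaries of `D_{(1)}` in degree `r ≥ 0`. -/
def posB1 : (r : ℕ) → Submodule k (Coch k A r 0)
  | 0 => (F.negD1 0).map F.normMap
  | r + 1 => (F.posD1 r).map (delta k A r 0)

/-- The cocycles of `D_{(1)}` in degree `-p-1`. -/
def negZ1 (p : ℕ) : Submodule k (LBar k A p) := F.negZ p ⊓ F.negD1 p

/-- The coboundaries of `D_{(1)}` in degree `-p-1`. -/
def negB1 (p : ℕ) : Submodule k (LBar k A p) := (F.negD1 (p + 1)).map (bdry F.nu.symm p)

/-- The cohomology of `D_{(1)}` in degree `r ≥ 0`. -/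
abbrev HH1pos (r : ℕ) : Type u := Coh (F.posZ1 r) (F.posB1 r)

/-- The cohomology of `D_{(1)}` in degree `-p-1`. -/
abbrev HH1neg (p : ℕ) : Type u := Coh (F.negZ1 p) (F.negB1 p)

/-- The `⋆`-product of `f ∈ C^m(A, A)` and `z = a₀ ⊗ ā_{1,p} ∈ C_p(A, A_{ν⁻¹})` for `m > p`,
`(f ⋆ z)(b₁, …, b_N) = ∑ᵢ f(b₁, …, b_N, uᵢ ν(a₀), a₁, …, a_p) vᵢ`, where `N = m - p - 1`. -/
def star {m p N : ℕ} (h : m = N + (p + 1)) (f : Coch k A m 0) (z : LBar k A p) : Coch k A N 0 :=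
  ∑ i, (LinearMap.mulRight k (F.v i) : A →ₗ[k] A) ∘ₗ (f : TPow k A m →ₗ[k] A) ∘ₗ
    (cut k A h).symm.toLinearMap ∘ₗ
    (TensorProduct.mk k (TPow k A N) (TPow k A (p + 1))).flip
      ((cut k A (Nat.add_comm p 1)).symm
        ((projT k A ∘ₗ LinearMap.mulLeft k (F.u i) ∘ₗ F.nu.toLinearMap).rTensor (TPow k A p) z))

/-- `Δ^ν : C^M(A, A) → C^r(A, A)`, `M = r + 1`, characterized by `⟨Δ(f)(a₁, …, a_r), a_M⟩ =
∑_{i=1}^M (-1)^{ir} ⟨f(a_i, …, a_M, ν a₁, …, ν a_{i-1}), 1⟩`. It is written with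
`x = ∑_l ⟨x, u_l⟩ v_l`. -/
def Delta {M r : ℕ} (hM : M = r + 1) (f : Coch k A M 0) : Coch k A r 0 :=
  ∑ l, LinearMap.smulRight
    (∑ j : Fin (r + 1), (-1 : k) ^ (((j : ℕ) + 1) * r) •
      (F.form.flip 1 ∘ₗ (f : TPow k A M →ₗ[k] A) ∘ₗ rot F.nu hM j ∘ₗ
        TensorProduct.mk k A (TPow k A r) (F.u l)))
    (F.v l : A)

/-- `{f, z} = (-1)^{|f||z|+|f|+|z|} ((-1)^{|f|+1} Δ^ν(f ⋆ z) + (-1)^{|f|} Δ^ν(f) ⋆ z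
+ (-1)^{|z|} f ⋆ B^{ν⁻¹}(z))` for `f ∈ D^m = C^m(A, A)`, `z ∈ D^{-n} = C_{n-1}(A, A_{ν⁻¹})`, with
`m > n ≥ 1`, `|f| = m`, `|z| = -n`. (Signs in the exponents are dropped.) -/
def brace {m n : ℕ} (hn : 1 ≤ n) (hmn : n < m) (f : Coch k A m 0) (z : LBar k A (n - 1)) :
    Coch k A (m - n - 1) 0 :=
  (-1 : k) ^ (m * n + m + n) •
    ((-1 : k) ^ (m + 1) •
        F.Delta (rfl : m - n - 1 + 1 = m - n - 1 + 1)
          (F.star (by omega : m = m - n - 1 + 1 + (n - 1 + 1)) f z) +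
      (-1 : k) ^ m •
        F.star (by omega : m - 1 = m - n - 1 + (n - 1 + 1))
          (F.Delta (by omega : m = m - 1 + 1) f) z +
      (-1 : k) ^ n •
        F.star (by omega : m = m - n - 1 + (n + 1)) f
          (connes F.nu.symm (by omega : n = n - 1 + 1) z))

/-- `κ_{p,q} : C_p(A, A_{ν⁻¹}) → C^q(A, Ωbar^P(A))`, `P = p + 1 + q`,
`κ(a₀ ⊗ ā_{1,p})(b_{1,q}) = ∑ⱼ d_P(uⱼ ν(a₀) ⊗ ā_{1,p} ⊗ v̄ⱼ ⊗ b_{1,q} ⊗ 1)`. -/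
def kappa {p q P : ℕ} (h : P = p + 1 + q) (z : LBar k A p) : Coch k A q P :=
  dOne k A P ∘ₗ appendL k A h ∘ₗ
    TensorProduct.mk k (LBar k A (p + 1)) (TPow k A q)
      (∑ j, appendL k A (rfl : p + 1 = p + 1)
        ((LinearMap.mulLeft k (F.u j) ∘ₗ F.nu.toLinearMap).rTensor (TPow k A p) z ⊗ₜ
          projT k A (F.v j)))

end FrobeniusData

end Frobenius

end

end TateHH

open TateHH

namespace TateHH
noncomputable section

/-! ### The differential graded algebra of the normalized bar resolution -/

section BarAlgebra

variable (k A : Type u) [Field k] [Ring A] [Algebra k A]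

/-- The relations of the algebra `A * k[ε]/(ε²)`. -/
inductive BarRel : FreeAlgebra k (Option A) → FreeAlgebra k (Option A) → Prop
  | add (a b : A) : BarRel (FreeAlgebra.ι k (some (a + b)))
      (FreeAlgebra.ι k (some a) + FreeAlgebra.ι k (some b))
  | mul (a b : A) : BarRel (FreeAlgebra.ι k (some (a * b)))
      (FreeAlgebra.ι k (some a) * FreeAlgebra.ι k (some b))
  | scalar (c : k) : BarRel (FreeAlgebra.ι k (some (algebraMap k A c)))
      (algebraMap k (FreeAlgebra k (Option A)) c)
  | eps : BarRel (FreeAlgebra.ι k none * FreeAlgebra.ι k none) 0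

/-- The algebra `A * k[ε]/(ε²)`. Its component of degree `p` in `ε` is `BarAug k A p`. -/
def BarAlg : Type u := RingQuot (BarRel k A)

instance : Ring (BarAlg k A) := inferInstanceAs (Ring (RingQuot (BarRel k A)))

instance : Algebra k (BarAlg k A) := inferInstanceAs (Algebra k (RingQuot (BarRel k A)))

namespace BarAlg

variable {k A}

/-- The quotient map from the free algebra. -/
def mk : FreeAlgebra k (Option A) →ₐ[k] BarAlg k A := RingQuot.mkAlgHom k (BarRel k A)

theorem mk_rel {x y : FreeAlgebra k (Option A)} (h : BarRel k A x y) :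
    (mk x : BarAlg k A) = mk y := RingQuot.mkAlgHom_rel k h

variable (k) in
/-- The inclusion of `A`. -/
def of : A →ₐ[k] BarAlg k A :=
  AlgHom.mk' (R := k)
    { toFun := fun a => mk (FreeAlgebra.ι k (some a))
      map_one' := by
        have := mk_rel (BarRel.scalar (k := k) (A := A) 1)
        simpa using this
      map_mul' := fun a b => by simpa using mk_rel (BarRel.mul (k := k) a b)
      map_zero' := by
        have := mk_rel (BarRel.scalar (k := k) (A := A) 0)
        simpa using this
      map_add' := fun a b => by simpa using mk_rel (BarRel.add (k := k) a b) }
    (fun c a => by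
      have h1 := mk_rel (BarRel.scalar (k := k) (A := A) c)
      have h2 := mk_rel (BarRel.mul (k := k) (algebraMap k A c) a)
      rw [map_mul, h1, AlgHom.commutes, ← Algebra.smul_def, ← Algebra.smul_def] at h2
      exact h2)

variable (k A) in
/-- The generator `ε` of degree one. -/
def eps : BarAlg k A := mk (FreeAlgebra.ι k none)

theorem eps_mul_eps : eps k A * eps k A = 0 := by
  have := mk_rel (BarRel.eps (k := k) (A := A))
  simpa [eps] using this

theorem eps_mul_eps_mul (x : BarAlg k A) : eps k A * (eps k A * x) = 0 := by
  rw [← mul_assoc, eps_mul_eps, zero_mul]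

/-- The universal property. -/
def lift {R : Type*} [Semiring R] [Algebra k R] (ρ : A →ₐ[k] R) (e : R) (he : e * e = 0) :
    BarAlg k A →ₐ[k] R :=
  RingQuot.liftAlgHom k ⟨FreeAlgebra.lift k (fun o => o.elim e ρ), by
    intro x y h
    cases h <;> simp [he]⟩

@[simp] theorem lift_of {R : Type*} [Semiring R] [Algebra k R] (ρ : A →ₐ[k] R) (e : R)
    (he : e * e = 0) (a : A) : lift ρ e he (of k a) = ρ a := by
  simp only [lift, BarAlg]
  erw [RingQuot.liftAlgHom_mkAlgHom_apply]
  simp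

@[simp] theorem lift_eps {R : Type*} [Semiring R] [Algebra k R] (ρ : A →ₐ[k] R) (e : R)
    (he : e * e = 0) : lift ρ e he (eps k A) = e := by
  simp only [lift, eps, mk, BarAlg]
  erw [RingQuot.liftAlgHom_mkAlgHom_apply]
  simp

theorem gen_induction {P : BarAlg k A → Prop} (hof : ∀ a, P (of k a)) (heps : P (eps k A))
    (hadd : ∀ x y, P x → P y → P (x + y)) (hmul : ∀ x y, P x → P y → P (x * y))
    (x : BarAlg k A) : P x := by
  obtain ⟨y, rfl⟩ : ∃ y, mk y = x := RingQuot.mkAlgHom_surjective k (BarRel k A) x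
  induction y using FreeAlgebra.induction with
  | grade0 c =>
    have h : (mk (algebraMap k (FreeAlgebra k (Option A)) c) : BarAlg k A) =
        of k (algebraMap k A c) := (mk_rel (BarRel.scalar c)).symm
    rw [h]; exact hof _
  | grade1 o =>
    cases o with
    | none => exact heps
    | some a => exact hof a
  | mul a b ha hb => rw [map_mul]; exact hmul _ _ ha hb
  | add a b ha hb => rw [map_add]; exact hadd _ _ ha hb

/-- Every element is a sum of words `a₀ ε a₁ ε ⋯ ε a_n`. -/
theorem word_induction {P : BarAlg k A → Prop} (hof : ∀ a, P (of k a))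
    (hadd : ∀ x y, P x → P y → P (x + y))
    (hword : ∀ a x, P x → P (of k a * (eps k A * x))) (x : BarAlg k A) : P x := by
  have key : ∀ y x : BarAlg k A, (∀ a, P (of k a * x)) → ∀ a, P (of k a * (y * x)) := by
    intro y
    induction y using gen_induction with
    | hof b => intro x hx a; rw [← mul_assoc, ← map_mul]; exact hx _
    | heps =>
      intro x hx a
      have h1 := hx 1
      rw [map_one, one_mul] at h1
      exact hword a x h1
    | hadd y z hy hz =>
      intro x hx a; rw [add_mul, mul_add]; exact hadd _ _ (hy x hx a) (hz x hx a)
    | hmul y z hy hz => intro x hx a; rw [mul_assoc]; exact hy _ (hz _ hx) a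
  have := key x 1 (fun a => by rw [mul_one]; exact hof a) 1
  simpa using this

theorem linearMap_ext {V : Type*} [AddCommMonoid V] [Module k V] {f g : BarAlg k A →ₗ[k] V}
    (hof : ∀ a, f (of k a) = g (of k a))
    (hword : ∀ a x, f x = g x → f (of k a * (eps k A * x)) = g (of k a * (eps k A * x))) :
    f = g := by
  ext x
  induction x using word_induction with
  | hof a => exact hof a
  | hadd x y hx hy => rw [map_add, map_add, hx, hy]
  | hword a x hx => exact hword a x hx

/-- Derivations that vanish on `A` and are prescribed on `ε`, with values in a bimodule `V`, where
the left action is `L` and the right action is `r`. -/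
theorem exists_derivation {V : Type*} [AddCommGroup V] [Module k V]
    (L : BarAlg k A →ₐ[k] Module.End k V) (r : BarAlg k A →ₗ[k] Module.End k V)
    (hr1 : ∀ v, r 1 v = v) (hr : ∀ x y v, r (x * y) v = r y (r x v))
    (hLr : ∀ x y v, L x (r y v) = r y (L x v)) (v₀ : V)
    (h : L (eps k A) v₀ + r (eps k A) v₀ = 0) :
    ∃ D : BarAlg k A →ₗ[k] V, (∀ a, D (of k a) = 0) ∧ D (eps k A) = v₀ ∧
      ∀ x y, D (x * y) = L x (D y) + r y (D x) := by
  let act : A →ₐ[k] Module.End k (V × BarAlg k A) :=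
    AlgHom.mk' (R := k)
      { toFun := fun a => (L (of k a)).prodMap (LinearMap.mulLeft k (of k a))
        map_one' := by ext <;> simp
        map_mul' := fun a b => by ext <;> simp
        map_zero' := by ext <;> simp
        map_add' := fun a b => by ext <;> simp [add_mul] }
      (fun c a => by ext <;> simp)
  let e : Module.End k (V × BarAlg k A) :=
    LinearMap.prod (L (eps k A) ∘ₗ LinearMap.fst k _ _ + r.flip v₀ ∘ₗ LinearMap.snd k _ _)
      (LinearMap.mulLeft k (eps k A) ∘ₗ LinearMap.snd k _ _)
  have hee : e * e = 0 := by
    have h1 : ∀ v, L (eps k A) (L (eps k A) v) = 0 := fun v => by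
      rw [← Module.End.mul_apply, ← map_mul, eps_mul_eps, map_zero, LinearMap.zero_apply]
    refine LinearMap.ext fun ⟨w, y⟩ => Prod.ext ?_ ?_
    · change L (eps k A) (L (eps k A) w + r y v₀) + r (eps k A * y) v₀ = 0
      rw [map_add, h1, hr, hLr, zero_add, ← map_add, h, map_zero]
    · change eps k A * (eps k A * y) = 0
      rw [eps_mul_eps_mul]
  let Φ := lift act e hee
  have hΦof : ∀ a w y, Φ (of k a) (w, y) = (L (of k a) w, of k a * y) := fun a w y => by
    simp only [Φ, lift_of]; rfl
  have hΦe : ∀ w y, Φ (eps k A) (w, y) = (L (eps k A) w + r y v₀, eps k A * y) := fun w y => by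
    simp only [Φ, lift_eps]; rfl
  let D : BarAlg k A →ₗ[k] V :=
    LinearMap.fst k V (BarAlg k A) ∘ₗ Φ.toLinearMap.flip ((0 : V), (1 : BarAlg k A))
  have hD : ∀ x, D x = (Φ x (0, 1)).1 := fun x => rfl
  have key : ∀ x w y, Φ x (w, y) = (L x w + r y (D x), x * y) := by
    intro x
    induction x using gen_induction with
    | hof a => intro w y; rw [hD, hΦof, hΦof]; simp
    | heps => intro w y; rw [hD, hΦe, hΦe]; simp [hr1]
    | hadd x z hx hz =>
      intro w y
      have : D (x + z) = D x + D z := map_add _ _ _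
      rw [map_add, LinearMap.add_apply, hx, hz, this, map_add, map_add, add_mul]
      refine Prod.ext ?_ rfl
      simp only [Prod.mk_add_mk, LinearMap.add_apply]; abel
    | hmul x z hx hz =>
      intro w y
      have : D (x * z) = L x (D z) + r z (D x) := by
        rw [hD, map_mul, Module.End.mul_apply, hz, hx]; simp [hr1]
      rw [map_mul, Module.End.mul_apply, hz, hx, this]
      refine Prod.ext ?_ (mul_assoc _ _ _).symm
      simp only [map_add, map_mul, Module.End.mul_apply, hLr, hr]; abel
  refine ⟨D, fun a => ?_, ?_, fun x y => ?_⟩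
  · rw [hD, hΦof]; simp
  · rw [hD, hΦe]; simp [hr1]
  · rw [hD, map_mul, Module.End.mul_apply, key y, key x]; simp [hr1]

/-- `ε ↦ c ε`. For `c = -1` this is the parity automorphism. -/
def sg (c : k) : BarAlg k A →ₐ[k] BarAlg k A :=
  lift (of k) (c • eps k A) (by simp [eps_mul_eps])

@[simp] theorem sg_of (c : k) (a : A) : sg c (of k a) = of k a := lift_of _ _ _ _

@[simp] theorem sg_eps (c : k) : sg c (eps k A) = c • eps k A := lift_eps _ _ _

theorem algHom_ext {R : Type*} [Semiring R] [Algebra k R] {f g : BarAlg k A →ₐ[k] R}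
    (hof : ∀ a, f (of k a) = g (of k a)) (heps : f (eps k A) = g (eps k A)) : f = g := by
  ext x
  induction x using gen_induction with
  | hof a => exact hof a
  | heps => exact heps
  | hadd x y hx hy => rw [map_add, map_add, hx, hy]
  | hmul x y hx hy => rw [map_mul, map_mul, hx, hy]

@[simp] theorem sg_sg (c c' : k) (x : BarAlg k A) : sg c (sg c' x) = sg (c * c') x := by
  have : (sg c).comp (sg c') = sg (A := A) (c * c') := algHom_ext (by simp)
    (by simp [smul_smul, mul_comm])
  exact AlgHom.congr_fun this x

/-- The algebra endomorphism induced by an endomorphism of `A`. -/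
def mapA (ν : A →ₐ[k] A) : BarAlg k A →ₐ[k] BarAlg k A :=
  lift ((of k).comp ν) (eps k A) eps_mul_eps

@[simp] theorem mapA_of (ν : A →ₐ[k] A) (a : A) : mapA ν (of k a) = of k (ν a) := lift_of _ _ _ _

@[simp] theorem mapA_eps (ν : A →ₐ[k] A) : mapA ν (eps k A) = eps k A := lift_eps _ _ _

theorem mapA_sg (ν : A →ₐ[k] A) (c : k) (x : BarAlg k A) :
    mapA ν (sg c x) = sg c (mapA ν x) := by
  have : (mapA ν).comp (sg c) = (sg c).comp (mapA ν) := algHom_ext (by simp) (by simp)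
  exact AlgHom.congr_fun this x

/-- The right regular action. -/
def rightMul : BarAlg k A →ₗ[k] Module.End k (BarAlg k A) := (LinearMap.mul k (BarAlg k A)).flip

/-- The left action twisted by `sg c`. -/
def leftMul (c : k) : BarAlg k A →ₐ[k] Module.End k (BarAlg k A) :=
  (Algebra.lmul k (BarAlg k A)).comp (sg c)

theorem exists_skewDer (c : k) (v₀ : BarAlg k A) (h : c • (eps k A * v₀) + v₀ * eps k A = 0) :
    ∃ D : BarAlg k A →ₗ[k] BarAlg k A, (∀ a, D (of k a) = 0) ∧ D (eps k A) = v₀ ∧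
      ∀ x y, D (x * y) = sg c x * D y + D x * y := by
  obtain ⟨D, h1, h2, h3⟩ := exists_derivation (leftMul c) (rightMul (k := k) (A := A))
    (fun v => by simp [rightMul]) (fun x y v => by simp [rightMul, mul_assoc])
    (fun x y v => by simp [rightMul, leftMul, mul_assoc]) v₀
    (by simpa [rightMul, leftMul] using h)
  exact ⟨D, h1, h2, fun x y => by simpa [rightMul, leftMul] using h3 x y⟩

variable (k A) in
theorem exists_d : ∃ D : BarAlg k A →ₗ[k] BarAlg k A, (∀ a, D (of k a) = 0) ∧ D (eps k A) = 1 ∧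
      ∀ x y, D (x * y) = sg (-1) x * D y + D x * y :=
  exists_skewDer (-1 : k) 1 (by simp)

/-- The differential: `d ε = 1`, `d a = 0`. -/
def d : BarAlg k A →ₗ[k] BarAlg k A := (exists_d k A).choose

@[simp] theorem d_of (a : A) : d (of k a) = 0 := (exists_d k A).choose_spec.1 a

@[simp] theorem d_eps : d (eps k A) = 1 := (exists_d k A).choose_spec.2.1

theorem d_mul (x y : BarAlg k A) : d (x * y) = sg (-1) x * d y + d x * y :=
  (exists_d k A).choose_spec.2.2 x y

@[simp] theorem d_of_mul (a : A) (y : BarAlg k A) : d (of k a * y) = of k a * d y := by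
  simp [d_mul]

@[simp] theorem d_mul_of (a : A) (y : BarAlg k A) : d (y * of k a) = d y * of k a := by
  simp [d_mul]

@[simp] theorem d_eps_mul (y : BarAlg k A) : d (eps k A * y) = y - eps k A * d y := by
  simp [d_mul]; abel

theorem d_sg (c : k) (x : BarAlg k A) : d (sg c x) = c • sg c (d x) := by
  have : d ∘ₗ (sg c).toLinearMap = c • ((sg c).toLinearMap ∘ₗ d (k := k) (A := A)) := by
    refine linearMap_ext (by simp) fun a x hx => ?_
    simp only [LinearMap.comp_apply, AlgHom.toLinearMap_apply, LinearMap.smul_apply] at hx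
    simp [hx, smul_sub, mul_sub]
  exact LinearMap.congr_fun this x

@[simp] theorem d_d (x : BarAlg k A) : d (d x) = 0 := by
  have : d ∘ₗ d = (0 : BarAlg k A →ₗ[k] BarAlg k A) := by
    refine linearMap_ext (by simp) fun a x hx => ?_
    simp only [LinearMap.comp_apply, LinearMap.zero_apply] at hx
    simp [hx]
  exact LinearMap.congr_fun this x

theorem d_mapA (ν : A →ₐ[k] A) (x : BarAlg k A) : d (mapA ν x) = mapA ν (d x) := by
  have : d ∘ₗ (mapA ν).toLinearMap = (mapA ν).toLinearMap ∘ₗ d (k := k) (A := A) := by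
    refine linearMap_ext (by simp) fun a x hx => ?_
    simp only [LinearMap.comp_apply, AlgHom.toLinearMap_apply] at hx
    simp [hx]
  exact LinearMap.congr_fun this x

/-- The left action on the first factor. -/
def actL : BarAlg k A →ₐ[k] Module.End k (BarAlg k A ⊗[k] BarAlg k A) :=
  (Module.End.rTensorAlgHom k (BarAlg k A) (BarAlg k A)).comp (Algebra.lmul k (BarAlg k A))

/-- The right action on the second factor. -/
def actR : BarAlg k A →ₗ[k] Module.End k (BarAlg k A ⊗[k] BarAlg k A) :=
  (LinearMap.lTensorHom (BarAlg k A)) ∘ₗ rightMul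

@[simp] theorem actL_tmul (x y z : BarAlg k A) : actL x (y ⊗ₜ[k] z) = (x * y) ⊗ₜ z := rfl

@[simp] theorem actR_tmul (x y z : BarAlg k A) : actR x (y ⊗ₜ[k] z) = y ⊗ₜ (z * x) := rfl

theorem actR_mul (x y : BarAlg k A) (v : BarAlg k A ⊗[k] BarAlg k A) :
    actR (x * y) v = actR y (actR x v) := by
  induction v with
  | zero => simp
  | tmul a b => simp [mul_assoc]
  | add a b ha hb => simp [ha, hb]

theorem actL_actR (x y : BarAlg k A) (v : BarAlg k A ⊗[k] BarAlg k A) :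
    actL x (actR y v) = actR y (actL x v) := by
  induction v with
  | zero => simp
  | tmul a b => simp
  | add a b ha hb => simp only [map_add, ha, hb]

@[simp] theorem actR_one (v : BarAlg k A ⊗[k] BarAlg k A) : actR 1 v = v := by
  induction v with
  | zero => simp
  | tmul a b => simp
  | add a b ha hb => simp only [map_add, ha, hb]

variable (k A) in
theorem exists_S : ∃ D : BarAlg k A →ₗ[k] BarAlg k A ⊗[k] BarAlg k A, (∀ a, D (of k a) = 0) ∧
    D (eps k A) = eps k A ⊗ₜ eps k A ∧ ∀ x y, D (x * y) = actL x (D y) + actR y (D x) :=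
  exists_derivation actL actR actR_one actR_mul actL_actR _ (by simp [eps_mul_eps])

/-- The sum over all ways to cut a word at an `ε`: `x ↦ ∑ x'ε ⊗ εx''` for `x = x'εx''`. -/
def S : BarAlg k A →ₗ[k] BarAlg k A ⊗[k] BarAlg k A := (exists_S k A).choose

@[simp] theorem S_of (a : A) : S (of k a) = 0 := (exists_S k A).choose_spec.1 a

@[simp] theorem S_eps : S (eps k A) = eps k A ⊗ₜ eps k A := (exists_S k A).choose_spec.2.1

theorem S_mul (x y : BarAlg k A) : S (x * y) = actL x (S y) + actR y (S x) :=
  (exists_S k A).choose_spec.2.2 x y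

@[simp] theorem S_of_mul (a : A) (y : BarAlg k A) : S (of k a * y) = actL (of k a) (S y) := by
  simp [S_mul]

@[simp] theorem S_one : S (1 : BarAlg k A) = 0 := by
  rw [← map_one (of k), S_of]

end BarAlg

end BarAlgebra
end
end TateHH

namespace TateHH
noncomputable section

namespace BarAlg

variable {k A : Type u} [Field k] [Ring A] [Algebra k A]
variable {V W : Type*} [AddCommGroup V] [Module k V] [AddCommGroup W] [Module k W]

/-- `x ↦ ∑ T(x'ε, εx'')`, the sum over all ways to cut `x` at an `ε`. -/
def cutSum (T : BarAlg k A →ₗ[k] BarAlg k A →ₗ[k] V) : BarAlg k A →ₗ[k] V :=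
  TensorProduct.lift T ∘ₗ S

@[simp] theorem cutSum_of (T : BarAlg k A →ₗ[k] BarAlg k A →ₗ[k] V) (a : A) :
    cutSum T (of k a) = 0 := by simp [cutSum]

@[simp] theorem cutSum_one (T : BarAlg k A →ₗ[k] BarAlg k A →ₗ[k] V) :
    cutSum T 1 = 0 := by simp [cutSum]

@[simp] theorem cutSum_eps (T : BarAlg k A →ₗ[k] BarAlg k A →ₗ[k] V) :
    cutSum T (eps k A) = T (eps k A) (eps k A) := by simp [cutSum]

theorem lift_actL (T : BarAlg k A →ₗ[k] BarAlg k A →ₗ[k] V) (x : BarAlg k A)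
    (w : BarAlg k A ⊗[k] BarAlg k A) :
    TensorProduct.lift T (actL x w) = TensorProduct.lift (T ∘ₗ LinearMap.mulLeft k x) w := by
  induction w with
  | zero => simp
  | tmul a b => simp
  | add a b ha hb => simp only [map_add, ha, hb]

theorem lift_actR (T : BarAlg k A →ₗ[k] BarAlg k A →ₗ[k] V) (x : BarAlg k A)
    (w : BarAlg k A ⊗[k] BarAlg k A) :
    TensorProduct.lift T (actR x w) =
      TensorProduct.lift (T.compl₂ (LinearMap.mulRight k x)) w := by
  induction w with
  | zero => simp
  | tmul a b => simp
  | add a b ha hb => simp only [map_add, ha, hb]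

theorem cutSum_mul (T : BarAlg k A →ₗ[k] BarAlg k A →ₗ[k] V) (x y : BarAlg k A) :
    cutSum T (x * y) =
      cutSum (T ∘ₗ LinearMap.mulLeft k x) y + cutSum (T.compl₂ (LinearMap.mulRight k y)) x := by
  simp [cutSum, S_mul, lift_actL, lift_actR]

theorem cutSum_of_mul (T : BarAlg k A →ₗ[k] BarAlg k A →ₗ[k] V) (a : A) (y : BarAlg k A) :
    cutSum T (of k a * y) = cutSum (T ∘ₗ LinearMap.mulLeft k (of k a)) y := by
  simp [cutSum_mul]

theorem cutSum_mul_of (T : BarAlg k A →ₗ[k] BarAlg k A →ₗ[k] V) (a : A) (y : BarAlg k A) :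
    cutSum T (y * of k a) = cutSum (T.compl₂ (LinearMap.mulRight k (of k a))) y := by
  simp [cutSum_mul]

theorem cutSum_word (T : BarAlg k A →ₗ[k] BarAlg k A →ₗ[k] V) (a : A) (y : BarAlg k A) :
    cutSum T (of k a * (eps k A * y)) = T (of k a * eps k A) (eps k A * y) +
      cutSum (T ∘ₗ LinearMap.mulLeft k (of k a * eps k A)) y := by
  rw [← mul_assoc, cutSum_mul, add_comm, cutSum_mul, cutSum_eps, cutSum_of]
  simp

theorem map_cutSum (g : V →ₗ[k] W) (T : BarAlg k A →ₗ[k] BarAlg k A →ₗ[k] V) (x : BarAlg k A) :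
    g (cutSum T x) = cutSum (T.compr₂ g) x := by
  simp only [cutSum, LinearMap.comp_apply]
  induction S x with
  | zero => simp
  | tmul a b => simp
  | add a b ha hb => simp only [map_add, ha, hb]

theorem cutSum_comp {f : BarAlg k A →ₗ[k] BarAlg k A} {c : k}
    (hf : ∀ x, S (f x) = c • TensorProduct.map f f (S x))
    (T : BarAlg k A →ₗ[k] BarAlg k A →ₗ[k] V) (x : BarAlg k A) :
    cutSum T (f x) = c • cutSum (T.compl₁₂ f f) x := by
  simp only [cutSum, LinearMap.comp_apply, hf, map_smul]
  congr 1
  induction S x with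
  | zero => simp
  | tmul a b => simp
  | add a b ha hb => simp only [map_add, ha, hb]

theorem map_actL {f : BarAlg k A →ₐ[k] BarAlg k A} (x : BarAlg k A)
    (w : BarAlg k A ⊗[k] BarAlg k A) :
    TensorProduct.map f.toLinearMap f.toLinearMap (actL x w) =
      actL (f x) (TensorProduct.map f.toLinearMap f.toLinearMap w) := by
  induction w with
  | zero => simp
  | tmul a b => simp
  | add a b ha hb => simp only [map_add, ha, hb]

theorem S_algHom (f : BarAlg k A →ₐ[k] BarAlg k A) (c c' : k) (hc : c * c' = 1)
    (hf : ∀ a, ∃ b, f (of k a) = of k b) (heps : f (eps k A) = c • eps k A) (x : BarAlg k A) :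
    S (f.toLinearMap x) = c' • TensorProduct.map f.toLinearMap f.toLinearMap (S x) := by
  induction x using word_induction with
  | hof a => obtain ⟨b, hb⟩ := hf a; simp [hb]
  | hadd x y hx hy => rw [map_add, map_add, hx, hy, map_add, map_add, smul_add]
  | hword a x hx =>
    obtain ⟨b, hb⟩ := hf a
    have e1 : S (eps k A * x) = actL (eps k A) (S x) + eps k A ⊗ₜ (eps k A * x) := by
      rw [S_mul, S_eps, actR_tmul]
    have e2 : S (eps k A * f x) = actL (eps k A) (S (f x)) + eps k A ⊗ₜ (eps k A * f x) := by
      rw [S_mul, S_eps, actR_tmul]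
    simp only [AlgHom.toLinearMap_apply] at hx
    have h2 : (TensorProduct.map f.toLinearMap f.toLinearMap) (eps k A ⊗ₜ[k] (eps k A * x)) =
        (c * c) • eps k A ⊗ₜ[k] (eps k A * f x) := by
      rw [TensorProduct.map_tmul]
      simp [heps, ← TensorProduct.smul_tmul', smul_smul]
    have e0 : f (of k a * (eps k A * x)) = c • (of k b * (eps k A * f x)) := by
      rw [map_mul f, map_mul f, hb, heps, smul_mul_assoc, mul_smul_comm]
    rw [AlgHom.toLinearMap_apply, e0, map_smul, S_of_mul, e2, hx, S_of_mul, map_actL, e1,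
      (TensorProduct.map f.toLinearMap f.toLinearMap).map_add, map_actL, h2, hb, heps]
    simp only [map_smul, map_add, smul_add, smul_smul, LinearMap.smul_apply]
    congr 1
    · rw [mul_comm]
    · congr 1
      rw [← mul_assoc, mul_comm c' c, hc, one_mul]

theorem cutSum_mapA (ν : A →ₐ[k] A) (T : BarAlg k A →ₗ[k] BarAlg k A →ₗ[k] V) (x : BarAlg k A) :
    cutSum T (mapA ν x) = cutSum (T.compl₁₂ (mapA ν).toLinearMap (mapA ν).toLinearMap) x := by
  have := cutSum_comp (S_algHom (mapA ν) 1 1 (by simp) (fun a => ⟨ν a, mapA_of ν a⟩)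
    (by simp)) T x
  simpa using this

theorem mul_cutSum (T : BarAlg k A →ₗ[k] BarAlg k A →ₗ[k] BarAlg k A) (x y : BarAlg k A) :
    y * cutSum T x = cutSum (T.compr₂ (LinearMap.mulLeft k y)) x :=
  map_cutSum (LinearMap.mulLeft k y) T x

theorem cutSum_mul_right (T : BarAlg k A →ₗ[k] BarAlg k A →ₗ[k] BarAlg k A) (x y : BarAlg k A) :
    cutSum T x * y = cutSum (T.compr₂ (LinearMap.mulRight k y)) x :=
  map_cutSum (LinearMap.mulRight k y) T x

theorem cutSum_add (T T' : BarAlg k A →ₗ[k] BarAlg k A →ₗ[k] V) (x : BarAlg k A) :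
    cutSum (T + T') x = cutSum T x + cutSum T' x := by
  simp only [cutSum, LinearMap.comp_apply]
  induction S x with
  | zero => simp
  | tmul a b => simp
  | add a b ha hb => simp only [map_add, ha, hb]; abel

theorem cutSum_smul (c : k) (T : BarAlg k A →ₗ[k] BarAlg k A →ₗ[k] V) (x : BarAlg k A) :
    cutSum (c • T) x = c • cutSum T x := by
  simp only [cutSum, LinearMap.comp_apply]
  induction S x with
  | zero => simp
  | tmul a b => simp
  | add a b ha hb => simp only [map_add, ha, hb, smul_add]

/-- `cutSum` as a linear map. -/
def cutSumₗ : (BarAlg k A →ₗ[k] BarAlg k A →ₗ[k] V) →ₗ[k] BarAlg k A →ₗ[k] V where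
  toFun := cutSum
  map_add' T T' := LinearMap.ext fun x => cutSum_add T T' x
  map_smul' c T := LinearMap.ext fun x => cutSum_smul c T x

@[simp] theorem cutSumₗ_apply (T : BarAlg k A →ₗ[k] BarAlg k A →ₗ[k] V) :
    cutSumₗ T = cutSum T := rfl

theorem cutSum_neg (T : BarAlg k A →ₗ[k] BarAlg k A →ₗ[k] V) (x : BarAlg k A) :
    cutSum (-T) x = -cutSum T x :=
  LinearMap.congr_fun (map_neg cutSumₗ T) x

theorem cutSum_sub (T T' : BarAlg k A →ₗ[k] BarAlg k A →ₗ[k] V) (x : BarAlg k A) :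
    cutSum (T - T') x = cutSum T x - cutSum T' x :=
  LinearMap.congr_fun (map_sub cutSumₗ T T') x

theorem cutSum_zero (x : BarAlg k A) :
    cutSum (0 : BarAlg k A →ₗ[k] BarAlg k A →ₗ[k] V) x = 0 :=
  LinearMap.congr_fun (map_zero cutSumₗ) x

/-- `T` is balanced over `A`. -/
def Balanced (T : BarAlg k A →ₗ[k] BarAlg k A →ₗ[k] V) : Prop :=
  ∀ x a y, T (x * of k a) y = T x (of k a * y)

/-- The compatibility of the cuts with the differential. -/
theorem cutSum_d (T : BarAlg k A →ₗ[k] BarAlg k A →ₗ[k] V) (hT : Balanced T) (x : BarAlg k A) :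
    cutSum (T ∘ₗ d) x - cutSum (T.compl₁₂ (sg (-1)).toLinearMap d) x =
      cutSum T (d x) + T 1 x - T (sg (-1) x) 1 := by
  induction x using word_induction generalizing T with
  | hof a =>
    have := hT 1 a 1
    simp only [one_mul, mul_one] at this
    simp [this]
  | hadd x y hx hy =>
    have h1 := hx T hT
    have h2 := hy T hT
    simp only [map_add, LinearMap.add_apply] at h1 h2 ⊢
    rw [add_sub_add_comm, h1, h2]; abel
  | hword a x hx =>
    have hT' : Balanced (T ∘ₗ LinearMap.mulLeft k (of k a * eps k A)) := by
      intro x b y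
      simp only [LinearMap.comp_apply, LinearMap.mulLeft_apply, ← mul_assoc]
      exact hT _ _ _
    have h := hx _ hT'
    have hb := hT 1 a (eps k A * x)
    rw [one_mul] at hb
    rw [cutSum_word, cutSum_word]
    have e1 : ((T ∘ₗ d) ∘ₗ LinearMap.mulLeft k (of k a * eps k A)) =
        (T ∘ₗ LinearMap.mulLeft k (of k a)) -
          (T ∘ₗ LinearMap.mulLeft k (of k a * eps k A)) ∘ₗ d := by
      ext y z
      simp [mul_sub]
    have e2 : ((T.compl₁₂ (sg (-1)).toLinearMap d) ∘ₗ LinearMap.mulLeft k (of k a * eps k A)) =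
        -((T ∘ₗ LinearMap.mulLeft k (of k a * eps k A)).compl₁₂ (sg (-1)).toLinearMap d) := by
      ext y z
      simp
    have edx : cutSum T (d (of k a * (eps k A * x))) = cutSum (T ∘ₗ LinearMap.mulLeft k (of k a)) x -
        (T (of k a * eps k A) (eps k A * d x) +
          cutSum (T ∘ₗ LinearMap.mulLeft k (of k a * eps k A)) (d x)) := by
      rw [d_of_mul, d_eps_mul, mul_sub, map_sub, cutSum_of_mul, cutSum_word]
    rw [e1, e2, cutSum_sub, cutSum_neg, edx]
    simp only [LinearMap.comp_apply, LinearMap.compl₁₂_apply, AlgHom.toLinearMap_apply,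
      LinearMap.mulLeft_apply, d_of_mul, d_eps, mul_one, map_mul, sg_of, sg_eps, neg_smul, one_smul,
      mul_neg, map_neg, LinearMap.neg_apply, neg_mul, d_eps_mul, map_sub, mul_assoc] at h ⊢
    rw [hb, ← sub_eq_zero]
    rw [← sub_eq_zero] at h
    rw [← neg_eq_zero, ← h]
    abel

/-! ### The grading -/

variable (k A) in
/-- The component of degree `n`, spanned by the words with `n` letters `ε`. -/
def deg : ℕ → Submodule k (BarAlg k A)
  | 0 => LinearMap.range (of k (A := A)).toLinearMap
  | n + 1 => Submodule.span k {z | ∃ a x, x ∈ deg n ∧ z = of k a * (eps k A * x)}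

theorem of_mem (a : A) : of k a ∈ deg k A 0 := ⟨a, rfl⟩

theorem one_mem : (1 : BarAlg k A) ∈ deg k A 0 := by rw [← map_one (of k)]; exact of_mem 1

theorem word_mem {n : ℕ} (a : A) {x : BarAlg k A} (hx : x ∈ deg k A n) :
    of k a * (eps k A * x) ∈ deg k A (n + 1) := Submodule.subset_span ⟨a, x, hx, rfl⟩

theorem eps_mul_mem {n : ℕ} {x : BarAlg k A} (hx : x ∈ deg k A n) :
    eps k A * x ∈ deg k A (n + 1) := by
  have := word_mem (k := k) (1 : A) hx
  rwa [map_one, one_mul] at this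

theorem eps_mem : eps k A ∈ deg k A 1 := by
  have := eps_mul_mem (one_mem (k := k) (A := A))
  rwa [mul_one] at this

theorem deg_induction {P : ∀ (n : ℕ) (x : BarAlg k A), x ∈ deg k A n → Prop}
    (hof : ∀ a, P 0 (of k a) (of_mem a))
    (hadd : ∀ n x y hx hy, P n x hx → P n y hy → P n (x + y) (add_mem hx hy))
    (hsmul : ∀ n (c : k) x hx, P n x hx → P n (c • x) (Submodule.smul_mem _ c hx))
    (hword : ∀ n a x hx, P n x hx → P (n + 1) (of k a * (eps k A * x)) (word_mem a hx))
    {n : ℕ} {x : BarAlg k A} (hx : x ∈ deg k A n) : P n x hx := by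
  induction n generalizing x with
  | zero => obtain ⟨a, rfl⟩ := hx; exact hof a
  | succ n ih =>
    refine Submodule.span_induction (p := fun x hx => P (n + 1) x hx) ?_ ?_ ?_ ?_ hx
    · rintro z ⟨a, y, hy, rfl⟩; exact hword n a y hy (ih hy)
    · have h0 := hsmul (n + 1) 0 _ _ (hword n 0 0 (zero_mem _) (ih (zero_mem _)))
      simpa using h0
    · intro x y _ _ hx hy; exact hadd _ _ _ _ _ hx hy
    · intro c x _ hx; exact hsmul _ _ _ _ hx

theorem of_mul_mem {n : ℕ} (a : A) {x : BarAlg k A} (hx : x ∈ deg k A n) :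
    of k a * x ∈ deg k A n := by
  induction hx using deg_induction with
  | hof b => rw [← map_mul]; exact of_mem _
  | hadd n x y _ _ hx hy => rw [mul_add]; exact add_mem hx hy
  | hsmul n c x _ hx => rw [mul_smul_comm]; exact Submodule.smul_mem _ _ hx
  | hword n b x hx _ => rw [← mul_assoc, ← map_mul]; exact word_mem _ hx

theorem mul_mem {m n : ℕ} {x y : BarAlg k A} (hx : x ∈ deg k A m) (hy : y ∈ deg k A n) :
    x * y ∈ deg k A (m + n) := by
  induction hx using deg_induction with
  | hof b => rw [Nat.zero_add]; exact of_mul_mem b hy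
  | hadd n x y _ _ hx hy => rw [add_mul]; exact add_mem hx hy
  | hsmul n c x _ hx => rw [smul_mul_assoc]; exact Submodule.smul_mem _ _ hx
  | hword m b x _ hx =>
    rw [mul_assoc, mul_assoc, Nat.add_right_comm]; exact word_mem _ hx

theorem mul_of_mem {n : ℕ} (a : A) {x : BarAlg k A} (hx : x ∈ deg k A n) :
    x * of k a ∈ deg k A n := mul_mem hx (of_mem a)

theorem sg_deg (c : k) {n : ℕ} {x : BarAlg k A} (hx : x ∈ deg k A n) : sg c x = c ^ n • x := by
  induction hx using deg_induction with
  | hof b => simp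
  | hadd n x y _ _ hx hy => rw [map_add, hx, hy, smul_add]
  | hsmul n c' x _ hx => rw [map_smul, hx, smul_comm]
  | hword m b x _ hx => simp [hx, smul_smul, pow_succ, mul_comm]

theorem d_mem {n : ℕ} {x : BarAlg k A} (hx : x ∈ deg k A (n + 1)) : d x ∈ deg k A n := by
  have : ∀ {m} {y : BarAlg k A}, y ∈ deg k A m →
      (m = 0 → d y = 0) ∧ ∀ n, m = n + 1 → d y ∈ deg k A n := by
    intro m y hy
    induction hy using deg_induction with
    | hof b => simp
    | hadd n x y _ _ hx hy =>
      refine ⟨fun h => by rw [map_add, hx.1 h, hy.1 h, add_zero], fun l hl => ?_⟩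
      rw [map_add]; exact add_mem (hx.2 l hl) (hy.2 l hl)
    | hsmul n c x _ hx =>
      refine ⟨fun h => by rw [map_smul, hx.1 h, smul_zero], fun l hl => ?_⟩
      rw [map_smul]; exact Submodule.smul_mem _ _ (hx.2 l hl)
    | hword m b x hx' hx =>
      refine ⟨fun h => by omega, fun l hl => ?_⟩
      obtain rfl : m = l := by omega
      rw [d_of_mul, d_eps_mul]
      refine of_mul_mem _ (sub_mem hx' ?_)
      cases m with
      | zero => rw [hx.1 rfl, mul_zero]; exact zero_mem _
      | succ m => exact eps_mul_mem (hx.2 m rfl)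
  exact (this hx).2 n rfl

theorem d_deg_zero {x : BarAlg k A} (hx : x ∈ deg k A 0) : d x = 0 := by
  obtain ⟨a, rfl⟩ := hx; exact d_of a

theorem mapA_mem (ν : A →ₐ[k] A) {n : ℕ} {x : BarAlg k A} (hx : x ∈ deg k A n) :
    mapA ν x ∈ deg k A n := by
  induction hx using deg_induction with
  | hof b => rw [mapA_of]; exact of_mem _
  | hadd n x y _ _ hx hy => rw [map_add]; exact add_mem hx hy
  | hsmul n c x _ hx => rw [map_smul]; exact Submodule.smul_mem _ _ hx
  | hword m b x _ hx => simp only [map_mul, mapA_of, mapA_eps]; exact word_mem _ hx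

theorem sg_mem (c : k) {n : ℕ} {x : BarAlg k A} (hx : x ∈ deg k A n) : sg c x ∈ deg k A n := by
  rw [sg_deg c hx]; exact Submodule.smul_mem _ _ hx

theorem iSup_deg : ⨆ n, deg k A n = ⊤ := by
  rw [eq_top_iff]
  rintro x -
  induction x using word_induction with
  | hof a => exact Submodule.mem_iSup_of_mem 0 (of_mem a)
  | hadd x y hx hy => exact add_mem hx hy
  | hword a x hx =>
    refine Submodule.iSup_induction _
      (motive := fun x => of k a * (eps k A * x) ∈ ⨆ n, deg k A n) hx ?_ ?_ ?_
    · intro n x hx; exact Submodule.mem_iSup_of_mem (n + 1) (word_mem a hx)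
    · simp
    · intro x y hx hy; rw [mul_add, mul_add]; exact add_mem hx hy

theorem ext_deg {f g : BarAlg k A →ₗ[k] V} (h : ∀ n, ∀ x ∈ deg k A n, f x = g x) : f = g := by
  ext x
  have hx : x ∈ ⨆ n, deg k A n := by rw [iSup_deg]; trivial
  refine Submodule.iSup_induction _ (motive := fun x => f x = g x) hx h (by simp) ?_
  intro x y hx hy; rw [map_add, map_add, hx, hy]

theorem split_mem {m n : ℕ} {x : BarAlg k A} (hx : x ∈ deg k A (m + 1 + n)) :
    x ∈ Submodule.span k {z | ∃ y w, y ∈ deg k A m ∧ w ∈ deg k A n ∧ z = y * (eps k A * w)} := by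
  induction m generalizing x with
  | zero =>
    rw [Nat.zero_add, Nat.add_comm] at hx
    refine Submodule.span_mono ?_ hx
    rintro z ⟨a, y, hy, rfl⟩; exact ⟨of k a, y, of_mem a, hy, rfl⟩
  | succ m ih =>
    rw [show m + 1 + 1 + n = (m + 1 + n) + 1 by omega] at hx
    refine Submodule.span_le.2 ?_ hx
    rintro z ⟨a, y, hy, rfl⟩
    have h := ih hy
    refine Submodule.span_induction
      (p := fun y _ => of k a * (eps k A * y) ∈ Submodule.span k _) ?_ ?_ ?_ ?_ h
    · rintro z ⟨y, w, hy, hw, rfl⟩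
      exact Submodule.subset_span ⟨of k a * (eps k A * y), w, word_mem a hy, hw,
        by simp only [mul_assoc]⟩
    · simp
    · intro x y _ _ hx hy; rw [mul_add, mul_add]; exact add_mem hx hy
    · intro c x _ hx
      rw [mul_smul_comm, mul_smul_comm]; exact Submodule.smul_mem _ _ hx

theorem S_deg {n : ℕ} {x : BarAlg k A} (hx : x ∈ deg k A n) :
    S x ∈ Submodule.span k {z : BarAlg k A ⊗[k] BarAlg k A | ∃ (a b : ℕ) (y w : BarAlg k A),
      a + b + 1 = n ∧ y ∈ deg k A a ∧ w ∈ deg k A b ∧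
      z = (y * eps k A) ⊗ₜ (eps k A * w)} := by
  induction hx using deg_induction with
  | hof b => simp
  | hadd n x y _ _ hx hy => rw [map_add]; exact add_mem hx hy
  | hsmul n c x _ hx => rw [map_smul]; exact Submodule.smul_mem _ _ hx
  | hword m b x hx' hx =>
    rw [S_of_mul, S_mul, S_eps, map_add, actR_tmul, actL_tmul]
    refine add_mem ?_ (Submodule.subset_span ⟨0, m, of k b, x, by omega, of_mem b, hx', rfl⟩)
    rw [← Module.End.mul_apply, ← map_mul]
    refine Submodule.span_induction (p := fun y _ => actL (of k b * eps k A) y ∈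
      Submodule.span k _) ?_ ?_ ?_ ?_ hx
    · rintro z ⟨a, c, y, w, h, hy, hw, rfl⟩
      refine Submodule.subset_span ⟨a + 1, c, of k b * (eps k A * y), w, by omega,
        word_mem b hy, hw, ?_⟩
      rw [actL_tmul]; simp only [mul_assoc]
    · simp
    · intro x y _ _ hx hy; rw [map_add]; exact add_mem hx hy
    · intro c x _ hx; rw [map_smul]; exact Submodule.smul_mem _ _ hx

theorem cutSum_congr {n : ℕ} {x : BarAlg k A} (hx : x ∈ deg k A n)
    {T T' : BarAlg k A →ₗ[k] BarAlg k A →ₗ[k] V}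
    (h : ∀ (a b : ℕ) (y w : BarAlg k A), a + b + 1 = n → y ∈ deg k A a → w ∈ deg k A b →
      T (y * eps k A) (eps k A * w) = T' (y * eps k A) (eps k A * w)) :
    cutSum T x = cutSum T' x := by
  simp only [cutSum, LinearMap.comp_apply]
  refine Submodule.span_induction (p := fun y _ => TensorProduct.lift T y =
    TensorProduct.lift T' y) ?_ ?_ ?_ ?_ (S_deg hx)
  · rintro z ⟨a, b, y, w, hab, hy, hw, rfl⟩
    simpa using h a b y w hab hy hw
  · simp
  · intro x y _ _ hx hy; rw [map_add, map_add, hx, hy]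
  · intro c x _ hx; rw [map_smul, map_smul, hx]

theorem mul_eps_mem {n : ℕ} {x : BarAlg k A} (hx : x ∈ deg k A n) :
    x * eps k A ∈ deg k A (n + 1) := mul_mem hx eps_mem

theorem cutSum_mem {n : ℕ} {x : BarAlg k A} (hx : x ∈ deg k A n)
    {T : BarAlg k A →ₗ[k] BarAlg k A →ₗ[k] V} (U : Submodule k V)
    (h : ∀ (a b : ℕ) (y w : BarAlg k A), a + b + 1 = n → y ∈ deg k A a → w ∈ deg k A b →
      T (y * eps k A) (eps k A * w) ∈ U) :
    cutSum T x ∈ U := by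
  rw [← Submodule.ker_mkQ U, LinearMap.mem_ker, map_cutSum, ← cutSum_zero x]
  refine cutSum_congr hx fun a b y w hab hy hw => ?_
  simpa using h a b y w hab hy hw

/-- Coassociativity of the cuts. -/
theorem cutSum_cutSum (T : BarAlg k A →ₗ[k] BarAlg k A →ₗ[k] BarAlg k A →ₗ[k] V)
    (T' : BarAlg k A →ₗ[k] BarAlg k A →ₗ[k] BarAlg k A →ₗ[k] V)
    (h : ∀ x y z, T' z x y = T x y z) (x : BarAlg k A) :
    cutSum (cutSumₗ ∘ₗ T) x = cutSum (cutSumₗ ∘ₗ T').flip x := by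
  induction x using word_induction generalizing T T' with
  | hof a => simp
  | hadd x y hx hy => rw [map_add, map_add, hx T T' h, hy T T' h]
  | hword a x hx =>
    let T₁ := T ∘ₗ LinearMap.mulLeft k (of k a * eps k A)
    have hT : ((cutSumₗ ∘ₗ T) ∘ₗ LinearMap.mulLeft k (of k a * eps k A)) = cutSumₗ ∘ₗ T₁ := rfl
    have e : ((cutSumₗ ∘ₗ T').flip ∘ₗ LinearMap.mulLeft k (of k a * eps k A)) =
        T (of k a * eps k A) ∘ₗ LinearMap.mulLeft k (eps k A) +
        (cutSumₗ ∘ₗ (LinearMap.lcomp k _ (LinearMap.mulLeft k (of k a * eps k A)) ∘ₗ T')).flip := by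
      refine LinearMap.ext fun y => LinearMap.ext fun z => ?_
      simp only [LinearMap.comp_apply, LinearMap.flip_apply, cutSumₗ_apply,
        LinearMap.mulLeft_apply, LinearMap.add_apply, mul_assoc, cutSum_word, h]
      rfl
    rw [cutSum_word, cutSum_word, hT, e, cutSum_add,
      hx T₁ (LinearMap.lcomp k _ (LinearMap.mulLeft k (of k a * eps k A)) ∘ₗ T')
        (fun x y z => by simp [T₁, h])]
    have e3 : cutSum (T (of k a * eps k A)) (eps k A * x) =
        T (of k a * eps k A) (eps k A) (eps k A * x) +
        cutSum (T (of k a * eps k A) ∘ₗ LinearMap.mulLeft k (eps k A)) x := by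
      have := cutSum_word (T (of k a * eps k A)) 1 x
      simpa using this
    have e4 : cutSum (T' (eps k A * x)) (of k a * eps k A) =
        T (of k a * eps k A) (eps k A) (eps k A * x) := by
      have := cutSum_word (T' (eps k A * x)) a 1
      simpa [h] using this
    simp only [LinearMap.comp_apply, LinearMap.flip_apply, cutSumₗ_apply, e3, e4]
    abel

end BarAlg
end
end TateHH

namespace TateHH
noncomputable section

namespace BarAlg

variable {k A : Type u} [Field k] [Ring A] [Algebra k A]
variable {V W : Type*} [AddCommGroup V] [Module k V] [AddCommGroup W] [Module k W]

/-! ### The bar resolution inside the algebra -/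

theorem cut_symm_tprod {N a b : ℕ} (h : N = a + b) (x : Fin a → Abar k A) (y : Fin b → Abar k A) :
    (cut k A h).symm (PiTensorProduct.tprod k x ⊗ₜ PiTensorProduct.tprod k y) =
      PiTensorProduct.tprod k (fun i => Fin.append x y (Fin.cast h i)) := by
  subst h
  have : (cut k A (rfl : a + b = a + b)).symm
      (PiTensorProduct.tprod k x ⊗ₜ PiTensorProduct.tprod k y) =
      TensorPower.cast k (Abar k A) rfl
        (TensorPower.mulEquiv (PiTensorProduct.tprod k x ⊗ₜ PiTensorProduct.tprod k y)) := rfl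
  rw [this, TensorPower.cast_refl]
  exact TensorPower.tprod_mul_tprod k x y

theorem cut_tprod {N a b : ℕ} (h : N = a + b) (x : Fin N → Abar k A) :
    cut k A h (PiTensorProduct.tprod k x) =
      PiTensorProduct.tprod k (fun i => x (Fin.cast h.symm (Fin.castAdd b i))) ⊗ₜ
        PiTensorProduct.tprod k (fun i => x (Fin.cast h.symm (Fin.natAdd a i))) := by
  rw [← LinearEquiv.eq_symm_apply, cut_symm_tprod]
  congr 1
  ext i
  subst h
  induction i using Fin.addCases <;> simp

variable (k A) in
/-- The letter `x ε` for `x ∈ Abar`. -/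
def letter : Abar k A →ₗ[k] BarAlg k A := LinearMap.mulRight k (eps k A) ∘ₗ (of k).toLinearMap ∘ₗ sec k A

theorem letter_apply (x : Abar k A) : letter k A x = of k (sec k A x) * eps k A := rfl

variable (k A) in
/-- `x₁ ⊗ ⋯ ⊗ x_n ↦ x₁ ε ⋯ x_n ε`. -/
def tau (n : ℕ) : TPow k A n →ₗ[k] BarAlg k A :=
  PiTensorProduct.lift ((MultilinearMap.mkPiAlgebraFin k n (BarAlg k A)).compLinearMap
    (fun _ => letter k A))

theorem tau_tprod {n : ℕ} (x : Fin n → Abar k A) :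
    tau k A n (PiTensorProduct.tprod k x) = (List.ofFn fun i => letter k A (x i)).prod := by
  simp [tau]

theorem tpow_induction {n : ℕ} {P : TPow k A n → Prop} (h : ∀ x, P (PiTensorProduct.tprod k x))
    (hadd : ∀ s t, P s → P t → P (s + t)) (hsmul : ∀ (c : k) t, P t → P (c • t)) (t : TPow k A n) :
    P t := by
  induction t using PiTensorProduct.induction_on with
  | smul_tprod c x => exact hsmul c _ (h x)
  | add x y hx hy => exact hadd x y hx hy

theorem tau_cut_symm {N a b : ℕ} (h : N = a + b) (s : TPow k A a) (t : TPow k A b) :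
    tau k A N ((cut k A h).symm (s ⊗ₜ t)) = tau k A a s * tau k A b t := by
  induction s using tpow_induction with
  | h x =>
    induction t using tpow_induction with
    | h y =>
      rw [cut_symm_tprod, tau_tprod, tau_tprod, tau_tprod, ← List.prod_append, ← List.ofFn_fin_append]
      subst h
      congr 2
      ext i
      induction i using Fin.addCases <;> simp
    | hadd s t hs ht => simp only [TensorProduct.tmul_add, map_add, mul_add, hs, ht]
    | hsmul c t ht => simp only [TensorProduct.tmul_smul, map_smul, ht, mul_smul_comm]
  | hadd s t hs ht => simp only [TensorProduct.add_tmul, map_add, add_mul, hs, ht]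
  | hsmul c t ht => simp only [← TensorProduct.smul_tmul', map_smul, ht, smul_mul_assoc]

theorem of_sec_proj (a : A) : ∃ c : k, of k (sec k A (proj k A a)) = of k a + c • 1 := by
  have hx : sec k A (proj k A a) - a ∈ Submodule.span k {(1 : A)} := by
    rw [← Submodule.Quotient.eq]
    exact proj_sec k A (proj k A a)
  obtain ⟨c, hc⟩ := Submodule.mem_span_singleton.1 hx
  refine ⟨c, ?_⟩
  rw [← sub_eq_iff_eq_add', ← map_sub, ← hc, map_smul, map_one]

theorem eps_sec_proj_eps (a : A) :
    eps k A * (of k (sec k A (proj k A a)) * eps k A) = eps k A * (of k a * eps k A) := by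
  obtain ⟨c, hc⟩ := of_sec_proj (k := k) a
  rw [hc, add_mul, mul_add, smul_mul_assoc, one_mul, mul_smul_comm, eps_mul_eps, smul_zero, add_zero]

theorem projT_eq (a : A) : projT k A a = PiTensorProduct.tprod k (fun _ => proj k A a) := by
  simp [projT]

theorem tau_projT (a : A) : tau k A 1 (projT k A a) = of k (sec k A (proj k A a)) * eps k A := by
  rw [projT_eq, tau_tprod]; simp [letter_apply]

theorem eps_tau_projT (a : A) : eps k A * tau k A 1 (projT k A a) = eps k A * (of k a * eps k A) := by
  rw [tau_projT, eps_sec_proj_eps]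

theorem tau_zero (t : TPow k A 0) :
    tau k A 0 t = PiTensorProduct.isEmptyEquiv (R := k) (Fin 0) t • (1 : BarAlg k A) := by
  induction t using tpow_induction with
  | h x => rw [tau_tprod]; simp
  | hadd s t hs ht => rw [map_add, map_add, add_smul, hs, ht]
  | hsmul c t ht => rw [map_smul, map_smul, ht, smul_assoc]

theorem eps_prod_eq (l : List (Abar k A)) : ∃ y ∈ deg k A l.length,
    eps k A * (l.map (letter k A)).prod = y * eps k A := by
  induction l using List.reverseRecOn with
  | nil => exact ⟨1, one_mem, by simp⟩
  | append_singleton l x ih =>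
    obtain ⟨y, hy, h⟩ := ih
    refine ⟨y * eps k A * of k (sec k A x), ?_, ?_⟩
    · rw [List.length_append]; exact mul_of_mem _ (mul_eps_mem hy)
    · rw [List.map_append, List.prod_append, ← mul_assoc, h]
      simp [letter_apply, mul_assoc]

/-- `ε τ(t)` ends with `ε`. -/
theorem eps_tau_eq {n : ℕ} (t : TPow k A n) :
    ∃ y ∈ deg k A n, eps k A * tau k A n t = y * eps k A := by
  induction t using tpow_induction with
  | h x =>
    obtain ⟨y, hy, h⟩ := eps_prod_eq (List.ofFn x)
    rw [List.length_ofFn] at hy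
    exact ⟨y, hy, by rw [tau_tprod, ← h, List.map_ofFn]; rfl⟩
  | hadd s t hs ht =>
    obtain ⟨y, hy, h⟩ := hs
    obtain ⟨z, hz, h'⟩ := ht
    exact ⟨y + z, add_mem hy hz, by rw [map_add, mul_add, add_mul, h, h']⟩
  | hsmul c t ht =>
    obtain ⟨y, hy, h⟩ := ht
    exact ⟨c • y, Submodule.smul_mem _ _ hy, by rw [map_smul, mul_smul_comm, smul_mul_assoc, h]⟩

theorem eps_tau_mem {n : ℕ} (t : TPow k A n) : eps k A * tau k A n t ∈ deg k A (n + 1) := by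
  obtain ⟨y, hy, h⟩ := eps_tau_eq t
  rw [h]; exact mul_eps_mem hy

variable (k A) in
/-- `a ⊗ t ↦ a ε τ(t)`. -/
def K (n : ℕ) : LBar k A n →ₗ[k] BarAlg k A :=
  TensorProduct.lift (((LinearMap.mul k (BarAlg k A)).compl₁₂ (of k).toLinearMap
    (LinearMap.mulLeft k (eps k A) ∘ₗ tau k A n)))

@[simp] theorem K_tmul {n : ℕ} (a : A) (t : TPow k A n) :
    K k A n (a ⊗ₜ t) = of k a * (eps k A * tau k A n t) := rfl

theorem lbar_induction {n : ℕ} {P : LBar k A n → Prop} (h : ∀ a t, P (a ⊗ₜ t))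
    (hadd : ∀ s t, P s → P t → P (s + t)) (y : LBar k A n) : P y :=
  TensorProduct.induction_on y (by simpa using h 0 0) h hadd

theorem bar_induction {n : ℕ} {P : Bar k A n → Prop} (h : ∀ a t b, P ((a ⊗ₜ t) ⊗ₜ b))
    (hadd : ∀ s t, P s → P t → P (s + t)) (y : Bar k A n) : P y := by
  refine TensorProduct.induction_on y (by simpa using h 0 0 0) (fun y b => ?_) hadd
  refine lbar_induction (P := fun y => P (y ⊗ₜ b)) (fun a t => h a t b) (fun s t hs ht => ?_) y
  rw [TensorProduct.add_tmul]; exact hadd _ _ hs ht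

variable (k A) in
/-- The term of the augmented bar resolution in position `0` is `A`. -/
def bz : A ≃ₗ[k] BarAug k A 0 := (LinearEquiv.refl k A : A ≃ₗ[k] A)

variable (k A) in
/-- The term of the augmented bar resolution in position `n + 1` is `Bar_n`. -/
def bs (n : ℕ) : Bar k A n ≃ₗ[k] BarAug k A (n + 1) :=
  (LinearEquiv.refl k (Bar k A n) : Bar k A n ≃ₗ[k] Bar k A n)

theorem barAug_induction {P : ∀ p, BarAug k A p → Prop} (h0 : ∀ a, P 0 (bz k A a))
    (h1 : ∀ n a t b, P (n + 1) (bs k A n ((a ⊗ₜ t) ⊗ₜ b)))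
    (hadd : ∀ p y z, P p y → P p z → P p (y + z)) : ∀ {p : ℕ} (y : BarAug k A p), P p y
  | 0, y => by simpa using h0 ((bz k A).symm y)
  | n + 1, y => by
    have := bar_induction (P := fun y => P (n + 1) (bs k A n y)) (h1 n)
      (fun s t hs ht => by rw [map_add]; exact hadd _ _ _ hs ht) ((bs k A n).symm y)
    simpa using this

theorem K_eq {n : ℕ} (y : LBar k A n) : ∃ z ∈ deg k A n, K k A n y = z * eps k A := by
  induction y using lbar_induction with
  | h a t =>
    obtain ⟨y, hy, h⟩ := eps_tau_eq t
    exact ⟨of k a * y, of_mul_mem a hy, by rw [K_tmul, h, mul_assoc]⟩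
  | hadd s t hs ht =>
    obtain ⟨y, hy, h⟩ := hs
    obtain ⟨z, hz, h'⟩ := ht
    exact ⟨y + z, add_mem hy hz, by rw [map_add, add_mul, h, h']⟩

variable (k A) in
/-- The inclusion of the component of degree `p`, `a₀ ⊗ ā₁ ⊗ ⋯ ⊗ a_p ↦ a₀ ε a₁ ε ⋯ ε a_p`. -/
def J : (p : ℕ) → BarAug k A p →ₗ[k] BarAlg k A
  | 0 => (of k).toLinearMap ∘ₗ (bz k A).symm.toLinearMap
  | n + 1 => TensorProduct.lift ((LinearMap.mul k (BarAlg k A)).compl₁₂ (K k A n) (of k).toLinearMap)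
      ∘ₗ (bs k A n).symm.toLinearMap

theorem J_zero (a : A) : J k A 0 (bz k A a) = of k a := by simp [J]

theorem J_tmul {n : ℕ} (y : LBar k A n) (b : A) :
    J k A (n + 1) (bs k A n (y ⊗ₜ[k] b)) = K k A n y * of k b := by simp [J]

theorem J_succ {n : ℕ} (a : A) (t : TPow k A n) (b : A) :
    J k A (n + 1) (bs k A n ((a ⊗ₜ[k] t) ⊗ₜ[k] b)) =
      of k a * (eps k A * tau k A n t) * of k b := J_tmul _ _

theorem J_mem {p : ℕ} (y : BarAug k A p) : J k A p y ∈ deg k A p := by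
  induction y using barAug_induction with
  | h0 a => rw [J_zero]; exact of_mem a
  | h1 n a t b => rw [J_succ]; exact mul_of_mem b (of_mul_mem a (eps_tau_mem t))
  | hadd p s t hs ht => rw [map_add]; exact add_mem hs ht

variable (k A) in
/-- Multiplication by `ε` from the left. -/
def epsB : (p : ℕ) → BarAug k A p →ₗ[k] BarAug k A (p + 1)
  | 0 => (bs k A 0).toLinearMap ∘ₗ
      (TensorProduct.mk k (LBar k A 0) A) (1 ⊗ₜ PiTensorProduct.tprod k Fin.elim0) ∘ₗ
      (bz k A).symm.toLinearMap
  | n + 1 => (bs k A (n + 1)).toLinearMap ∘ₗ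
      (oneL k A (n + 1) ∘ₗ (cut k A (Nat.add_comm n 1)).symm.toLinearMap ∘ₗ
      (projT k A).rTensor (TPow k A n)).rTensor A ∘ₗ (bs k A n).symm.toLinearMap

theorem epsB_zero (a : A) : epsB k A 0 (bz k A a) =
    bs k A 0 ((1 ⊗ₜ[k] PiTensorProduct.tprod k Fin.elim0) ⊗ₜ[k] a) := by simp [epsB]

theorem epsB_succ {n : ℕ} (a : A) (t : TPow k A n) (b : A) :
    epsB k A (n + 1) (bs k A n ((a ⊗ₜ[k] t) ⊗ₜ[k] b)) = bs k A (n + 1)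
      (((1 : A) ⊗ₜ[k] (cut k A (Nat.add_comm n 1)).symm (projT k A a ⊗ₜ t)) ⊗ₜ[k] b) := by
  simp [epsB, oneL]

theorem projT_one : projT k A 1 = 0 := by
  have : proj k A 1 = 0 := by simp
  rw [projT, LinearMap.comp_apply, this, map_zero]

theorem epsB_epsB {p : ℕ} (y : BarAug k A p) : epsB k A (p + 1) (epsB k A p y) = 0 := by
  induction y using barAug_induction with
  | h0 a =>
    rw [epsB_zero, epsB_succ, projT_one, TensorProduct.zero_tmul, map_zero, TensorProduct.tmul_zero,
      TensorProduct.zero_tmul, map_zero]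
  | h1 n a t b =>
    rw [epsB_succ, epsB_succ, projT_one, TensorProduct.zero_tmul, map_zero, TensorProduct.tmul_zero,
      TensorProduct.zero_tmul, map_zero]
  | hadd p s t hs ht => rw [map_add, map_add, hs, ht, add_zero]

theorem lact_zero (a b : A) : lact k A 0 (a ⊗ₜ[k] bz k A b) = bz k A (a * b) := rfl

theorem lact_succ {n : ℕ} (a a' : A) (t : TPow k A n) (b : A) :
    lact k A (n + 1) (a ⊗ₜ[k] bs k A n ((a' ⊗ₜ[k] t) ⊗ₜ[k] b)) =
      bs k A n (((a * a') ⊗ₜ[k] t) ⊗ₜ[k] b) := rfl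

theorem lact_one {p : ℕ} (y : BarAug k A p) : lact k A p (1 ⊗ₜ y) = y := by
  induction y using barAug_induction with
  | h0 a => rw [lact_zero, one_mul]
  | h1 n a t b => rw [lact_succ, one_mul]
  | hadd p s t hs ht => rw [TensorProduct.tmul_add, map_add, hs, ht]

theorem lact_mul (a b : A) {p : ℕ} (y : BarAug k A p) :
    lact k A p ((a * b) ⊗ₜ y) = lact k A p (a ⊗ₜ lact k A p (b ⊗ₜ y)) := by
  induction y using barAug_induction with
  | h0 c => simp only [lact_zero, mul_assoc]
  | h1 n c t d => simp only [lact_succ, mul_assoc]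
  | hadd p s t hs ht => simp only [TensorProduct.tmul_add, map_add, hs, ht]

variable (k A) in
/-- The sequences of elements of the terms of the bar resolution. -/
abbrev BarSeq : Type u := ∀ p, BarAug k A p

variable (k A) in
/-- Multiplication by `ε` on sequences of elements of the bar resolution. -/
def seqEps : (p : ℕ) → BarSeq k A →ₗ[k] BarAug k A p
  | 0 => 0
  | p + 1 => epsB k A p ∘ₗ LinearMap.proj p

variable (k A) in
theorem seqEps_sq : (LinearMap.pi (seqEps k A) : Module.End k (BarSeq k A)) *
    LinearMap.pi (seqEps k A) = 0 := by
  refine LinearMap.ext fun y => funext fun p => ?_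
  match p with
  | 0 => rfl
  | 1 =>
    change epsB k A 0 0 = 0
    rw [map_zero]
  | p + 2 => exact epsB_epsB (y p)

variable (k A) in
/-- The action of the algebra on sequences of elements of the bar resolution. -/
def seqAct : BarAlg k A →ₐ[k] Module.End k (BarSeq k A) :=
  lift
    (AlgHom.mk' (R := k)
      { toFun := fun a => LinearMap.pi fun p => lact k A p ∘ₗ TensorProduct.mk k A _ a ∘ₗ
          LinearMap.proj p
        map_one' := LinearMap.ext fun y => funext fun p => lact_one (y p)
        map_mul' := fun a b => LinearMap.ext fun y => funext fun p => lact_mul a b (y p)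
        map_zero' := LinearMap.ext fun y => funext fun p => by simp
        map_add' := fun a b => LinearMap.ext fun y => funext fun p => by simp }
      (fun c a => LinearMap.ext fun y => funext fun p => by simp))
    (LinearMap.pi (seqEps k A)) (seqEps_sq k A)

theorem seqAct_of (a : A) (y : BarSeq k A) (p : ℕ) :
    seqAct k A (of k a) y p = lact k A p (a ⊗ₜ y p) := by
  rw [seqAct, lift_of]; rfl

theorem seqAct_eps (y : BarSeq k A) (p : ℕ) : seqAct k A (eps k A) y p = seqEps k A p y := by
  rw [seqAct, lift_eps]; rfl

theorem seqAct_of_single (a : A) (p : ℕ) (z : BarAug k A p) :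
    seqAct k A (of k a) (Pi.single p z) = Pi.single p (lact k A p (a ⊗ₜ z)) := by
  funext q
  rw [seqAct_of]
  by_cases h : q = p
  · subst h; simp
  · simp [Pi.single_eq_of_ne h]

theorem seqAct_eps_single (p : ℕ) (z : BarAug k A p) :
    seqAct k A (eps k A) (Pi.single p z) = Pi.single (p + 1) (epsB k A p z) := by
  funext q
  rw [seqAct_eps]
  cases q with
  | zero => rw [Pi.single_eq_of_ne (by omega)]; rfl
  | succ q =>
    change epsB k A q _ = _
    by_cases h : q = p
    · subst h; simp
    · simp [Pi.single_eq_of_ne h, Pi.single_eq_of_ne (show q + 1 ≠ p + 1 by omega)]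

theorem seqAct_eps_tau {n : ℕ} (t : TPow k A n) (b : A) :
    seqAct k A (eps k A * tau k A n t) (Pi.single 0 (bz k A b)) =
      Pi.single (n + 1) (bs k A n ((1 ⊗ₜ[k] t) ⊗ₜ[k] b)) := by
  induction t using tpow_induction with
  | h x =>
    induction n with
    | zero =>
      rw [tau_tprod, List.ofFn_zero, List.prod_nil, mul_one, seqAct_eps_single, epsB_zero]
      obtain rfl : x = Fin.elim0 := funext fun i => i.elim0
      rfl
    | succ n ih =>
      rw [tau_tprod, List.ofFn_succ, List.prod_cons, letter_apply, mul_assoc, map_mul, map_mul,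
        Module.End.mul_apply, Module.End.mul_apply, ← tau_tprod (fun i => x i.succ), ih,
        seqAct_of_single, seqAct_eps_single, lact_succ, mul_one, epsB_succ, projT_eq,
        cut_symm_tprod, proj_sec]
      congr 5
      ext i
      refine Fin.cases ?_ (fun i => ?_) i
      · have : Fin.cast (Nat.add_comm n 1) 0 = Fin.castAdd n (0 : Fin 1) := rfl
        rw [this, Fin.append_left]
      · have : Fin.cast (Nat.add_comm n 1) i.succ = Fin.natAdd 1 i := by ext; simp; omega
        rw [this, Fin.append_right]
  | hadd s t hs ht =>
    simp only [map_add, mul_add, LinearMap.add_apply, hs, ht, TensorProduct.tmul_add,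
      TensorProduct.add_tmul, Pi.single_add]
  | hsmul c t ht =>
    simp only [map_smul, mul_smul_comm, LinearMap.smul_apply, ht, TensorProduct.tmul_smul,
      ← TensorProduct.smul_tmul', Pi.single_smul]

theorem seqAct_J {p : ℕ} (y : BarAug k A p) :
    seqAct k A (J k A p y) (Pi.single 0 (bz k A 1)) = Pi.single p y := by
  induction y using barAug_induction with
  | h0 a => rw [J_zero, seqAct_of_single, lact_zero, mul_one]
  | h1 n a t b =>
    rw [J_succ, map_mul, map_mul, Module.End.mul_apply, Module.End.mul_apply, seqAct_of_single,
      lact_zero, mul_one, seqAct_eps_tau, seqAct_of_single, lact_succ, mul_one]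
  | hadd p s t hs ht => rw [map_add, map_add, LinearMap.add_apply, hs, ht, Pi.single_add]

variable (k A) in
/-- The projection to the component of degree `p`. -/
def pr (p : ℕ) : BarAlg k A →ₗ[k] BarAug k A p :=
  LinearMap.proj p ∘ₗ (seqAct k A).toLinearMap.flip (Pi.single 0 (bz k A 1))

theorem pr_J {p : ℕ} (y : BarAug k A p) : pr k A p (J k A p y) = y := by
  change seqAct k A (J k A p y) (Pi.single 0 (bz k A 1)) p = y
  rw [seqAct_J]; simp

theorem pr_J_ne {p q : ℕ} (h : q ≠ p) (y : BarAug k A p) : pr k A q (J k A p y) = 0 := by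
  change seqAct k A (J k A p y) (Pi.single 0 (bz k A 1)) q = 0
  rw [seqAct_J, Pi.single_eq_of_ne h]

theorem J_injective (p : ℕ) : Function.Injective (J k A p) :=
  Function.LeftInverse.injective (g := pr k A p) pr_J

theorem J_lact (a : A) {p : ℕ} (y : BarAug k A p) :
    J k A p (lact k A p (a ⊗ₜ y)) = of k a * J k A p y := by
  induction y using barAug_induction with
  | h0 b => rw [lact_zero, J_zero, J_zero, map_mul]
  | h1 n c t d => rw [lact_succ, J_succ, J_succ, map_mul]; simp only [mul_assoc]
  | hadd p s t hs ht => rw [TensorProduct.tmul_add, map_add, map_add, hs, ht, map_add, mul_add]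

theorem ract_zero (a b : A) : ract k A 0 (bz k A b ⊗ₜ[k] a) = bz k A (b * a) := rfl

theorem ract_succ {n : ℕ} (a : A) (y : LBar k A n) (b : A) :
    ract k A (n + 1) (bs k A n (y ⊗ₜ[k] b) ⊗ₜ[k] a) = bs k A n (y ⊗ₜ[k] (b * a)) := rfl

theorem J_ract (a : A) {p : ℕ} (y : BarAug k A p) :
    J k A p (ract k A p (y ⊗ₜ a)) = J k A p y * of k a := by
  induction y using barAug_induction with
  | h0 b => rw [ract_zero, J_zero, J_zero, map_mul]
  | h1 n c t d => rw [ract_succ, J_tmul, J_tmul, map_mul, mul_assoc]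
  | hadd p s t hs ht => rw [TensorProduct.add_tmul, map_add, map_add, hs, ht, map_add, add_mul]

theorem J_epsB {p : ℕ} (y : BarAug k A p) :
    J k A (p + 1) (epsB k A p y) = eps k A * J k A p y := by
  induction y using barAug_induction with
  | h0 a => rw [epsB_zero, J_succ, J_zero, tau_tprod]; simp
  | h1 n a t b =>
    rw [epsB_succ, J_succ, J_succ, tau_cut_symm, map_one, one_mul, ← mul_assoc (eps k A),
      eps_tau_projT]
    simp only [mul_assoc]
  | hadd p s t hs ht => rw [map_add, map_add, hs, ht, map_add, mul_add]

theorem exists_J {p : ℕ} {x : BarAlg k A} (hx : x ∈ deg k A p) : ∃ y, J k A p y = x := by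
  induction hx using deg_induction with
  | hof a => exact ⟨bz k A a, J_zero a⟩
  | hadd n x y _ _ hx hy =>
    obtain ⟨x, rfl⟩ := hx
    obtain ⟨y, rfl⟩ := hy
    exact ⟨x + y, map_add _ _ _⟩
  | hsmul n c x _ hx =>
    obtain ⟨x, rfl⟩ := hx
    exact ⟨c • x, map_smul _ _ _⟩
  | hword n a x _ hx =>
    obtain ⟨x, rfl⟩ := hx
    exact ⟨lact k A (n + 1) (a ⊗ₜ epsB k A n x), by rw [J_lact, J_epsB]⟩

theorem J_pr {p : ℕ} {x : BarAlg k A} (hx : x ∈ deg k A p) : J k A p (pr k A p x) = x := by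
  obtain ⟨y, rfl⟩ := exists_J hx; rw [pr_J]

theorem pr_ne {p q : ℕ} (h : q ≠ p) {x : BarAlg k A} (hx : x ∈ deg k A p) : pr k A q x = 0 := by
  obtain ⟨y, rfl⟩ := exists_J hx; exact pr_J_ne h y

end BarAlg
end
end TateHH

namespace TateHH
noncomputable section

namespace BarAlg

variable {k A : Type u} [Field k] [Ring A] [Algebra k A]
variable {V W : Type*} [AddCommGroup V] [Module k V] [AddCommGroup W] [Module k W]

/-! ### Words and the differential -/

variable (k) in
/-- The word `w₀ ε w₁ ε ⋯ ε w_n`. -/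
def wd : (n : ℕ) → (Fin (n + 1) → A) → BarAlg k A
  | 0, w => of k (w 0)
  | n + 1, w => of k (w 0) * (eps k A * wd n (Fin.tail w))

theorem d_wd {n : ℕ} (w : Fin (n + 2) → A) : d (wd k (n + 1) w) =
    ∑ j : Fin (n + 1), (-1 : k) ^ (j : ℕ) • wd k n (Fin.contractNth j.castSucc (· * ·) w) := by
  induction n with
  | zero => simp [wd, Fin.contractNth, Fin.tail]
  | succ n ih =>
    have h0 : wd k (n + 1) (Fin.contractNth (Fin.castSucc 0) (· * ·) w) =
        of k (w 0) * wd k (n + 1) (Fin.tail w) := by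
      rw [wd, wd, ← mul_assoc (of k (w 0)), ← map_mul]
      congr 3
    have h1 : ∀ j : Fin (n + 1), wd k (n + 1) (Fin.contractNth (Fin.castSucc j.succ) (· * ·) w) =
        of k (w 0) * (eps k A * wd k n (Fin.contractNth j.castSucc (· * ·) (Fin.tail w))) := by
      intro j
      rw [wd]
      congr 3
      ext i
      simp [Fin.contractNth, Fin.tail]
    rw [Fin.sum_univ_succ, wd, d_of_mul, d_eps_mul, ih, h0, mul_sub, Finset.mul_sum,
      Finset.mul_sum, sub_eq_add_neg, ← Finset.sum_neg_distrib]
    simp only [h1]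
    congr 1
    · simp
    · refine Finset.sum_congr rfl fun j _ => ?_
      simp [pow_succ]

theorem eps_prod_letter (l : List A) (c : A) :
    eps k A * (l.map fun a => letter k A (proj k A a)).prod * of k c =
      (l.map fun a => eps k A * of k a).prod * (eps k A * of k c) := by
  induction l with
  | nil => simp
  | cons a l ih =>
    rw [List.map_cons, List.prod_cons, List.map_cons, List.prod_cons,
      mul_assoc (eps k A * of k a), ← ih, letter_apply]
    have := congrArg (· * ((l.map fun a => letter k A (proj k A a)).prod * of k c))
      (eps_sec_proj_eps (k := k) a)
    simpa only [mul_assoc] using this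

theorem wd_eq {n : ℕ} (w : Fin (n + 2) → A) : wd k (n + 1) w =
    of k (w 0) * (((List.ofFn fun i : Fin n => w i.succ.castSucc).map
      fun a => eps k A * of k a).prod * (eps k A * of k (w (Fin.last _)))) := by
  induction n with
  | zero => simp [wd, Fin.tail]
  | succ n ih =>
    rw [wd, ih, List.ofFn_succ, List.map_cons, List.prod_cons]
    simp only [mul_assoc]
    rfl

theorem J_barWord {p : ℕ} (w : Fin (p + 2) → A) :
    J k A (p + 1) (bs k A p (barWord k A p w)) = wd k (p + 1) w := by
  rw [barWord_apply, J_succ, wd_eq, ← eps_prod_letter, tau_tprod, List.map_ofFn]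
  simp only [mul_assoc]; rfl

theorem exists_barWord {p : ℕ} {P : Bar k A p → Prop} (h : ∀ w, P (barWord k A p w))
    (hadd : ∀ s t, P s → P t → P (s + t)) (hsmul : ∀ (c : k) t, P t → P (c • t))
    (y : Bar k A p) : P y := by
  induction y using bar_induction with
  | h a t b =>
    induction t using tpow_induction with
    | h x =>
      have := h (Fin.cons a (Fin.snoc (fun i => sec k A (x i)) b))
      rw [barWord_apply] at this
      simp only [Fin.cons_zero] at this
      convert this using 2
      · congr 2
        ext i
        rw [← Fin.succ_castSucc, Fin.cons_succ, Fin.snoc_castSucc, proj_sec]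
      · rw [← Fin.succ_last, Fin.cons_succ, Fin.snoc_last]
    | hadd s t hs ht =>
      rw [TensorProduct.tmul_add, TensorProduct.add_tmul]; exact hadd _ _ hs ht
    | hsmul c t ht =>
      rw [TensorProduct.tmul_smul, ← TensorProduct.smul_tmul']; exact hsmul _ _ ht
  | hadd s t hs ht => exact hadd _ _ hs ht

theorem barD_succ_eq {p : ℕ} (y : Bar k A (p + 1)) :
    barD k A (p + 1) y = bs k A p (barDSucc k A p y) := rfl

theorem J_barD : ∀ {p : ℕ} (y : Bar k A p), J k A p (barD k A p y) = d (J k A (p + 1) (bs k A p y))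
  | 0, y => by
    induction y using exists_barWord with
    | h w =>
      have : barD k A 0 (barWord k A 0 w) = bz k A (w 0 * w 1) := barD_barWord_zero k A w
      rw [this, J_zero, J_barWord, d_wd]
      simp [wd, Fin.contractNth]
    | hadd s t hs ht => simp only [map_add, hs, ht]
    | hsmul c t ht => simp only [map_smul, ht]
  | p + 1, y => by
    induction y using exists_barWord with
    | h w =>
      have : barD k A (p + 1) (barWord k A (p + 1) w) =
        bs k A p (∑ j : Fin (p + 2), (-1 : k) ^ (j : ℕ) •
          barWord k A p (Fin.contractNth j.castSucc (· * ·) w)) := barD_barWord_succ k A p w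
      rw [this, J_barWord, d_wd]
      simp only [map_sum, map_smul, J_barWord]
    | hadd s t hs ht => simp only [map_add, hs, ht]
    | hsmul c t ht => simp only [map_smul, ht]

theorem mem_Om_iff {p : ℕ} (m : BarAug k A p) : m ∈ Om k A p ↔ d (J k A p m) = 0 := by
  constructor
  · rintro ⟨y, rfl⟩
    rw [J_barD, d_d]
  · intro h
    refine ⟨(bs k A p).symm (epsB k A p m), J_injective p ?_⟩
    rw [J_barD, LinearEquiv.apply_symm_apply, J_epsB, d_eps_mul, h, mul_zero, sub_zero]

/-! ### Cochains as endomorphisms of the algebra -/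

/-- `F` is `A`-bilinear, vanishes outside of degree `s + 1` and takes values in degree `p`. -/
structure IsC (s p : ℕ) (F : BarAlg k A →ₗ[k] BarAlg k A) : Prop where
  of_mul : ∀ a x, F (of k a * x) = of k a * F x
  mul_of : ∀ x a, F (x * of k a) = F x * of k a
  supp : ∀ n x, x ∈ deg k A n → n ≠ s + 1 → F x = 0
  mem : ∀ x, x ∈ deg k A (s + 1) → F x ∈ deg k A p

variable (k A) in
theorem deg_induction_on {P : BarAlg k A → Prop} (hdeg : ∀ n x, x ∈ deg k A n → P x)
    (hadd : ∀ x y, P x → P y → P (x + y)) (x : BarAlg k A) : P x := by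
  have hx : x ∈ ⨆ n, deg k A n := by rw [iSup_deg]; trivial
  exact Submodule.iSup_induction _ (motive := P) hx hdeg (hdeg 0 0 (zero_mem _)) hadd

theorem IsC.mem' {s p : ℕ} {F : BarAlg k A →ₗ[k] BarAlg k A} (hF : IsC s p F) (x : BarAlg k A) :
    F x ∈ deg k A p := by
  induction x using deg_induction_on with
  | hdeg n x hx =>
    by_cases h : n = s + 1
    · subst h; exact hF.mem x hx
    · rw [hF.supp n x hx h]; exact zero_mem _
  | hadd x y hx hy => rw [map_add]; exact add_mem hx hy

theorem deg_eq_eps_tau {n : ℕ} {U : Submodule k (BarAlg k A)}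
    (hU : ∀ (a : A) (t : TPow k A n) (b : A), of k a * (eps k A * tau k A n t) * of k b ∈ U)
    {x : BarAlg k A} (hx : x ∈ deg k A (n + 1)) : x ∈ U := by
  obtain ⟨y, rfl⟩ := exists_J hx
  obtain ⟨y, rfl⟩ := (bs k A n).surjective y
  induction y using bar_induction with
  | h a t b => rw [J_succ]; exact hU a t b
  | hadd s t hs ht =>
    rw [map_add, map_add] at *
    exact add_mem (hs (J_mem _)) (ht (J_mem _))

theorem IsC.ext {s p q : ℕ} {F G : BarAlg k A →ₗ[k] BarAlg k A} (hF : IsC s p F) (hG : IsC s q G)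
    (h : ∀ t, F (eps k A * tau k A s t) = G (eps k A * tau k A s t)) : F = G := by
  refine ext_deg fun n x hx => ?_
  by_cases hn : n = s + 1
  · subst hn
    refine LinearMap.mem_eqLocus.1 (deg_eq_eps_tau (U := LinearMap.eqLocus F G) ?_ hx)
    intro a t b
    rw [LinearMap.mem_eqLocus, hF.mul_of, hF.of_mul, hG.mul_of, hG.of_mul, h]
  · rw [hF.supp n x hx hn, hG.supp n x hx hn]

theorem IsC.add {s p : ℕ} {F G : BarAlg k A →ₗ[k] BarAlg k A} (hF : IsC s p F) (hG : IsC s p G) :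
    IsC s p (F + G) where
  of_mul a x := by simp [hF.of_mul, hG.of_mul, mul_add]
  mul_of x a := by simp [hF.mul_of, hG.mul_of, add_mul]
  supp n x hx h := by simp [hF.supp n x hx h, hG.supp n x hx h]
  mem x hx := add_mem (hF.mem x hx) (hG.mem x hx)

theorem IsC.smul {s p : ℕ} {F : BarAlg k A →ₗ[k] BarAlg k A} (hF : IsC s p F) (c : k) :
    IsC s p (c • F) where
  of_mul a x := by simp [hF.of_mul]
  mul_of x a := by simp [hF.mul_of]
  supp n x hx h := by simp [hF.supp n x hx h]
  mem x hx := Submodule.smul_mem _ c (hF.mem x hx)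

theorem IsC.comp_d {s p : ℕ} {F : BarAlg k A →ₗ[k] BarAlg k A} (hF : IsC s p F) :
    IsC (s + 1) p (F ∘ₗ d) where
  of_mul a x := by simp [hF.of_mul]
  mul_of x a := by simp [hF.mul_of]
  supp n x hx h := by
    cases n with
    | zero => simp [d_deg_zero hx]
    | succ n => exact hF.supp n _ (d_mem hx) (by omega)
  mem x hx := hF.mem _ (d_mem hx)

theorem bimodExt_add {s p : ℕ} (f g : Coch k A s p) :
    bimodExt k A (f + g) = bimodExt k A f + bimodExt k A g := by
  simp only [bimodExt, LinearMap.lTensor_add, LinearMap.comp_add, LinearMap.rTensor_add]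

theorem bimodExt_smul {s p : ℕ} (c : k) (f : Coch k A s p) :
    bimodExt k A (c • f) = c • bimodExt k A f := by
  simp only [bimodExt, LinearMap.lTensor_smul, LinearMap.comp_smul, LinearMap.rTensor_smul]

/-- The endomorphism of the algebra that corresponds to a cochain. -/
def ext {s p : ℕ} : Coch k A s p →ₗ[k] BarAlg k A →ₗ[k] BarAlg k A where
  toFun f := J k A p ∘ₗ bimodExt k A f ∘ₗ (bs k A s).symm.toLinearMap ∘ₗ pr k A (s + 1)
  map_add' f g := by rw [bimodExt_add, LinearMap.add_comp, LinearMap.comp_add]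
  map_smul' c f := by rw [bimodExt_smul, LinearMap.smul_comp, LinearMap.comp_smul]; rfl

theorem ext_apply {s p : ℕ} (f : Coch k A s p) (x : BarAlg k A) :
    ext f x = J k A p (bimodExt k A f ((bs k A s).symm (pr k A (s + 1) x))) := rfl

theorem ext_J {s p : ℕ} (f : Coch k A s p) (y : Bar k A s) :
    ext f (J k A (s + 1) (bs k A s y)) = J k A p (bimodExt k A f y) := by
  rw [ext_apply, pr_J, LinearEquiv.symm_apply_apply]

theorem bimodExt_tmul {s p : ℕ} (f : Coch k A s p) (a : A) (t : TPow k A s) (b : A) :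
    bimodExt k A f ((a ⊗ₜ t) ⊗ₜ b) = ract k A p (lact k A p (a ⊗ₜ f t) ⊗ₜ b) := rfl

theorem ext_word {s p : ℕ} (f : Coch k A s p) (a : A) (t : TPow k A s) (b : A) :
    ext f (of k a * (eps k A * tau k A s t) * of k b) = of k a * J k A p (f t) * of k b := by
  rw [← J_succ, ext_J, bimodExt_tmul, J_ract, J_lact]

theorem ext_tau {s p : ℕ} (f : Coch k A s p) (t : TPow k A s) :
    ext f (eps k A * tau k A s t) = J k A p (f t) := by
  have := ext_word f 1 t 1
  simpa using this

theorem ext_isC {s p : ℕ} (f : Coch k A s p) : IsC s p (ext f) := by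
  have hs : ∀ n x, x ∈ deg k A n → n ≠ s + 1 → ext f x = 0 := fun n x hx h => by
    rw [ext_apply, pr_ne (Ne.symm h) hx, map_zero, map_zero, map_zero]
  refine ⟨fun a x => ?_, fun x a => ?_, hs, fun x _ => J_mem _⟩
  · have : ext f ∘ₗ LinearMap.mulLeft k (of k a) = LinearMap.mulLeft k (of k a) ∘ₗ ext f := by
      refine ext_deg fun n x hx => ?_
      by_cases hn : n = s + 1
      · subst hn
        refine LinearMap.mem_eqLocus.1 (deg_eq_eps_tau (U := LinearMap.eqLocus _ _) ?_ hx)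
        intro b t c
        rw [LinearMap.mem_eqLocus, LinearMap.comp_apply, LinearMap.comp_apply, ext_word,
          LinearMap.mulLeft_apply, LinearMap.mulLeft_apply, ← mul_assoc, ← mul_assoc, ← map_mul,
          ext_word, map_mul]
        simp only [mul_assoc]
      · simp [hs n x hx hn, hs n _ (of_mul_mem a hx) hn]
    exact LinearMap.congr_fun this x
  · have : ext f ∘ₗ LinearMap.mulRight k (of k a) = LinearMap.mulRight k (of k a) ∘ₗ ext f := by
      refine ext_deg fun n x hx => ?_
      by_cases hn : n = s + 1
      · subst hn
        refine LinearMap.mem_eqLocus.1 (deg_eq_eps_tau (U := LinearMap.eqLocus _ _) ?_ hx)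
        intro b t c
        rw [LinearMap.mem_eqLocus, LinearMap.comp_apply, LinearMap.comp_apply, ext_word,
          LinearMap.mulRight_apply, LinearMap.mulRight_apply, mul_assoc, ← map_mul,
          ext_word, map_mul]
        simp only [mul_assoc]
      · simp [hs n x hx hn, hs n _ (mul_of_mem a hx) hn]
    exact LinearMap.congr_fun this x

theorem ext_injective {s p : ℕ} : Function.Injective (ext (k := k) (A := A) (s := s) (p := p)) := by
  intro f g h
  refine LinearMap.ext fun t => J_injective p ?_
  rw [← ext_tau, ← ext_tau, h]

/-- The cochain that corresponds to an endomorphism. -/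
def unext (s p : ℕ) (F : BarAlg k A →ₗ[k] BarAlg k A) : Coch k A s p :=
  pr k A p ∘ₗ F ∘ₗ LinearMap.mulLeft k (eps k A) ∘ₗ tau k A s

theorem ext_unext {s p : ℕ} {F : BarAlg k A →ₗ[k] BarAlg k A} (hF : IsC s p F) :
    ext (unext s p F) = F := by
  refine (ext_isC _).ext hF fun t => ?_
  rw [ext_tau]
  exact J_pr (hF.mem' _)

theorem ext_delta {s p : ℕ} (f : Coch k A s p) : ext (delta k A s p f) = ext f ∘ₗ d := by
  refine (ext_isC _).ext (ext_isC f).comp_d fun t => ?_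
  have h : delta k A s p f t =
    bimodExt k A f ((bs k A s).symm (barD k A (s + 1) ((1 ⊗ₜ t) ⊗ₜ 1))) := rfl
  rw [ext_tau, h, ← ext_J, LinearEquiv.apply_symm_apply, J_barD, J_succ]
  simp

theorem mem_omCoch_iff {s p : ℕ} (f : Coch k A s p) : f ∈ omCoch k A s p ↔ d ∘ₗ ext f = 0 := by
  constructor
  · intro h
    refine ext_deg fun n x hx => ?_
    by_cases hn : n = s + 1
    · subst hn
      refine LinearMap.mem_ker.1 (deg_eq_eps_tau (U := LinearMap.ker (d ∘ₗ ext f)) ?_ hx)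
      intro a t b
      rw [LinearMap.mem_ker, LinearMap.comp_apply, ext_word, d_mul_of, d_of_mul,
        (mem_Om_iff _).1 (h t), mul_zero, zero_mul]
    · simp [(ext_isC f).supp n x hx hn]
  · intro h t
    rw [mem_Om_iff, ← ext_tau]
    exact LinearMap.congr_fun h _

theorem mem_extZ_iff {s p : ℕ} (f : Coch k A s p) :
    f ∈ extZ k A s p ↔ ext f ∘ₗ d = 0 ∧ d ∘ₗ ext f = 0 := by
  rw [extZ, Submodule.mem_inf, mem_omCoch_iff, LinearMap.mem_ker, ← ext_delta]
  exact and_congr_left fun _ => ⟨fun h => by rw [h, map_zero],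
    fun h => ext_injective (by rw [h, map_zero])⟩

theorem mem_extB_succ_iff {s p : ℕ} (f : Coch k A (s + 1) p) :
    f ∈ extB k A (s + 1) p ↔ ∃ G, IsC s p G ∧ d ∘ₗ G = 0 ∧ ext f = G ∘ₗ d := by
  constructor
  · rintro ⟨g, hg, rfl⟩
    exact ⟨ext g, ext_isC g, (mem_omCoch_iff g).1 hg, ext_delta g⟩
  · rintro ⟨G, hG, hd, h⟩
    refine ⟨unext s p G, ?_, ext_injective ?_⟩
    · rw [SetLike.mem_coe, mem_omCoch_iff, ext_unext hG, hd]
    · rw [ext_delta, ext_unext hG, h]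

/-! ### The maps between the terms of the bar resolution -/

theorem K_appendL {P p q : ℕ} (h : P = p + q) (y : LBar k A p) (t : TPow k A q) :
    K k A P (appendL k A h (y ⊗ₜ t)) = K k A p y * tau k A q t := by
  induction y using lbar_induction with
  | h a s =>
    have : appendL k A h ((a ⊗ₜ s) ⊗ₜ t) = a ⊗ₜ (cut k A h).symm (s ⊗ₜ t) := rfl
    rw [this, K_tmul, K_tmul, tau_cut_symm]
    simp only [mul_assoc]
  | hadd x y hx hy => simp only [TensorProduct.add_tmul, map_add, hx, hy, add_mul]

theorem K_mul_tau_projT {n : ℕ} (y : LBar k A n) (a : A) :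
    K k A n y * tau k A 1 (projT k A a) = K k A n y * (of k a * eps k A) := by
  obtain ⟨z, -, h⟩ := K_eq y
  rw [h, mul_assoc, eps_tau_projT, mul_assoc]

theorem K_zeroEquiv (a : A) : K k A 0 ((zeroEquiv k A).symm a) = of k a * eps k A := by
  have h : (zeroEquiv k A).symm a = a ⊗ₜ PiTensorProduct.tprod k Fin.elim0 := by
    rw [LinearEquiv.symm_apply_eq]; simp [zeroEquiv]
  rw [h, K_tmul, tau_tprod]; simp

theorem K_piR {p : ℕ} (m : BarAug k A p) : K k A p (piR k A p m) = J k A p m * eps k A := by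
  induction m using barAug_induction with
  | h0 a =>
    have : piR k A 0 (bz k A a) = (zeroEquiv k A).symm a := rfl
    rw [this, K_zeroEquiv, J_zero]
  | h1 n a t b =>
    have : piR k A (n + 1) (bs k A n ((a ⊗ₜ t) ⊗ₜ b)) =
      appendL k A (rfl : n + 1 = n + 1) ((a ⊗ₜ t) ⊗ₜ projT k A b) := rfl
    rw [this, K_appendL, K_mul_tau_projT, K_tmul, J_succ]
    simp only [mul_assoc]
  | hadd p y z hy hz => simp only [map_add, add_mul, hy, hz]

theorem J_dOne {n : ℕ} (y : LBar k A n) : J k A n (dOne k A n y) = d (K k A n y) := by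
  have : dOne k A n y = barD k A n (y ⊗ₜ 1) := rfl
  rw [this, J_barD, J_tmul, map_one, mul_one]

theorem eps_tau_piB {p : ℕ} (m : BarAug k A p) :
    eps k A * tau k A (p + 1) (piB k A p m) = eps k A * (J k A p m * eps k A) := by
  rw [← K_piR]
  have : piB k A p m = (cut k A (Nat.add_comm p 1)).symm
    ((projT k A).rTensor (TPow k A p) (piR k A p m)) := rfl
  rw [this]
  generalize piR k A p m = y
  induction y using lbar_induction with
  | h a t =>
    rw [LinearMap.rTensor_tmul, tau_cut_symm, ← mul_assoc, eps_tau_projT, K_tmul]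
    simp only [mul_assoc]
  | hadd x y hx hy => simp only [map_add, mul_add, hx, hy]

/-! ### Convolution -/

/-- The convolution `x ↦ ∑ F(x'ε) G(εx'')`. -/
def conv (F G : BarAlg k A →ₗ[k] BarAlg k A) : BarAlg k A →ₗ[k] BarAlg k A :=
  cutSum ((LinearMap.mul k (BarAlg k A)).compl₁₂ F G)

/-- `x ↦ ∑ F(x'ε) εx''`. -/
def tilde (F : BarAlg k A →ₗ[k] BarAlg k A) : BarAlg k A →ₗ[k] BarAlg k A := conv F LinearMap.id

/-- `x ↦ ∑ sg c (x'ε) F~(εx'')`. -/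
def Lam (c : k) (F : BarAlg k A →ₗ[k] BarAlg k A) : BarAlg k A →ₗ[k] BarAlg k A :=
  conv (sg c).toLinearMap (tilde F)

theorem cutSum_eq_zero {T : BarAlg k A →ₗ[k] BarAlg k A →ₗ[k] V}
    (h : ∀ a, ∀ y ∈ deg k A a, ∀ w, T (y * eps k A) (eps k A * w) = 0) (x : BarAlg k A) :
    cutSum T x = 0 := by
  rw [← cutSum_zero x]
  refine LinearMap.congr_fun (ext_deg fun n x hx => cutSum_congr hx ?_) x
  intro a b y w _ hy _
  rw [h a y hy, LinearMap.zero_apply, LinearMap.zero_apply]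

theorem cutSum_ext {T T' : BarAlg k A →ₗ[k] BarAlg k A →ₗ[k] V} (h : ∀ y z, T y z = T' y z)
    (x : BarAlg k A) : cutSum T x = cutSum T' x := by rw [LinearMap.ext₂ h]

theorem conv_apply (F G : BarAlg k A →ₗ[k] BarAlg k A) (x : BarAlg k A) :
    conv F G x = cutSum ((LinearMap.mul k (BarAlg k A)).compl₁₂ F G) x := rfl

theorem tilde_mul_eps_mul {s p : ℕ} {F : BarAlg k A →ₗ[k] BarAlg k A} (hF : IsC s p F)
    {y : BarAlg k A} (hy : y ∈ deg k A s) (w : BarAlg k A) :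
    tilde F (y * (eps k A * w)) = F (y * eps k A) * (eps k A * w) := by
  have e1 : ∀ T : BarAlg k A →ₗ[k] BarAlg k A →ₗ[k] BarAlg k A, cutSum T (eps k A * w) =
      T (eps k A) (eps k A * w) + cutSum (T ∘ₗ LinearMap.mulLeft k (eps k A)) w := fun T => by
    simpa using cutSum_word T 1 w
  rw [tilde, conv, cutSum_mul, e1, cutSum_eq_zero, add_zero]
  · convert add_zero _ using 2
    rw [← cutSum_zero y]
    refine cutSum_congr hy fun a b y w hab hy hw => ?_
    simp [hF.supp _ _ (mul_eps_mem hy) (by omega)]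
    rfl
  · intro a z hz w
    simp only [LinearMap.comp_apply, LinearMap.compl₁₂_apply, LinearMap.mulLeft_apply]
    rw [hF.supp _ _ (mul_mem hy (eps_mul_mem (mul_eps_mem hz))) (by omega)]
    simp

theorem tilde_mul {s p n : ℕ} {F : BarAlg k A →ₗ[k] BarAlg k A} (hF : IsC s p F)
    {y : BarAlg k A} (hy : y ∈ deg k A n) (hn : s + 1 ≤ n) (w : BarAlg k A) :
    tilde F (y * w) = tilde F y * w := by
  rw [tilde, conv, cutSum_mul, cutSum_eq_zero, zero_add, cutSum_mul_right]
  · exact cutSum_ext (fun y z => by simp [mul_assoc]) _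
  · intro a z hz w
    simp only [LinearMap.comp_apply, LinearMap.compl₁₂_apply, LinearMap.mulLeft_apply]
    rw [hF.supp _ _ (mul_mem hy (mul_eps_mem hz)) (by omega)]
    simp

theorem tilde_low {s p n : ℕ} {F : BarAlg k A →ₗ[k] BarAlg k A} (hF : IsC s p F)
    {y : BarAlg k A} (hy : y ∈ deg k A n) (hn : n < s + 1) : tilde F y = 0 := by
  rw [tilde, conv, ← cutSum_zero y]
  refine cutSum_congr hy fun a b y w hab hy hw => ?_
  simp [hF.supp _ _ (mul_eps_mem hy) (by omega)]

theorem tilde_mem {s p n : ℕ} {F : BarAlg k A →ₗ[k] BarAlg k A} (hF : IsC s p F)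
    {y : BarAlg k A} (hy : y ∈ deg k A (s + n + 1)) : tilde F y ∈ deg k A (p + (n + 1)) := by
  refine cutSum_mem hy _ fun a b y w hab hy hw => ?_
  by_cases h : a = s
  · subst h
    obtain rfl : b = n := by omega
    exact mul_mem (hF.mem' _) (eps_mul_mem hw)
  · simp [hF.supp _ _ (mul_eps_mem hy) (by omega)]

theorem tilde_add (F G : BarAlg k A →ₗ[k] BarAlg k A) : tilde (F + G) = tilde F + tilde G := by
  refine LinearMap.ext fun x => ?_
  rw [LinearMap.add_apply, tilde, tilde, tilde, conv, conv, conv, ← cutSum_add]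
  exact cutSum_ext (fun y z => by simp) _

theorem tilde_smul (c : k) (F : BarAlg k A →ₗ[k] BarAlg k A) : tilde (c • F) = c • tilde F := by
  refine LinearMap.ext fun x => ?_
  rw [LinearMap.smul_apply, tilde, tilde, conv, conv, ← cutSum_smul]
  exact cutSum_ext (fun y z => by simp) _

theorem conv_add_right (F G H : BarAlg k A →ₗ[k] BarAlg k A) :
    conv F (G + H) = conv F G + conv F H := by
  refine LinearMap.ext fun x => ?_
  rw [LinearMap.add_apply, conv, conv, conv, ← cutSum_add]
  exact cutSum_ext (fun y z => by simp [mul_add]) _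

theorem conv_smul_right (c : k) (F G : BarAlg k A →ₗ[k] BarAlg k A) :
    conv F (c • G) = c • conv F G := by
  refine LinearMap.ext fun x => ?_
  rw [LinearMap.smul_apply, conv, conv, ← cutSum_smul]
  exact cutSum_ext (fun y z => by simp) _

theorem Lam_add (c : k) (F G : BarAlg k A →ₗ[k] BarAlg k A) : Lam c (F + G) = Lam c F + Lam c G := by
  rw [Lam, tilde_add, conv_add_right]; rfl

theorem Lam_smul (c c' : k) (F : BarAlg k A →ₗ[k] BarAlg k A) : Lam c (c' • F) = c' • Lam c F := by
  rw [Lam, tilde_smul, conv_smul_right]; rfl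

/-! ### The bracket -/

theorem K_appendL_piR {s p q P N : ℕ} (hN : N = s + q) (h : P = p + q) (f : Coch k A s p)
    (t : TPow k A N) :
    K k A P (appendL k A h ((piR k A p ∘ₗ f).rTensor (TPow k A q) (cut k A hN t))) =
      tilde (ext f) (eps k A * tau k A N t) := by
  obtain ⟨z, rfl⟩ := (cut k A hN).symm.surjective t
  rw [LinearEquiv.apply_symm_apply]
  induction z using TensorProduct.induction_on with
  | zero => simp
  | tmul t₁ t₂ =>
    obtain ⟨y, hy, h1⟩ := eps_tau_eq t₁
    rw [LinearMap.rTensor_tmul, K_appendL, LinearMap.comp_apply, K_piR, tau_cut_symm, ← mul_assoc,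
      h1, mul_assoc, mul_assoc, tilde_mul_eps_mul (ext_isC f) hy, ← h1, ext_tau]
  | add x y hx hy => simp only [map_add, mul_add, hx, hy]

theorem J_theta {s p : ℕ} (f : Coch k A s p) (t : TPow k A (s + 1)) :
    J k A (p + 1) (theta k A s p f t) =
      (-1 : k) ^ s • d (tilde (ext f) (eps k A * tau k A (s + 1) t)) := by
  rw [← K_appendL_piR (rfl : s + 1 = s + 1) (rfl : p + 1 = p + 1), ← J_dOne, ← map_smul]
  rfl

theorem cutSum_tau (T : BarAlg k A →ₗ[k] BarAlg k A →ₗ[k] V) (a : A) (l : List (Abar k A)) :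
    cutSum T (of k a * (eps k A * (l.map (letter k A)).prod)) =
      ∑ i ∈ Finset.range (l.length + 1),
        T (of k a * (eps k A * ((l.take i).map (letter k A)).prod))
          (eps k A * ((l.drop i).map (letter k A)).prod) := by
  induction l generalizing a T with
  | nil => simp [cutSum_mul]
  | cons b l ih =>
    rw [List.map_cons, List.prod_cons, letter_apply, mul_assoc (of k _) (eps k A), cutSum_word,
      ih, List.length_cons, Finset.sum_range_succ' _ (l.length + 1), add_comm]
    congr 1
    · refine Finset.sum_congr rfl fun i _ => ?_
      simp [letter_apply, mul_assoc]
    · simp [letter_apply, mul_assoc]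

theorem tau_tprod_map {n : ℕ} (x : Fin n → Abar k A) :
    tau k A n (PiTensorProduct.tprod k x) = ((List.ofFn x).map (letter k A)).prod := by
  rw [tau_tprod, List.map_ofFn]; rfl

theorem tau_eq_take {N n : ℕ} (x : Fin N → Abar k A) (y : Fin n → Abar k A) (j : ℕ)
    (hj : n + j ≤ N) (h : ∀ i : Fin n, y i = x ⟨i + j, by omega⟩) :
    tau k A n (PiTensorProduct.tprod k y) =
      ((((List.ofFn x).drop j).take n).map (letter k A)).prod := by
  rw [tau_tprod_map]
  congr 2
  apply List.ext_getElem
  · simp; omega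
  · intro i h1 h2
    simp [h, add_comm]

theorem eps_tau_onMiddle {N n a b q : ℕ} (h : N = a + n + b) {N' : ℕ} (h' : N' = a + (q + 1) + b)
    (f : Coch k A n q) (x : Fin N → Abar k A) :
    eps k A * tau k A N' (onMiddle k A a b h h' (piB k A q ∘ₗ f) (PiTensorProduct.tprod k x)) =
      eps k A * (((List.ofFn x).take a).map (letter k A)).prod *
        ext f (eps k A * ((((List.ofFn x).drop a).take n).map (letter k A)).prod) *
        (eps k A * (((List.ofFn x).drop (a + n)).map (letter k A)).prod) := by
  have e : onMiddle k A a b h h' (piB k A q ∘ₗ f) (PiTensorProduct.tprod k x) =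
    (cut k A h').symm ((((cut k A (rfl : a + (q + 1) = a + (q + 1))).symm.toLinearMap ∘ₗ
      (piB k A q ∘ₗ f).lTensor (TPow k A a) ∘ₗ
      (cut k A (rfl : a + n = a + n)).toLinearMap).rTensor (TPow k A b))
      (cut k A h (PiTensorProduct.tprod k x))) := rfl
  rw [e, cut_tprod, LinearMap.rTensor_tmul, LinearMap.comp_apply, LinearMap.comp_apply,
    LinearEquiv.coe_coe, LinearEquiv.coe_coe, cut_tprod, LinearMap.lTensor_tmul,
    LinearMap.comp_apply, tau_cut_symm, tau_cut_symm]
  rw [tau_eq_take x _ 0 (by omega) (by intro i; rfl),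
    tau_eq_take x _ (a + n) (by omega) (by intro i; congr 1; ext; simp; omega)]
  have h1 := eps_tau_eq (PiTensorProduct.tprod k (fun i : Fin a => x ⟨i, by omega⟩))
  rw [tau_eq_take x _ 0 (by omega) (by intro i; rfl)] at h1
  obtain ⟨y, -, hy⟩ := h1
  rw [List.drop_zero] at hy ⊢
  rw [← tau_eq_take x (fun i : Fin n => x ⟨i + a, by omega⟩) a (by omega) (by intro i; rfl),
    ext_tau, hy, ← mul_assoc, ← mul_assoc, hy, mul_assoc y, eps_tau_piB,
    List.take_of_length_le (by simp; omega)]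
  have e3 : (fun i : Fin n => x ⟨i + a, by omega⟩) = fun i : Fin n =>
      x (Fin.cast h.symm (Fin.castAdd b (Fin.cast rfl (Fin.natAdd a i)))) := by
    ext i; congr 1; ext; simp; omega
  rw [e3]
  simp only [mul_assoc]

theorem Lam_tau {M L n q N' : ℕ} (hM : M + 1 = L + n) (hN' : N' = L + q) (c : k)
    (f : Coch k A n q) (a : A) (t : TPow k A M) :
    Lam c (ext f) (of k a * (eps k A * tau k A M t)) =
      ∑ i : Fin L, c ^ ((i : ℕ) + 1) • (of k a * (eps k A * tau k A N'
        (onMiddle k A (i : ℕ) (L - 1 - i) (by omega) (by omega) (piB k A q ∘ₗ f) t))) := by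
  induction t using tpow_induction with
  | h x =>
    simp only [eps_tau_onMiddle]
    rw [tau_tprod_map, Lam, conv, cutSum_tau, List.length_ofFn, hM,
      ← Finset.sum_subset (Finset.range_mono (Nat.le_add_right L n)) ?_, Finset.sum_range]
    · refine Finset.sum_congr rfl fun i _ => ?_
      obtain ⟨y, hy, h⟩ := eps_prod_eq ((List.ofFn x).take i)
      obtain ⟨z, hz, h'⟩ := eps_prod_eq (((List.ofFn x).drop i).take n)
      rw [List.length_take, List.length_ofFn, min_eq_left (by omega)] at hy
      rw [List.length_take, List.length_drop, List.length_ofFn, min_eq_left (by omega)] at hz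
      have e : eps k A * (((List.ofFn x).drop i).map (letter k A)).prod =
          z * (eps k A * (((List.ofFn x).drop (i + n)).map (letter k A)).prod) := by
        rw [← mul_assoc, ← h', mul_assoc, ← List.prod_append, ← List.map_append,
          ← List.drop_drop, List.take_append_drop]
      rw [LinearMap.compl₁₂_apply, LinearMap.mul_apply', AlgHom.toLinearMap_apply, e,
        tilde_mul_eps_mul (ext_isC f) hz, ← h', h,
        sg_deg c (of_mul_mem a (mul_eps_mem hy)), smul_mul_assoc]
      simp only [mul_assoc]
    · intro i hi hi'
      rw [Finset.mem_range] at hi hi'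
      obtain ⟨z, hz, h'⟩ := eps_prod_eq ((List.ofFn x).drop i)
      rw [List.length_drop, List.length_ofFn] at hz
      rw [LinearMap.compl₁₂_apply, h', tilde_low (ext_isC f) (mul_eps_mem hz) (by omega), map_zero]
  | hadd s t hs ht =>
    simp only [map_add, mul_add, smul_add, Finset.sum_add_distrib, hs, ht]
  | hsmul c' t ht =>
    simp only [map_smul, mul_smul_comm, ht, Finset.smul_sum, smul_comm c']

theorem J_bulletPos {s p t q N P : ℕ} (hN : N + 1 = s + t) (hP : P = p + q)
    (f : Coch k A s p) (g : Coch k A t q) (i : Fin s) (x : TPow k A N) :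
    J k A P (bulletPos hN hP f g i x) = d (tilde (ext f) (eps k A * tau k A (s + q)
      (onMiddle k A (i : ℕ) (s - 1 - i) (by omega) (by omega) (piB k A q ∘ₗ g) x))) := by
  rw [← K_appendL_piR (rfl : s + q = s + q) hP, ← J_dOne]
  rfl

theorem J_bulletNeg {s p t q N P : ℕ} (hs : 1 ≤ s) (hN : N + 1 = s + t) (hP : P = p + q)
    (f : Coch k A s p) (g : Coch k A t q) (i : Fin q) (x : TPow k A N) :
    J k A P (bulletNeg hs hN hP f g i x) = d (K k A P
      ((onMiddle k A (i : ℕ) (q - 1 - i) (by omega) (by omega) (piB k A p ∘ₗ f)).lTensor A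
      (appendL k A (rfl : q + (s - 1) = q + (s - 1)) ((piR k A q ∘ₗ g).rTensor (TPow k A (s - 1))
      (cut k A (by omega : N = t + (s - 1)) x))))) := by
  rw [← J_dOne]
  rfl

theorem Lam_K {M L n q N' : ℕ} (hM : M + 1 = L + n) (hN' : N' = L + q) (c : k)
    (f : Coch k A n q) (y : LBar k A M) :
    Lam c (ext f) (K k A M y) = ∑ i : Fin L, c ^ ((i : ℕ) + 1) • K k A N'
      ((onMiddle k A (i : ℕ) (L - 1 - i) (by omega) (by omega) (piB k A q ∘ₗ f)).lTensor A y) := by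
  induction y using lbar_induction with
  | h a t => rw [K_tmul, Lam_tau hM hN']; rfl
  | hadd s t hs ht => simp only [map_add, smul_add, Finset.sum_add_distrib, hs, ht]

theorem J_bullet {s p t q N P : ℕ} (hs : 1 ≤ s) (hN : N + 1 = s + t) (hP : P = p + q)
    (f : Coch k A s p) (g : Coch k A t q) (x : TPow k A N) :
    J k A P (bullet hs hN hP f g x) = (-1 : k) ^ (p + q) •
      d (((-1 : k) ^ (t + q + 1)) • tilde (ext f) (Lam ((-1) ^ (t + q + 1)) (ext g)
        (eps k A * tau k A N x)) + Lam ((-1) ^ (s + p + 1)) (ext f)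
          (tilde (ext g) (eps k A * tau k A N x))) := by
  have e1 := Lam_tau hN (rfl : s + q = s + q) ((-1 : k) ^ (t + q + 1)) g 1 x
  simp only [map_one, one_mul] at e1
  rw [e1, ← K_appendL_piR (by omega : N = t + (s - 1)) (rfl : q + (s - 1) = q + (s - 1)),
    Lam_K (by omega : q + (s - 1) + 1 = q + s) (by rw [hP]; omega : P = q + p)]
  simp only [bullet, LinearMap.add_apply, LinearMap.sum_apply, LinearMap.smul_apply, map_add,
    map_sum, map_smul, J_bulletPos, J_bulletNeg, smul_add, Finset.smul_sum, smul_smul, ← pow_add,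
    ← pow_mul]
  refine congrArg₂ (· + ·) ?_ ?_
  · refine Finset.sum_congr rfl fun i _ => ?_
    refine congrArg (· • _) ?_
    apply neg_one_pow_congr
    simp only [Nat.even_add, Nat.even_mul, Nat.even_add_one]
    tauto
  · refine Finset.sum_congr rfl fun i _ => ?_
    refine congrArg (fun n : ℕ => (-1 : k) ^ n • _) ?_
    ring

theorem J_bracketSg {s p t q N P : ℕ} (hs : 1 ≤ s) (ht : 1 ≤ t) (hN : N + 1 = s + t)
    (hP : P = p + q) (f : Coch k A s p) (g : Coch k A t q) (x : TPow k A N) :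
    J k A P (bracketSg hs ht hN hP f g x) = (-1 : k) ^ (p + q) •
      d (((-1 : k) ^ (t + q + 1)) • tilde (ext f) (Lam ((-1) ^ (t + q + 1)) (ext g)
        (eps k A * tau k A N x)) + Lam ((-1) ^ (s + p + 1)) (ext f)
          (tilde (ext g) (eps k A * tau k A N x)) - (-1 : k) ^ ((s + p + 1) * (t + q + 1)) •
        (((-1 : k) ^ (s + p + 1)) • tilde (ext g) (Lam ((-1) ^ (s + p + 1)) (ext f)
        (eps k A * tau k A N x)) + Lam ((-1) ^ (t + q + 1)) (ext g)
          (tilde (ext f) (eps k A * tau k A N x)))) := by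
  rw [bracketSg, LinearMap.sub_apply, LinearMap.smul_apply, map_sub, map_smul, J_bullet, J_bullet,
    add_comm q p, map_sub d, smul_sub, map_smul d _ (_ + _), smul_comm]

end BarAlg
end
end TateHH

namespace TateHH
noncomputable section

namespace BarAlg

variable {k A : Type u} [Field k] [Ring A] [Algebra k A]
variable {V W : Type*} [AddCommGroup V] [Module k V] [AddCommGroup W] [Module k W]

/-! ### Convolutions and the differential -/

theorem neg_one_pow_mul_self (n : ℕ) : (-1 : k) ^ n * (-1) ^ n = 1 := by
  rw [← mul_pow]; simp

theorem neg_one_pow_eq_neg {a b : ℕ} (h : Even a ↔ ¬ Even b) : (-1 : k) ^ a = -(-1) ^ b := by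
  have : -(-1 : k) ^ b = (-1) ^ (b + 1) := by rw [pow_succ]; ring
  rw [this]
  apply neg_one_pow_congr
  rw [h, Nat.even_add_one]

theorem IsC.map_one {s p : ℕ} {F : BarAlg k A →ₗ[k] BarAlg k A} (hF : IsC s p F) : F 1 = 0 :=
  hF.supp 0 1 one_mem (by omega)

theorem IsC.map_sg {s p : ℕ} {F : BarAlg k A →ₗ[k] BarAlg k A} (hF : IsC s p F) (c : k)
    (x : BarAlg k A) : F (sg c x) = c ^ (s + 1) • F x := by
  induction x using deg_induction_on with
  | hdeg n x hx =>
    rw [sg_deg c hx, map_smul]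
    by_cases h : n = s + 1
    · rw [h]
    · rw [hF.supp n x hx h, smul_zero, smul_zero]
  | hadd x y hx hy => rw [map_add, map_add, map_add, smul_add, hx, hy]

theorem IsC.sg_map {s p : ℕ} {F : BarAlg k A →ₗ[k] BarAlg k A} (hF : IsC s p F) (c : k)
    (x : BarAlg k A) : sg c (F x) = c ^ p • F x := sg_deg c (hF.mem' x)

theorem tilde_one (F : BarAlg k A →ₗ[k] BarAlg k A) : tilde F 1 = 0 := cutSum_one _

theorem tilde_of_mul {s p : ℕ} {F : BarAlg k A →ₗ[k] BarAlg k A} (hF : IsC s p F) (a : A)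
    (x : BarAlg k A) : tilde F (of k a * x) = of k a * tilde F x := by
  rw [tilde, conv, cutSum_of_mul, mul_cutSum]
  exact cutSum_ext (fun y z => by simp [hF.of_mul, mul_assoc]) _

theorem tilde_mul_of (F : BarAlg k A →ₗ[k] BarAlg k A) (a : A)
    (x : BarAlg k A) : tilde F (x * of k a) = tilde F x * of k a := by
  rw [tilde, conv, cutSum_mul_of, cutSum_mul_right]
  exact cutSum_ext (fun y z => by simp [mul_assoc]) _

theorem tilde_d {s p : ℕ} {F : BarAlg k A →ₗ[k] BarAlg k A} (hF : IsC s p F) (x : BarAlg k A) :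
    tilde F (d x) = tilde (F ∘ₗ d) x - (-1 : k) ^ (s + p + 1) • d (tilde F x) +
      (-1 : k) ^ (s + p + 1) • tilde (d ∘ₗ F) x - (-1 : k) ^ s • F x := by
  have h := cutSum_d ((LinearMap.mul k (BarAlg k A)).compl₁₂ F LinearMap.id)
    (fun x a y => by simp [hF.mul_of, mul_assoc]) x
  have e1 : cutSum (((LinearMap.mul k (BarAlg k A)).compl₁₂ F LinearMap.id) ∘ₗ d) x =
      tilde (F ∘ₗ d) x := cutSum_ext (fun y z => by simp) _
  have e2 : (-1 : k) ^ (s + p + 1) • cutSum (((LinearMap.mul k (BarAlg k A)).compl₁₂ F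
      LinearMap.id).compl₁₂ (sg (-1)).toLinearMap d) x =
      d (tilde F x) - tilde (d ∘ₗ F) x := by
    rw [tilde, conv, map_cutSum, tilde, conv, ← cutSum_sub, ← cutSum_smul]
    refine cutSum_ext (fun y z => ?_) _
    simp only [LinearMap.smul_apply, LinearMap.compl₁₂_apply, AlgHom.toLinearMap_apply,
      LinearMap.mul_apply', hF.map_sg, LinearMap.id_apply, LinearMap.sub_apply,
      LinearMap.compr₂_apply, d_mul, hF.sg_map, LinearMap.comp_apply, smul_mul_assoc, smul_smul,
      add_sub_cancel_right]
    congr 1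
    rw [← pow_add]
    apply neg_one_pow_congr
    simp only [Nat.even_add, Nat.even_add_one]; tauto
  have e3 := congrArg (((-1 : k) ^ (s + p + 1)) • ·) e2
  simp only [smul_smul, neg_one_pow_mul_self, one_smul] at e3
  rw [e1, e3] at h
  simp only [LinearMap.compl₁₂_apply, LinearMap.mul_apply', LinearMap.id_apply, hF.map_one,
    zero_mul, add_zero, mul_one, hF.map_sg] at h
  have h2 : tilde F (d x) = cutSum ((LinearMap.mul k (BarAlg k A)).compl₁₂ F LinearMap.id) (d x) :=
    rfl
  rw [h2, eq_comm, ← sub_eq_zero, ← sub_eq_zero.2 h, pow_succ]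
  module

theorem Lam_d {s p : ℕ} {F : BarAlg k A →ₗ[k] BarAlg k A} (hF : IsC s p F) (hd : d ∘ₗ F = 0)
    {c : k} (hc : c = (-1) ^ (s + p + 1)) (x : BarAlg k A) :
    Lam c F (d x) = c • d (Lam c F x) - tilde F x - Lam (-c) (F ∘ₗ d) x +
      (-1 : k) ^ s • conv (sg (-c)).toLinearMap F x := by
  have hcc : c * c = 1 := by rw [hc, neg_one_pow_mul_self]
  have h := cutSum_d ((LinearMap.mul k (BarAlg k A)).compl₁₂ (sg c).toLinearMap (tilde F))
    (fun x a y => by simp [tilde_of_mul hF, mul_assoc]) x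
  have ht : ∀ y, tilde F (d y) = tilde (F ∘ₗ d) y - c • d (tilde F y) - (-1 : k) ^ s • F y := by
    intro y
    have h0 : tilde (0 : BarAlg k A →ₗ[k] BarAlg k A) = 0 := by
      have := tilde_smul (0 : k) F; simpa using this
    rw [tilde_d hF, hd, h0, hc]; simp
  have e1 : cutSum (((LinearMap.mul k (BarAlg k A)).compl₁₂ (sg c).toLinearMap (tilde F)) ∘ₗ d) x -
      cutSum (((LinearMap.mul k (BarAlg k A)).compl₁₂ (sg c).toLinearMap (tilde F)).compl₁₂
        (sg (-1)).toLinearMap d) x = c • d (Lam c F x) - Lam (-c) (F ∘ₗ d) x +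
      (-1 : k) ^ s • conv (sg (-c)).toLinearMap F x := by
    rw [Lam, Lam, conv, map_cutSum, conv, conv, ← cutSum_smul, ← cutSum_smul, ← cutSum_sub,
      ← cutSum_sub, ← cutSum_add]
    refine cutSum_ext (fun y z => ?_) _
    simp only [LinearMap.smul_apply, LinearMap.compl₁₂_apply, AlgHom.toLinearMap_apply,
      LinearMap.mul_apply', LinearMap.sub_apply, LinearMap.add_apply, LinearMap.comp_apply,
      LinearMap.compr₂_apply, d_mul, d_sg, sg_sg, ht, smul_add, mul_sub, mul_smul_comm,
      smul_mul_assoc, smul_smul, hcc, one_smul, mul_neg, neg_mul, mul_one, one_mul]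
    abel
  rw [e1] at h
  simp only [LinearMap.compl₁₂_apply, LinearMap.mul_apply', tilde_one, mul_zero, sub_zero,
    AlgHom.toLinearMap_apply, _root_.map_one, one_mul] at h
  have h2 : Lam c F (d x) = cutSum ((LinearMap.mul k (BarAlg k A)).compl₁₂ (sg c).toLinearMap
    (tilde F)) (d x) := rfl
  rw [h2, ← sub_eq_iff_eq_add.2 h]
  abel

/-! ### The bracket of endomorphisms -/

/-- One half of the bracket. -/
def betaHalf (cF cG : k) (F G : BarAlg k A →ₗ[k] BarAlg k A) : BarAlg k A →ₗ[k] BarAlg k A :=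
  cG • tilde F ∘ₗ Lam cG G + Lam cF F ∘ₗ tilde G

/-- The bracket is `± d ∘ beta`. -/
def beta (s p t q : ℕ) (F G : BarAlg k A →ₗ[k] BarAlg k A) : BarAlg k A →ₗ[k] BarAlg k A :=
  betaHalf ((-1) ^ (s + p + 1)) ((-1) ^ (t + q + 1)) F G -
    (-1 : k) ^ ((s + p + 1) * (t + q + 1)) •
      betaHalf ((-1) ^ (t + q + 1)) ((-1) ^ (s + p + 1)) G F

theorem conv_word {t q n : ℕ} {G : BarAlg k A →ₗ[k] BarAlg k A} (hG : IsC t q G) (c : k)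
    {y w : BarAlg k A} (hy : y ∈ deg k A n) (hw : w ∈ deg k A t) :
    conv (sg c).toLinearMap G (y * (eps k A * w)) = c ^ (n + 1) • (y * eps k A * G (eps k A * w)) := by
  have e1 : ∀ T : BarAlg k A →ₗ[k] BarAlg k A →ₗ[k] BarAlg k A, cutSum T (eps k A * w) =
      T (eps k A) (eps k A * w) + cutSum (T ∘ₗ LinearMap.mulLeft k (eps k A)) w := fun T => by
    simpa using cutSum_word T 1 w
  rw [conv, cutSum_mul, e1]
  have e2 : cutSum (((LinearMap.mul k (BarAlg k A)).compl₁₂ (sg c).toLinearMap G ∘ₗ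
      LinearMap.mulLeft k y) ∘ₗ LinearMap.mulLeft k (eps k A)) w = 0 := by
    rw [← cutSum_zero w]
    refine cutSum_congr hw fun a b y w hab hy hw => ?_
    simp [hG.supp _ _ (eps_mul_mem hw) (by omega)]
  have e3 : cutSum (((LinearMap.mul k (BarAlg k A)).compl₁₂ (sg c).toLinearMap G).compl₂
      (LinearMap.mulRight k (eps k A * w))) y = 0 := by
    rw [← cutSum_zero y]
    refine cutSum_congr hy fun a b y w' hab hy hw' => ?_
    simp only [LinearMap.compl₂_apply, LinearMap.compl₁₂_apply, LinearMap.mulRight_apply]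
    rw [hG.supp _ _ (mul_mem (eps_mul_mem hw') (eps_mul_mem hw)) (by omega), map_zero]
    rfl
  rw [e2, e3, add_zero, add_zero]
  simp only [LinearMap.comp_apply, LinearMap.compl₁₂_apply, LinearMap.mulLeft_apply,
    AlgHom.toLinearMap_apply, LinearMap.mul_apply', sg_deg c (mul_eps_mem hy), smul_mul_assoc]

theorem deg_split_induction {m n : ℕ} {U : Submodule k (BarAlg k A)}
    (hU : ∀ y ∈ deg k A m, ∀ w ∈ deg k A n, y * (eps k A * w) ∈ U)
    {x : BarAlg k A} (hx : x ∈ deg k A (m + 1 + n)) : x ∈ U := by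
  refine Submodule.span_le.2 ?_ (split_mem hx)
  rintro z ⟨y, w, hy, hw, rfl⟩
  exact hU y hy w hw

theorem eqOn_split {m n : ℕ} {F G : BarAlg k A →ₗ[k] V}
    (h : ∀ y ∈ deg k A m, ∀ w ∈ deg k A n, F (y * (eps k A * w)) = G (y * (eps k A * w)))
    {x : BarAlg k A} (hx : x ∈ deg k A (m + 1 + n)) : F x = G x :=
  LinearMap.mem_eqLocus.1 (deg_split_induction (U := LinearMap.eqLocus F G) h hx)

theorem conv_tilde_word {s p t q : ℕ} {F G : BarAlg k A →ₗ[k] BarAlg k A} (hF : IsC s p F)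
    (hG : IsC t q G) {y w : BarAlg k A} (hy : y ∈ deg k A s) (hw : w ∈ deg k A t) :
    conv (tilde F) G (y * (eps k A * w)) = F (y * eps k A) * (eps k A * G (eps k A * w)) := by
  have e1 : ∀ T : BarAlg k A →ₗ[k] BarAlg k A →ₗ[k] BarAlg k A, cutSum T (eps k A * w) =
      T (eps k A) (eps k A * w) + cutSum (T ∘ₗ LinearMap.mulLeft k (eps k A)) w := fun T => by
    simpa using cutSum_word T 1 w
  rw [conv, cutSum_mul, e1]
  have e2 : cutSum (((LinearMap.mul k (BarAlg k A)).compl₁₂ (tilde F) G ∘ₗ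
      LinearMap.mulLeft k y) ∘ₗ LinearMap.mulLeft k (eps k A)) w = 0 := by
    rw [← cutSum_zero w]
    refine cutSum_congr hw fun a b y w hab hy hw => ?_
    simp [hG.supp _ _ (eps_mul_mem hw) (by omega)]
  have e3 : cutSum (((LinearMap.mul k (BarAlg k A)).compl₁₂ (tilde F) G).compl₂
      (LinearMap.mulRight k (eps k A * w))) y = 0 := by
    rw [← cutSum_zero y]
    refine cutSum_congr hy fun a b y w' hab hy hw' => ?_
    simp only [LinearMap.compl₂_apply, LinearMap.compl₁₂_apply, LinearMap.mulRight_apply]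
    rw [hG.supp _ _ (mul_mem (eps_mul_mem hw') (eps_mul_mem hw)) (by omega), map_zero]
    rfl
  have e4 := tilde_mul_eps_mul hF hy 1
  rw [mul_one] at e4
  rw [e2, e3, add_zero, add_zero]
  simp only [LinearMap.comp_apply, LinearMap.compl₁₂_apply, LinearMap.mulLeft_apply,
    LinearMap.mul_apply', e4, mul_assoc]

theorem tilde_conv {s p t q : ℕ} {F G : BarAlg k A →ₗ[k] BarAlg k A} (hF : IsC s p F)
    (hG : IsC t q G) (c : k) {x : BarAlg k A} (hx : x ∈ deg k A (s + 1 + t)) :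
    tilde F (conv (sg c).toLinearMap G x) = c ^ (s + 1) • conv (tilde F) G x := by
  refine eqOn_split (F := tilde F ∘ₗ conv (sg c).toLinearMap G)
    (G := c ^ (s + 1) • conv (tilde F) G) (fun y hy w hw => ?_) hx
  rw [LinearMap.comp_apply, LinearMap.smul_apply, conv_word hG c hy hw, map_smul, mul_assoc,
    tilde_mul_eps_mul hF hy, conv_tilde_word hF hG hy hw]

theorem conv_tilde {s p t q : ℕ} {F G : BarAlg k A →ₗ[k] BarAlg k A} (hF : IsC s p F)
    (hG : IsC t q G) (c : k) {x : BarAlg k A} (hx : x ∈ deg k A (s + 1 + t)) :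
    conv (sg c).toLinearMap G (tilde F x) = c ^ (p + 1) • conv (tilde F) G x := by
  refine eqOn_split (F := conv (sg c).toLinearMap G ∘ₗ tilde F)
    (G := c ^ (p + 1) • conv (tilde F) G) (fun y hy w hw => ?_) hx
  rw [LinearMap.comp_apply, LinearMap.smul_apply, tilde_mul_eps_mul hF hy,
    conv_word hG c (hF.mem _ (mul_eps_mem hy)) hw, conv_tilde_word hF hG hy hw, mul_assoc]

theorem Lam_mem {t q n : ℕ} {G : BarAlg k A →ₗ[k] BarAlg k A} (hG : IsC t q G) (c : k)
    {x : BarAlg k A} (hx : x ∈ deg k A (n + t)) : Lam c G x ∈ deg k A (n + q + 1) := by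
  refine cutSum_mem hx _ fun a b y w hab hy hw => ?_
  simp only [LinearMap.compl₁₂_apply, LinearMap.mul_apply', AlgHom.toLinearMap_apply]
  by_cases h : t ≤ b
  · obtain ⟨j, rfl⟩ := Nat.exists_eq_add_of_le h
    have : n + q + 1 = (a + 1) + (q + (j + 1)) := by omega
    rw [this]
    exact mul_mem (sg_mem c (mul_eps_mem hy))
      (tilde_mem hG (by rw [show t + j + 1 = t + j + 1 from rfl]; exact eps_mul_mem hw))
  · rw [tilde_low hG (eps_mul_mem hw) (by omega), mul_zero]; exact zero_mem _

theorem betaHalf_d {s p t q : ℕ} {F G : BarAlg k A →ₗ[k] BarAlg k A} (hF : IsC s p F)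
    (hG : IsC t q G) (hdF : d ∘ₗ F = 0) (hdG : d ∘ₗ G = 0) (hs : 1 ≤ s) {cF cG : k}
    (hcF : cF = (-1) ^ (s + p + 1)) (hcG : cG = (-1) ^ (t + q + 1))
    {x : BarAlg k A} (hx : x ∈ deg k A (s + t + 1)) :
    betaHalf cF cG F G (d x) = -(cF * cG) • d (betaHalf cF cG F G x) +
      cG • betaHalf (-cF) cG (F ∘ₗ d) G x + betaHalf cF (-cG) F (G ∘ₗ d) x +
      ((cG * (-1) ^ t * (-cG) ^ (s + 1)) • conv (tilde F) G x -
        (cG * (-1) ^ s * (-cF) ^ (q + 1)) • conv (tilde G) F x) := by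
  have hcc : cG * cG = 1 := by rw [hcG, neg_one_pow_mul_self]
  have h0 : tilde (0 : BarAlg k A →ₗ[k] BarAlg k A) = 0 := by
    have := tilde_smul (0 : k) F; simpa using this
  have tF : ∀ y, tilde F (d y) = tilde (F ∘ₗ d) y - cF • d (tilde F y) - (-1 : k) ^ s • F y := by
    intro y; rw [tilde_d hF, hdF, h0, hcF]; simp
  have tG : ∀ y, tilde G (d y) = tilde (G ∘ₗ d) y - cG • d (tilde G y) - (-1 : k) ^ t • G y := by
    intro y; rw [tilde_d hG, hdG, h0, hcG]; simp
  have lF := Lam_d hF hdF hcF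
  have lG := Lam_d hG hdG hcG
  have z1 : G x = 0 := hG.supp _ _ hx (by omega)
  have z2 : F (Lam cG G x) = 0 := by
    rw [show s + t + 1 = s + 1 + t by omega] at hx
    exact hF.supp _ _ (Lam_mem hG cG hx) (by omega)
  have r1 := tilde_conv hF hG (-cG) (x := x) (by convert hx using 2; omega)
  have r2 := conv_tilde hG hF (-cF) (x := x) (by convert hx using 2; omega)
  have lFG := lF (tilde G x)
  have e1 : d (Lam cG G x) = cG • (Lam cG G (d x) + tilde G x + Lam (-cG) (G ∘ₗ d) x -
      (-1 : k) ^ t • conv (sg (-cG)).toLinearMap G x) := by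
    rw [lG]
    simp only [smul_sub, smul_add, smul_smul, hcc, one_smul]
    module
  have e2 := tF (Lam cG G x)
  rw [e1, map_smul, map_sub, map_add, map_add, map_smul, r1, z2, smul_zero, sub_zero] at e2
  have e3 := congrArg (Lam cF F) (tG x)
  rw [z1, smul_zero, sub_zero, map_sub, map_smul] at e3
  have e4 := lF (tilde G x)
  rw [r2] at e4
  rw [e4] at e3
  simp only [betaHalf, LinearMap.add_apply, LinearMap.smul_apply, LinearMap.comp_apply, e3,
    map_add, map_smul]
  have e5 : cG • tilde F (Lam cG G (d x)) =
      tilde (F ∘ₗ d) (Lam cG G x) - cF • d (tilde F (Lam cG G x)) - cG • tilde F (tilde G x) -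
        cG • tilde F (Lam (-cG) (G ∘ₗ d) x) +
        cG • (-1 : k) ^ t • (-cG) ^ (s + 1) • conv (tilde F) G x := by
    linear_combination (norm := module) e2
  rw [e5]
  generalize conv (tilde F) G x = X1
  generalize conv (tilde G) F x = X2
  have e6 : (-(cF * cG)) • cG • d (tilde F (Lam cG G x)) = -cF • d (tilde F (Lam cG G x)) := by
    rw [smul_smul, neg_mul, mul_assoc, hcc, mul_one]
  have e8 : cG • cG • tilde (F ∘ₗ d) (Lam cG G x) = tilde (F ∘ₗ d) (Lam cG G x) := by
    rw [smul_smul, hcc, one_smul]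
  linear_combination (norm := module) -e6 - e8

theorem neg_neg_one_pow_succ (n : ℕ) : -(-1 : k) ^ (n + 1) = (-1) ^ n := by rw [pow_succ]; ring

theorem sign_bracket (s p t q : ℕ) :
    (-1 : k) ^ (t + q + 1) * (-1) ^ t * (-(-1) ^ (t + q + 1)) ^ (s + 1) =
      -((-1) ^ ((s + p + 1) * (t + q + 1)) * ((-1) ^ (s + p + 1) * (-1) ^ t *
        (-(-1) ^ (t + q + 1)) ^ (p + 1))) := by
  simp only [neg_neg_one_pow_succ, ← pow_mul, ← pow_add]
  apply neg_one_pow_eq_neg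
  simp only [Nat.even_add, Nat.even_mul, Nat.even_add_one]
  by_cases hs : Even s <;> by_cases hp : Even p <;> by_cases ht : Even t <;>
    by_cases hq : Even q <;> simp [hs, hp, ht, hq]

theorem sign_bracket' (s p t q : ℕ) :
    (-1 : k) ^ (t + q + 1) * (-1) ^ s * (-(-1) ^ (s + p + 1)) ^ (q + 1) =
      -((-1) ^ ((s + p + 1) * (t + q + 1)) * ((-1) ^ (s + p + 1) * (-1) ^ s *
        (-(-1) ^ (s + p + 1)) ^ (t + 1))) := by
  simp only [neg_neg_one_pow_succ, ← pow_mul, ← pow_add]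
  apply neg_one_pow_eq_neg
  simp only [Nat.even_add, Nat.even_mul, Nat.even_add_one]
  by_cases hs : Even s <;> by_cases hp : Even p <;> by_cases ht : Even t <;>
    by_cases hq : Even q <;> simp [hs, hp, ht, hq]

theorem beta_d {s p t q : ℕ} {F G : BarAlg k A →ₗ[k] BarAlg k A} (hF : IsC s p F)
    (hG : IsC t q G) (hdF : d ∘ₗ F = 0) (hdG : d ∘ₗ G = 0) (hs : 1 ≤ s) (ht : 1 ≤ t)
    {x : BarAlg k A} (hx : x ∈ deg k A (s + t + 1)) :
    beta s p t q F G (d x) = -((-1) ^ (s + p + 1) * (-1) ^ (t + q + 1) : k) • d (beta s p t q F G x) +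
      (-1 : k) ^ (t + q + 1) • beta (s + 1) p t q (F ∘ₗ d) G x +
      beta s p (t + 1) q F (G ∘ₗ d) x := by
  have h1 := betaHalf_d hF hG hdF hdG hs rfl rfl hx
  have h2 := betaHalf_d hG hF hdG hdF ht rfl rfl (by rwa [add_comm t s] : x ∈ deg k A (t + s + 1))
  simp only [beta, LinearMap.sub_apply, LinearMap.smul_apply, h1, h2]
  have c1 : (-1 : k) ^ (s + 1 + p + 1) = -(-1) ^ (s + p + 1) := by
    rw [show s + 1 + p + 1 = s + p + 1 + 1 by omega, pow_succ]; ring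
  have c2 : (-1 : k) ^ (t + 1 + q + 1) = -(-1) ^ (t + q + 1) := by
    rw [show t + 1 + q + 1 = t + q + 1 + 1 by omega, pow_succ]; ring
  have c3 : (-1 : k) ^ ((s + 1 + p + 1) * (t + q + 1)) =
      (-1) ^ ((s + p + 1) * (t + q + 1)) * (-1) ^ (t + q + 1) := by
    rw [← pow_add]; congr 1; ring
  have c4 : (-1 : k) ^ ((s + p + 1) * (t + 1 + q + 1)) =
      (-1) ^ ((s + p + 1) * (t + q + 1)) * (-1) ^ (s + p + 1) := by
    rw [← pow_add]; congr 1; ring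
  have c6 := sign_bracket (k := k) s p t q
  have c7 := sign_bracket' (k := k) s p t q
  rw [c6, c7, c1, c2, c3, c4]
  simp only [map_sub, map_smul]
  have ht' := neg_one_pow_mul_self (k := k) (t + q + 1)
  generalize (-1 : k) ^ (s + p + 1) = cF at *
  generalize (-1 : k) ^ (t + q + 1) = cG at *
  generalize betaHalf (-cF) cG (F ∘ₗ d) G x = X1
  generalize betaHalf cG (-cF) G (F ∘ₗ d) x = X2
  generalize betaHalf cF (-cG) F (G ∘ₗ d) x = X3
  generalize betaHalf (-cG) cF (G ∘ₗ d) F x = X4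
  have e : X2 = (cG * cG) • X2 := by rw [ht', one_smul]
  linear_combination (norm := module) (-(-1 : k) ^ ((s + p + 1) * (t + q + 1))) • e


/-! ### The bracket and right multiplication -/

theorem Lam_eps_mul (c : k) (G : BarAlg k A →ₗ[k] BarAlg k A) (x : BarAlg k A) :
    Lam c G (eps k A * x) = c • (eps k A * (Lam c G x + tilde G (eps k A * x))) := by
  have e1 : ∀ T : BarAlg k A →ₗ[k] BarAlg k A →ₗ[k] BarAlg k A, cutSum T (eps k A * x) =
      T (eps k A) (eps k A * x) + cutSum (T ∘ₗ LinearMap.mulLeft k (eps k A)) x := fun T => by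
    simpa using cutSum_word T 1 x
  rw [Lam, conv, e1, mul_add, mul_cutSum, smul_add, ← cutSum_smul, add_comm]
  congr 1
  · exact cutSum_ext (fun y z => by simp [mul_assoc]) _
  · simp

theorem Lam_low {t q n : ℕ} {G : BarAlg k A →ₗ[k] BarAlg k A} (hG : IsC t q G) (c : k)
    {x : BarAlg k A} (hx : x ∈ deg k A n) (hn : n ≤ t) : Lam c G x = 0 := by
  rw [Lam, conv, ← cutSum_zero x]
  refine cutSum_congr hx fun a b y w hab hy hw => ?_
  rw [LinearMap.compl₁₂_apply, tilde_low hG (eps_mul_mem hw) (by omega), map_zero]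
  rfl

theorem Lam_mul {t q n : ℕ} {G : BarAlg k A →ₗ[k] BarAlg k A} (hG : IsC (t + 1) q G) (c : k)
    {y v : BarAlg k A} (hy : y ∈ deg k A n) (hv : v ∈ deg k A t) (w : BarAlg k A) :
    Lam c G (y * (eps k A * v) * w) = Lam c G (y * (eps k A * v)) * w +
      c ^ n • (y * Lam c G (eps k A * v * w)) := by
  have e1 : ∀ w, cutSum ((LinearMap.mul k (BarAlg k A)).compl₁₂ (sg c).toLinearMap (tilde G) ∘ₗ
      LinearMap.mulLeft k y) w = c ^ n • (y * Lam c G w) := fun w => by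
    rw [Lam, conv, mul_cutSum, ← cutSum_smul]
    exact cutSum_ext (fun y' z => by simp [sg_deg c hy, mul_assoc]) _
  have e2 : cutSum (((LinearMap.mul k (BarAlg k A)).compl₁₂ (sg c).toLinearMap (tilde G)).compl₂
      (LinearMap.mulRight k (eps k A * v * w))) y =
      cutSum (((LinearMap.mul k (BarAlg k A)).compl₁₂ (sg c).toLinearMap (tilde G)).compl₂
      (LinearMap.mulRight k (eps k A * v))) y * w := by
    rw [cutSum_mul_right]
    refine cutSum_congr hy fun a b y' z _ _ hz => ?_
    simp only [LinearMap.compl₂_apply, LinearMap.compl₁₂_apply, LinearMap.mulRight_apply,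
      LinearMap.compr₂_apply, LinearMap.mul_apply']
    rw [← mul_assoc (eps k A * z), tilde_mul hG (mul_mem (eps_mul_mem hz) (eps_mul_mem hv))
      (by omega)]
    simp only [mul_assoc]
  rw [mul_assoc y, Lam, conv, cutSum_mul, cutSum_mul _ y (eps k A * v), e1, e1,
    Lam_low hG c (eps_mul_mem hv) le_rfl, mul_zero, smul_zero, zero_add, e2, add_comm]
  rfl

theorem tilde_Lam_mul {s p t q : ℕ} {F G : BarAlg k A →ₗ[k] BarAlg k A} (hF : IsC s p F)
    (hG : IsC (t + 1) q G) {c : k} (hc : c * c = 1) {x : BarAlg k A}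
    (hx : x ∈ deg k A (s + 1 + t)) (w : BarAlg k A) :
    c • tilde F (Lam c G (x * w)) - c ^ (s + p + 1) • Lam c G (tilde F (x * w)) =
      (c • tilde F (Lam c G x) - c ^ (s + p + 1) • Lam c G (tilde F x)) * w := by
  have hp : ∀ n, c ^ n * c ^ n = 1 := fun n => by rw [← mul_pow, hc, one_pow]
  refine eqOn_split (F := (c • tilde F ∘ₗ Lam c G - c ^ (s + p + 1) • Lam c G ∘ₗ tilde F) ∘ₗ
    LinearMap.mulRight k w) (G := LinearMap.mulRight k w ∘ₗ
    (c • tilde F ∘ₗ Lam c G - c ^ (s + p + 1) • Lam c G ∘ₗ tilde F)) (fun y hy v hv => ?_) hx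
  have hFy := hF.mem _ (mul_eps_mem hy)
  have e1 : ∀ z, tilde F (y * (eps k A * z)) = F (y * eps k A) * (eps k A * z) :=
    tilde_mul_eps_mul hF hy
  have e2 : tilde F (y * Lam c G (eps k A * v * w)) =
      F (y * eps k A) * Lam c G (eps k A * v * w) := by
    rw [mul_assoc (eps k A), Lam_eps_mul, mul_smul_comm, map_smul, e1, mul_smul_comm]
  have e3 : tilde F (Lam c G (y * (eps k A * v)) * w) =
      tilde F (Lam c G (y * (eps k A * v))) * w := by
    have : y * (eps k A * v) ∈ deg k A (s + (t + 1)) := mul_mem hy (eps_mul_mem hv)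
    exact tilde_mul hF (Lam_mem hG c this) (by omega) w
  have e4 : tilde F (y * (eps k A * v) * w) = F (y * eps k A) * (eps k A * v) * w := by
    rw [mul_assoc, mul_assoc (eps k A), e1]; simp only [mul_assoc]
  simp only [LinearMap.comp_apply, LinearMap.sub_apply, LinearMap.smul_apply,
    LinearMap.mulRight_apply]
  rw [Lam_mul hG c hy hv, e4, Lam_mul hG c hFy hv, map_add, e3, map_smul, e2, e1, sub_mul,
    smul_mul_assoc, smul_mul_assoc]
  have e5 : c ^ (s + p + 1) * c ^ p = c * c ^ s := by
    rw [show s + p + 1 = s + 1 + p by omega, pow_add _ (s + 1), mul_assoc, hp, mul_one, pow_succ']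
  simp only [smul_add, smul_smul, e5]
  abel

theorem beta_mul {s p t q : ℕ} {F G : BarAlg k A →ₗ[k] BarAlg k A} (hF : IsC s p F)
    (hG : IsC t q G) (hs : 1 ≤ s) (ht : 1 ≤ t) {x : BarAlg k A} (hx : x ∈ deg k A (s + t))
    (w : BarAlg k A) : beta s p t q F G (x * w) = beta s p t q F G x * w := by
  obtain ⟨s, rfl⟩ : ∃ s', s = s' + 1 := ⟨s - 1, by omega⟩
  obtain ⟨t, rfl⟩ : ∃ t', t = t' + 1 := ⟨t - 1, by omega⟩
  have h1 := tilde_Lam_mul hF hG (neg_one_pow_mul_self (t + 1 + q + 1)) (x := x)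
    (by convert hx using 2; omega) w
  have h2 := tilde_Lam_mul hG hF (neg_one_pow_mul_self (s + 1 + p + 1)) (x := x)
    (by convert hx using 2; omega) w
  rw [← pow_mul, mul_comm (t + 1 + q + 1)] at h1
  rw [← pow_mul] at h2
  have hp := neg_one_pow_mul_self (k := k) ((s + 1 + p + 1) * (t + 1 + q + 1))
  have h2' := congrArg ((-1 : k) ^ ((s + 1 + p + 1) * (t + 1 + q + 1)) • ·) h2
  simp only [smul_sub, sub_mul, smul_mul_assoc, smul_smul, hp, one_smul] at h2'
  simp only [beta, betaHalf, LinearMap.sub_apply, LinearMap.add_apply, LinearMap.smul_apply,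
    LinearMap.comp_apply]
  simp only [smul_add, add_mul, sub_mul, smul_mul_assoc, smul_smul] at h1 h2' ⊢
  linear_combination (norm := module) h1 - h2'

theorem Lam_of_mul (c : k) (G : BarAlg k A →ₗ[k] BarAlg k A) (a : A)
    (x : BarAlg k A) : Lam c G (of k a * x) = of k a * Lam c G x := by
  rw [Lam, conv, cutSum_of_mul, mul_cutSum]
  exact cutSum_ext (fun y z => by simp [mul_assoc]) _

theorem Lam_mul_of (c : k) (G : BarAlg k A →ₗ[k] BarAlg k A) (a : A)
    (x : BarAlg k A) : Lam c G (x * of k a) = Lam c G x * of k a := by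
  rw [Lam, conv, cutSum_mul_of, cutSum_mul_right]
  exact cutSum_ext (fun y z => by simp [tilde_mul_of, mul_assoc]) _

theorem beta_of_mul {s p t q : ℕ} {F G : BarAlg k A →ₗ[k] BarAlg k A} (hF : IsC s p F)
    (hG : IsC t q G) (a : A) (x : BarAlg k A) :
    beta s p t q F G (of k a * x) = of k a * beta s p t q F G x := by
  simp [beta, betaHalf, Lam_of_mul, tilde_of_mul hF, tilde_of_mul hG, mul_sub,
    mul_add]

theorem beta_mul_of (s p t q : ℕ) (F G : BarAlg k A →ₗ[k] BarAlg k A) (a : A) (x : BarAlg k A) :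
    beta s p t q F G (x * of k a) = beta s p t q F G x * of k a := by
  simp [beta, betaHalf, Lam_mul_of, tilde_mul_of, sub_mul, add_mul]

theorem betaHalf_mem {s p t q : ℕ} {F G : BarAlg k A →ₗ[k] BarAlg k A} (hF : IsC s p F)
    (hG : IsC t q G) (hs : 1 ≤ s) (cF cG : k) {x : BarAlg k A} (hx : x ∈ deg k A (s + t)) :
    betaHalf cF cG F G x ∈ deg k A (p + q + 1) := by
  refine add_mem (Submodule.smul_mem _ _ (tilde_mem hF (Lam_mem hG _ hx))) ?_
  have h : x ∈ deg k A (t + (s - 1) + 1) := by convert hx using 2; omega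
  have := tilde_mem hG h
  have h2 : tilde G x ∈ deg k A (q + s) := by convert this using 2; omega
  rw [add_comm p q]
  exact Lam_mem hF _ h2

theorem beta_mem {s p t q : ℕ} {F G : BarAlg k A →ₗ[k] BarAlg k A} (hF : IsC s p F)
    (hG : IsC t q G) (hs : 1 ≤ s) (ht : 1 ≤ t) {x : BarAlg k A} (hx : x ∈ deg k A (s + t)) :
    beta s p t q F G x ∈ deg k A (p + q + 1) := by
  refine sub_mem (betaHalf_mem hF hG hs _ _ hx) (Submodule.smul_mem _ _ ?_)
  rw [add_comm p q]
  exact betaHalf_mem hG hF ht _ _ (by rwa [add_comm])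

theorem tilde_zero : tilde (0 : BarAlg k A →ₗ[k] BarAlg k A) = 0 := by
  have := tilde_smul (0 : k) (0 : BarAlg k A →ₗ[k] BarAlg k A); simpa using this

theorem Lam_zero (c : k) : Lam c (0 : BarAlg k A →ₗ[k] BarAlg k A) = 0 := by
  have := Lam_smul c (0 : k) (0 : BarAlg k A →ₗ[k] BarAlg k A); simpa using this

theorem beta_zero_left (s p t q : ℕ) (G : BarAlg k A →ₗ[k] BarAlg k A) :
    beta s p t q 0 G = 0 := by
  simp [beta, betaHalf, tilde_zero, Lam_zero]

theorem beta_zero_right (s p t q : ℕ) (F : BarAlg k A →ₗ[k] BarAlg k A) :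
    beta s p t q F 0 = 0 := by
  simp [beta, betaHalf, tilde_zero, Lam_zero]

theorem beta_add_left (s p t q : ℕ) (F F' G : BarAlg k A →ₗ[k] BarAlg k A) :
    beta s p t q (F + F') G = beta s p t q F G + beta s p t q F' G := by
  simp only [beta, betaHalf, tilde_add, Lam_add, LinearMap.add_comp, LinearMap.comp_add]
  module

theorem beta_smul_left (s p t q : ℕ) (c : k) (F G : BarAlg k A →ₗ[k] BarAlg k A) :
    beta s p t q (c • F) G = c • beta s p t q F G := by
  simp only [beta, betaHalf, tilde_smul, Lam_smul, LinearMap.smul_comp, LinearMap.comp_smul]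
  module

/-! ### Restriction to a degree -/

/-- The restriction of `F` to degree `n`, extended by zero. -/
def restr (n : ℕ) (F : BarAlg k A →ₗ[k] V) : BarAlg k A →ₗ[k] V :=
  F ∘ₗ J k A n ∘ₗ pr k A n

theorem restr_deg {n : ℕ} (F : BarAlg k A →ₗ[k] V) {x : BarAlg k A} (hx : x ∈ deg k A n) :
    restr n F x = F x := by
  change F (J k A n (pr k A n x)) = F x
  rw [J_pr hx]

theorem restr_ne {n m : ℕ} (F : BarAlg k A →ₗ[k] V) {x : BarAlg k A} (hx : x ∈ deg k A m)
    (h : n ≠ m) : restr n F x = 0 := by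
  change F (J k A n (pr k A n x)) = 0
  rw [pr_ne h hx, map_zero, map_zero]

theorem IsC.restr {n r : ℕ} {G : BarAlg k A →ₗ[k] BarAlg k A}
    (h1 : ∀ a x, G (of k a * x) = of k a * G x) (h2 : ∀ x a, G (x * of k a) = G x * of k a)
    (h3 : ∀ x ∈ deg k A (n + 1), G x ∈ deg k A r) : IsC n r (restr (n + 1) G) where
  of_mul a x := by
    induction x using deg_induction_on with
    | hdeg m x hx =>
      by_cases h : n + 1 = m
      · subst h; rw [restr_deg _ hx, restr_deg _ (of_mul_mem a hx), h1]
      · rw [restr_ne _ hx h, restr_ne _ (of_mul_mem a hx) h, mul_zero]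
    | hadd x y hx hy => simp only [mul_add, map_add, hx, hy]
  mul_of x a := by
    induction x using deg_induction_on with
    | hdeg m x hx =>
      by_cases h : n + 1 = m
      · subst h; rw [restr_deg _ hx, restr_deg _ (mul_of_mem a hx), h2]
      · rw [restr_ne _ hx h, restr_ne _ (mul_of_mem a hx) h, zero_mul]
    | hadd x y hx hy => simp only [add_mul, map_add, hx, hy]
  supp m x hx h := restr_ne _ hx (Ne.symm h)
  mem x hx := by rw [restr_deg _ hx]; exact h3 x hx

theorem tilde_eq_of_eq_d {n r : ℕ} {F G : BarAlg k A →ₗ[k] BarAlg k A} (hF : IsC n r F) (c : k)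
    (hG : ∀ x ∈ deg k A (n + 1), ∀ w, G (x * w) = G x * w)
    (hGr : ∀ x ∈ deg k A (n + 1), G x ∈ deg k A (r + 1))
    (h : ∀ x ∈ deg k A (n + 1), F x = c • d (G x)) {m : ℕ} (hm : n + 1 ≤ m) {x : BarAlg k A}
    (hx : x ∈ deg k A m) : tilde F x = (c * (-1) ^ r) • G x := by
  obtain ⟨j, rfl⟩ := Nat.exists_eq_add_of_le hm
  refine eqOn_split (F := tilde F) (G := (c * (-1) ^ r) • G) (fun y hy w _ => ?_) hx
  have hy' := mul_eps_mem hy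
  have e1 : G (y * eps k A) * eps k A = 0 := by
    rw [← hG _ hy', mul_assoc, eps_mul_eps, mul_zero, map_zero]
  have e2 := congrArg d e1
  rw [d_mul, d_eps, mul_one, map_zero, sg_deg _ (hGr _ hy'), pow_succ] at e2
  have e3 : d (G (y * eps k A)) * eps k A = (-1 : k) ^ r • G (y * eps k A) := by
    rw [← sub_eq_zero, ← e2]; module
  rw [tilde_mul_eps_mul hF hy, h _ hy', LinearMap.smul_apply, ← mul_assoc y, hG _ hy',
    smul_mul_assoc, ← mul_assoc, e3, smul_mul_assoc, smul_smul]

/-! ### The bracket of cochains -/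

theorem ext_bracketSg {s p t q N P : ℕ} (hs : 1 ≤ s) (ht : 1 ≤ t) (hN : N + 1 = s + t)
    (hP : P = p + q) (f : Coch k A s p) (g : Coch k A t q) :
    IsC N P (restr (N + 1) ((-1 : k) ^ P • (d ∘ₗ beta s p t q (ext f) (ext g)))) ∧
    ext (bracketSg hs ht hN hP f g) =
      restr (N + 1) ((-1 : k) ^ P • (d ∘ₗ beta s p t q (ext f) (ext g))) := by
  have h : IsC N P (restr (N + 1) ((-1 : k) ^ P • (d ∘ₗ beta s p t q (ext f) (ext g)))) := by
    refine IsC.restr (fun a x => ?_) (fun x a => ?_) fun x hx => ?_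
    · simp [beta_of_mul (ext_isC f) (ext_isC g)]
    · simp [beta_mul_of]
    · rw [hN] at hx
      rw [hP]
      exact Submodule.smul_mem _ _ (d_mem (beta_mem (ext_isC f) (ext_isC g) hs ht hx))
  refine ⟨h, (ext_isC _).ext h fun x => ?_⟩
  rw [ext_tau, restr_deg _ (eps_tau_mem x), J_bracketSg, hP]
  simp only [LinearMap.smul_apply, LinearMap.comp_apply, beta, betaHalf, LinearMap.sub_apply,
    LinearMap.add_apply]

theorem bracketSg_swap {s p t q N P : ℕ} (hs : 1 ≤ s) (ht : 1 ≤ t) (hN : N + 1 = s + t)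
    (hP : P = p + q) (f : Coch k A s p) (g : Coch k A t q) :
    bracketSg hs ht hN hP f g = -(-1 : k) ^ ((s + p + 1) * (t + q + 1)) •
      bracketSg ht hs (by omega) (by omega) g f := by
  rw [bracketSg, bracketSg, smul_sub, smul_smul, neg_mul, mul_comm (t + q + 1),
    neg_one_pow_mul_self]
  module

theorem bracketSg_add_left {s p t q N P : ℕ} (hs : 1 ≤ s) (ht : 1 ≤ t) (hN : N + 1 = s + t)
    (hP : P = p + q) (f f' : Coch k A s p) (g : Coch k A t q) :
    bracketSg hs ht hN hP (f + f') g = bracketSg hs ht hN hP f g + bracketSg hs ht hN hP f' g := by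
  apply ext_injective
  rw [map_add, (ext_bracketSg hs ht hN hP _ _).2, (ext_bracketSg hs ht hN hP _ _).2,
    (ext_bracketSg hs ht hN hP _ _).2, map_add, beta_add_left]
  simp only [restr, LinearMap.comp_add, smul_add, LinearMap.add_comp]

theorem bracketSg_smul_left {s p t q N P : ℕ} (hs : 1 ≤ s) (ht : 1 ≤ t) (hN : N + 1 = s + t)
    (hP : P = p + q) (c : k) (f : Coch k A s p) (g : Coch k A t q) :
    bracketSg hs ht hN hP (c • f) g = c • bracketSg hs ht hN hP f g := by
  apply ext_injective
  rw [map_smul, (ext_bracketSg hs ht hN hP _ _).2, (ext_bracketSg hs ht hN hP _ _).2,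
    map_smul, beta_smul_left]
  simp only [restr, LinearMap.comp_smul, LinearMap.smul_comp, smul_comm c]

theorem bracketSg_add_right {s p t q N P : ℕ} (hs : 1 ≤ s) (ht : 1 ≤ t) (hN : N + 1 = s + t)
    (hP : P = p + q) (f : Coch k A s p) (g g' : Coch k A t q) :
    bracketSg hs ht hN hP f (g + g') = bracketSg hs ht hN hP f g + bracketSg hs ht hN hP f g' := by
  rw [bracketSg_swap, bracketSg_add_left, smul_add, ← bracketSg_swap, ← bracketSg_swap]

theorem bracketSg_smul_right {s p t q N P : ℕ} (hs : 1 ≤ s) (ht : 1 ≤ t) (hN : N + 1 = s + t)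
    (hP : P = p + q) (c : k) (f : Coch k A s p) (g : Coch k A t q) :
    bracketSg hs ht hN hP f (c • g) = c • bracketSg hs ht hN hP f g := by
  rw [bracketSg_swap, bracketSg_smul_left, smul_comm, ← bracketSg_swap]

theorem bracketSg_mem_extZ {s p t q N P : ℕ} (hs : 1 ≤ s) (ht : 1 ≤ t) (hN : N + 1 = s + t)
    (hP : P = p + q) {f : Coch k A s p} {g : Coch k A t q} (hf : f ∈ extZ k A s p)
    (hg : g ∈ extZ k A t q) : bracketSg hs ht hN hP f g ∈ extZ k A N P := by
  rw [mem_extZ_iff] at *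
  obtain ⟨hI, he⟩ := ext_bracketSg hs ht hN hP f g
  rw [he]
  constructor
  · refine ext_deg fun n x hx => ?_
    by_cases h : n = N + 2
    · subst h
      rw [LinearMap.comp_apply, restr_deg _ (d_mem hx), LinearMap.smul_apply,
        LinearMap.comp_apply, beta_d (ext_isC f) (ext_isC g) hf.2 hg.2 hs ht
        (by convert hx using 2; omega), hf.1, hg.1, beta_zero_left, beta_zero_right]
      simp
    · exact hI.comp_d.supp _ _ hx h
  · refine ext_deg fun n x hx => ?_
    by_cases h : n = N + 1
    · subst h
      rw [LinearMap.comp_apply, restr_deg _ hx]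
      simp
    · rw [LinearMap.comp_apply, hI.supp _ _ hx h, map_zero]
      rfl

/-- The bracket with a coboundary of a cochain of positive degree is a coboundary. -/
theorem bracketSg_mem_extB {s p t q N P : ℕ} (hs : 1 ≤ s) (ht : 1 ≤ t) (hN : N + 1 = s + 1 + t)
    (hP : P = p + q) {f : Coch k A (s + 1) p} {g : Coch k A t q} (hf : f ∈ extB k A (s + 1) p)
    (hg : g ∈ extZ k A t q) :
    bracketSg (Nat.le_add_left 1 s) ht hN hP f g ∈ extB k A N P := by
  obtain ⟨N, rfl⟩ : ∃ N', N = N' + 1 := ⟨N - 1, by omega⟩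
  obtain ⟨H, hH, hdH, hfH⟩ := (mem_extB_succ_iff f).1 hf
  rw [mem_extZ_iff] at hg
  rw [mem_extB_succ_iff]
  obtain ⟨h, rfl⟩ : ∃ h, ext h = H := ⟨_, ext_unext hH⟩
  obtain ⟨hI, -⟩ := ext_bracketSg hs ht (by omega : N + 1 = s + t) hP h g
  obtain ⟨hI', he⟩ := ext_bracketSg (Nat.le_add_left 1 s) ht hN hP f g
  refine ⟨_, hI.smul ((-1) ^ (t + q + 1)), ?_, ?_⟩
  · refine ext_deg fun n x hx => ?_
    by_cases h : n = N + 1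
    · subst h
      rw [LinearMap.comp_apply, LinearMap.smul_apply, restr_deg _ hx]
      simp
    · rw [LinearMap.comp_apply, LinearMap.smul_apply, hI.supp _ _ hx h, smul_zero, map_zero]
      rfl
  · rw [he]
    refine ext_deg fun n x hx => ?_
    by_cases h' : n = N + 1 + 1
    · subst h'
      rw [restr_deg _ hx, LinearMap.comp_apply, LinearMap.smul_apply, LinearMap.smul_apply,
        restr_deg _ (d_mem hx), hfH, LinearMap.comp_apply, LinearMap.smul_apply,
        LinearMap.comp_apply, beta_d (ext_isC h) (ext_isC g) hdH hg.2 hs ht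
        (by convert hx using 2; omega), hg.1, beta_zero_right]
      simp only [map_add, map_smul, d_d, smul_zero, zero_add, LinearMap.zero_apply, add_zero,
        smul_smul]
      rw [mul_comm ((-1 : k) ^ P), ← mul_assoc, neg_one_pow_mul_self, one_mul]
    · rw [hI'.supp _ _ hx h']
      exact ((hI.smul _).comp_d.supp _ _ hx h').symm

end BarAlg
end
end TateHH

namespace TateHH
noncomputable section

namespace BarAlg
variable {k A : Type u} [Field k] [Ring A] [Algebra k A]
variable {V W : Type*} [AddCommGroup V] [Module k V] [AddCommGroup W] [Module k W]

/-! ### The structure maps of the inductive system -/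

theorem IsC.restr_d_tilde {s p : ℕ} {F : BarAlg k A →ₗ[k] BarAlg k A} (hF : IsC s p F) (c : k) :
    IsC (s + 1) (p + 1) (BarAlg.restr (s + 2) (c • (d ∘ₗ tilde F))) := by
  refine IsC.restr (fun a x => ?_) (fun x a => ?_) fun x hx => ?_
  · simp [tilde_of_mul hF]
  · simp [tilde_mul_of]
  · exact Submodule.smul_mem _ _ (d_mem (tilde_mem hF hx))

theorem IsC.restr_tilde {s p : ℕ} {F : BarAlg k A →ₗ[k] BarAlg k A} (hF : IsC s p F) :
    IsC s (p + 1) (BarAlg.restr (s + 1) (tilde F)) :=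
  IsC.restr (fun a x => tilde_of_mul hF a x) (fun x a => tilde_mul_of F a x)
    fun _ hx => tilde_mem hF (n := 0) hx

theorem ext_theta {s p : ℕ} (f : Coch k A s p) :
    ext (theta k A s p f) = restr (s + 2) ((-1 : k) ^ s • (d ∘ₗ tilde (ext f))) := by
  refine (ext_isC _).ext ((ext_isC f).restr_d_tilde _) fun x => ?_
  rw [ext_tau, restr_deg _ (eps_tau_mem x), J_theta]
  rfl

/-- The sign in the structure map of the inductive system. -/
def phiSgn (k : Type*) [Field k] (s p : ℕ) : k := if s = 0 then 1 else (-1) ^ p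

theorem phiSgn_mul_self (s p : ℕ) : phiSgn k s p * phiSgn k s p = 1 := by
  rw [phiSgn]; split_ifs
  · simp
  · exact neg_one_pow_mul_self p

theorem phiSgn_pos {s : ℕ} (hs : 1 ≤ s) (p : ℕ) : phiSgn k s p = (-1) ^ p := by
  rw [phiSgn, if_neg (by omega)]

theorem phiSgn_eq (s p : ℕ) :
    (-1 : k) ^ (if s = 0 ∨ p = 0 then s else s + p) * (-1) ^ s = phiSgn k s p := by
  rw [phiSgn]
  by_cases hs : s = 0
  · simp [hs]
  · by_cases hp : p = 0
    · simp [hs, hp, neg_one_pow_mul_self]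
    · rw [if_neg (by tauto), if_neg hs, pow_add, mul_right_comm, neg_one_pow_mul_self, one_mul]

theorem ext_phi {s p : ℕ} (f : Coch k A s p) :
    ext (phi k A s p f) = restr (s + 2) (phiSgn k s p • (d ∘ₗ tilde (ext f))) := by
  rw [phi, map_smul, ext_theta, ← phiSgn_eq, mul_smul]
  simp only [restr, LinearMap.smul_comp]

theorem restr_add (n : ℕ) (F G : BarAlg k A →ₗ[k] V) : restr n (F + G) = restr n F + restr n G :=
  LinearMap.add_comp _ _ _

theorem restr_smul (n : ℕ) (c : k) (F : BarAlg k A →ₗ[k] V) : restr n (c • F) = c • restr n F :=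
  LinearMap.smul_comp _ _ _

variable (k A) in
/-- `phi` as a linear map. -/
def phiₗ (s p : ℕ) : Coch k A s p →ₗ[k] Coch k A (s + 1) (p + 1) where
  toFun := phi k A s p
  map_add' f g := by
    apply ext_injective
    simp only [map_add, ext_phi, tilde_add, LinearMap.comp_add, smul_add, restr_add]
  map_smul' c f := by
    apply ext_injective
    simp only [map_smul, ext_phi, tilde_smul, LinearMap.comp_smul, restr_smul,
      RingHom.id_apply, smul_comm c]

theorem phiₗ_apply {s p : ℕ} (f : Coch k A s p) : phiₗ k A s p f = phi k A s p f := rfl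

theorem tilde_phi {s p m : ℕ} (f : Coch k A s p) (hm : s + 2 ≤ m) {x : BarAlg k A}
    (hx : x ∈ deg k A m) :
    tilde (ext (phi k A s p f)) x = (phiSgn k s p * (-1) ^ (p + 1)) • tilde (ext f) x := by
  refine tilde_eq_of_eq_d (ext_isC (phi k A s p f)) (phiSgn k s p)
    (fun y hy w => tilde_mul (ext_isC f) hy (by omega) w)
    (fun y hy => tilde_mem (ext_isC f) (n := 1) hy) (fun y hy => ?_) hm hx
  rw [ext_phi, restr_deg _ hy, LinearMap.smul_apply, LinearMap.comp_apply]

theorem tilde_phi_pos {s p : ℕ} (hs : 1 ≤ s) (f : Coch k A s p) :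
    tilde (ext (phi k A s p f)) = restr (s + 1) (tilde (ext f)) - tilde (ext f) := by
  refine ext_deg fun n x hx => ?_
  rw [LinearMap.sub_apply]
  rcases lt_trichotomy n (s + 1) with h | rfl | h
  · rw [tilde_low (ext_isC _) hx (by omega), tilde_low (ext_isC _) hx h, restr_ne _ hx (by omega),
      sub_zero]
  · rw [tilde_low (ext_isC _) hx (by omega), restr_deg _ hx, sub_self]
  · rw [tilde_phi f h hx, restr_ne _ hx (by omega), phiSgn_pos hs, pow_succ, ← mul_assoc,
      neg_one_pow_mul_self]
    module

theorem beta_phi {s p t q : ℕ} (hs : 1 ≤ s) (ht : 1 ≤ t) (f : Coch k A s p)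
    {G : BarAlg k A →ₗ[k] BarAlg k A} (hG : IsC t q G) {x : BarAlg k A}
    (hx : x ∈ deg k A (s + t + 1)) :
    beta (s + 1) (p + 1) t q (ext (phi k A s p f)) G x = -beta s p t q (ext f) G x := by
  have hB := (ext_isC f).restr_tilde
  have hB1 : restr (s + 1) (tilde (ext f)) x = 0 := restr_ne _ hx (by omega)
  have hx' : x ∈ deg k A (s + 1 + t) := by convert hx using 2; omega
  have hx'' : x ∈ deg k A (t + 1 + s) := by convert hx using 2; omega
  have hB2 : ∀ c, restr (s + 1) (tilde (ext f)) (Lam c G x) = 0 := fun c =>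
    restr_ne _ (Lam_mem hG c hx') (by omega)
  have hL : ∀ c, Lam c (ext (phi k A s p f)) =
      conv (sg c).toLinearMap (restr (s + 1) (tilde (ext f))) - Lam c (ext f) := fun c => by
    have := conv_add_right (sg c).toLinearMap (restr (s + 1) (tilde (ext f)))
      ((-1 : k) • tilde (ext f))
    rw [conv_smul_right] at this
    rw [Lam, tilde_phi_pos hs, Lam, sub_eq_add_neg, ← neg_one_smul k, this]
    module
  have hc : (-1 : k) ^ (s + 1 + (p + 1) + 1) = (-1) ^ (s + p + 1) := by
    apply neg_one_pow_congr; simp only [Nat.even_add, Nat.even_add_one]; tauto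
  have hc' : (-1 : k) ^ ((s + 1 + (p + 1) + 1) * (t + q + 1)) =
      (-1) ^ ((s + p + 1) * (t + q + 1)) := by
    rw [pow_mul, hc, ← pow_mul]
  have e1 := conv_tilde hG hB ((-1 : k) ^ (s + p + 1)) hx''
  have e2 := tilde_conv hG hB ((-1 : k) ^ (s + p + 1)) hx''
  have e3 : ((-1 : k) ^ (s + p + 1)) ^ (q + 1) = (-1) ^ ((s + p + 1) * (t + q + 1)) *
      ((-1) ^ (s + p + 1) * ((-1) ^ (s + p + 1)) ^ (t + 1)) := by
    simp only [← pow_mul, ← pow_add]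
    apply neg_one_pow_congr
    simp only [Nat.even_add, Nat.even_mul, Nat.even_add_one]
    by_cases h1 : Even s <;> by_cases h2 : Even p <;> by_cases h3 : Even t <;> by_cases h4 : Even q
      <;> simp [h1, h2, h3, h4]
  simp only [beta, betaHalf, hc, hc', hL, tilde_phi_pos hs, LinearMap.sub_apply,
    LinearMap.add_apply, LinearMap.smul_apply, LinearMap.comp_apply, hB1, hB2, map_sub, map_zero,
    e1, e2, e3]
  module

theorem tilde_bracketSg {s p t q N P m : ℕ} (hs : 1 ≤ s) (ht : 1 ≤ t) (hN : N + 1 = s + t)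
    (hP : P = p + q) (f : Coch k A s p) (g : Coch k A t q) (hm : N + 1 ≤ m) {x : BarAlg k A}
    (hx : x ∈ deg k A m) :
    tilde (ext (bracketSg hs ht hN hP f g)) x = beta s p t q (ext f) (ext g) x := by
  subst hP
  rw [tilde_eq_of_eq_d (ext_isC _) ((-1 : k) ^ (p + q)) (G := beta s p t q (ext f) (ext g))
    (fun y hy w => beta_mul (ext_isC f) (ext_isC g) hs ht (hN ▸ hy) w)
    (fun y hy => beta_mem (ext_isC f) (ext_isC g) hs ht (hN ▸ hy))
    (fun y hy => ?_) hm hx, neg_one_pow_mul_self, one_smul]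
  rw [(ext_bracketSg hs ht hN rfl f g).2, restr_deg _ hy]
  rfl

theorem bracketSg_phi {s p t q N P : ℕ} (hs : 1 ≤ s) (ht : 1 ≤ t) (hN : N + 1 = s + t)
    (hP : P = p + q) (f : Coch k A s p) (g : Coch k A t q) :
    bracketSg (by omega) ht (by omega) (by omega) (phi k A s p f) g =
      phi k A N P (bracketSg hs ht hN hP f g) := by
  apply ext_injective
  rw [(ext_bracketSg _ _ _ _ (phi k A s p f) g).2, ext_phi (bracketSg hs ht hN hP f g)]
  refine ext_deg fun n x hx => ?_
  by_cases h : n = N + 2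
  · subst h
    rw [restr_deg _ hx, restr_deg _ hx, LinearMap.smul_apply, LinearMap.smul_apply,
      LinearMap.comp_apply, LinearMap.comp_apply, tilde_bracketSg hs ht hN hP f g (by omega) hx,
      beta_phi hs ht f (ext_isC g) (by convert hx using 2; omega), phiSgn_pos (by omega), map_neg,
      pow_succ]
    module
  · rw [restr_ne _ hx (Ne.symm h), restr_ne _ hx (Ne.symm h)]

theorem bracketSg_phi_right {s p t q N P : ℕ} (hs : 1 ≤ s) (ht : 1 ≤ t) (hN : N + 1 = s + t)
    (hP : P = p + q) (f : Coch k A s p) (g : Coch k A t q) :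
    bracketSg hs (by omega) (by omega) (by omega) f (phi k A t q g) =
      phi k A N P (bracketSg hs ht hN hP f g) := by
  rw [bracketSg_swap, bracketSg_phi ht hs (by omega : N + 1 = t + s) (by omega : P = q + p),
    bracketSg_swap hs ht, ← phiₗ_apply, ← phiₗ_apply, map_smul]
  congr 2
  apply neg_one_pow_congr
  simp only [Nat.even_add, Nat.even_mul, Nat.even_add_one]
  tauto

theorem phi_mem_extZ {s p : ℕ} {f : Coch k A s p} (hf : f ∈ extZ k A s p) :
    phi k A s p f ∈ extZ k A (s + 1) (p + 1) := by
  rw [mem_extZ_iff] at *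
  rw [ext_phi]
  have hI := (ext_isC f).restr_d_tilde (phiSgn k s p)
  constructor
  · refine ext_deg fun n x hx => ?_
    by_cases h : n = s + 3
    · subst h
      rw [LinearMap.comp_apply, restr_deg _ (d_mem hx), LinearMap.smul_apply,
        LinearMap.comp_apply, tilde_d (ext_isC f), hf.1, hf.2, tilde_zero,
        (ext_isC f).supp _ _ hx (by omega)]
      simp
    · exact hI.comp_d.supp _ _ hx h
  · refine ext_deg fun n x hx => ?_
    by_cases h : n = s + 2
    · subst h
      rw [LinearMap.comp_apply, restr_deg _ hx]
      simp
    · rw [LinearMap.comp_apply, hI.supp _ _ hx h, map_zero]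
      rfl

theorem phi_mem_extB {s p : ℕ} {f : Coch k A s p} (hf : f ∈ extB k A s p) :
    phi k A s p f ∈ extB k A (s + 1) (p + 1) := by
  cases s with
  | zero =>
    have : f = 0 := by simpa [extB] using hf
    rw [this, ← phiₗ_apply, map_zero]
    exact zero_mem _
  | succ s =>
    obtain ⟨H, hH, hdH, hfH⟩ := (mem_extB_succ_iff f).1 hf
    rw [mem_extB_succ_iff]
    have hI := hH.restr_d_tilde (phiSgn k (s + 1) p)
    have hI' := (ext_isC f).restr_d_tilde (phiSgn k (s + 1) p)
    refine ⟨_, hI, ?_, ?_⟩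
    · refine ext_deg fun n x hx => ?_
      by_cases h : n = s + 2
      · subst h
        rw [LinearMap.comp_apply, restr_deg _ hx]
        simp
      · rw [LinearMap.comp_apply, hI.supp _ _ hx h, map_zero]
        rfl
    · rw [ext_phi]
      refine ext_deg fun n x hx => ?_
      by_cases h : n = s + 3
      · subst h
        have := tilde_d hH x
        rw [hdH, tilde_zero, hH.supp _ _ hx (by omega)] at this
        rw [restr_deg _ hx, LinearMap.comp_apply, restr_deg _ (d_mem hx), hfH,
          LinearMap.smul_apply, LinearMap.smul_apply, LinearMap.comp_apply, LinearMap.comp_apply,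
          this]
        simp
      · rw [hI'.supp _ _ hx h]
        exact (hI.comp_d.supp _ _ hx h).symm

end BarAlg
end
end TateHH

namespace TateHH
noncomputable section

namespace BarAlg
variable {k A : Type u} [Field k] [Ring A] [Algebra k A]
variable {V W : Type*} [AddCommGroup V] [Module k V] [AddCommGroup W] [Module k W]

/-! ### The first letter of a word -/

variable (k A) in
/-- `a ⊗ w ↦ a w`. -/
def letterMul : A ⊗[k] BarAlg k A →ₗ[k] BarAlg k A :=
  TensorProduct.lift ((LinearMap.mul k (BarAlg k A)) ∘ₗ (of k).toLinearMap)

variable (k A) in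
/-- The action of the algebra on the words with their first letter split off. -/
def letterAct : BarAlg k A →ₐ[k] Module.End k (A ⊗[k] BarAlg k A) :=
  lift ((Module.End.rTensorAlgHom k A (BarAlg k A)).comp (Algebra.lmul k A))
    (TensorProduct.mk k A (BarAlg k A) 1 ∘ₗ LinearMap.mulLeft k (eps k A) ∘ₗ letterMul k A)
    (LinearMap.ext fun v => by simp [letterMul, eps_mul_eps_mul])

theorem letterMul_tmul (a : A) (w : BarAlg k A) : letterMul k A (a ⊗ₜ w) = of k a * w := rfl

theorem letterAct_of_tmul (a b : A) (w : BarAlg k A) :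
    letterAct k A (of k a) (b ⊗ₜ w) = (a * b) ⊗ₜ w := by
  rw [letterAct, lift_of]; rfl

theorem letterAct_eps (v : A ⊗[k] BarAlg k A) :
    letterAct k A (eps k A) v = 1 ⊗ₜ (eps k A * letterMul k A v) := by
  rw [letterAct, lift_eps]; rfl

theorem letterMul_letterAct (x : BarAlg k A) (v : A ⊗[k] BarAlg k A) :
    letterMul k A (letterAct k A x v) = x * letterMul k A v := by
  induction x using gen_induction generalizing v with
  | hof a =>
    induction v using TensorProduct.induction_on with
    | zero => simp
    | tmul b w => rw [letterAct_of_tmul, letterMul_tmul, letterMul_tmul, map_mul, mul_assoc]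
    | add v w hv hw => rw [map_add, map_add, hv, hw, map_add, mul_add]
  | heps => rw [letterAct_eps, letterMul_tmul, map_one, one_mul]
  | hadd x y hx hy => simp only [map_add, LinearMap.add_apply, hx, hy, add_mul]
  | hmul x y hx hy => rw [map_mul, Module.End.mul_apply, hx, hy, mul_assoc]

/-- The application of the functional `l` to the first letter,
`a ε w ↦ l(a) ε w`. -/
def first (l : A →ₗ[k] k) : BarAlg k A →ₗ[k] BarAlg k A :=
  TensorProduct.lift (LinearMap.lsmul k (BarAlg k A) ∘ₗ l) ∘ₗ
    LinearMap.flip (letterAct k A).toLinearMap (1 ⊗ₜ 1)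

theorem first_of (l : A →ₗ[k] k) (a : A) : first l (of k a) = l a • (1 : BarAlg k A) := by
  simp only [first, LinearMap.comp_apply, LinearMap.flip_apply, AlgHom.toLinearMap_apply,
    letterAct_of_tmul, mul_one, TensorProduct.lift.tmul, LinearMap.lsmul_apply]

theorem first_word (l : A →ₗ[k] k) (a : A) (w : BarAlg k A) :
    first l (of k a * (eps k A * w)) = l a • (eps k A * w) := by
  simp only [first, LinearMap.comp_apply, LinearMap.flip_apply, AlgHom.toLinearMap_apply, map_mul,
    Module.End.mul_apply]
  rw [letterAct_eps, letterMul_letterAct, letterMul_tmul, map_one, one_mul, mul_one,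
    letterAct_of_tmul, mul_one]
  rfl

theorem first_mem (l : A →ₗ[k] k) {n : ℕ} {x : BarAlg k A} (hx : x ∈ deg k A n) :
    first l x ∈ deg k A n := by
  induction hx using deg_induction with
  | hof a => rw [first_of]; exact Submodule.smul_mem _ _ one_mem
  | hadd n x y _ _ hx hy => rw [map_add]; exact add_mem hx hy
  | hsmul n c x _ hx => rw [map_smul]; exact Submodule.smul_mem _ _ hx
  | hword n a x hx _ => rw [first_word]; exact Submodule.smul_mem _ _ (eps_mul_mem hx)

theorem first_mul_of (l : A →ₗ[k] k) {n : ℕ} {x : BarAlg k A} (hx : x ∈ deg k A (n + 1)) (b : A) :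
    first l (x * of k b) = first l x * of k b := by
  have hx' : x ∈ deg k A (0 + 1 + n) := by convert hx using 2; omega
  refine eqOn_split (F := first l ∘ₗ LinearMap.mulRight k (of k b))
    (G := LinearMap.mulRight k (of k b) ∘ₗ first l) (fun y hy w _ => ?_) hx'
  obtain ⟨a, rfl⟩ := hy
  simp [first_word, mul_assoc]

/-! ### Cochains of degree zero -/

/-- The element `y` of degree `p` as a cochain of degree zero. -/
def cen (p : ℕ) : BarAlg k A →ₗ[k] Coch k A 0 p :=
  LinearMap.smulRightₗ (PiTensorProduct.isEmptyEquiv (R := k) (Fin 0)).toLinearMap ∘ₗ pr k A p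

theorem ext_cen {p : ℕ} {y : BarAlg k A} (hy : y ∈ deg k A p) (t : TPow k A 0) :
    ext (cen p y) (eps k A * tau k A 0 t) =
      PiTensorProduct.isEmptyEquiv (R := k) (Fin 0) t • y := by
  rw [ext_tau]
  change J k A p (PiTensorProduct.isEmptyEquiv (R := k) (Fin 0) t • pr k A p y) = _
  rw [map_smul, J_pr hy]

theorem ext_cen_eps {p : ℕ} {y : BarAlg k A} (hy : y ∈ deg k A p) :
    ext (cen p y) (eps k A) = y := by
  have := ext_cen hy (PiTensorProduct.tprod k Fin.elim0)
  rw [tau_tprod] at this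
  simpa using this

theorem IsC.ext_zero {p q : ℕ} {F G : BarAlg k A →ₗ[k] BarAlg k A} (hF : IsC 0 p F)
    (hG : IsC 0 q G) (h : F (eps k A) = G (eps k A)) : F = G := by
  refine hF.ext hG fun t => ?_
  rw [tau_zero, mul_smul_comm, mul_one, map_smul, map_smul, h]

theorem IsC.comp_d_eq_zero_iff {p : ℕ} {F : BarAlg k A →ₗ[k] BarAlg k A} (hF : IsC 0 p F) :
    F ∘ₗ d = 0 ↔ ∀ a, of k a * F (eps k A) = F (eps k A) * of k a := by
  have h : ∀ a, F (d (eps k A * (of k a * eps k A))) =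
      of k a * F (eps k A) - F (eps k A) * of k a := fun a => by
    rw [d_eps_mul, d_of_mul, d_eps, mul_one, map_sub, hF.of_mul, hF.mul_of]
  constructor
  · intro h0 a
    have := LinearMap.congr_fun h0 (eps k A * (of k a * eps k A))
    rw [LinearMap.comp_apply, h] at this
    exact sub_eq_zero.1 this
  · intro h0
    refine hF.comp_d.ext (s := 0 + 1) (q := p)
      (G := 0) ⟨by simp, by simp, by simp, fun _ _ => zero_mem _⟩ fun t => ?_
    induction t using tpow_induction with
    | h x =>
      rw [tau_tprod, LinearMap.comp_apply]
      simp only [zero_add, List.ofFn_succ, List.ofFn_zero, List.prod_cons, List.prod_nil, mul_one,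
        letter_apply]
      rw [h, h0, sub_self]
      rfl
    | hadd s t hs ht => rw [map_add, mul_add, map_add, hs, ht]; simp
    | hsmul c t ht => rw [map_smul, mul_smul_comm, map_smul, ht]; simp

end BarAlg

/-! ### Maps that induce isomorphisms on cohomology -/

section Coh
variable {k : Type*} [Field k] {C C' C'' : Type*} [AddCommGroup C] [Module k C] [AddCommGroup C']
  [Module k C'] [AddCommGroup C''] [Module k C'']

/-- `φ` induces an isomorphism `Z / B ≅ Z' / B'`. -/
structure IsCohIso (Z B : Submodule k C) (Z' B' : Submodule k C') (φ : C →ₗ[k] C') : Prop where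
  map : ∀ x ∈ Z, φ x ∈ Z'
  mem_iff : ∀ x ∈ Z, φ x ∈ B' ↔ x ∈ B
  surj : ∀ y ∈ Z', ∃ x ∈ Z, y - φ x ∈ B'

theorem IsCohIso.refl (Z B : Submodule k C) : IsCohIso Z B Z B LinearMap.id :=
  ⟨fun _ h => h, fun _ _ => Iff.rfl, fun y hy => ⟨y, hy, by simp⟩⟩

theorem IsCohIso.comp {Z B : Submodule k C} {Z' B' : Submodule k C'} {Z'' B'' : Submodule k C''}
    {φ : C →ₗ[k] C'} {ψ : C' →ₗ[k] C''} (hψ : IsCohIso Z' B' Z'' B'' ψ)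
    (hφ : IsCohIso Z B Z' B' φ) : IsCohIso Z B Z'' B'' (ψ ∘ₗ φ) where
  map x hx := hψ.map _ (hφ.map x hx)
  mem_iff x hx := (hψ.mem_iff _ (hφ.map x hx)).trans (hφ.mem_iff x hx)
  surj y hy := by
    obtain ⟨x, hx, h⟩ := hψ.surj y hy
    obtain ⟨w, hw, h'⟩ := hφ.surj x hx
    refine ⟨w, hw, ?_⟩
    have := (hψ.mem_iff _ (sub_mem hx (hφ.map w hw))).2 h'
    rw [map_sub] at this
    convert add_mem h this using 1
    rw [LinearMap.comp_apply]; abel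

/-- The isomorphism of cohomology groups. -/
theorem IsCohIso.exists_equiv {Z B : Submodule k C} {Z' B' : Submodule k C'} {φ : C →ₗ[k] C'}
    (h : IsCohIso Z B Z' B' φ) : ∃ e : Coh Z B ≃ₗ[k] Coh Z' B', Induces e φ := by
  have hmap : ∀ x : Z, φ (Z.subtype x) ∈ Z' := fun x => h.map x x.2
  let ψ : Z →ₗ[k] Z' := (φ ∘ₗ Z.subtype).codRestrict Z' hmap
  let χ : Z →ₗ[k] Coh Z' B' := (B'.submoduleOf Z').mkQ ∘ₗ ψ
  have hker : LinearMap.ker χ = B.submoduleOf Z := by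
    ext x
    rw [LinearMap.mem_ker, LinearMap.comp_apply, Submodule.mkQ_apply,
      Submodule.Quotient.mk_eq_zero]
    exact h.mem_iff x x.2
  have hsurj : LinearMap.range χ = ⊤ := by
    rw [LinearMap.range_eq_top]
    intro y
    obtain ⟨y, rfl⟩ := Submodule.mkQ_surjective _ y
    obtain ⟨x, hx, hxy⟩ := h.surj y y.2
    refine ⟨⟨x, hx⟩, ((Submodule.Quotient.eq _).2 ?_).symm⟩
    exact hxy
  refine ⟨(Submodule.quotEquivOfEq _ _ hker.symm).trans (χ.quotKerEquivOfSurjective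
    (LinearMap.range_eq_top.1 hsurj)), fun x => ⟨hmap x, rfl⟩⟩

end Coh

end
end TateHH

namespace TateHH
noncomputable section

namespace BarAlg
variable {k A : Type u} [Field k] [Ring A] [Algebra k A]
variable {V W : Type*} [AddCommGroup V] [Module k V] [AddCommGroup W] [Module k W]

theorem d_tilde_top {s p : ℕ} {H : BarAlg k A →ₗ[k] BarAlg k A} (hH : IsC s p H)
    {x : BarAlg k A} (hx : x ∈ deg k A (s + 1)) :
    d (tilde H x) = tilde (d ∘ₗ H) x + (-1 : k) ^ p • H x := by
  have h := tilde_d hH x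
  rw [tilde_low hH (d_mem hx) (by omega), tilde_low hH.comp_d hx (by omega), zero_sub, eq_comm,
    sub_eq_zero] at h
  have e : (-1 : k) ^ (s + p + 1) * (-1) ^ s = -(-1) ^ p := by
    rw [pow_succ, pow_add]
    linear_combination (-(-1 : k) ^ p) * neg_one_pow_mul_self (k := k) s
  have e' := neg_one_pow_mul_self (k := k) (s + p + 1)
  have h2 := congrArg (fun y => (-1 : k) ^ (s + p + 1) • y) h
  simp only [smul_add, smul_smul, e, smul_neg, e', one_smul] at h2
  linear_combination (norm := module) -h2

theorem IsC.d_comp {s p : ℕ} {H : BarAlg k A →ₗ[k] BarAlg k A} (hH : IsC s (p + 1) H) :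
    IsC s p (d ∘ₗ H) where
  of_mul a x := by simp [hH.of_mul]
  mul_of x a := by simp [hH.mul_of]
  supp n x hx hn := by simp [hH.supp n x hx hn]
  mem x hx := d_mem (hH.mem x hx)

theorem restr_d {n : ℕ} {L : BarAlg k A →ₗ[k] V} : restr n L ∘ₗ d = restr (n + 1) (L ∘ₗ d) := by
  refine ext_deg fun m x hx => ?_
  by_cases h : m = n + 1
  · subst h; rw [LinearMap.comp_apply, restr_deg _ (d_mem hx), restr_deg _ hx]; rfl
  · rw [restr_ne _ hx (Ne.symm h), LinearMap.comp_apply]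
    cases m with
    | zero => rw [d_deg_zero hx, map_zero]
    | succ m => exact restr_ne _ (d_mem hx) (by omega)

theorem restr_zero (n : ℕ) : restr n (0 : BarAlg k A →ₗ[k] V) = 0 := LinearMap.zero_comp _

theorem restr_congr {n : ℕ} {L L' : BarAlg k A →ₗ[k] V} (h : ∀ x ∈ deg k A n, L x = L' x) :
    restr n L = restr n L' := by
  refine ext_deg fun m x hx => ?_
  by_cases hm : m = n
  · subst hm; rw [restr_deg _ hx, restr_deg _ hx, h x hx]
  · rw [restr_ne _ hx (Ne.symm hm), restr_ne _ hx (Ne.symm hm)]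

theorem IsC.eq_restr {s p : ℕ} {H : BarAlg k A →ₗ[k] BarAlg k A}
    (hH : IsC s p H) : BarAlg.restr (s + 1) H = H := by
  refine ext_deg fun m x hx => ?_
  by_cases hm : m = s + 1
  · subst hm; rw [restr_deg _ hx]
  · rw [restr_ne _ hx (Ne.symm hm), hH.supp _ _ hx hm]

/-- The differential of `F~` on the degree after the lowest one. -/
theorem d_tilde_eq {s p : ℕ} {H : BarAlg k A →ₗ[k] BarAlg k A} (hH : IsC s p H)
    (h1 : H ∘ₗ d = 0) (h2 : d ∘ₗ H = 0) {x : BarAlg k A} (hx : x ∈ deg k A (s + 2)) :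
    d (tilde H x) = (-1 : k) ^ (s + p) • tilde H (d x) := by
  rw [tilde_d hH, h1, h2, tilde_zero, hH.supp _ _ hx (by omega), pow_succ]
  have := neg_one_pow_mul_self (k := k) (s + p)
  simp only [LinearMap.zero_apply, smul_zero, smul_sub, smul_add, smul_smul]
  linear_combination (norm := module) this • (-(d (tilde H x)))

end BarAlg

namespace FrobeniusData
open BarAlg
variable {k A ι : Type u} [Field k] [Ring A] [Algebra k A] [DecidableEq ι]
  (F : FrobeniusData k A ι)
variable {V : Type*} [AddCommGroup V] [Module k V]

/-! ### The Casimir element of a Frobenius algebra -/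

/-- The functional `a ↦ ⟨a, 1⟩`. -/
def lam : A →ₗ[k] k := F.form.flip 1

theorem form_eq (a b : A) : F.form a b = F.lam (a * b) := by
  have := F.form_assoc a b 1
  rw [mul_one] at this
  exact this.symm

theorem lam_mul (a b : A) : F.lam (a * b) = F.lam (b * F.nu a) := by
  rw [← form_eq, ← form_eq, F.form_nu]

theorem lam_nu (a : A) : F.lam (F.nu a) = F.lam a := by
  have := F.lam_mul a 1
  rwa [mul_one, one_mul, eq_comm] at this

theorem lam_v_mul_u (i j : ι) : F.lam (F.v i * F.u j) = if i = j then 1 else 0 := by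
  rw [← form_eq, F.form_v_u]

variable [Fintype ι]

theorem sum_lam_mul_u (x : A) : ∑ i, F.lam (x * F.u i) • F.v i = x := by
  have h : ∀ i, F.lam (x * F.u i) = F.v.repr x i := fun i => by
    conv_lhs => rw [← F.v.sum_repr x]
    simp only [Finset.sum_mul, map_sum, smul_mul_assoc, map_smul, lam_v_mul_u]
    simp
  simp only [h, F.v.sum_repr]

theorem sum_lam_v_mul (x : A) : ∑ i, F.lam (F.v i * x) • F.u i = x := by
  have h : ∀ i, F.lam (F.v i * x) = F.u.repr x i := fun i => by
    conv_lhs => rw [← F.u.sum_repr x]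
    simp only [Finset.mul_sum, map_sum, mul_smul_comm, map_smul, lam_v_mul_u]
    simp
  simp only [h, F.u.sum_repr]

theorem casimir_mul (T : A →ₗ[k] A →ₗ[k] V) (a : A) :
    ∑ i, T (a * F.u i) (F.v i) = ∑ i, T (F.u i) (F.v i * a) := by
  have h1 : ∀ i, T (a * F.u i) (F.v i) = ∑ j, F.lam (F.v j * (a * F.u i)) • T (F.u j) (F.v i) := by
    intro i
    conv_lhs => rw [← F.sum_lam_v_mul (a * F.u i)]
    simp [LinearMap.sum_apply]
  have h2 : ∀ i, T (F.u i) (F.v i * a) = ∑ j, F.lam (F.v i * a * F.u j) • T (F.u i) (F.v j) := by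
    intro i
    conv_lhs => rw [← F.sum_lam_mul_u (F.v i * a)]
    simp
  simp only [h1, h2, mul_assoc]
  exact Finset.sum_comm

theorem casimir_nu (T : A →ₗ[k] A →ₗ[k] V) (a : A) :
    ∑ i, T (F.u i * F.nu a) (F.v i) = ∑ i, T (F.u i) (a * F.v i) := by
  have h1 : ∀ i, T (F.u i * F.nu a) (F.v i) =
      ∑ j, F.lam (a * F.v j * F.u i) • T (F.u j) (F.v i) := by
    intro i
    conv_lhs => rw [← F.sum_lam_v_mul (F.u i * F.nu a)]
    simp [LinearMap.sum_apply, F.lam_mul a, mul_assoc]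
  have h2 : ∀ i, T (F.u i) (a * F.v i) = ∑ j, F.lam (a * F.v i * F.u j) • T (F.u i) (F.v j) := by
    intro i
    conv_lhs => rw [← F.sum_lam_mul_u (a * F.v i)]
    simp
  simp only [h1, h2]
  exact Finset.sum_comm

/-- `y ↦ ∑ᵢ uᵢ y vᵢ`. -/
def cas : BarAlg k A →ₗ[k] BarAlg k A :=
  ∑ i, LinearMap.mulRight k (of k (F.v i)) ∘ₗ LinearMap.mulLeft k (of k (F.u i))

theorem cas_apply (y : BarAlg k A) : F.cas y = ∑ i, of k (F.u i) * y * of k (F.v i) := by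
  simp [cas, LinearMap.sum_apply]

theorem of_mul_cas (a : A) (y : BarAlg k A) : of k a * F.cas y = F.cas y * of k a := by
  have := F.casimir_mul ((LinearMap.mul k (BarAlg k A)).compl₁₂
    (LinearMap.mulRight k y ∘ₗ (of k).toLinearMap) (of k).toLinearMap) a
  simpa [cas_apply, Finset.mul_sum, Finset.sum_mul, mul_assoc] using this

theorem cas_mul_of (a : A) (y : BarAlg k A) : F.cas (y * of k a) = F.cas (of k (F.nu a) * y) := by
  have := F.casimir_nu ((LinearMap.mul k (BarAlg k A)).compl₁₂
    (LinearMap.mulRight k y ∘ₗ (of k).toLinearMap) (of k).toLinearMap) a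
  rw [eq_comm] at this
  simpa [cas_apply, mul_assoc] using this

theorem d_cas (y : BarAlg k A) : d (F.cas y) = F.cas (d y) := by
  simp [cas_apply]

theorem cas_mem {n : ℕ} {y : BarAlg k A} (hy : y ∈ deg k A n) : F.cas y ∈ deg k A n := by
  rw [cas_apply]
  exact sum_mem fun i _ => mul_of_mem _ (of_mul_mem _ hy)

theorem sum_first (y : BarAlg k A) : ∑ i, of k (F.u i) * first F.lam (of k (F.v i) * y) = y := by
  have : (∑ i, LinearMap.mulLeft k (of k (F.u i)) ∘ₗ first F.lam ∘ₗ
      LinearMap.mulLeft k (of k (F.v i))) = LinearMap.id := by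
    refine linearMap_ext (fun a => ?_) fun a w _ => ?_
    · conv_rhs => rw [← F.sum_lam_v_mul a]
      simp only [LinearMap.sum_apply, LinearMap.comp_apply, LinearMap.mulLeft_apply, ← map_mul,
        first_of, mul_one, LinearMap.id_apply, map_sum, map_smul]
    · conv_rhs => rw [← F.sum_lam_v_mul a]
      simp only [LinearMap.sum_apply, LinearMap.comp_apply, LinearMap.mulLeft_apply, ← mul_assoc,
        ← map_mul]
      simp only [mul_assoc, first_word, mul_smul_comm, LinearMap.id_apply, map_sum, map_smul,
        Finset.sum_mul, smul_mul_assoc]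
  have h := LinearMap.congr_fun this y
  simpa [LinearMap.sum_apply] using h

theorem first_cas (w : BarAlg k A) : first F.lam (F.cas (eps k A * w)) = eps k A * w := by
  have h : ∑ i, F.lam (F.u i) • of k (F.v i) = 1 := by
    have := congrArg (of k) (F.sum_lam_mul_u 1)
    simpa using this
  simp only [cas_apply, mul_assoc, map_sum, first_word]
  conv_rhs => rw [← mul_one w, ← h]
  simp only [Finset.mul_sum, mul_smul_comm]

theorem cas_first {p : ℕ} {y : BarAlg k A} (hy : y ∈ deg k A (p + 1))
    (h : ∀ a, of k a * y = y * of k a) : F.cas (first F.lam y) = y := by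
  conv_rhs => rw [← F.sum_first y]
  rw [cas_apply]
  refine Finset.sum_congr rfl fun i _ => ?_
  rw [h, first_mul_of _ hy, mul_assoc]

theorem _root_.TateHH.BarAlg.tau_mem {n : ℕ} (t : TPow k A n) : tau k A n t ∈ deg k A n := by
  induction t using tpow_induction with
  | h x =>
    rw [tau_tprod]
    induction n with
    | zero => simpa using BarAlg.one_mem
    | succ n ih =>
      rw [List.ofFn_succ, List.prod_cons, letter_apply, mul_assoc]
      exact word_mem _ (ih _)
  | hadd s t hs ht => rw [map_add]; exact add_mem hs ht
  | hsmul c t ht => rw [map_smul]; exact Submodule.smul_mem _ _ ht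

/-! ### Vanishing of cohomology with induced coefficients -/

theorem exists_comp_d (F : FrobeniusData k A ι) {s p : ℕ} {G : BarAlg k A →ₗ[k] BarAlg k A} (hG : IsC (s + 1) (p + 1) G)
    (h : G ∘ₗ d = 0) : ∃ H, IsC s (p + 1) H ∧ G = H ∘ₗ d := by
  let H : BarAlg k A →ₗ[k] BarAlg k A := ∑ i, LinearMap.mulLeft k (of k (F.u i)) ∘ₗ first F.lam ∘ₗ
    G ∘ₗ LinearMap.mulLeft k (eps k A * of k (F.v i))
  have hH : ∀ x, H x = ∑ i, of k (F.u i) * first F.lam (G (eps k A * of k (F.v i) * x)) := by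
    intro x; simp [H, LinearMap.sum_apply, mul_assoc]
  refine ⟨H, ⟨fun a x => ?_, fun x a => ?_, fun n x hx hn => ?_, fun x hx => ?_⟩, ?_⟩
  · have := F.casimir_mul ((LinearMap.mul k (BarAlg k A)).compl₁₂ (of k).toLinearMap
      (first F.lam ∘ₗ G ∘ₗ LinearMap.mulRight k x ∘ₗ LinearMap.mulLeft k (eps k A) ∘ₗ
        (of k).toLinearMap)) a
    simp only [LinearMap.compl₁₂_apply, LinearMap.mul_apply', LinearMap.comp_apply,
      LinearMap.mulLeft_apply, LinearMap.mulRight_apply, AlgHom.toLinearMap_apply, map_mul] at this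
    rw [hH, hH, Finset.mul_sum]
    simp only [mul_assoc] at this ⊢
    exact this.symm
  · rw [hH, hH, Finset.sum_mul]
    refine Finset.sum_congr rfl fun i _ => ?_
    rw [← mul_assoc, hG.mul_of, first_mul_of _ (hG.mem' _)]
    simp only [mul_assoc]
  · rw [hH]
    refine Finset.sum_eq_zero fun i _ => ?_
    rw [mul_assoc, hG.supp _ _ (eps_mul_mem (of_mul_mem _ hx)) (by omega), map_zero, mul_zero]
  · rw [hH]
    exact sum_mem fun i _ => of_mul_mem _ (first_mem _ (hG.mem' _))
  · refine LinearMap.ext fun x => ?_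
    have e : ∀ i, G (eps k A * of k (F.v i) * d x) = of k (F.v i) * G x := fun i => by
      have := LinearMap.congr_fun h (eps k A * (of k (F.v i) * x))
      rw [LinearMap.comp_apply, d_eps_mul, d_of_mul, map_sub, hG.of_mul] at this
      rw [mul_assoc]
      exact (sub_eq_zero.1 this).symm
    rw [LinearMap.comp_apply, hH]
    simp only [e, F.sum_first]

theorem exists_phi_sub_mem (F : FrobeniusData k A ι) {s p : ℕ} {g : Coch k A (s + 1) (p + 1)}
    (hg : g ∈ extZ k A (s + 1) (p + 1)) :
    ∃ f ∈ extZ k A s p, g - phiₗ k A s p f ∈ extB k A (s + 1) (p + 1) := by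
  rw [mem_extZ_iff] at hg
  obtain ⟨H, hH, hgH⟩ := F.exists_comp_d (ext_isC g) hg.1
  have hD := IsC.d_comp hH
  have hDd : (d ∘ₗ H) ∘ₗ d = 0 := by rw [LinearMap.comp_assoc, ← hgH, hg.2]
  have hdD : d ∘ₗ (d ∘ₗ H) = 0 := LinearMap.ext fun x => d_d _
  have hL : IsC s (p + 1) (restr (s + 1) (d ∘ₗ tilde H)) := by
    refine IsC.restr (fun a x => ?_) (fun x a => ?_) fun x hx => ?_
    · simp [tilde_of_mul hH]
    · simp [tilde_mul_of]
    · exact d_mem (tilde_mem hH (n := 0) hx)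
  refine ⟨(phiSgn k s p * (-1) ^ s) • unext s p (d ∘ₗ H), ?_, ?_⟩
  · refine Submodule.smul_mem _ _ ?_
    rw [mem_extZ_iff, ext_unext hD]
    exact ⟨hDd, hdD⟩
  · rw [mem_extB_succ_iff]
    refine ⟨-(-1 : k) ^ p • restr (s + 1) (d ∘ₗ tilde H), hL.smul _, ?_, ?_⟩
    · refine ext_deg fun n x hx => ?_
      rw [LinearMap.comp_apply, LinearMap.smul_apply]
      by_cases h : n = s + 1
      · subst h; rw [restr_deg _ hx]; simp
      · rw [hL.supp _ _ hx h]; simp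
    · rw [map_sub, map_smul, map_smul, phiₗ_apply, ext_phi, ext_unext hD, LinearMap.smul_comp,
        restr_d, ← (ext_isC g).eq_restr, ← restr_smul, ← restr_smul, sub_eq_add_neg,
        ← neg_one_smul k, ← restr_smul, ← restr_add]
      refine restr_congr fun x hx => ?_
      have e1 := d_tilde_eq hD hDd hdD hx
      have e2 := d_tilde_top hH (d_mem hx)
      have e3 : H (d x) = ext g x := (LinearMap.congr_fun hgH x).symm
      rw [e3] at e2
      have e4 : tilde (d ∘ₗ H) (d x) = d (tilde H (d x)) - (-1 : k) ^ (p + 1) • ext g x := by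
        rw [e2]; abel
      simp only [LinearMap.add_apply, LinearMap.smul_apply, LinearMap.comp_apply, e1, e4,
        smul_smul]
      have c1 := phiSgn_mul_self (k := k) s p
      have c2 := neg_one_pow_mul_self (k := k) s
      have c3 := neg_one_pow_mul_self (k := k) p
      have e5 : -1 * (phiSgn k s p * (-1) ^ s * (phiSgn k s p * (-1) ^ (s + p))) = -(-1) ^ p := by
        rw [pow_add]
        linear_combination (-(-1 : k) ^ s * (-1) ^ s * (-1) ^ p) * c1 - (-1 : k) ^ p * c2
      have e6 : (1 : k) + -1 * (phiSgn k s p * (-1) ^ s * (phiSgn k s p * (-1) ^ (s + p))) *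
          -(-1) ^ (p + 1) = 0 := by
        rw [e5, pow_succ]
        linear_combination -c3
      linear_combination (norm := module) e5 • d (tilde H (d x)) + e6 • ext g x



theorem phi_isCohIso (F : FrobeniusData k A ι) {s : ℕ} (hs : 1 ≤ s) (p : ℕ) :
    IsCohIso (extZ k A s p) (extB k A s p) (extZ k A (s + 1) (p + 1)) (extB k A (s + 1) (p + 1))
      (phiₗ k A s p) where
  map _ hf := phi_mem_extZ hf
  mem_iff f hf := by
    refine ⟨fun h => ?_, phi_mem_extB⟩
    obtain ⟨s, rfl⟩ := Nat.exists_eq_add_of_le' hs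
    rw [mem_extZ_iff] at hf
    obtain ⟨K, hK, hdK, hfK⟩ := (mem_extB_succ_iff _).1 h
    rw [phiₗ_apply, ext_phi] at hfK
    have hL := (ext_isC f).restr_tilde.add (hK.smul (-(-1 : k) ^ (s + 1 + p) * phiSgn k (s + 1) p))
    have hLd : (restr (s + 1 + 1) (tilde (ext f)) + (-(-1 : k) ^ (s + 1 + p) * phiSgn k (s + 1) p) • K) ∘ₗ
        d = 0 := by
      rw [LinearMap.add_comp, LinearMap.smul_comp, ← hfK, restr_d, ← restr_smul, ← restr_add,
        ← restr_zero (s + 1 + 1 + 1)]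
      refine restr_congr fun x hx => ?_
      have e1 := d_tilde_eq (ext_isC f) hf.1 hf.2 hx
      have c1 := phiSgn_mul_self (k := k) (s + 1) p
      have c2 := neg_one_pow_mul_self (k := k) (s + 1 + p)
      simp only [LinearMap.add_apply, LinearMap.smul_apply, LinearMap.comp_apply, e1, smul_smul,
        LinearMap.zero_apply]
      have e2 : (1 : k) + -(-1) ^ (s + 1 + p) * phiSgn k (s + 1) p *
          (phiSgn k (s + 1) p * (-1) ^ (s + 1 + p)) = 0 := by
        linear_combination -((-1 : k) ^ (s + 1 + p) * (-1) ^ (s + 1 + p)) * c1 - c2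
      linear_combination (norm := module) e2 • tilde (ext f) (d x)
    obtain ⟨M, hM, hLM⟩ := F.exists_comp_d hL hLd
    rw [mem_extB_succ_iff]
    refine ⟨(-1 : k) ^ p • (d ∘ₗ M), (IsC.d_comp hM).smul _, ?_, ?_⟩
    · refine LinearMap.ext fun x => ?_
      simp
    · rw [LinearMap.smul_comp, LinearMap.comp_assoc, ← hLM]
      rw [← (ext_isC f).eq_restr, LinearMap.comp_add, LinearMap.comp_smul, hdK, smul_zero,
        add_zero]
      refine ext_deg fun n x hx => ?_
      rw [LinearMap.smul_apply, LinearMap.comp_apply]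
      by_cases h : n = s + 1 + 1
      · subst h
        rw [restr_deg _ hx, restr_deg _ hx, (ext_isC f).eq_restr, d_tilde_top (ext_isC f) hx,
          hf.2, tilde_zero, LinearMap.zero_apply, zero_add, smul_smul, neg_one_pow_mul_self,
          one_smul]
      · rw [restr_ne _ hx (Ne.symm h), restr_ne _ hx (Ne.symm h), map_zero, smul_zero]
  surj _ hg := F.exists_phi_sub_mem hg

theorem phi_zero_mem_iff (F : FrobeniusData k A ι) {p : ℕ} {f : Coch k A 0 p}
    (hf : f ∈ extZ k A 0 p) : phiₗ k A 0 p f ∈ extB k A 1 (p + 1) ↔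
      ∃ w ∈ deg k A p, ext f (eps k A) = d (F.cas (eps k A * w)) := by
  rw [mem_extZ_iff] at hf
  rw [mem_extB_succ_iff, phiₗ_apply, ext_phi]
  have hF0 : tilde (ext f) (eps k A) = ext f (eps k A) * eps k A := by
    have := tilde_mul_eps_mul (ext_isC f) BarAlg.one_mem 1
    simpa using this
  have c2 := neg_one_pow_mul_self (k := k) p
  have hs : phiSgn k 0 p = 1 := rfl
  have he : eps k A ∈ deg k A (0 + 1) := eps_mem
  have hdd : ∀ x ∈ deg k A (0 + 2), d (tilde (ext f) x) =
      (-1 : k) ^ p • tilde (ext f) (d x) := fun x hx => by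
    have := d_tilde_eq (ext_isC f) hf.1 hf.2 hx
    rwa [Nat.zero_add] at this
  constructor
  · rintro ⟨K, hK, hdK, hfK⟩
    have hL := (ext_isC f).restr_tilde.add (hK.smul (-(-1 : k) ^ p))
    have hLd : (restr (0 + 1) (tilde (ext f)) + (-(-1 : k) ^ p) • K) ∘ₗ d = 0 := by
      rw [LinearMap.add_comp, LinearMap.smul_comp, ← hfK, restr_d, ← restr_smul, ← restr_add,
        ← restr_zero (0 + 1 + 1)]
      refine restr_congr fun x hx => ?_
      simp only [LinearMap.add_apply, LinearMap.smul_apply, LinearMap.comp_apply, hdd x hx,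
        smul_smul, LinearMap.zero_apply, hs]
      linear_combination (norm := module) -c2 • tilde (ext f) (d x)
    have hy := hL.mem' (eps k A)
    have hc := hL.comp_d_eq_zero_iff.1 hLd
    have hdy : d ((restr (0 + 1) (tilde (ext f)) + (-(-1 : k) ^ p) • K) (eps k A)) =
        (-1 : k) ^ p • ext f (eps k A) := by
      have h2 : d (K (eps k A)) = 0 := LinearMap.congr_fun hdK _
      rw [LinearMap.add_apply, LinearMap.smul_apply, map_add, map_smul, h2, smul_zero, add_zero,
        restr_deg _ he, d_tilde_top (ext_isC f) he, hf.2, tilde_zero, LinearMap.zero_apply,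
        zero_add]
    generalize (restr (0 + 1) (tilde (ext f)) + (-(-1 : k) ^ p) • K) (eps k A) = y at hy hc hdy
    have hw : ∃ w ∈ deg k A p, first F.lam y = eps k A * w := by
      have hU := deg_split_induction (m := 0) (n := p) (x := y)
        (U := ((deg k A p).map (LinearMap.mulLeft k (eps k A))).comap (first F.lam)) ?_
        (by rwa [Nat.zero_add, Nat.add_comm])
      · obtain ⟨w, hw, h⟩ := hU
        exact ⟨w, hw, h.symm⟩
      · rintro z ⟨a, rfl⟩ w hw
        refine ⟨F.lam a • w, Submodule.smul_mem _ _ hw, ?_⟩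
        rw [AlgHom.toLinearMap_apply, first_word, LinearMap.mulLeft_apply, mul_smul_comm]
    obtain ⟨w, hw, hyw⟩ := hw
    refine ⟨(-1 : k) ^ p • w, Submodule.smul_mem _ _ hw, ?_⟩
    rw [mul_smul_comm, map_smul, map_smul, ← hyw, F.cas_first hy hc, hdy, smul_smul, c2, one_smul]
  · rintro ⟨w, hw, hfw⟩
    have hy : F.cas (eps k A * w) ∈ deg k A (p + 1) := F.cas_mem (eps_mul_mem hw)
    have hc := fun a => F.of_mul_cas a (eps k A * w)
    generalize F.cas (eps k A * w) = y at hy hc hfw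
    have hY := ext_isC (cen (k := k) (A := A) (p + 1) y)
    have hYd : ext (cen (k := k) (A := A) (p + 1) y) ∘ₗ d = 0 := by
      rw [hY.comp_d_eq_zero_iff, ext_cen_eps hy]
      exact hc
    have hK := ((ext_isC f).restr_tilde.smul ((-1 : k) ^ p)).add (hY.smul (-1 : k))
    refine ⟨_, hK, ?_, ?_⟩
    · have h0 : IsC 0 p (0 : BarAlg k A →ₗ[k] BarAlg k A) :=
        ⟨by simp, by simp, by simp, fun _ _ => zero_mem _⟩
      refine (IsC.d_comp hK).ext_zero h0 ?_
      have h3 := congrArg d hfw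
      rw [d_d] at h3
      rw [LinearMap.comp_apply, LinearMap.add_apply, LinearMap.smul_apply, LinearMap.smul_apply,
        restr_deg _ he, ext_cen_eps hy, hF0, map_add, map_smul, map_smul, d_mul, h3, d_eps, zero_mul,
        add_zero, mul_one, (ext_isC f).sg_map, smul_smul, c2, ← hfw, LinearMap.zero_apply]
      module
    · rw [LinearMap.add_comp, LinearMap.smul_comp, LinearMap.smul_comp, hYd, smul_zero, add_zero,
        restr_d, ← restr_smul]
      refine restr_congr fun x hx => ?_
      simp only [LinearMap.smul_apply, LinearMap.comp_apply, hdd x hx, hs, one_smul]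

/-! ### Chains as elements of the algebra -/

/-- `a ⊗ x ↦ ε τ(x) a`. -/
def chainEl (k A : Type u) [Field k] [Ring A] [Algebra k A] (p : ℕ) :
    LBar k A p →ₗ[k] BarAlg k A :=
  TensorProduct.lift ((LinearMap.mul k (BarAlg k A)).flip.compl₁₂ (of k).toLinearMap
    (LinearMap.mulLeft k (eps k A) ∘ₗ tau k A p))

theorem chainEl_tmul {p : ℕ} (a : A) (t : TPow k A p) :
    chainEl k A p (a ⊗ₜ t) = eps k A * tau k A p t * of k a := rfl

theorem chainEl_mem {p : ℕ} (z : LBar k A p) : chainEl k A p z ∈ deg k A (p + 1) := by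
  induction z using lbar_induction with
  | h a t => exact mul_of_mem _ (eps_tau_mem t)
  | hadd y z hy hz => rw [map_add]; exact add_mem hy hz

theorem chainEl_eps {p : ℕ} (z : LBar k A p) : ∃ w ∈ deg k A p, chainEl k A p z = eps k A * w := by
  have : chainEl k A p z ∈ (deg k A p).map (LinearMap.mulLeft k (eps k A)) := by
    induction z using lbar_induction with
    | h a t =>
      refine ⟨tau k A p t * of k a, mul_of_mem _ (tau_mem t), ?_⟩
      rw [chainEl_tmul, mul_assoc]; rfl
    | hadd y z hy hz => rw [map_add]; exact add_mem hy hz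
  obtain ⟨w, hw, h⟩ := this
  exact ⟨w, hw, h.symm⟩

theorem chainEl_injective (p : ℕ) : Function.Injective (chainEl k A p) := by
  have : chainEl k A p = J k A (p + 1) ∘ₗ (bs k A p).toLinearMap ∘ₗ
      ((TensorProduct.mk k A (TPow k A p) 1).rTensor A) ∘ₗ
        (TensorProduct.comm k A (TPow k A p)).toLinearMap := by
    refine TensorProduct.ext' fun a t => ?_
    rw [chainEl_tmul]
    have := J_succ (k := k) (1 : A) t a
    rw [map_one, one_mul] at this
    exact this.symm
  rcases subsingleton_or_nontrivial A with hA | hA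
  · have h0 : ∀ z : LBar k A p, z = 0 := fun z => by
      induction z using lbar_induction with
      | h a t => rw [Subsingleton.elim a 0, TensorProduct.zero_tmul]
      | hadd y z hy hz => rw [hy, hz, add_zero]
    exact fun x y _ => (h0 x).trans (h0 y).symm
  · obtain ⟨l, hl⟩ : ∃ l : Module.Dual k A, l 1 ≠ 0 := by
      by_contra! h
      exact one_ne_zero ((Module.forall_dual_apply_eq_zero_iff k (1 : A)).1 h)
    have hmk : Function.Injective (TensorProduct.mk k A (TPow k A p) 1) := by
      intro t t' h
      have h2 := congrArg ((TensorProduct.lid k _).toLinearMap ∘ₗ l.rTensor (TPow k A p)) h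
      simp only [LinearMap.comp_apply, TensorProduct.mk_apply, LinearMap.rTensor_tmul,
        LinearEquiv.coe_coe, TensorProduct.lid_tmul] at h2
      exact smul_right_injective _ hl h2
    rw [this]
    exact (J_injective _).comp ((bs k A p).injective.comp
      ((Module.Flat.rTensor_preserves_injective_linearMap _ hmk).comp (LinearEquiv.injective _)))

/-- The central element of degree `p + 1` that corresponds to a chain,
`a₀ ⊗ x ↦ ∑ᵢ uᵢ ε τ(x) a₀ vᵢ`. -/
def nm (p : ℕ) : LBar k A p →ₗ[k] BarAlg k A := F.cas ∘ₗ chainEl k A p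

theorem nm_apply {p : ℕ} (z : LBar k A p) : F.nm p z = F.cas (chainEl k A p z) := rfl

theorem nm_mem {p : ℕ} (z : LBar k A p) : F.nm p z ∈ deg k A (p + 1) := F.cas_mem (chainEl_mem z)

theorem of_mul_nm (a : A) {p : ℕ} (z : LBar k A p) :
    of k a * F.nm p z = F.nm p z * of k a := F.of_mul_cas a _

theorem nm_injective (p : ℕ) : Function.Injective (F.nm p) := by
  intro y z h
  apply chainEl_injective
  have h' : ∀ z : LBar k A p, first F.lam (F.nm p z) = chainEl k A p z := fun z => by
    obtain ⟨w, -, hw⟩ := chainEl_eps z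
    rw [nm_apply, hw, first_cas]
  rw [← h', ← h', h]

theorem exists_chainEl {p : ℕ} {w : BarAlg k A} (hw : w ∈ deg k A p) :
    ∃ z, chainEl k A p z = eps k A * w := by
  obtain ⟨y, rfl⟩ := exists_J hw
  have : eps k A * J k A p y = J k A (p + 1) (epsB k A p y) := (J_epsB y).symm
  rw [this]
  have h : J k A (p + 1) (epsB k A p y) ∈ LinearMap.range (chainEl k A p) := by
    clear this hw
    induction y using barAug_induction with
    | h0 a =>
      rw [epsB_zero, J_succ, map_one, one_mul]
      exact ⟨a ⊗ₜ PiTensorProduct.tprod k Fin.elim0, rfl⟩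
    | h1 n a t b =>
      rw [epsB_succ, J_succ, map_one, one_mul]
      exact ⟨b ⊗ₜ _, rfl⟩
    | hadd p y z hy hz => rw [map_add, map_add]; exact add_mem hy hz
  exact h

theorem exists_nm {p : ℕ} {y : BarAlg k A} (hy : y ∈ deg k A (p + 1))
    (hc : ∀ a, of k a * y = y * of k a) : ∃ z, F.nm p z = y := by
  have h : first F.lam y ∈ LinearMap.range (chainEl k A p) := by
    refine deg_split_induction (m := 0) (n := p) (x := y)
      (U := (LinearMap.range (chainEl k A p)).comap (first F.lam)) ?_
      (by rwa [Nat.zero_add, Nat.add_comm])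
    rintro z ⟨a, rfl⟩ w hw
    obtain ⟨v, hv⟩ := exists_chainEl hw
    refine ⟨F.lam a • v, ?_⟩
    rw [AlgHom.toLinearMap_apply, first_word, map_smul, hv]
  obtain ⟨z, hz⟩ := h
  exact ⟨z, by rw [nm_apply, hz, F.cas_first hy hc]⟩

theorem cas_chainEl_coinv {p : ℕ} (m : A) (w : Bar k A p) :
    F.cas (chainEl k A p (coinv F.nu.symm p (m ⊗ₜ w))) =
      F.cas (J k A (p + 1) (bs k A p w) * of k m) := by
  induction w using bar_induction with
  | h a t b =>
    have : coinv F.nu.symm p (m ⊗ₜ[k] ((a ⊗ₜ[k] t) ⊗ₜ[k] b)) = (b * m * F.nu.symm a) ⊗ₜ t := rfl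
    rw [this, chainEl_tmul, J_succ, map_mul (of k), ← mul_assoc, F.cas_mul_of,
      AlgEquiv.apply_symm_apply, map_mul (of k)]
    simp only [mul_assoc]
  | hadd y z hy hz => simp only [TensorProduct.tmul_add, map_add, add_mul, hy, hz]

theorem d_nm {p : ℕ} (z : LBar k A (p + 1)) :
    d (F.nm (p + 1) z) = F.nm p (bdry F.nu.symm p z) := by
  rw [nm_apply, d_cas, nm_apply]
  induction z using lbar_induction with
  | h a t =>
    have : bdry F.nu.symm p (a ⊗ₜ[k] t) =
      coinv F.nu.symm p (a ⊗ₜ barDSucc k A p (oneR k A (p + 1) (oneL k A (p + 1) t))) := rfl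
    rw [this, F.cas_chainEl_coinv, ← barD_succ_eq, J_barD, chainEl_tmul, d_mul_of]
    have h : J k A (p + 2) (bs k A (p + 1) (oneR k A (p + 1) (oneL k A (p + 1) t))) =
      eps k A * tau k A (p + 1) t := by
      have := J_succ (k := k) (1 : A) t 1
      rw [map_one, one_mul, mul_one] at this
      exact this
    rw [h]
  | hadd y z hy hz => simp only [map_add, hy, hz]

theorem ext_normMap (z : LBar k A 0) : ext (F.normMap z) (eps k A) = d (F.nm 0 z) := by
  have e : eps k A * tau k A 0 (PiTensorProduct.tprod k Fin.elim0) = eps k A := by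
    rw [tau_tprod]; simp
  rw [← e, ext_tau, nm_apply, d_cas]
  have h1 : F.normMap z (PiTensorProduct.tprod k Fin.elim0) =
      bz k A (∑ i, F.u i * zeroEquiv k A z * F.v i) := by
    have : F.normMap z (PiTensorProduct.tprod k Fin.elim0) =
      PiTensorProduct.isEmptyEquiv (R := k) (Fin 0) (PiTensorProduct.tprod k Fin.elim0) •
        bz k A ((∑ i, LinearMap.mulRight k (F.v i : A) ∘ₗ LinearMap.mulLeft k (F.u i : A) :
          A →ₗ[k] A) (zeroEquiv k A z)) := rfl
    rw [this]
    simp [LinearMap.sum_apply]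
  have h2 : d (chainEl k A 0 z) = of k (zeroEquiv k A z) := by
    obtain ⟨a, rfl⟩ := (zeroEquiv k A).symm.surjective z
    have h : (zeroEquiv k A).symm a = a ⊗ₜ PiTensorProduct.tprod k Fin.elim0 := by
      rw [LinearEquiv.symm_apply_eq]; simp [zeroEquiv]
    rw [LinearEquiv.apply_symm_apply, h, chainEl_tmul, e]
    simp
  rw [h1, J_zero, h2, cas_apply]
  simp

theorem mem_negZ_iff {p : ℕ} (z : LBar k A p) : z ∈ F.negZ p ↔ d (F.nm p z) = 0 := by
  cases p with
  | zero =>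
    rw [← ext_normMap]
    refine ⟨fun h => ?_, fun h => ?_⟩
    · have : F.normMap z = 0 := h
      rw [this]; simp
    · refine LinearMap.mem_ker.2 (ext_injective ((ext_isC (F.normMap z)).ext_zero
        (ext_isC (0 : Coch k A 0 0)) ?_))
      rw [h]; simp
  | succ p =>
    rw [d_nm]
    exact ⟨fun h => by rw [LinearMap.mem_ker.1 h, map_zero],
      fun h => LinearMap.mem_ker.2 (F.nm_injective p (by rw [h, map_zero]))⟩

theorem mem_negB_iff {p : ℕ} (z : LBar k A p) :
    z ∈ F.negB p ↔ ∃ w ∈ deg k A (p + 1), F.nm p z = d (F.cas (eps k A * w)) := by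
  constructor
  · rintro ⟨y, rfl⟩
    obtain ⟨w, hw, h⟩ := chainEl_eps y
    exact ⟨w, hw, by rw [← d_nm, nm_apply, h]⟩
  · rintro ⟨w, hw, h⟩
    obtain ⟨y, hy⟩ := exists_chainEl hw
    exact ⟨y, F.nm_injective p (by rw [← d_nm, nm_apply, hy, h])⟩

/-- The cochain of degree zero that corresponds to a chain. -/
def nmCoch (p : ℕ) : LBar k A p →ₗ[k] Coch k A 0 (p + 1) := cen (p + 1) ∘ₗ F.nm p

theorem ext_nmCoch {p : ℕ} (z : LBar k A p) : ext (F.nmCoch p z) (eps k A) = F.nm p z :=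
  ext_cen_eps (F.nm_mem z)

theorem nmCoch_mem {p : ℕ} {z : LBar k A p} (hz : z ∈ F.negZ p) :
    F.nmCoch p z ∈ extZ k A 0 (p + 1) := by
  have hI := ext_isC (F.nmCoch p z)
  rw [mem_extZ_iff]
  constructor
  · rw [hI.comp_d_eq_zero_iff, ext_nmCoch]
    exact fun a => F.of_mul_nm a z
  · refine (IsC.d_comp hI).ext_zero
      (⟨by simp, by simp, by simp, fun _ _ => zero_mem _⟩ : IsC 0 p 0) ?_
    rw [LinearMap.comp_apply, ext_nmCoch, (F.mem_negZ_iff z).1 hz, LinearMap.zero_apply]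

theorem J_kappa {p q P : ℕ} (h : P = p + 1 + q) (z : LBar k A p) (t : TPow k A q) :
    J k A P (F.kappa h z t) = d (F.nm p z * (eps k A * tau k A q t)) := by
  have : F.kappa h z t = dOne k A P (appendL k A h ((∑ j, appendL k A (rfl : p + 1 = p + 1)
        ((LinearMap.mulLeft k (F.u j) ∘ₗ F.nu.toLinearMap).rTensor (TPow k A p) z ⊗ₜ
          projT k A (F.v j))) ⊗ₜ t)) := rfl
  have e2 : ∑ j, K k A (p + 1) (appendL k A (rfl : p + 1 = p + 1)
      ((LinearMap.mulLeft k (F.u j) ∘ₗ F.nu.toLinearMap).rTensor (TPow k A p) z ⊗ₜ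
        projT k A (F.v j))) = F.nm p z * eps k A := by
    have e1 : ∀ j, K k A (p + 1) (appendL k A (rfl : p + 1 = p + 1)
        ((LinearMap.mulLeft k (F.u j) ∘ₗ F.nu.toLinearMap).rTensor (TPow k A p) z ⊗ₜ
          projT k A (F.v j))) =
        K k A p ((LinearMap.mulLeft k (F.u j) ∘ₗ F.nu.toLinearMap).rTensor (TPow k A p) z) *
          (of k (F.v j) * eps k A) := fun j => by rw [K_appendL, K_mul_tau_projT]
    simp only [e1]
    clear e1 this
    induction z using lbar_induction with
    | h a t =>
      rw [nm_apply, chainEl_tmul, F.cas_mul_of, cas_apply, Finset.sum_mul]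
      refine Finset.sum_congr rfl fun j _ => ?_
      rw [LinearMap.rTensor_tmul, K_tmul]
      simp only [LinearMap.comp_apply, LinearMap.mulLeft_apply, AlgEquiv.toLinearMap_apply, map_mul,
        mul_assoc]
    | hadd y z hy hz => simp only [map_add, add_mul, Finset.sum_add_distrib, hy, hz]
  rw [this, J_dOne, K_appendL, map_sum, e2, mul_assoc]

theorem kappa_eq {p : ℕ} (z : LBar k A p) :
    F.kappa (rfl : p + 1 + 1 = p + 1 + 1) z = phiₗ k A 0 (p + 1) (F.nmCoch p z) := by
  refine LinearMap.ext fun t => J_injective _ ?_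
  have h : J k A (p + 1 + 1) (phiₗ k A 0 (p + 1) (F.nmCoch p z) t) =
      ext (phi k A 0 (p + 1) (F.nmCoch p z)) (eps k A * tau k A 1 t) := (ext_tau _ t).symm
  have h2 := tilde_mul_eps_mul (ext_isC (F.nmCoch p z)) BarAlg.one_mem (tau k A 1 t)
  rw [one_mul, one_mul, ext_nmCoch] at h2
  rw [J_kappa, h, ext_phi, restr_deg _ (eps_tau_mem t), LinearMap.smul_apply,
    LinearMap.comp_apply, h2]
  exact (one_smul k _).symm

theorem kappa_isCohIso (p : ℕ) : IsCohIso (F.negZ p) (F.negB p) (extZ k A 1 (p + 1 + 1))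
    (extB k A 1 (p + 1 + 1)) (phiₗ k A 0 (p + 1) ∘ₗ F.nmCoch p) where
  map z hz := phi_mem_extZ (F.nmCoch_mem hz)
  mem_iff z hz := by
    rw [LinearMap.comp_apply, F.phi_zero_mem_iff (F.nmCoch_mem hz), mem_negB_iff, ext_nmCoch]
  surj g hg := by
    obtain ⟨f, hf, hfg⟩ := F.exists_phi_sub_mem hg
    have hI := ext_isC f
    have hf' := (mem_extZ_iff f).1 hf
    obtain ⟨z, hz⟩ := F.exists_nm (hI.mem' (eps k A)) (hI.comp_d_eq_zero_iff.1 hf'.1)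
    have h : f = F.nmCoch p z := ext_injective (hI.ext_zero (ext_isC _) (by rw [ext_nmCoch, hz]))
    refine ⟨z, (F.mem_negZ_iff z).2 ?_, ?_⟩
    · rw [hz]; exact LinearMap.congr_fun hf'.2 _
    · rw [LinearMap.comp_apply, ← h]; exact hfg

/-! ### Cochains with values in the algebra -/

theorem omCoch_zero (s : ℕ) : omCoch k A s 0 = ⊤ := by
  rw [eq_top_iff]
  rintro f -
  rw [mem_omCoch_iff]
  exact LinearMap.ext fun x => d_deg_zero ((ext_isC f).mem' x)

theorem posZ_eq {k A ι : Type u} [Field k] [Ring A] [Algebra k A] [DecidableEq ι]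
    (F : FrobeniusData k A ι) (r : ℕ) : F.posZ r = extZ k A r 0 := by
  rw [posZ, extZ, omCoch_zero, inf_top_eq]

theorem posB_eq (r : ℕ) : F.posB (r + 1) = extB k A (r + 1) 0 := by
  rw [posB, extB, omCoch_zero, Submodule.map_top]

theorem phi_zero_isCohIso : IsCohIso (F.posZ 0) (F.posB 0) (extZ k A 1 1) (extB k A 1 1)
    (phiₗ k A 0 0) where
  map f hf := phi_mem_extZ (F.posZ_eq 0 ▸ hf)
  mem_iff f hf := by
    rw [F.phi_zero_mem_iff (F.posZ_eq 0 ▸ hf)]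
    constructor
    · rintro ⟨w, hw, h⟩
      obtain ⟨z, hz⟩ := exists_chainEl hw
      refine ⟨z, ext_injective ((ext_isC (F.normMap z)).ext_zero (ext_isC f) ?_)⟩
      rw [ext_normMap, h, nm_apply, hz]
    · rintro ⟨z, rfl⟩
      obtain ⟨w, hw, h⟩ := chainEl_eps z
      exact ⟨w, hw, by rw [ext_normMap, nm_apply, h]⟩
  surj g hg := by
    rw [posZ_eq]
    exact F.exists_phi_sub_mem hg

/-- `phiIter` as a linear map. -/
def phiIterₗ (k A : Type u) [Field k] [Ring A] [Algebra k A] (s p : ℕ) :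
    (n : ℕ) → Coch k A s p →ₗ[k] Coch k A (s + n) (p + n)
  | 0 => LinearMap.id
  | n + 1 => phiₗ k A (s + n) (p + n) ∘ₗ phiIterₗ k A s p n

theorem phiIterₗ_apply (s p : ℕ) (f : Coch k A s p) (n : ℕ) :
    phiIterₗ k A s p n f = phiIter k A s p f n := by
  induction n with
  | zero => rfl
  | succ n ih =>
    change phi k A (s + n) (p + n) (phiIterₗ k A s p n f) = _
    rw [ih]; rfl

theorem phiIter_isCohIso (r n : ℕ) : IsCohIso (F.posZ r) (F.posB r) (extZ k A (r + (n + 1)) (0 + (n + 1)))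
    (extB k A (r + (n + 1)) (0 + (n + 1))) (phiIterₗ k A r 0 (n + 1)) := by
  induction n with
  | zero =>
    cases r with
    | zero => exact F.phi_zero_isCohIso
    | succ r =>
      rw [posZ_eq, posB_eq]
      exact F.phi_isCohIso (Nat.le_add_left 1 r) 0
  | succ n ih => exact (F.phi_isCohIso (by omega : 1 ≤ r + (n + 1)) (0 + (n + 1))).comp ih

end FrobeniusData
end
end TateHH

namespace TateHH
noncomputable section

section Pairing
variable {k : Type*} [Field k] {C₁ C₂ C' : Type*} [AddCommGroup C₁] [Module k C₁]
  [AddCommGroup C₂] [Module k C₂] [AddCommGroup C'] [Module k C']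

/-- A pairing of cochains that is compatible with cocycles and coboundaries induces a pairing on
cohomology. -/
theorem exists_induces₂ {Z₁ B₁ : Submodule k C₁} {Z₂ B₂ : Submodule k C₂} {Z' B' : Submodule k C'}
    (φ : C₁ →ₗ[k] C₂ →ₗ[k] C') (hZ : ∀ x ∈ Z₁, ∀ y ∈ Z₂, φ x y ∈ Z')
    (h₁ : ∀ x ∈ Z₁, x ∈ B₁ → ∀ y ∈ Z₂, φ x y ∈ B') (h₂ : ∀ x ∈ Z₁, ∀ y ∈ Z₂, y ∈ B₂ → φ x y ∈ B') :
    ∃ e : Coh Z₁ B₁ →ₗ[k] Coh Z₂ B₂ →ₗ[k] Coh Z' B', Induces₂ e (fun x y => φ x y) := by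
  let ψ : Z₁ →ₗ[k] Z₂ →ₗ[k] Coh Z' B' := LinearMap.mk₂ k
    (fun x y => Coh.cls Z' B' ⟨φ x y, hZ x x.2 y y.2⟩)
    (fun x x' y => by rw [← map_add]; congr 1; ext; simp)
    (fun c x y => by rw [← map_smul]; congr 1; ext; simp)
    (fun x y y' => by rw [← map_add]; congr 1; ext; simp)
    (fun c x y => by rw [← map_smul]; congr 1; ext; simp)
  have hψ₂ : ∀ x, B₂.submoduleOf Z₂ ≤ LinearMap.ker (ψ x) := fun x y hy =>
    LinearMap.mem_ker.2 ((Submodule.Quotient.mk_eq_zero _).2 (h₂ x x.2 y y.2 hy))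
  let χ : Z₁ →ₗ[k] Coh Z₂ B₂ →ₗ[k] Coh Z' B' :=
    { toFun := fun x => (B₂.submoduleOf Z₂).liftQ (ψ x) (hψ₂ x)
      map_add' := fun x x' => Submodule.linearMap_qext _ (LinearMap.ext fun y => by simp)
      map_smul' := fun c x => Submodule.linearMap_qext _ (LinearMap.ext fun y => by simp) }
  have hχ : B₁.submoduleOf Z₁ ≤ LinearMap.ker χ := fun x hx =>
    LinearMap.mem_ker.2 (Submodule.linearMap_qext _ (LinearMap.ext fun y =>
      (Submodule.Quotient.mk_eq_zero _).2 (h₁ x x.2 hx y y.2)))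
  exact ⟨(B₁.submoduleOf Z₁).liftQ χ hχ, fun x y => ⟨hZ x x.2 y y.2, rfl⟩⟩

end Pairing

section Family
variable {k : Type*} [Field k]

theorem exists_compatible_family {E : ℕ → Type*} [∀ j, AddCommGroup (E j)] [∀ j, Module k (E j)]
    (Φ : ∀ j, E j →ₗ[k] E (j + 1)) (j₀ : ℕ) (hΦ : ∀ j, j₀ ≤ j → Function.Bijective (Φ j)) :
    ∃ g : ∀ j, E j →ₗ[k] E j₀, (∀ j x, g (j + 1) (Φ j x) = g j x) ∧ g j₀ = LinearMap.id := by
  induction j₀ generalizing E with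
  | zero =>
    let g : ∀ j, E j →ₗ[k] E 0 := fun j => Nat.rec LinearMap.id
      (fun j g => g ∘ₗ (LinearEquiv.ofBijective (Φ j) (hΦ j (Nat.zero_le j))).symm.toLinearMap) j
    refine ⟨g, fun j x => ?_, rfl⟩
    change g j ((LinearEquiv.ofBijective (Φ j) (hΦ j (Nat.zero_le j))).symm (Φ j x)) = g j x
    congr 1
    exact (LinearEquiv.ofBijective (Φ j) (hΦ j (Nat.zero_le j))).symm_apply_apply x
  | succ j₀ ih =>
    obtain ⟨g, hg, hg0⟩ := ih (E := fun j => E (j + 1)) (fun j => Φ (j + 1))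
      (fun j hj => hΦ (j + 1) (by omega))
    refine ⟨fun j => match j with
      | 0 => g 0 ∘ₗ Φ 0
      | j + 1 => g j, fun j x => ?_, hg0⟩
    cases j with
    | zero => rfl
    | succ j => exact hg j x

end Family

open BarAlg
variable {k A : Type u} [Field k] [Ring A] [Algebra k A]

theorem extB_le_extZ (s p : ℕ) : extB k A s p ≤ extZ k A s p := by
  cases s with
  | zero => exact bot_le
  | succ s =>
    intro f hf
    obtain ⟨G, hG, hdG, hfG⟩ := (mem_extB_succ_iff f).1 hf
    rw [mem_extZ_iff, hfG]
    refine ⟨LinearMap.ext fun x => by simp, ?_⟩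
    rw [← LinearMap.comp_assoc, hdG, LinearMap.zero_comp]

/-- The bracket of cochains as a bilinear map. -/
def bracketₗ {s p t q N P : ℕ} (hs : 1 ≤ s) (ht : 1 ≤ t) (hN : N + 1 = s + t) (hP : P = p + q) :
    Coch k A s p →ₗ[k] Coch k A t q →ₗ[k] Coch k A N P :=
  LinearMap.mk₂ k (bracketSg hs ht hN hP) (bracketSg_add_left hs ht hN hP)
    (bracketSg_smul_left hs ht hN hP) (bracketSg_add_right hs ht hN hP)
    (bracketSg_smul_right hs ht hN hP)

variable {ι : Type u} [Fintype ι] [DecidableEq ι]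

theorem bracketSg_mem_extB_left (F : FrobeniusData k A ι) {s p t q N P : ℕ} (hs : 1 ≤ s)
    (ht : 1 ≤ t) (hN : N + 1 = s + t) (hP : P = p + q) {f : Coch k A s p} {g : Coch k A t q}
    (hf : f ∈ extB k A s p) (hg : g ∈ extZ k A t q) :
    bracketSg hs ht hN hP f g ∈ extB k A N P := by
  rw [← (F.phi_isCohIso (by omega : 1 ≤ N) P).mem_iff _
    (bracketSg_mem_extZ hs ht hN hP (extB_le_extZ _ _ hf) hg), phiₗ_apply,
    ← bracketSg_phi hs ht hN hP]
  exact bracketSg_mem_extB hs ht (by omega) (by omega) (phi_mem_extB hf) hg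

theorem bracketSg_mem_extB_right (F : FrobeniusData k A ι) {s p t q N P : ℕ} (hs : 1 ≤ s)
    (ht : 1 ≤ t) (hN : N + 1 = s + t) (hP : P = p + q) {f : Coch k A s p} {g : Coch k A t q}
    (hf : f ∈ extZ k A s p) (hg : g ∈ extB k A t q) :
    bracketSg hs ht hN hP f g ∈ extB k A N P := by
  rw [bracketSg_swap]
  exact Submodule.smul_mem _ _
    (bracketSg_mem_extB_left F ht hs (by omega) (by omega) hg hf)

theorem exists_bracketExt (F : FrobeniusData k A ι) {s p t q N P : ℕ} (hs : 1 ≤ s)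
    (ht : 1 ≤ t) (hN : N + 1 = s + t) (hP : P = p + q) :
    ∃ e : ExtOm k A s p →ₗ[k] ExtOm k A t q →ₗ[k] ExtOm k A N P,
      Induces₂ e (bracketSg hs ht hN hP) :=
  exists_induces₂ (bracketₗ hs ht hN hP) (fun _ hx _ hy => bracketSg_mem_extZ hs ht hN hP hx hy)
    (fun _ _ hx _ hy => bracketSg_mem_extB_left F hs ht hN hP hx hy)
    (fun _ hx _ _ hy => bracketSg_mem_extB_right F hs ht hN hP hx hy)

/-! ### The direct limit -/

variable (k A) in
/-- The structure map of the inductive system on cohomology. -/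
def phiExt (s p : ℕ) : ExtOm k A s p →ₗ[k] ExtOm k A (s + 1) (p + 1) :=
  Submodule.mapQ _ _ ((phiₗ k A s p).restrict (fun _ hf => phi_mem_extZ hf))
    (fun _ hf => phi_mem_extB hf)

theorem phiExt_cls {s p : ℕ} (f : extZ k A s p) :
    phiExt k A s p (Coh.cls _ _ f) = Coh.cls (extZ k A (s + 1) (p + 1)) (extB k A (s + 1) (p + 1))
      ⟨phi k A s p f, phi_mem_extZ f.2⟩ := rfl

theorem phiExt_surjective (F : FrobeniusData k A ι) (s p : ℕ) :
    Function.Surjective (phiExt k A s p) := by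
  intro y
  obtain ⟨g, rfl⟩ := Submodule.mkQ_surjective _ y
  obtain ⟨f, hf, h⟩ := F.exists_phi_sub_mem g.2
  refine ⟨Coh.cls _ _ ⟨f, hf⟩, ?_⟩
  rw [phiExt_cls, eq_comm]
  refine (Submodule.Quotient.eq _).2 ?_
  rw [Submodule.submoduleOf, Submodule.mem_comap, map_sub]
  exact h

theorem phiExt_injective (F : FrobeniusData k A ι) {s : ℕ} (hs : 1 ≤ s) (p : ℕ) :
    Function.Injective (phiExt k A s p) := by
  rw [injective_iff_map_eq_zero]
  intro x hx
  obtain ⟨f, rfl⟩ := Submodule.mkQ_surjective _ x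
  rw [Submodule.mkQ_apply, Submodule.Quotient.mk_eq_zero]
  exact ((F.phi_isCohIso hs p).mem_iff f f.2).1 ((Submodule.Quotient.mk_eq_zero
    ((extB k A (s + 1) (p + 1)).submoduleOf (extZ k A (s + 1) (p + 1)))).1 hx)

theorem TateExt.of_phiExt {r : ℤ} {s p : ℕ} (h : (s : ℤ) - (p : ℤ) = r)
    (h' : ((s + 1 : ℕ) : ℤ) - ((p + 1 : ℕ) : ℤ) = r) (x : ExtOm k A s p) :
    TateExt.of k A (s + 1) (p + 1) h' (phiExt k A s p x) = TateExt.of k A s p h x := by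
  obtain ⟨f, rfl⟩ := Submodule.mkQ_surjective _ x
  refine ((Submodule.Quotient.eq _).2 (Submodule.subset_span ?_)).symm
  exact ⟨s, p, h, h', f, ⟨phi k A s p f, phi_mem_extZ f.2⟩, rfl, rfl⟩

/-- The levels of the inductive system. -/
def levelAt {r : ℤ} {a b : ℕ} (h : (a : ℤ) - (b : ℤ) = r) (j : ℕ) : Level r :=
  ⟨(a + j, b + j), by push_cast; omega⟩

theorem exists_levelAt {r : ℤ} {a b : ℕ} (h : (a : ℤ) - (b : ℤ) = r) (h0 : a = 0 ∨ b = 0)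
    (i : Level r) : ∃ j, i = levelAt h j := by
  obtain ⟨⟨s, p⟩, hi⟩ := i
  simp only at hi
  refine ⟨s - a, Subtype.ext (Prod.ext ?_ ?_)⟩
  · change s = a + (s - a); omega
  · change p = b + (s - a); omega

theorem exists_base (r : ℤ) : ∃ a b : ℕ, (a : ℤ) - (b : ℤ) = r ∧ (a = 0 ∨ b = 0) :=
  ⟨r.toNat, (-r).toNat, by omega, by omega⟩

theorem levelAt_injective {r : ℤ} {a b : ℕ} (h : (a : ℤ) - (b : ℤ) = r) :
    Function.Injective (levelAt h) := by
  intro j j' e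
  have := congrArg (fun i : Level r => i.1.1) e
  simp only [levelAt] at this
  omega

theorem TateExt.of_injective (F : FrobeniusData k A ι) {r : ℤ} {s p : ℕ} (hs : 1 ≤ s)
    (h : (s : ℤ) - (p : ℤ) = r) : Function.Injective (TateExt.of k A s p h) := by
  obtain ⟨a, b, hab, h0⟩ := exists_base r
  obtain ⟨j₀, hj₀⟩ := exists_levelAt hab h0 ⟨(s, p), h⟩
  obtain rfl : s = a + j₀ := congrArg (fun i : Level r => i.1.1) hj₀
  obtain rfl : p = b + j₀ := congrArg (fun i : Level r => i.1.2) hj₀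
  obtain ⟨g, hg, hg0⟩ := exists_compatible_family (k := k) (E := fun j => ExtOm k A (a + j) (b + j))
    (fun j => phiExt k A (a + j) (b + j)) j₀
    (fun j hj => ⟨phiExt_injective F (by omega) _, phiExt_surjective F _ _⟩)
  have hG : ∀ i : Level r, ∃ f : LevelExt k A r i →ₗ[k] ExtOm k A (a + j₀) (b + j₀),
      ∀ j, i = levelAt hab j → HEq f (g j) := by
    intro i
    obtain ⟨j, rfl⟩ := exists_levelAt hab h0 i
    refine ⟨g j, fun j' h => ?_⟩
    obtain rfl := levelAt_injective hab h
    rfl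
  choose G hG using hG
  have hGj : ∀ j, G (levelAt hab j) = g j := fun j => eq_of_heq (hG _ j rfl)
  have hlof : ∀ i (y : LevelExt k A r i), DirectSum.toModule k (Level r) _ G
      (DirectSum.lof k (Level r) (LevelExt k A r) i y) = G i y := fun i y =>
    DirectSum.toModule_lof k i y
  have hker : limRel k A r ≤ LinearMap.ker (DirectSum.toModule k (Level r) _ G) := by
    refine Submodule.span_le.2 ?_
    rintro x ⟨s, p, h, h', f, f', hf, rfl⟩
    obtain ⟨j, hj⟩ := exists_levelAt hab h0 ⟨(s, p), h⟩
    obtain rfl : s = a + j := congrArg (fun i : Level r => i.1.1) hj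
    obtain rfl : p = b + j := congrArg (fun i : Level r => i.1.2) hj
    refine LinearMap.mem_ker.2 ((map_sub _ _ _).trans (sub_eq_zero.2 ?_))
    have e1 := hGj j
    have e2 := hGj (j + 1)
    have e3 := hg j (Coh.cls _ _ f)
    have e4 : f' = ⟨phi k A _ _ f, phi_mem_extZ f.2⟩ := Subtype.ext hf
    subst e4
    rw [phiExt_cls] at e3
    exact (hlof _ _).trans ((LinearMap.congr_fun e1 _).trans
      (e3.symm.trans ((LinearMap.congr_fun e2 _).symm.trans (hlof (levelAt hab (j + 1)) _).symm)))
  intro x y hxy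
  have h1 := congrArg ((limRel k A r).liftQ _ hker) hxy
  have h2 : ∀ x, (limRel k A r).liftQ _ hker (TateExt.of k A (a + j₀) (b + j₀) h x) = x := by
    intro x
    exact (hlof (levelAt hab j₀) x).trans ((LinearMap.congr_fun (hGj j₀) x).trans
      (LinearMap.congr_fun hg0 x))
  rwa [h2, h2] at h1

theorem TateExt.of_surjective (F : FrobeniusData k A ι) {r : ℤ} {s p : ℕ}
    (h : (s : ℤ) - (p : ℤ) = r) : Function.Surjective (TateExt.of k A s p h) := by
  obtain ⟨a, b, hab, h0⟩ := exists_base r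
  obtain ⟨j₀, hj₀⟩ := exists_levelAt hab h0 ⟨(s, p), h⟩
  obtain rfl : s = a + j₀ := congrArg (fun i : Level r => i.1.1) hj₀
  obtain rfl : p = b + j₀ := congrArg (fun i : Level r => i.1.2) hj₀
  have hr : ∀ j, ((a + j : ℕ) : ℤ) - ((b + j : ℕ) : ℤ) = r := fun j => (levelAt hab j).2
  have h1 : ∀ j, LinearMap.range (TateExt.of k A (a + j) (b + j) (hr j)) =
      LinearMap.range (TateExt.of k A (a + (j + 1)) (b + (j + 1)) (hr (j + 1))) := fun j => by
    apply le_antisymm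
    · rintro - ⟨x, rfl⟩
      exact ⟨_, TateExt.of_phiExt (hr j) (hr (j + 1)) x⟩
    · rintro - ⟨x, rfl⟩
      obtain ⟨x, rfl⟩ := phiExt_surjective F (a + j) (b + j) x
      exact ⟨x, (TateExt.of_phiExt (hr j) (hr (j + 1)) x).symm⟩
  have h2 : ∀ j, LinearMap.range (TateExt.of k A (a + j) (b + j) (hr j)) =
      LinearMap.range (TateExt.of k A (a + 0) (b + 0) (hr 0)) := fun j => by
    induction j with
    | zero => rfl
    | succ j ih => rw [← h1, ih]
  rw [← LinearMap.range_eq_top, eq_top_iff]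
  rintro x -
  obtain ⟨x, rfl⟩ := Submodule.mkQ_surjective _ x
  induction x using DirectSum.induction_on with
  | zero => rw [map_zero]; exact zero_mem _
  | of i x =>
    obtain ⟨j, rfl⟩ := exists_levelAt hab h0 i
    have : (limRel k A r).mkQ (DirectSum.of (LevelExt k A r) (levelAt hab j) x) ∈
      LinearMap.range (TateExt.of k A (a + j) (b + j) (hr j)) := ⟨x, rfl⟩
    rwa [h2, ← h2 j₀] at this
  | add x y hx hy => rw [map_add]; exact add_mem hx hy

/-- The isomorphism of a term of positive degree to the direct limit. -/
def limEquiv (F : FrobeniusData k A ι) {r : ℤ} {s p : ℕ} (hs : 1 ≤ s)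
    (h : (s : ℤ) - (p : ℤ) = r) : ExtOm k A s p ≃ₗ[k] TateExt k A r :=
  LinearEquiv.ofBijective (TateExt.of k A s p h)
    ⟨TateExt.of_injective F hs h, TateExt.of_surjective F h⟩

end
end TateHH

namespace TateHH
noncomputable section

open BarAlg
variable {k A ι : Type u} [Field k] [Ring A] [Algebra k A] [Fintype ι] [DecidableEq ι]

theorem TateExt.of_eq_of_sub_mem {r : ℤ} {s p : ℕ} (h : (s : ℤ) - (p : ℤ) = r)
    {f g : Coch k A s p} (hf : f ∈ extZ k A s p) (hg : g ∈ extZ k A s p)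
    (hfg : f - g ∈ extB k A s p) :
    TateExt.of k A s p h (Coh.cls _ _ ⟨f, hf⟩) = TateExt.of k A s p h (Coh.cls _ _ ⟨g, hg⟩) := by
  congr 1
  exact (Submodule.Quotient.eq _).2 (by
    rw [Submodule.submoduleOf, Submodule.mem_comap, map_sub]; exact hfg)

theorem TateExt.of_phi {r : ℤ} {s p : ℕ} (h : (s : ℤ) - (p : ℤ) = r)
    (h' : ((s + 1 : ℕ) : ℤ) - ((p + 1 : ℕ) : ℤ) = r) {f : Coch k A s p} (hf : f ∈ extZ k A s p) :
    TateExt.of k A (s + 1) (p + 1) h' (Coh.cls _ _ ⟨phi k A s p f, phi_mem_extZ hf⟩) =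
      TateExt.of k A s p h (Coh.cls _ _ ⟨f, hf⟩) :=
  TateExt.of_phiExt h h' (Coh.cls _ _ ⟨f, hf⟩)

theorem bracketSg_sub_left {s p t q N P : ℕ} (hs : 1 ≤ s) (ht : 1 ≤ t) (hN : N + 1 = s + t)
    (hP : P = p + q) (f f' : Coch k A s p) (g : Coch k A t q) :
    bracketSg hs ht hN hP (f - f') g = bracketSg hs ht hN hP f g - bracketSg hs ht hN hP f' g :=
  LinearMap.map_sub₂ (bracketₗ hs ht hN hP) f f' g

theorem bracketSg_sub_right {s p t q N P : ℕ} (hs : 1 ≤ s) (ht : 1 ≤ t) (hN : N + 1 = s + t)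
    (hP : P = p + q) (f : Coch k A s p) (g g' : Coch k A t q) :
    bracketSg hs ht hN hP f (g - g') = bracketSg hs ht hN hP f g - bracketSg hs ht hN hP f g' :=
  (bracketₗ hs ht hN hP f).map_sub g g'

theorem of_bracketSg_left (F : FrobeniusData k A ι) {s p t q N P : ℕ} (hs : 1 ≤ s) (ht : 1 ≤ t)
    (hN : N + 1 = s + t) (hP : P = p + q) {f : Coch k A (s + 1) (p + 1)} {f₀ : Coch k A s p}
    {g : Coch k A t q} (hf : f ∈ extZ k A (s + 1) (p + 1)) (hf₀ : f₀ ∈ extZ k A s p)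
    (hff : f - phi k A s p f₀ ∈ extB k A (s + 1) (p + 1)) (hg : g ∈ extZ k A t q) {c : ℤ}
    (hc : (N : ℤ) - (P : ℤ) = c) (hc' : ((N + 1 : ℕ) : ℤ) - ((P + 1 : ℕ) : ℤ) = c) :
    TateExt.of k A (N + 1) (P + 1) hc' (Coh.cls _ _ ⟨bracketSg (by omega) ht (by omega) (by omega)
      f g, bracketSg_mem_extZ _ _ _ _ hf hg⟩) =
    TateExt.of k A N P hc (Coh.cls _ _ ⟨bracketSg hs ht hN hP f₀ g,
      bracketSg_mem_extZ _ _ _ _ hf₀ hg⟩) := by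
  rw [← TateExt.of_phi hc hc']
  refine TateExt.of_eq_of_sub_mem hc' _ _ ?_
  rw [← bracketSg_phi hs ht hN hP]
  have h := bracketSg_mem_extB_left F (Nat.le_add_left 1 s) ht (by omega : N + 1 + 1 = s + 1 + t)
    (by omega : P + 1 = p + 1 + q) hff hg
  rwa [bracketSg_sub_left] at h

theorem of_bracketSg_right (F : FrobeniusData k A ι) {s p t q N P : ℕ} (hs : 1 ≤ s) (ht : 1 ≤ t)
    (hN : N + 1 = s + t) (hP : P = p + q) {f : Coch k A s p} {g : Coch k A (t + 1) (q + 1)}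
    {g₀ : Coch k A t q} (hf : f ∈ extZ k A s p) (hg : g ∈ extZ k A (t + 1) (q + 1))
    (hg₀ : g₀ ∈ extZ k A t q) (hgg : g - phi k A t q g₀ ∈ extB k A (t + 1) (q + 1)) {c : ℤ}
    (hc : (N : ℤ) - (P : ℤ) = c) (hc' : ((N + 1 : ℕ) : ℤ) - ((P + 1 : ℕ) : ℤ) = c) :
    TateExt.of k A (N + 1) (P + 1) hc' (Coh.cls _ _ ⟨bracketSg hs (by omega) (by omega) (by omega)
      f g, bracketSg_mem_extZ _ _ _ _ hf hg⟩) =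
    TateExt.of k A N P hc (Coh.cls _ _ ⟨bracketSg hs ht hN hP f g₀,
      bracketSg_mem_extZ _ _ _ _ hf hg₀⟩) := by
  rw [← TateExt.of_phi hc hc']
  refine TateExt.of_eq_of_sub_mem hc' _ _ ?_
  rw [← bracketSg_phi_right hs ht hN hP]
  have h := bracketSg_mem_extB_right F hs (Nat.le_add_left 1 t) (by omega : N + 1 + 1 = s + (t + 1))
    (by omega : P + 1 = p + (q + 1)) hf hgg
  rwa [bracketSg_sub_right] at h

/-- The bilinear map `e` on direct limits is given by `[ , ]_sg` at the levels `(s, p)`, `(t, q)`. -/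
def CompatibleAt {a b c : ℤ} (e : TateExt k A a →ₗ[k] TateExt k A b →ₗ[k] TateExt k A c)
    (s p t q : ℕ) : Prop :=
  ∀ (N P : ℕ) (hs : 1 ≤ s) (ht : 1 ≤ t) (hN : N + 1 = s + t) (hP : P = p + q)
    (ha : (s : ℤ) - (p : ℤ) = a) (hb : (t : ℤ) - (q : ℤ) = b) (hc : (N : ℤ) - (P : ℤ) = c)
    (f : Coch k A s p) (g : Coch k A t q) (hf : f ∈ extZ k A s p) (hg : g ∈ extZ k A t q),
    e (TateExt.of k A s p ha (Coh.cls _ _ ⟨f, hf⟩)) (TateExt.of k A t q hb (Coh.cls _ _ ⟨g, hg⟩)) =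
      TateExt.of k A N P hc (Coh.cls _ _ ⟨bracketSg hs ht hN hP f g,
        bracketSg_mem_extZ _ _ _ _ hf hg⟩)

section Compatible

variable {a b c : ℤ} {e : TateExt k A a →ₗ[k] TateExt k A b →ₗ[k] TateExt k A c} {s p t q : ℕ}

theorem CompatibleAt.succ_left (F : FrobeniusData k A ι) (hs : 1 ≤ s)
    (h : CompatibleAt e s p t q) : CompatibleAt e (s + 1) (p + 1) t q := by
  intro N P _ ht hN hP ha hb hc f g hf hg
  obtain ⟨f₀, hf₀, hff⟩ := F.exists_phi_sub_mem hf
  obtain ⟨N, rfl⟩ : ∃ N', N = N' + 1 := ⟨N - 1, by omega⟩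
  obtain ⟨P, rfl⟩ : ∃ P', P = P' + 1 := ⟨P - 1, by omega⟩
  have ha' : (s : ℤ) - (p : ℤ) = a := by omega
  have hc' : (N : ℤ) - (P : ℤ) = c := by omega
  have hN' : N + 1 = s + t := by omega
  have hP' : P = p + q := by omega
  have e1 := of_bracketSg_left F hs ht hN' hP' hf hf₀ hff hg hc' hc
  have e2 := TateExt.of_eq_of_sub_mem ha hf (phi_mem_extZ hf₀) hff
  have e3 := TateExt.of_phi ha' ha hf₀
  have e4 := h N P hs ht hN' hP' ha' hb hc' f₀ g hf₀ hg
  rw [e2, e3, e4]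
  exact e1.symm

theorem CompatibleAt.succ_right (F : FrobeniusData k A ι) (ht : 1 ≤ t)
    (h : CompatibleAt e s p t q) : CompatibleAt e s p (t + 1) (q + 1) := by
  intro N P hs _ hN hP ha hb hc f g hf hg
  obtain ⟨g₀, hg₀, hgg⟩ := F.exists_phi_sub_mem hg
  obtain ⟨N, rfl⟩ : ∃ N', N = N' + 1 := ⟨N - 1, by omega⟩
  obtain ⟨P, rfl⟩ : ∃ P', P = P' + 1 := ⟨P - 1, by omega⟩
  have hb' : (t : ℤ) - (q : ℤ) = b := by omega
  have hc' : (N : ℤ) - (P : ℤ) = c := by omega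
  have hN' : N + 1 = s + t := by omega
  have hP' : P = p + q := by omega
  have e1 := of_bracketSg_right F hs ht hN' hP' hf hg hg₀ hgg hc' hc
  have e2 := TateExt.of_eq_of_sub_mem hb hg (phi_mem_extZ hg₀) hgg
  have e3 := TateExt.of_phi hb' hb hg₀
  have e4 := h N P hs ht hN' hP' ha hb' hc' f g₀ hf hg₀
  rw [e2, e3, e4]
  exact e1.symm

theorem CompatibleAt.add (F : FrobeniusData k A ι) (hs : 1 ≤ s) (ht : 1 ≤ t)
    (h : CompatibleAt e s p t q) (i j : ℕ) : CompatibleAt e (s + i) (p + i) (t + j) (q + j) := by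
  induction i with
  | zero =>
    induction j with
    | zero => exact h
    | succ j ih => exact ih.succ_right F (Nat.le_add_right_of_le ht)
  | succ i ih => exact ih.succ_left F (Nat.le_add_right_of_le hs)

end Compatible

/-- The bracket on the direct limits. -/
theorem exists_bracketTate (F : FrobeniusData k A ι) {m n : ℕ} (hm : 1 ≤ m) (hn : n + 1 = 0 + (n + 1))
    (brExt : ExtOm k A m 0 →ₗ[k] ExtOm k A 1 (n + 1) →ₗ[k] ExtOm k A m (n + 1))
    (hbr : Induces₂ brExt (bracketSg hm (le_refl 1) (rfl : m + 1 = m + 1) hn)) {c : ℤ} (ha : (m : ℤ) - ((0 : ℕ) : ℤ) = m)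
    (hb : ((1 : ℕ) : ℤ) - ((n + 1 : ℕ) : ℤ) = -n) (hc : (m : ℤ) - ((n + 1 : ℕ) : ℤ) = c) :
    ∃ e : TateExt k A (m : ℤ) →ₗ[k] TateExt k A (-(n : ℤ)) →ₗ[k] TateExt k A c, InducesTate e ∧
      ∀ x y, e (TateExt.of k A m 0 ha x) (TateExt.of k A 1 (n + 1) hb y) =
        TateExt.of k A m (n + 1) hc (brExt x y) := by
  let e : TateExt k A (m : ℤ) →ₗ[k] TateExt k A (-(n : ℤ)) →ₗ[k] TateExt k A c :=
    (brExt.compl₁₂ (limEquiv F hm ha).symm.toLinearMap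
      (limEquiv F le_rfl hb).symm.toLinearMap).compr₂ (TateExt.of k A m (n + 1) hc)
  have he : ∀ x y, e (TateExt.of k A m 0 ha x) (TateExt.of k A 1 (n + 1) hb y) =
      TateExt.of k A m (n + 1) hc (brExt x y) := fun x y => by
    have e1 : (limEquiv F hm ha).symm (TateExt.of k A m 0 ha x) = x :=
      (limEquiv F hm ha).symm_apply_apply x
    have e2 : (limEquiv F le_rfl hb).symm (TateExt.of k A 1 (n + 1) hb y) = y :=
      (limEquiv F le_rfl hb).symm_apply_apply y
    change TateExt.of k A m (n + 1) hc (brExt _ _) = _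
    rw [LinearEquiv.coe_coe, LinearEquiv.coe_coe, e1, e2]
  have h0 : CompatibleAt e m 0 1 (n + 1) := by
    intro N P _ _ hN hP _ _ hc f g hf hg
    obtain rfl : N = m := by omega
    obtain rfl : P = n + 1 := by omega
    rw [he]
    obtain ⟨_, h⟩ := hbr ⟨f, hf⟩ ⟨g, hg⟩
    exact congrArg _ h
  refine ⟨e, ?_, he⟩
  intro s p t q N P hs ht hN hP ha' hb' hc' f g
  refine ⟨bracketSg_mem_extZ hs ht hN hP f.2 g.2, ?_⟩
  have h := h0.add F hm le_rfl p (t - 1)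
  rw [show m + p = s by omega, show 0 + p = p by omega, show 1 + (t - 1) = t by omega,
    show n + 1 + (t - 1) = q by omega] at h
  exact h N P hs ht hN hP ha' hb' hc' f g f.2 g.2

end
end TateHH

namespace TateHH
noncomputable section

namespace BarAlg
variable {k A : Type u} [Field k] [Ring A] [Algebra k A]
variable {V W : Type*} [AddCommGroup V] [Module k V] [AddCommGroup W] [Module k W]

/-- `(x, y) ↦ φ(y g(x))`. -/
def rotForm (φ : BarAlg k A →ₗ[k] V) (g : BarAlg k A →ₗ[k] BarAlg k A) :
    BarAlg k A →ₗ[k] BarAlg k A →ₗ[k] V :=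
  ((LinearMap.mul k (BarAlg k A)).flip ∘ₗ g).compr₂ φ

@[simp] theorem rotForm_apply (φ : BarAlg k A →ₗ[k] V) (g : BarAlg k A →ₗ[k] BarAlg k A)
    (x y : BarAlg k A) : rotForm φ g x y = φ (y * g x) := rfl

theorem eps_prod_barMap (σ : A ≃ₐ[k] A) (l : List (Abar k A)) :
    eps k A * (l.map fun x => letter k A (barMap σ x)).prod =
      mapA (σ : A →ₐ[k] A) (eps k A * (l.map (letter k A)).prod) := by
  induction l with
  | nil => simp
  | cons x l ih =>
    have hx : barMap σ x = proj k A (σ (sec k A x)) := by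
      conv_lhs => rw [← proj_sec k A x]
      rfl
    rw [List.map_cons, List.prod_cons, ← mul_assoc, letter_apply, hx, eps_sec_proj_eps, mul_assoc,
      mul_assoc, ih, List.map_cons, List.prod_cons, letter_apply]
    simp [mul_assoc]

theorem tau_map_barMap (σ : A ≃ₐ[k] A) {n : ℕ} (t : TPow k A n) :
    eps k A * tau k A n (PiTensorProduct.map (fun _ => barMap σ) t) =
      mapA (σ : A →ₐ[k] A) (eps k A * tau k A n t) := by
  induction t using tpow_induction with
  | h x =>
    rw [PiTensorProduct.map_tprod, tau_tprod, tau_tprod]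
    have := eps_prod_barMap σ (List.ofFn x)
    simpa only [List.map_ofFn, Function.comp_def] using this
  | hadd s t hs ht => simp only [map_add, mul_add, hs, ht]
  | hsmul c t ht => simp only [map_smul, mul_smul_comm, ht]

theorem eps_tau_rot (σ : A ≃ₐ[k] A) {M p : ℕ} (hM : M = p + 1) (j : Fin (p + 1)) (a : A)
    (x : Fin p → Abar k A) :
    eps k A * tau k A M (rot σ hM j (a ⊗ₜ PiTensorProduct.tprod k x)) =
      eps k A * (((List.ofFn x).drop j).map (letter k A)).prod *
        (of k a * mapA (σ : A →ₐ[k] A) (eps k A * (((List.ofFn x).take j).map (letter k A)).prod)) := by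
  have e : rot σ hM j (a ⊗ₜ PiTensorProduct.tprod k x) =
      (cut k A (by omega : M = (p - j) + (1 + j))).symm
        (TensorProduct.comm k (TPow k A (1 + j)) (TPow k A (p - j))
          ((cut k A (rfl : 1 + (j : ℕ) = 1 + j)).symm.toLinearMap.rTensor (TPow k A (p - j))
            ((TensorProduct.assoc k (TPow k A 1) (TPow k A j) (TPow k A (p - j))).symm
              (projT k A a ⊗ₜ ((PiTensorProduct.map (fun _ => barMap σ) :
                TPow k A j →ₗ[k] TPow k A j).rTensor (TPow k A (p - j))
                (cut k A (by omega : p = j + (p - j)) (PiTensorProduct.tprod k x))))))) := rfl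
  rw [e, cut_tprod, LinearMap.rTensor_tmul, TensorProduct.assoc_symm_tmul, LinearMap.rTensor_tmul,
    TensorProduct.comm_tmul, tau_cut_symm, LinearEquiv.coe_coe, tau_cut_symm, tau_projT]
  rw [tau_eq_take x (fun i => x _) (j : ℕ) (by omega) (fun i => by
    congr 1; ext; simp [Nat.add_comm])]
  have h1 : ((List.ofFn x).drop (j : ℕ)).take (p - j) = (List.ofFn x).drop (j : ℕ) :=
    List.take_of_length_le (by simp)
  rw [h1]
  obtain ⟨y, -, hy⟩ := eps_prod_eq ((List.ofFn x).drop (j : ℕ))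
  have h2 : ∀ v, eps k A * (of k (sec k A (proj k A a)) * (eps k A * v)) =
      eps k A * (of k a * (eps k A * v)) := fun v => by
    have := congrArg (· * v) (eps_sec_proj_eps (k := k) a)
    simpa only [mul_assoc] using this
  rw [← mul_assoc, hy, mul_assoc, mul_assoc, mul_assoc, h2, tau_map_barMap,
    tau_eq_take x (fun i => x _) 0 (by omega) (fun i => by congr 1), List.drop_zero]

/-- `τ` is a trace, for the multiplication twisted by `σ`. -/
def IsTr (σ : A ≃ₐ[k] A) (τ : BarAlg k A →ₗ[k] V) : Prop :=
  ∀ y b, τ (y * of k b) = τ (of k (σ b) * y)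

theorem IsTr.of_mul {σ : A ≃ₐ[k] A} {τ : BarAlg k A →ₗ[k] V} (h : IsTr σ τ) (y : BarAlg k A)
    (b : A) : τ (of k b * y) = τ (y * of k (σ.symm b)) := by
  rw [h]; simp

/-- Traces are determined by the values at the elements `a ε τ(t)`. -/
theorem IsTr.eqOn {σ : A ≃ₐ[k] A} {τ τ' : BarAlg k A →ₗ[k] V} (h : IsTr σ τ)
    (h' : IsTr σ τ') {n : ℕ}
    (H : ∀ (a : A) (t : TPow k A n), τ (of k a * (eps k A * tau k A n t)) =
      τ' (of k a * (eps k A * tau k A n t))) {x : BarAlg k A} (hx : x ∈ deg k A (n + 1)) :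
    τ x = τ' x := by
  refine LinearMap.mem_eqLocus.1 (deg_eq_eps_tau (U := LinearMap.eqLocus τ τ') (fun a t b => ?_) hx)
  rw [LinearMap.mem_eqLocus, h, h', ← mul_assoc, ← map_mul, H]

/-- The element `a` of `A`, for `x = a` in degree zero. -/
def toA : BarAlg k A →ₗ[k] A := (bz k A).symm.toLinearMap ∘ₗ pr k A 0

@[simp] theorem toA_of (a : A) : toA (of k a) = a := by
  rw [← J_zero, toA, LinearMap.comp_apply, pr_J]
  exact (bz k A).symm_apply_apply a

end BarAlg

namespace FrobeniusData
open BarAlg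
variable {k A ι : Type u} [Field k] [Ring A] [Algebra k A] [DecidableEq ι]
  (F : FrobeniusData k A ι)
variable {V : Type*} [AddCommGroup V] [Module k V]

/-- The automorphism of the algebra induced by `ν`. -/
def nuE : BarAlg k A →ₐ[k] BarAlg k A := mapA (F.nu : A →ₐ[k] A)

/-- The automorphism of the algebra induced by `ν⁻¹`. -/
def alE : BarAlg k A →ₐ[k] BarAlg k A := mapA (F.nu.symm : A →ₐ[k] A)

@[simp] theorem nuE_of (a : A) : F.nuE (of k a) = of k (F.nu a) := mapA_of _ _
@[simp] theorem alE_of (a : A) : F.alE (of k a) = of k (F.nu.symm a) := mapA_of _ _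
@[simp] theorem nuE_eps : F.nuE (eps k A) = eps k A := mapA_eps _
@[simp] theorem alE_eps : F.alE (eps k A) = eps k A := mapA_eps _

@[simp] theorem nuE_alE (x : BarAlg k A) : F.nuE (F.alE x) = x := by
  have : (F.nuE).comp F.alE = AlgHom.id k _ := algHom_ext (by simp) (by simp)
  exact AlgHom.congr_fun this x

@[simp] theorem alE_nuE (x : BarAlg k A) : F.alE (F.nuE x) = x := by
  have : (F.alE).comp F.nuE = AlgHom.id k _ := algHom_ext (by simp) (by simp)
  exact AlgHom.congr_fun this x

theorem d_nuE (x : BarAlg k A) : d (F.nuE x) = F.nuE (d x) := d_mapA _ x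
theorem d_alE (x : BarAlg k A) : d (F.alE x) = F.alE (d x) := d_mapA _ x
theorem nuE_sg (c : k) (x : BarAlg k A) : F.nuE (sg c x) = sg c (F.nuE x) := mapA_sg _ c x
theorem nuE_mem {n : ℕ} {x : BarAlg k A} (hx : x ∈ deg k A n) : F.nuE x ∈ deg k A n := mapA_mem _ hx
theorem alE_mem {n : ℕ} {x : BarAlg k A} (hx : x ∈ deg k A n) : F.alE x ∈ deg k A n := mapA_mem _ hx

/-- The functional `x ↦ ⟨G(x), 1⟩`. -/
def tr (G : BarAlg k A →ₗ[k] BarAlg k A) : BarAlg k A →ₗ[k] k := F.lam ∘ₗ toA ∘ₗ G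

theorem tr_apply (G : BarAlg k A →ₗ[k] BarAlg k A) (x : BarAlg k A) :
    F.tr G x = F.lam (toA (G x)) := rfl

theorem tr_of_eq {G : BarAlg k A →ₗ[k] BarAlg k A} {x : BarAlg k A} {a : A} (h : G x = of k a) :
    F.tr G x = F.lam a := by rw [tr_apply, h, toA_of]

theorem isTr_tr {s : ℕ} {G : BarAlg k A →ₗ[k] BarAlg k A} (hG : IsC s 0 G) :
    IsTr F.nu.symm (F.tr G) := by
  intro y b
  obtain ⟨a, ha⟩ := hG.mem' y
  have ha' : G y = of k a := ha.symm
  rw [F.tr_of_eq (a := a * b), F.tr_of_eq (a := F.nu.symm b * a)]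
  · rw [F.lam_mul (F.nu.symm b)]; simp
  · rw [hG.of_mul, ha', map_mul]
  · rw [hG.mul_of, ha', map_mul]

theorem tr_supp {s n : ℕ} {G : BarAlg k A →ₗ[k] BarAlg k A} (hG : IsC s 0 G) {x : BarAlg k A}
    (hx : x ∈ deg k A n) (h : n ≠ s + 1) : F.tr G x = 0 := by
  rw [tr_apply, hG.supp n x hx h, map_zero, map_zero]

variable [Fintype ι]

theorem isTr_cas : IsTr F.nu F.cas := fun y b => F.cas_mul_of b y

theorem sum_lam_u_mul_nu (a : A) : ∑ i, F.lam (F.u i * a) • F.nu (F.v i) = a := by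
  have : ∀ i, F.lam (F.u i * a) = F.lam (F.nu.symm a * F.u i) := fun i => by
    rw [F.lam_mul (F.nu.symm a)]; simp
  simp only [this, ← map_smul, ← map_sum, sum_lam_mul_u]
  simp

theorem _root_.TateHH.BarAlg.IsTr.first_cas {F : FrobeniusData k A ι} {τ : BarAlg k A →ₗ[k] V} (h : IsTr F.nu τ)
    (h0 : ∀ a, τ (of k a) = 0) (y : BarAlg k A) : τ (first F.lam (F.cas y)) = τ y := by
  induction y using word_induction with
  | hof a =>
    have h1 : τ 1 = 0 := by simpa using h0 1
    simp only [cas_apply, map_sum, ← map_mul, first_of, map_smul, h1, smul_zero, h0,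
      Finset.sum_const_zero]
  | hadd x y hx hy => simp only [map_add, hx, hy]
  | hword a x _ =>
    simp only [cas_apply, map_sum]
    have : ∀ i, τ (first F.lam (of k (F.u i) * (of k a * (eps k A * x)) * of k (F.v i))) =
        τ (of k (F.lam (F.u i * a) • F.nu (F.v i)) * (eps k A * x)) := fun i => by
      have e : of k (F.u i) * (of k a * (eps k A * x)) * of k (F.v i) =
          of k (F.u i * a) * (eps k A * (x * of k (F.v i))) := by
        simp only [map_mul, mul_assoc]
      rw [e, first_word, ← mul_assoc (eps k A), map_smul, h, map_smul, smul_mul_assoc, map_smul]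
    simp only [this]
    rw [← map_sum, ← Finset.sum_mul, ← map_sum, sum_lam_u_mul_nu]

/-- Traces only depend on the image under `cas`. -/
theorem _root_.TateHH.BarAlg.IsTr.eq_zero {F : FrobeniusData k A ι} {τ : BarAlg k A →ₗ[k] V} (h : IsTr F.nu τ)
    (h0 : ∀ a, τ (of k a) = 0) {y : BarAlg k A} (hy : F.cas y = 0) : τ y = 0 := by
  rw [← h.first_cas h0, hy, map_zero, map_zero]

theorem sum_tr_mul_u {s : ℕ} {G : BarAlg k A →ₗ[k] BarAlg k A} (hG : IsC s 0 G) (x : BarAlg k A) :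
    ∑ l, F.tr G (x * of k (F.u l)) • of k (F.v l) = G x := by
  obtain ⟨a, ha⟩ := hG.mem' x
  have ha' : G x = of k a := ha.symm
  have : ∀ l, F.tr G (x * of k (F.u l)) = F.lam (a * F.u l) := fun l =>
    F.tr_of_eq (by rw [hG.mul_of, ha', map_mul])
  simp only [this, ← map_smul, ← map_sum, sum_lam_mul_u, ha']

theorem sum_tr_v_mul {s : ℕ} {G : BarAlg k A →ₗ[k] BarAlg k A} (hG : IsC s 0 G) (x : BarAlg k A) :
    ∑ l, F.tr G (of k (F.v l) * x) • of k (F.u l) = G x := by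
  obtain ⟨a, ha⟩ := hG.mem' x
  have ha' : G x = of k a := ha.symm
  have : ∀ l, F.tr G (of k (F.v l) * x) = F.lam (F.v l * a) := fun l =>
    F.tr_of_eq (by rw [hG.of_mul, ha', map_mul])
  simp only [this, ← map_smul, ← map_sum, sum_lam_v_mul, ha']

theorem eq_of_tr {s t : ℕ} {G H : BarAlg k A →ₗ[k] BarAlg k A} (hG : IsC s 0 G) (hH : IsC t 0 H)
    (h : ∀ x, F.tr G x = F.tr H x) : G = H := by
  ext x
  rw [← F.sum_tr_mul_u hG, ← F.sum_tr_mul_u hH]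
  simp only [h]

/-! ### The operations on (co)chains in terms of the algebra -/

theorem ext_star {m p N : ℕ} (h : m = N + (p + 1)) (f : Coch k A m 0) (z : LBar k A p)
    (t : TPow k A N) :
    ext (F.star h f z) (eps k A * tau k A N t) = ext f (eps k A * tau k A N t * F.nm p z) := by
  induction z using lbar_induction with
  | hadd y z hy hz =>
    have : F.star h f (y + z) = F.star h f y + F.star h f z := by
      have e : ∀ z t, (show A from F.star h f z t) = ∑ i, (LinearMap.mulRight k (F.v i) ∘ₗ
          (f : TPow k A m →ₗ[k] A)) ((cut k A h).symm (t ⊗ₜ ((cut k A (Nat.add_comm p 1)).symm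
            ((projT k A ∘ₗ LinearMap.mulLeft k (F.u i) ∘ₗ F.nu.toLinearMap).rTensor
              (TPow k A p) z)))) := fun z t => by
        simp only [star, LinearMap.sum_apply]
        rfl
      refine LinearMap.ext fun t => (e _ _).trans ?_
      simp only [map_add, TensorProduct.tmul_add, Finset.sum_add_distrib]
      exact (congrArg₂ (· + ·) (e y t) (e z t)).symm
    rw [this, map_add, LinearMap.add_apply, hy, hz, map_add, mul_add, map_add]
  | h a s =>
    have e : (show A from F.star h f (a ⊗ₜ s) t) = ∑ i, (show A from f ((cut k A h).symm (t ⊗ₜ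
        ((cut k A (Nat.add_comm p 1)).symm (projT k A (F.u i * F.nu a) ⊗ₜ s))))) * F.v i := by
      simp only [star, LinearMap.sum_apply]
      rfl
    have e2 : ext (F.star h f (a ⊗ₜ s)) (eps k A * tau k A N t) =
        of k (show A from F.star h f (a ⊗ₜ s) t) := ext_tau _ _
    obtain ⟨y, -, hy⟩ := eps_tau_eq t
    have e3 : ∀ i, of k (show A from f ((cut k A h).symm (t ⊗ₜ
        ((cut k A (Nat.add_comm p 1)).symm (projT k A (F.u i * F.nu a) ⊗ₜ s))))) =
        ext f (eps k A * tau k A N t * (of k (F.u i * F.nu a) * (eps k A * tau k A p s))) :=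
        fun i => by
      have := ext_tau f ((cut k A h).symm (t ⊗ₜ
        ((cut k A (Nat.add_comm p 1)).symm (projT k A (F.u i * F.nu a) ⊗ₜ s))))
      refine this.symm.trans ?_
      rw [tau_cut_symm, tau_cut_symm, ← mul_assoc, hy, mul_assoc, ← mul_assoc (eps k A),
        eps_tau_projT, mul_assoc, mul_assoc, mul_assoc]
    rw [e2, e, map_sum, nm_apply, chainEl_tmul, cas_mul_of, cas_apply, Finset.mul_sum, map_sum]
    refine Finset.sum_congr rfl fun i _ => ?_
    rw [map_mul (of k), e3, ← (ext_isC f).mul_of, map_mul (of k)]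
    simp only [mul_assoc]

theorem nm_connes {M p : ℕ} (hM : M = p + 1) (z : LBar k A p) :
    F.nm M (connes F.nu.symm hM z) =
      cutSum (rotForm F.cas (F.alE.toLinearMap ∘ₗ (sg ((-1) ^ p)).toLinearMap))
        (chainEl k A p z) := by
  induction z using lbar_induction with
  | hadd y z hy hz => simp only [map_add, hy, hz]
  | h a t =>
    induction t using tpow_induction with
    | hadd s t hs ht => simp only [TensorProduct.tmul_add, map_add, hs, ht]
    | hsmul c t ht => simp only [TensorProduct.tmul_smul, map_smul, ht]
    | h x =>
      have e1 : ∀ j : Fin (p + 1), F.nm M (oneL k A M (rot F.nu.symm hM j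
          (a ⊗ₜ PiTensorProduct.tprod k x))) = F.cas (eps k A * tau k A M (rot F.nu.symm hM j
          (a ⊗ₜ PiTensorProduct.tprod k x))) := fun j => by
        rw [nm_apply]
        refine congrArg F.cas ((chainEl_tmul _ _).trans ?_)
        rw [map_one, mul_one]
      rw [chainEl_tmul, cutSum_mul_of, tau_tprod_map]
      have e2 := cutSum_tau ((rotForm F.cas (F.alE.toLinearMap ∘ₗ
        (sg ((-1) ^ p)).toLinearMap)).compl₂ (LinearMap.mulRight k (of k a))) 1 (List.ofFn x)
      rw [map_one, one_mul] at e2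
      rw [e2, List.length_ofFn, Finset.sum_range]
      simp only [connes, LinearMap.sum_apply, map_sum, LinearMap.smul_apply, map_smul,
        LinearMap.comp_apply, e1, eps_tau_rot, one_mul]
      refine Finset.sum_congr rfl fun j _ => ?_
      rw [LinearMap.compl₂_apply, rotForm_apply, LinearMap.comp_apply, LinearMap.mulRight_apply,
        AlgHom.toLinearMap_apply, AlgHom.toLinearMap_apply]
      obtain ⟨y, hy, hy'⟩ := eps_prod_eq ((List.ofFn x).take j)
      rw [hy', sg_deg (n := j + 1), map_smul, mul_smul_comm, map_smul, ← pow_mul, Nat.mul_comm,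
        ← mul_assoc]
      · rfl
      · have := mul_eps_mem hy
        rwa [List.length_take, List.length_ofFn, min_eq_left (by omega)] at this

end FrobeniusData

end
end TateHH

namespace TateHH
noncomputable section

namespace BarAlg
variable {k A : Type u} [Field k] [Ring A] [Algebra k A]
variable {V W : Type*} [AddCommGroup V] [Module k V] [AddCommGroup W] [Module k W]

theorem isTr_cutSum_rotForm {σ : A ≃ₐ[k] A} (φ : BarAlg k A →ₗ[k] V)
    {g : BarAlg k A →ₗ[k] BarAlg k A} (hg : ∀ b x, g (of k (σ b) * x) = of k b * g x) :
    IsTr σ (cutSum (rotForm φ g)) := by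
  intro y b
  rw [cutSum_of_mul, cutSum_mul_of]
  refine cutSum_ext (fun y z => ?_) _
  simp [hg, mul_assoc]

theorem balanced_rotForm {σ : A ≃ₐ[k] A} {φ : BarAlg k A →ₗ[k] V} (hφ : IsTr σ φ)
    {g : BarAlg k A →ₗ[k] BarAlg k A} (hg : ∀ b x, g (x * of k (σ b)) = g x * of k b) :
    Balanced (rotForm φ g) := by
  intro x a y
  obtain ⟨b, rfl⟩ := σ.surjective a
  rw [rotForm_apply, rotForm_apply, hg, ← mul_assoc, hφ, mul_assoc]

/-- The sum over the pairs of cuts. -/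
def cutSum₃ (T : BarAlg k A →ₗ[k] BarAlg k A →ₗ[k] BarAlg k A →ₗ[k] V) : BarAlg k A →ₗ[k] V :=
  cutSum (cutSumₗ ∘ₗ T)

/-- A trilinear map. -/
def mk₃ (f : BarAlg k A → BarAlg k A → BarAlg k A → V)
    (h1 : ∀ x x' y z, f (x + x') y z = f x y z + f x' y z)
    (h1' : ∀ (c : k) x y z, f (c • x) y z = c • f x y z)
    (h2 : ∀ x y y' z, f x (y + y') z = f x y z + f x y' z)
    (h2' : ∀ (c : k) x y z, f x (c • y) z = c • f x y z)
    (h3 : ∀ x y z z', f x y (z + z') = f x y z + f x y z')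
    (h3' : ∀ (c : k) x y z, f x y (c • z) = c • f x y z) :
    BarAlg k A →ₗ[k] BarAlg k A →ₗ[k] BarAlg k A →ₗ[k] V :=
  LinearMap.mk₂ k (fun x y => { toFun := f x y, map_add' := h3 x y, map_smul' := fun c => h3' c x y })
    (fun x x' y => LinearMap.ext (h1 x x' y)) (fun c x y => LinearMap.ext (h1' c x y))
    (fun x y y' => LinearMap.ext (h2 x y y')) (fun c x y => LinearMap.ext (h2' c x y))

@[simp] theorem mk₃_apply (f : BarAlg k A → BarAlg k A → BarAlg k A → V) (h1 h1' h2 h2' h3 h3')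
    (x y z : BarAlg k A) : mk₃ (k := k) f h1 h1' h2 h2' h3 h3' x y z = f x y z := rfl

theorem cutSum_congr' {n : ℕ} {x : BarAlg k A} (hx : x ∈ deg k A n)
    {T T' : BarAlg k A →ₗ[k] BarAlg k A →ₗ[k] V}
    (h : ∀ (a b : ℕ) (y w : BarAlg k A), a + b = n + 1 → 1 ≤ a → 1 ≤ b → y ∈ deg k A a →
      w ∈ deg k A b → T y w = T' y w) : cutSum T x = cutSum T' x :=
  cutSum_congr hx fun a b _ _ hab hy hw => h (a + 1) (b + 1) _ _ (by omega) (by omega) (by omega)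
    (mul_eps_mem hy) (eps_mul_mem hw)

theorem cutSum₃_congr {n : ℕ} {x : BarAlg k A} (hx : x ∈ deg k A n)
    {T T' : BarAlg k A →ₗ[k] BarAlg k A →ₗ[k] BarAlg k A →ₗ[k] V}
    (h : ∀ (a b c : ℕ) (y w v : BarAlg k A), a + b + c = n + 2 → 1 ≤ a → 1 ≤ b → 1 ≤ c →
      y ∈ deg k A a → w ∈ deg k A b → v ∈ deg k A c → T y w v = T' y w v) :
    cutSum₃ T x = cutSum₃ T' x :=
  cutSum_congr' hx fun a b _ _ hab h1 _ hy hw => cutSum_congr' hw fun a' b' _ _ hab' h1' h2' hy' hw' =>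
    h a a' b' _ _ _ (by omega) h1 h1' h2' hy hy' hw'

theorem cutSum₃_of_mul (T : BarAlg k A →ₗ[k] BarAlg k A →ₗ[k] BarAlg k A →ₗ[k] V) (a : A)
    (x : BarAlg k A) : cutSum₃ T (of k a * x) = cutSum₃ (T ∘ₗ LinearMap.mulLeft k (of k a)) x :=
  cutSum_of_mul _ a x

@[simp] theorem cutSum₃_of (T : BarAlg k A →ₗ[k] BarAlg k A →ₗ[k] BarAlg k A →ₗ[k] V) (a : A) :
    cutSum₃ T (of k a) = 0 := by simp [cutSum₃]

/-- The compatibility of pairs of cuts with the differential. -/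
theorem cutSum₃_d (T T' : BarAlg k A →ₗ[k] BarAlg k A →ₗ[k] BarAlg k A →ₗ[k] V)
    (P Q : BarAlg k A →ₗ[k] BarAlg k A →ₗ[k] V)
    (h1 : ∀ x a y z, T (x * of k a) y z = T x (of k a * y) z) (h2 : ∀ x, Balanced (T x))
    (hT' : ∀ x y z, T' x y z =
      T (d x) y z - T (sg (-1) x) (d y) z + T (sg (-1) x) (sg (-1) y) (d z))
    (hP : ∀ x y, P x y = T (sg (-1) x) (sg (-1) y) 1) (hQ : ∀ x y, Q x y = T (sg (-1) x) 1 y)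
    (x : BarAlg k A) :
    cutSum₃ T' x = cutSum₃ T (d x) + cutSum (T 1) x + cutSum P x - cutSum Q x := by
  have hb : Balanced (cutSumₗ ∘ₗ T) := fun y a w => by
    simp only [LinearMap.comp_apply, cutSumₗ_apply, cutSum_of_mul]
    exact cutSum_ext (fun u v => h1 _ _ _ _) w
  have e := cutSum_d _ hb x
  have hone : ∀ S : BarAlg k A →ₗ[k] BarAlg k A →ₗ[k] V, cutSum S 1 = 0 := fun S => by
    rw [← map_one (of k)]; simp
  have e1 : cutSum₃ T' x = cutSum ((cutSumₗ ∘ₗ T) ∘ₗ d) x -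
      (cutSum ((cutSumₗ ∘ₗ T).compl₁₂ (sg (-1)).toLinearMap d) x + cutSum Q x - cutSum P x) := by
    rw [← cutSum_add, ← cutSum_sub, ← cutSum_sub]
    refine cutSum_ext (fun y w => ?_) x
    simp only [LinearMap.comp_apply, cutSumₗ_apply, LinearMap.sub_apply, LinearMap.add_apply,
      LinearMap.compl₁₂_apply, AlgHom.toLinearMap_apply, hQ, hP]
    have e2 := cutSum_d _ (h2 (sg (-1) y)) w
    have e3 : cutSum (T' y) w = cutSum (T (d y)) w - (cutSum (T (sg (-1) y) ∘ₗ d) w -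
        cutSum ((T (sg (-1) y)).compl₁₂ (sg (-1)).toLinearMap d) w) := by
      rw [← cutSum_sub, ← cutSum_sub]
      refine cutSum_ext (fun u v => ?_) w
      simp only [LinearMap.comp_apply, LinearMap.sub_apply, LinearMap.compl₁₂_apply,
        AlgHom.toLinearMap_apply, hT']
      abel
    rw [e3, e2]
  rw [e1]
  simp only [LinearMap.comp_apply, cutSumₗ_apply, hone, sub_zero] at e
  simp only [cutSum₃] at e ⊢
  linear_combination (norm := module) e

end BarAlg

namespace FrobeniusData
open BarAlg
variable {k A ι : Type u} [Field k] [Ring A] [Algebra k A] [DecidableEq ι]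
  (F : FrobeniusData k A ι)
variable {V : Type*} [AddCommGroup V] [Module k V]

/-- `x ↦ ν(σ(x))` for the sign automorphism `σ`, `ε ↦ c ε`. -/
def nuSg (c : k) : BarAlg k A →ₗ[k] BarAlg k A := F.nuE.toLinearMap ∘ₗ (sg c).toLinearMap

/-- `x ↦ ν⁻¹(σ(x))` for the sign automorphism `σ`, `ε ↦ c ε`. -/
def alSg (c : k) : BarAlg k A →ₗ[k] BarAlg k A := F.alE.toLinearMap ∘ₗ (sg c).toLinearMap

theorem nuSg_apply (c : k) (x : BarAlg k A) : F.nuSg c x = F.nuE (sg c x) := rfl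
theorem alSg_apply (c : k) (x : BarAlg k A) : F.alSg c x = F.alE (sg c x) := rfl

theorem nuSg_deg (c : k) {n : ℕ} {x : BarAlg k A} (hx : x ∈ deg k A n) :
    F.nuSg c x = c ^ n • F.nuE x := by rw [nuSg_apply, sg_deg c hx, map_smul]
theorem alSg_deg (c : k) {n : ℕ} {x : BarAlg k A} (hx : x ∈ deg k A n) :
    F.alSg c x = c ^ n • F.alE x := by rw [alSg_apply, sg_deg c hx, map_smul]

theorem isTr_cutSum_nu (φ : BarAlg k A →ₗ[k] V) (c : k) :
    IsTr F.nu.symm (cutSum (rotForm φ (F.nuSg c))) :=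
  isTr_cutSum_rotForm φ fun b x => by simp [nuSg_apply]

theorem isTr_cutSum_al (φ : BarAlg k A →ₗ[k] V) (c : k) :
    IsTr F.nu (cutSum (rotForm φ (F.alSg c))) :=
  isTr_cutSum_rotForm φ fun b x => by simp [alSg_apply]

theorem balanced_nu {φ : BarAlg k A →ₗ[k] V} (hφ : IsTr F.nu.symm φ) (c : k) :
    Balanced (rotForm φ (F.nuSg c)) :=
  balanced_rotForm hφ fun b x => by simp [nuSg_apply]

theorem balanced_al {φ : BarAlg k A →ₗ[k] V} (hφ : IsTr F.nu φ) (c : k) :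
    Balanced (rotForm φ (F.alSg c)) :=
  balanced_rotForm hφ fun b x => by simp [alSg_apply]

variable [Fintype ι]

theorem tr_Delta {M r : ℕ} (hM : M = r + 1) (f : Coch k A M 0) (x : BarAlg k A) :
    F.tr (ext (F.Delta hM f)) x = cutSum (rotForm (F.tr (ext f)) (F.nuSg ((-1) ^ r))) x := by
  refine LinearMap.congr_fun (ext_deg (f := F.tr (ext (F.Delta hM f))) fun n x hx => ?_) x
  by_cases hn : n = r + 1
  · subst hn
    refine (F.isTr_tr (ext_isC _)).eqOn (F.isTr_cutSum_nu _ _) (fun a t => ?_) hx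
    induction t using tpow_induction with
    | hadd s t hs ht => simp only [map_add, mul_add, hs, ht]
    | hsmul c t ht => simp only [map_smul, mul_smul_comm, ht]
    | h y =>
      let G : A →ₗ[k] k := ∑ j : Fin (r + 1), (-1 : k) ^ (((j : ℕ) + 1) * r) •
        (F.lam ∘ₗ (f : TPow k A M →ₗ[k] A) ∘ₗ rot F.nu hM j ∘ₗ
          (TensorProduct.mk k A (TPow k A r)).flip (PiTensorProduct.tprod k y))
      have e1 : (show A from F.Delta hM f (PiTensorProduct.tprod k y)) =
          ∑ l, G (F.u l) • F.v l := by
        simp only [Delta, LinearMap.sum_apply]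
        refine Finset.sum_congr rfl fun l _ => ?_
        change (_ : k) • (_ : A) = _
        congr 1
        simp only [G, LinearMap.sum_apply]
        rfl
      have e2 : F.tr (ext (F.Delta hM f)) (of k a * (eps k A * tau k A r
          (PiTensorProduct.tprod k y))) = G (F.nu a) := by
        rw [F.tr_of_eq (a := a * ∑ l, G (F.u l) • F.v l)]
        · rw [Finset.mul_sum, map_sum]
          conv_rhs => rw [← F.sum_lam_v_mul (F.nu a)]
          rw [map_sum]
          refine Finset.sum_congr rfl fun l _ => ?_
          rw [mul_smul_comm, map_smul, map_smul, smul_eq_mul, smul_eq_mul, mul_comm, F.lam_mul]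
        · rw [(ext_isC _).of_mul, ext_tau, map_mul]
          congr 1
          rw [← e1]
          exact J_zero _
      rw [e2, tau_tprod_map, cutSum_tau, List.length_ofFn, Finset.sum_range]
      simp only [G, LinearMap.sum_apply]
      refine Finset.sum_congr rfl fun j _ => ?_
      have e3 : F.lam (show A from f (rot F.nu hM j (F.nu a ⊗ₜ PiTensorProduct.tprod k y))) =
          F.tr (ext f) (eps k A * tau k A M (rot F.nu hM j (F.nu a ⊗ₜ PiTensorProduct.tprod k y))) :=
        (F.tr_of_eq (ext_tau f _)).symm
      refine (congrArg (fun y : k => (-1 : k) ^ (((j : ℕ) + 1) * r) * y) e3).trans ?_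
      obtain ⟨w, hw, hw'⟩ := eps_prod_eq ((List.ofFn y).take j)
      rw [rotForm_apply, F.nuSg_deg (n := j + 1), eps_tau_rot, mul_smul_comm, map_smul, ← pow_mul,
        Nat.mul_comm, map_mul F.nuE, nuE_of]
      · rfl
      · rw [hw']
        have := of_mul_mem a (mul_eps_mem hw)
        rwa [List.length_take, List.length_ofFn, min_eq_left (by omega)] at this
  · rw [F.tr_supp (ext_isC _) hx hn]
    symm
    rw [← cutSum_zero x]
    refine cutSum_congr' hx fun a b y w hab _ _ hy hw => ?_
    rw [rotForm_apply, F.nuSg_deg _ hy, mul_smul_comm, map_smul,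
      F.tr_supp (ext_isC f) (mul_mem hw (F.nuE_mem hy)) (by omega), smul_zero]
    rfl

end FrobeniusData

end
end TateHH

namespace TateHH
noncomputable section

namespace FrobeniusData
open BarAlg
variable {k A ι : Type u} [Field k] [Ring A] [Algebra k A] [DecidableEq ι]
  (F : FrobeniusData k A ι)
variable {V : Type*} [AddCommGroup V] [Module k V]

/-! ### The action of the Nakayama automorphism on (co)chains -/

/-- `f ↦ ν⁻¹ ∘ f ∘ ν^{⊗r}`. -/
def posT (r : ℕ) : Coch k A r 0 →ₗ[k] Coch k A r 0 where
  toFun f := F.nu.symm.toLinearMap ∘ₗ (f : TPow k A r →ₗ[k] A) ∘ₗ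
    PiTensorProduct.map fun _ => barMap F.nu
  map_add' _ _ := LinearMap.ext fun _ => map_add F.nu.symm _ _
  map_smul' c _ := LinearMap.ext fun _ => map_smul F.nu.symm c _

theorem posT_apply {r : ℕ} (f : Coch k A r 0) (t : TPow k A r) :
    F.posT r f t = F.nu.symm (show A from f (PiTensorProduct.map (fun _ => barMap F.nu) t)) := rfl

theorem ext_posT {r : ℕ} (f : Coch k A r 0) (x : BarAlg k A) :
    ext (F.posT r f) x = F.alE (ext f (F.nuE x)) := by
  have h : IsC r 0 (F.alE.toLinearMap ∘ₗ ext f ∘ₗ F.nuE.toLinearMap) :=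
    { of_mul := fun a x => by simp [(ext_isC f).of_mul]
      mul_of := fun x a => by simp [(ext_isC f).mul_of]
      supp := fun n x hx hn => by
        simp only [LinearMap.comp_apply, AlgHom.toLinearMap_apply]
        rw [(ext_isC f).supp n _ (F.nuE_mem hx) hn, map_zero]
      mem := fun x hx => F.alE_mem ((ext_isC f).mem _ (F.nuE_mem hx)) }
  refine LinearMap.congr_fun ((ext_isC _).ext h fun t => ?_) x
  simp only [LinearMap.comp_apply, AlgHom.toLinearMap_apply]
  have e : F.nuE (eps k A * tau k A r t) =
    eps k A * tau k A r (PiTensorProduct.map (fun _ => barMap F.nu) t) := (tau_map_barMap _ t).symm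
  rw [e, ext_tau, ext_tau]
  obtain ⟨a, ha⟩ := (bz k A).surjective (f (PiTensorProduct.map (fun _ => barMap F.nu) t))
  have e1 : F.posT r f t = bz k A (F.nu.symm a) := by
    refine (F.posT_apply f t).trans ?_
    rw [← ha]; rfl
  rw [← ha, e1, J_zero, J_zero, alE_of]

theorem tr_posT {r : ℕ} (f : Coch k A r 0) (x : BarAlg k A) :
    F.tr (ext (F.posT r f)) x = F.tr (ext f) (F.nuE x) := by
  obtain ⟨a, ha⟩ := (ext_isC f).mem' (F.nuE x)
  have ha' : ext f (F.nuE x) = of k a := ha.symm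
  rw [F.tr_of_eq ha', F.tr_of_eq (a := F.nu.symm a), ← F.lam_nu]
  · simp
  · rw [ext_posT, ha', alE_of]

theorem tr_d {r : ℕ} {f : Coch k A r 0} (hf : ext f ∘ₗ d = 0) (x : BarAlg k A) :
    F.tr (ext f) (d x) = 0 := by
  have : ext f (d x) = 0 := LinearMap.congr_fun hf x
  rw [tr_apply, this, map_zero, map_zero]

variable [Fintype ι]

theorem sum_nu (T : A →ₗ[k] A →ₗ[k] V) :
    ∑ i, T (F.nu (F.u i)) (F.nu (F.v i)) = ∑ i, T (F.u i) (F.v i) := by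
  have h1 : ∀ i, T (F.nu (F.u i)) (F.nu (F.v i)) =
      ∑ j, F.lam (F.v j * F.nu (F.u i)) • T (F.u j) (F.nu (F.v i)) := fun i => by
    conv_lhs => rw [← F.sum_lam_v_mul (F.nu (F.u i))]
    simp [LinearMap.sum_apply]
  have h2 : ∀ i j, F.lam (F.v j * F.nu (F.u i)) = F.lam (F.nu.symm (F.v j) * F.u i) := fun i j => by
    rw [← F.lam_nu (F.nu.symm (F.v j) * F.u i)]; simp
  have h3 : ∀ j, ∑ i, F.lam (F.nu.symm (F.v j) * F.u i) • F.nu (F.v i) = F.v j := fun j => by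
    simp only [← map_smul, ← map_sum, sum_lam_mul_u, AlgEquiv.apply_symm_apply]
  simp only [h1, h2]
  rw [Finset.sum_comm]
  refine Finset.sum_congr rfl fun j _ => ?_
  conv_rhs => rw [← h3 j]
  simp

theorem cas_nuE (y : BarAlg k A) : F.cas (F.nuE y) = F.nuE (F.cas y) := by
  simp only [cas_apply, map_sum, map_mul, nuE_of]
  exact (F.sum_nu ((LinearMap.mul k (BarAlg k A)).compl₁₂
    (LinearMap.mulRight k (F.nuE y) ∘ₗ (of k).toLinearMap) (of k).toLinearMap)).symm

theorem cas_alE (y : BarAlg k A) : F.cas (F.alE y) = F.alE (F.cas y) := by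
  conv_rhs => rw [← F.nuE_alE y, cas_nuE, alE_nuE]

theorem delta_Delta {r : ℕ} {f : Coch k A (r + 1) 0} (hf : ext f ∘ₗ d = 0) :
    delta k A r 0 (F.Delta rfl f) = F.posT (r + 1) f - f := by
  apply ext_injective
  refine F.eq_of_tr (ext_isC _) (ext_isC _) fun x => ?_
  refine LinearMap.congr_fun (ext_deg (f := F.tr _) fun n x hx => ?_) x
  by_cases hn : n = r + 1 + 1
  swap
  · rw [F.tr_supp (ext_isC _) hx hn, F.tr_supp (ext_isC _) hx hn]
  subst hn
  have e0 : F.tr (ext (F.posT (r + 1) f - f)) x = F.tr (ext f) (F.nuE x) - F.tr (ext f) x := by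
    rw [← tr_posT]
    simp only [tr, map_sub, LinearMap.comp_apply, LinearMap.sub_apply]
  have e1 : F.tr (ext (delta k A r 0 (F.Delta rfl f))) x = F.tr (ext (F.Delta rfl f)) (d x) := by
    rw [tr_apply, ext_delta]; rfl
  have e2 := cutSum_d _ (F.balanced_nu (F.isTr_tr (ext_isC f)) ((-1) ^ r)) x
  rw [e0, e1, tr_Delta]
  rw [← cutSum_sub] at e2
  have e3 : cutSum ((rotForm (F.tr (ext f)) (F.nuSg ((-1) ^ r))) ∘ₗ d -
      (rotForm (F.tr (ext f)) (F.nuSg ((-1) ^ r))).compl₁₂ (sg (-1)).toLinearMap d) x = 0 := by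
    rw [← cutSum_zero x]
    refine cutSum_congr' hx fun a b y w hab ha hb hy hw => ?_
    obtain ⟨a, rfl⟩ : ∃ a', a = a' + 1 := ⟨a - 1, by omega⟩
    have h := F.tr_d hf (w * F.nuE y)
    rw [d_mul, sg_deg _ hw, d_nuE, smul_mul_assoc, map_add, map_smul] at h
    simp only [LinearMap.sub_apply, LinearMap.comp_apply, rotForm_apply, LinearMap.compl₁₂_apply,
      AlgHom.toLinearMap_apply, LinearMap.zero_apply]
    rw [F.nuSg_deg _ (d_mem hy), F.nuSg_deg _ (sg_mem _ hy), sg_deg _ hy]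
    simp only [map_smul, mul_smul_comm, smul_smul, smul_eq_mul] at h ⊢
    have hp : Even (a + 1 + b) ↔ Even (r + 1 + 1 + 1) := by rw [hab]
    have e4 : ((-1 : k) ^ r) ^ a = -(((-1 : k) ^ r) ^ (a + 1) * (-1) ^ (a + 1) * (-1) ^ b) := by
      rw [← pow_mul, ← pow_mul, ← pow_add, ← pow_add]
      apply neg_one_pow_eq_neg
      simp only [Nat.even_add, Nat.even_mul, Nat.even_add_one] at hp ⊢
      tauto
    rw [e4]
    linear_combination (-((-1 : k) ^ r) ^ (a + 1) * (-1) ^ (a + 1)) * h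
  rw [e3, rotForm_apply, rotForm_apply] at e2
  have h1 : F.nuSg ((-1) ^ r) 1 = 1 := by rw [nuSg_apply, map_one, map_one]
  rw [F.nuSg_deg _ (sg_mem _ hx), sg_deg _ hx, h1, mul_one, map_smul, one_mul, smul_smul,
    map_smul] at e2
  have e5 : ((-1 : k) ^ r) ^ (r + 1 + 1) * (-1) ^ (r + 1 + 1) = 1 := by
    rw [← pow_mul, ← pow_add]
    apply Even.neg_one_pow
    simp only [Nat.even_add, Nat.even_mul, Nat.even_add_one]
    tauto
  rw [e5, one_smul] at e2
  linear_combination -e2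

theorem d_nm_connes {p : ℕ} {z : LBar k A p} (hz : d (F.nm p z) = 0) :
    d (F.nm (p + 1) (connes F.nu.symm rfl z)) = F.alE (F.nm p z) - F.nm p z := by
  rw [nm_connes, map_cutSum]
  rw [nm_apply, d_cas] at hz
  have hx := chainEl_mem z
  have e1 := cutSum_d _ (F.balanced_al F.isTr_cas ((-1) ^ (p + 1))) (chainEl k A p z)
  rw [(F.isTr_cutSum_al _ _).eq_zero (by simp) hz, zero_add, ← cutSum_sub] at e1
  have e2 : cutSum ((rotForm F.cas (F.alSg ((-1) ^ p))).compr₂ d) (chainEl k A p z) =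
      -cutSum (rotForm F.cas (F.alSg ((-1) ^ (p + 1))) ∘ₗ d -
        (rotForm F.cas (F.alSg ((-1) ^ (p + 1)))).compl₁₂ (sg (-1)).toLinearMap d)
          (chainEl k A p z) := by
    rw [← cutSum_neg]
    refine cutSum_congr' hx fun a b y w hab ha hb hy hw => ?_
    obtain ⟨a, rfl⟩ : ∃ a', a = a' + 1 := ⟨a - 1, by omega⟩
    simp only [LinearMap.sub_apply, LinearMap.comp_apply, rotForm_apply, LinearMap.compl₁₂_apply,
      AlgHom.toLinearMap_apply, LinearMap.neg_apply, LinearMap.compr₂_apply, d_cas]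
    rw [F.alSg_deg _ (d_mem hy), F.alSg_deg _ (sg_mem _ hy), sg_deg _ hy, F.alSg_deg _ hy, d_mul,
      sg_deg _ hw, map_smul d, d_alE]
    simp only [map_smul, mul_smul_comm, smul_mul_assoc, smul_smul, map_add]
    have hp : Even (a + 1 + b) ↔ Even (p + 1 + 1) := by rw [hab]
    have e4 : ((-1 : k) ^ p) ^ (a + 1) * (-1 : k) ^ b = -((-1 : k) ^ (p + 1)) ^ a := by
      rw [← pow_mul, ← pow_mul, ← pow_add]
      apply neg_one_pow_eq_neg
      simp only [Nat.even_add, Nat.even_mul, Nat.even_add_one] at hp ⊢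
      tauto
    have e5 : ((-1 : k) ^ p) ^ (a + 1) = ((-1 : k) ^ (p + 1)) ^ (a + 1) * (-1) ^ (a + 1) := by
      rw [← pow_mul, ← pow_mul, ← pow_add]
      apply neg_one_pow_congr
      simp only [Nat.even_add, Nat.even_mul, Nat.even_add_one]
      tauto
    rw [e4, e5]
    module
  refine e2.trans ?_
  rw [e1, rotForm_apply, rotForm_apply]
  have h1 : F.alSg ((-1) ^ (p + 1)) 1 = 1 := by rw [alSg_apply, map_one, map_one]
  have e5 : ((-1 : k) ^ (p + 1)) ^ (p + 1) * (-1) ^ (p + 1) = 1 := by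
    rw [← pow_mul, ← pow_add]
    apply Even.neg_one_pow
    simp only [Nat.even_add, Nat.even_mul, Nat.even_add_one]
    tauto
  rw [F.alSg_deg _ (sg_mem _ hx), sg_deg _ hx, h1, mul_one, map_smul, one_mul, smul_smul, e5,
    one_smul, nm_apply, cas_alE]
  abel

end FrobeniusData

end
end TateHH

namespace TateHH
noncomputable section

/-! ### Diagonalizable endomorphisms -/

section Diag

variable {k : Type*} [Field k] {V : Type*} [AddCommGroup V] [Module k V]

open Module.End

theorem isCompl_of_eigenspaces {T : Module.End k V} {D D' : Submodule k V}
    (hD : D ≤ eigenspace T 1) (hD' : D' ≤ ⨆ μ ≠ 1, eigenspace T μ) (h : D ⊔ D' = ⊤) :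
    eigenspace T 1 = D ∧ IsCompl (eigenspace T 1) (LinearMap.range (1 - T)) := by
  have hdis : Disjoint (eigenspace T 1) (⨆ μ ≠ 1, eigenspace T μ) := eigenspaces_iSupIndep T 1
  have hsup : eigenspace T 1 ⊔ ⨆ μ ≠ 1, eigenspace T μ = ⊤ :=
    top_le_iff.1 (h ▸ sup_le_sup hD hD')
  have hle : (⨆ μ ≠ 1, eigenspace T μ) ≤ LinearMap.range (1 - T) := by
    refine iSup₂_le fun μ hμ x hx => ⟨(1 - μ)⁻¹ • x, ?_⟩
    rw [mem_eigenspace_iff] at hx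
    have : (1 - T) x = (1 - μ) • x := by
      rw [LinearMap.sub_apply, hx, sub_smul, one_smul]; rfl
    rw [map_smul, this, smul_smul, inv_mul_cancel₀ (sub_ne_zero.2 (Ne.symm hμ)), one_smul]
  have hge : LinearMap.range (1 - T) ≤ ⨆ μ ≠ 1, eigenspace T μ := by
    rintro _ ⟨x, rfl⟩
    have hx : x ∈ eigenspace T 1 ⊔ ⨆ μ ≠ 1, eigenspace T μ := hsup ▸ Submodule.mem_top
    obtain ⟨y, hy, z, hz, rfl⟩ := Submodule.mem_sup.1 hx
    have h1 : (1 - T) y = 0 := by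
      rw [mem_eigenspace_iff, one_smul] at hy
      rw [LinearMap.sub_apply, hy]; exact sub_self y
    rw [map_add, h1, zero_add]
    refine Submodule.iSup_induction' (motive := fun z _ => (1 - T) z ∈ ⨆ μ ≠ 1, eigenspace T μ) _
      (fun μ w hw => ?_) (by simp) (fun v w _ _ hv hw => by rw [map_add]; exact add_mem hv hw) hz
    by_cases hμ : μ = 1
    · subst hμ
      simp only [ne_eq, not_true_eq_false, iSup_false, Submodule.mem_bot] at hw
      simp [hw]
    · rw [iSup_pos hμ] at hw
      have : (1 - T) w = (1 - μ) • w := by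
        rw [mem_eigenspace_iff] at hw
        rw [LinearMap.sub_apply, hw, sub_smul, one_smul]; rfl
      rw [this]
      exact Submodule.smul_mem _ _ (Submodule.mem_iSup_of_mem μ (Submodule.mem_iSup_of_mem hμ hw))
  refine ⟨le_antisymm (fun x hx => ?_) hD, hdis.mono_right hge, ?_⟩
  · have hx' : x ∈ D ⊔ D' := h ▸ Submodule.mem_top
    obtain ⟨y, hy, z, hz, rfl⟩ := Submodule.mem_sup.1 hx'
    have hz' : z ∈ eigenspace T 1 := by simpa using sub_mem hx (hD hy)
    rw [Submodule.disjoint_def.1 hdis z hz' (hD' hz), add_zero]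
    exact hy
  · rw [codisjoint_iff]
    exact top_le_iff.1 (hsup ▸ sup_le_sup le_rfl hle)

theorem isCompl_of_span {X : Type*} {T : Module.End k V} {v : X → V} {c : X → k}
    (hv : ∀ x, T (v x) = c x • v x) (h : Submodule.span k (Set.range v) = ⊤) :
    eigenspace T 1 = Submodule.span k (v '' {x | c x = 1}) ∧
      IsCompl (eigenspace T 1) (LinearMap.range (1 - T)) := by
  refine isCompl_of_eigenspaces (D' := Submodule.span k (v '' {x | c x ≠ 1})) ?_ ?_ ?_
  · rw [Submodule.span_le]
    rintro _ ⟨x, hx, rfl⟩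
    rw [SetLike.mem_coe, mem_eigenspace_iff, hv, hx]
  · rw [Submodule.span_le]
    rintro _ ⟨x, hx, rfl⟩
    exact Submodule.mem_iSup_of_mem (c x) (Submodule.mem_iSup_of_mem hx
      (mem_eigenspace_iff.2 (hv x)))
  · rw [← Submodule.span_union, ← Set.image_union, ← h, ← Set.image_univ]
    congr 2
    ext x
    simp [em]

theorem exists_eq_add_of_isCompl {T : Module.End k V}
    (h : IsCompl (eigenspace T 1) (LinearMap.range (1 - T))) (x : V) :
    ∃ y w, T y = y ∧ x = y + (w - T w) := by
  have hx : x ∈ eigenspace T 1 ⊔ LinearMap.range (1 - T) := by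
    rw [h.sup_eq_top]; exact Submodule.mem_top
  obtain ⟨y, hy, _, ⟨w, rfl⟩, rfl⟩ := Submodule.mem_sup.1 hx
  rw [mem_eigenspace_iff, one_smul] at hy
  exact ⟨y, w, hy, rfl⟩

theorem eq_of_isCompl {T : Module.End k V}
    (h : IsCompl (eigenspace T 1) (LinearMap.range (1 - T))) {w : V}
    (hw : T (w - T w) = w - T w) : w - T w = 0 :=
  Submodule.disjoint_def.1 h.disjoint _ (by rw [mem_eigenspace_iff, one_smul, hw]) ⟨w, rfl⟩

variable {C C' C'' : Type*} [AddCommGroup C] [Module k C] [AddCommGroup C'] [Module k C']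
  [AddCommGroup C''] [Module k C'']

/-- The inclusion of the invariants of an automorphism that is homotopic to the identity. -/
theorem inclusion_isCohIso {δ : C →ₗ[k] C'} {δ' : C' →ₗ[k] C''} {T : Module.End k C}
    {T' : Module.End k C'} {T'' : Module.End k C''}
    (h : IsCompl (eigenspace T 1) (LinearMap.range (1 - T)))
    (h' : IsCompl (eigenspace T' 1) (LinearMap.range (1 - T')))
    (h'' : IsCompl (eigenspace T'' 1) (LinearMap.range (1 - T'')))
    (hδ : ∀ x, δ (T x) = T' (δ x)) (hδ' : ∀ x, δ' (T' x) = T'' (δ' x))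
    (hT : ∀ x, δ' x = 0 → x - T' x ∈ LinearMap.range δ) :
    IsCohIso (LinearMap.ker δ' ⊓ eigenspace T' 1) ((eigenspace T 1).map δ)
      (LinearMap.ker δ') (LinearMap.range δ) LinearMap.id where
  map x hx := hx.1
  mem_iff x hx := by
    refine ⟨fun ⟨y, hy⟩ => ?_, fun ⟨y, _, hy⟩ => ⟨y, hy⟩⟩
    obtain ⟨y₁, w, h₁, rfl⟩ := exists_eq_add_of_isCompl h y
    have hx' : T' x = x := by simpa [mem_eigenspace_iff] using hx.2
    have e1 : x = δ y₁ + (δ w - T' (δ w)) := by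
      rw [← hδ, ← map_sub, ← map_add]; exact hy.symm
    have e2 : T' (δ y₁) = δ y₁ := by rw [← hδ, h₁]
    have e3 : T' (δ w - T' (δ w)) = δ w - T' (δ w) := by
      rw [e1, map_add, e2] at hx'
      exact add_left_cancel hx'
    refine ⟨y₁, by simpa [mem_eigenspace_iff] using h₁, ?_⟩
    rw [e1, eq_of_isCompl h' e3, add_zero]
  surj x hx := by
    obtain ⟨x₁, w, h₁, rfl⟩ := exists_eq_add_of_isCompl h' x
    obtain ⟨w₁, v, h₂, rfl⟩ := exists_eq_add_of_isCompl h' w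
    have hw : w₁ + (v - T' v) - T' (w₁ + (v - T' v)) = (v - T' v) - T' (v - T' v) := by
      rw [map_add, h₂]; abel
    rw [hw] at hx ⊢
    set u := v - T' v with hu
    have e1 : T'' (δ' x₁) = δ' x₁ := by rw [← hδ', h₁]
    have e2 : δ' x₁ + (δ' u - T'' (δ' u)) = 0 := by
      rw [← hδ', ← map_sub, ← map_add]; exact hx
    have e3 : T'' (δ' u - T'' (δ' u)) = δ' u - T'' (δ' u) := by
      have := congrArg T'' e2
      rw [map_add, e1, map_zero, ← e2] at this
      exact add_left_cancel this
    have e4 := eq_of_isCompl h'' e3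
    have e5 : δ' u = δ' v - T'' (δ' v) := by rw [hu, map_sub, hδ']
    have e6 : δ' u = 0 := by
      rw [e5]
      refine eq_of_isCompl h'' ?_
      rw [← e5]
      exact (sub_eq_zero.1 e4).symm
    refine ⟨x₁, ⟨?_, by simpa [mem_eigenspace_iff] using h₁⟩, ?_⟩
    · rw [e4, add_zero] at e2
      exact e2
    · rw [LinearMap.id_apply, add_sub_cancel_left]
      exact hT u e6

end Diag

namespace FrobeniusData
open BarAlg Module.End
variable {k A ι : Type u} [Field k] [Ring A] [Algebra k A] [DecidableEq ι]
  (F : FrobeniusData k A ι)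

/-- `ν⁻¹` applied to all factors of a chain. -/
def negT (p : ℕ) : LBar k A p →ₗ[k] LBar k A p :=
  TensorProduct.map F.nu.symm.toLinearMap (PiTensorProduct.map fun _ => barMap F.nu.symm)

theorem chainEl_negT {p : ℕ} (z : LBar k A p) :
    chainEl k A p (F.negT p z) = F.alE (chainEl k A p z) := by
  induction z using lbar_induction with
  | hadd y z hy hz => simp only [map_add, hy, hz]
  | h a t =>
    have e : F.negT p (a ⊗ₜ t) = F.nu.symm a ⊗ₜ PiTensorProduct.map (fun _ => barMap F.nu.symm) t :=
      rfl
    rw [e, chainEl_tmul, chainEl_tmul, tau_map_barMap, map_mul F.alE, alE_of]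
    rfl

theorem barMap_proj (σ : A ≃ₐ[k] A) (a : A) : barMap σ (proj k A a) = proj k A (σ a) := rfl

theorem map_tprod_eigen {σ : A ≃ₐ[k] A} {r : ℕ} {μ : Fin r → k} {a : Fin r → A}
    (h : ∀ i, σ (a i) = μ i • a i) :
    PiTensorProduct.map (fun _ => barMap σ) (PiTensorProduct.tprod k fun i => proj k A (a i)) =
      (∏ i, μ i) • PiTensorProduct.tprod k fun i => proj k A (a i) := by
  simp only [PiTensorProduct.map_tprod, barMap_proj, h, map_smul]
  exact MultilinearMap.map_smul_univ _ _ _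

theorem symm_eigen {μ : k} {a : A} (hμ : μ ≠ 0) (h : F.nu a = μ • a) : F.nu.symm a = μ⁻¹ • a := by
  rw [AlgEquiv.symm_apply_eq, map_smul, h, smul_smul, inv_mul_cancel₀ hμ, one_smul]

variable [Fintype ι]

theorem nm_negT {p : ℕ} (z : LBar k A p) : F.nm p (F.negT p z) = F.alE (F.nm p z) := by
  rw [nm_apply, chainEl_negT, cas_alE, nm_apply]

theorem exists_eigenbasis (hF : F.NuDiagonalizable) : ∃ (κ : Type u) (_ : Finite κ)
    (b : Module.Basis κ k A) (μ : κ → k), (∀ j, F.nu (b j) = μ j • b j) ∧ ∀ j, μ j ≠ 0 := by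
  have : Module.Finite k A := Module.Finite.of_basis F.u
  have hs : ⊤ ≤ Submodule.span k {a : A | ∃ μ : k, F.nu a = μ • a} := by
    rw [← hF, iSup_le_iff]
    intro μ a ha
    exact Submodule.subset_span ⟨μ, mem_eigenspace_iff.1 ha⟩
  let b := Module.Basis.ofSpan hs
  have hb : ∀ j, ∃ μ : k, F.nu (b j) = μ • b j := fun j =>
    Module.Basis.ofSpan_subset hs ⟨j, rfl⟩
  choose μ hμ using hb
  refine ⟨_, Module.Finite.finite_basis b, b, μ, hμ, fun j hj => b.ne_zero j ?_⟩
  have := hμ j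
  rw [hj, zero_smul] at this
  simpa using this

theorem span_tprod_basis {κ : Type u} [Finite κ] (b : Module.Basis κ k A) (r : ℕ) :
    Submodule.span k (Set.range fun p : Fin r → κ =>
      (PiTensorProduct.tprod k fun i => proj k A (b (p i)) : TPow k A r)) = ⊤ := by
  have h1 := (_root_.Basis.piTensorProduct (R := k) fun _ : Fin r => b).span_eq
  have h2 : Function.Surjective (PiTensorProduct.map (R := k) fun _ : Fin r => proj k A) := by
    intro t
    induction t using tpow_induction with
    | h x =>
      refine ⟨PiTensorProduct.tprod k fun i => sec k A (x i), ?_⟩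
      simp only [PiTensorProduct.map_tprod, proj_sec]
    | hadd s t hs ht =>
      obtain ⟨s, rfl⟩ := hs
      obtain ⟨t, rfl⟩ := ht
      exact ⟨s + t, map_add _ _ _⟩
    | hsmul c t ht =>
      obtain ⟨t, rfl⟩ := ht
      exact ⟨c • t, map_smul _ _ _⟩
  rw [← LinearMap.range_eq_top.2 h2, ← Submodule.map_top, ← h1, Submodule.map_span,
    ← Set.range_comp]
  congr 2
  ext p
  simp [Basis.piTensorProduct_apply, PiTensorProduct.map_tprod]

theorem negT_isCompl (hF : F.NuDiagonalizable) (p : ℕ) :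
    F.negD1 p = eigenspace (F.negT p) 1 ∧
      IsCompl (eigenspace (F.negT p) 1) (LinearMap.range (1 - F.negT p)) := by
  obtain ⟨κ, _, b, μ, hμ, h0⟩ := F.exists_eigenbasis hF
  let v : κ × (Fin p → κ) → LBar k A p := fun x =>
    b x.1 ⊗ₜ PiTensorProduct.tprod k fun i => proj k A (b (x.2 i))
  have hv : ∀ (μ₀ : k) (μ : Fin p → k) (a₀ : A) (a : Fin p → A), F.nu a₀ = μ₀ • a₀ →
      (∀ i, F.nu (a i) = μ i • a i) → μ₀ * ∏ i, μ i ≠ 0 →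
      F.negT p (a₀ ⊗ₜ PiTensorProduct.tprod k fun i => proj k A (a i)) =
        (μ₀ * ∏ i, μ i)⁻¹ • (a₀ ⊗ₜ PiTensorProduct.tprod k fun i => proj k A (a i)) := by
    intro μ₀ μ a₀ a h0 h h1
    have h2 : ∀ i, μ i ≠ 0 := fun i =>
      Finset.prod_ne_zero_iff.1 (right_ne_zero_of_mul h1) i (Finset.mem_univ i)
    refine (TensorProduct.map_tmul _ _ _ _).trans ?_
    rw [map_tprod_eigen fun i => F.symm_eigen (h2 i) (h i)]
    refine (congrArg (· ⊗ₜ _) (F.symm_eigen (left_ne_zero_of_mul h1) h0)).trans ?_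
    rw [TensorProduct.smul_tmul_smul, mul_inv, Finset.prod_inv_distrib]
  have hspan : Submodule.span k (Set.range v) = ⊤ := by
    have h1 := Submodule.map₂_span_span k (TensorProduct.mk k A (TPow k A p)) (Set.range b)
      (Set.range fun q : Fin p → κ => PiTensorProduct.tprod k fun i => proj k A (b (q i)))
    rw [span_tprod_basis, b.span_eq, TensorProduct.map₂_mk_top_top_eq_top] at h1
    rw [h1]
    congr 1
    ext x
    simp [v, Set.mem_image2]
  have h := isCompl_of_span (T := F.negT p) (v := v) (c := fun x => (μ x.1 * ∏ i, μ (x.2 i))⁻¹)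
    (fun x => hv _ _ _ _ (hμ _) (fun i => hμ _)
      (mul_ne_zero (h0 _) (Finset.prod_ne_zero_iff.2 fun i _ => h0 _))) hspan
  refine ⟨le_antisymm ?_ ?_, h.2⟩
  · refine Submodule.span_le.2 ?_
    rintro _ ⟨μ₀, μ', a₀, a, h1, h2, h3, rfl⟩
    rw [SetLike.mem_coe, mem_eigenspace_iff, hv μ₀ μ' a₀ a (mem_eigenspace_iff.1 h1)
      (fun i => mem_eigenspace_iff.1 (h2 i)) (by rw [h3]; exact one_ne_zero), h3, inv_one]
  · rw [h.1]
    refine Submodule.span_mono ?_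
    rintro _ ⟨x, hx, rfl⟩
    exact ⟨μ x.1, fun i => μ (x.2 i), b x.1, fun i => b (x.2 i), mem_eigenspace_iff.2 (hμ _),
      fun i => mem_eigenspace_iff.2 (hμ _), inv_eq_one.1 hx, rfl⟩

end FrobeniusData

end
end TateHH

namespace TateHH
noncomputable section
namespace FrobeniusData
open BarAlg Module.End
variable {k A ι : Type u} [Field k] [Ring A] [Algebra k A] [DecidableEq ι]
  (F : FrobeniusData k A ι)

theorem posT_eq_iff {r : ℕ} (f : Coch k A r 0) (t : TPow k A r) :
    F.posT r f t = f t ↔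
      (show A from f (PiTensorProduct.map (fun _ => barMap F.nu) t)) = F.nu (show A from f t) := by
  rw [posT_apply]
  exact F.nu.symm_apply_eq

theorem posT_delta {r : ℕ} (f : Coch k A r 0) :
    delta k A r 0 (F.posT r f) = F.posT (r + 1) (delta k A r 0 f) := by
  apply ext_injective
  refine LinearMap.ext fun x => ?_
  rw [ext_posT, ext_delta, ext_delta, LinearMap.comp_apply, LinearMap.comp_apply, ext_posT, d_nuE]

variable [Fintype ι]

theorem posD1_eq (hF : F.NuDiagonalizable) (r : ℕ) : F.posD1 r = eigenspace (F.posT r) 1 := by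
  ext f
  rw [mem_eigenspace_iff, one_smul]
  refine ⟨fun h => ?_, fun h μ a ha => ?_⟩
  · obtain ⟨κ, _, b, μ, hμ, h0⟩ := F.exists_eigenbasis hF
    refine LinearMap.ext_on_range (span_tprod_basis b r) fun p => ?_
    rw [posT_eq_iff, map_tprod_eigen fun i => hμ (p i)]
    refine (map_smul f _ _).trans ?_
    exact (mem_eigenspace_iff.1 (h (fun i => μ (p i)) (fun i => b (p i))
      fun i => mem_eigenspace_iff.2 (hμ _))).symm
  · have h1 := (F.posT_eq_iff f _).1
      (LinearMap.congr_fun h (PiTensorProduct.tprod k fun i => proj k A (a i)))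
    rw [map_tprod_eigen fun i => mem_eigenspace_iff.1 (ha i)] at h1
    exact mem_eigenspace_iff.2 (h1.symm.trans (map_smul f _ _))

theorem exists_eigenbasis_tpow (hF : F.NuDiagonalizable) (r : ℕ) :
    ∃ (κ : Type u) (_ : Finite κ) (c : Module.Basis κ k (TPow k A r)) (M : κ → k),
      ∀ j, PiTensorProduct.map (fun _ => barMap F.nu) (c j) = M j • c j := by
  obtain ⟨κ, _, b, μ, hμ, h0⟩ := F.exists_eigenbasis hF
  let S : Set (TPow k A r) := Set.range fun p : Fin r → κ =>
    PiTensorProduct.tprod k fun i => proj k A (b (p i))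
  have hS : ⊤ ≤ Submodule.span k S := (span_tprod_basis b r).ge
  let c := Module.Basis.ofSpan (K := k) (V := TPow k A r) (s := S) hS
  have hc : ∀ j, ∃ M : k, PiTensorProduct.map (fun _ => barMap F.nu) (c j) = M • c j := by
    intro j
    obtain ⟨p, hp⟩ := Module.Basis.ofSpan_subset (K := k) (V := TPow k A r) (s := S) hS ⟨j, rfl⟩
    have e : c j = PiTensorProduct.tprod k fun i => proj k A (b (p i)) := hp.symm
    rw [e]
    exact ⟨_, map_tprod_eigen fun i => hμ (p i)⟩
  choose M hM using hc
  have : Module.Finite k A := Module.Finite.of_basis F.u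
  have : Module.Finite k (TPow k A r) := inferInstance
  exact ⟨_, Module.Finite.finite_basis c, c, M, hM⟩

theorem posT_isCompl (hF : F.NuDiagonalizable) (r : ℕ) :
    IsCompl (eigenspace (F.posT r) 1) (LinearMap.range (1 - F.posT r)) := by
  obtain ⟨κ, _, b, μ, hμ, h0⟩ := F.exists_eigenbasis hF
  obtain ⟨κ', _, c, M, hM⟩ := F.exists_eigenbasis_tpow hF r
  have hcM : ∀ j t, c.coord j (PiTensorProduct.map (fun _ => barMap F.nu) t) =
      M j * c.coord j t := by
    intro j t
    have : c.coord j ∘ₗ PiTensorProduct.map (fun _ => barMap F.nu) = M j • c.coord j := by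
      refine c.ext fun i => ?_
      rw [LinearMap.comp_apply, hM, map_smul, LinearMap.smul_apply, smul_eq_mul, smul_eq_mul,
        c.coord_apply, c.repr_self]
      by_cases h : i = j
      · rw [h]
      · rw [Finsupp.single_eq_of_ne (Ne.symm h), mul_zero, mul_zero]
    exact LinearMap.congr_fun this t
  let v : κ' × κ → Coch k A r 0 := fun x => (c.coord x.1).smulRight (bz k A (b x.2))
  refine (isCompl_of_span (v := v) (c := fun x => (μ x.2)⁻¹ * M x.1) (fun x => ?_) ?_).2
  · refine LinearMap.ext fun t => (F.posT_apply _ t).trans ?_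
    refine (congrArg F.nu.symm (show _ = (M x.1 * c.coord x.1 t) • b x.2 from
      congrArg (· • b x.2) (hcM _ _))).trans ?_
    rw [map_smul, F.symm_eigen (h0 _) (hμ _)]
    refine Eq.trans ?_ (show (((μ x.2)⁻¹ * M x.1) • (c.coord x.1 t • b x.2) : A) = _ from rfl)
    module
  · rw [← top_le_iff]
    intro f _
    have := Fintype.ofFinite κ'
    have e : f = ∑ j, (c.coord j).smulRight (f (c j)) := by
      refine c.ext fun i => ?_
      rw [LinearMap.sum_apply, Finset.sum_eq_single i]
      · simp
      · intro j _ hj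
        simp [Finsupp.single_eq_of_ne hj]
      · simp
    rw [e]
    refine sum_mem fun j _ => ?_
    have h1 : (bz k A).symm (f (c j)) ∈ Submodule.span k (Set.range b) := by
      rw [b.span_eq]; exact Submodule.mem_top
    have h2 : ∀ a ∈ Submodule.span k (Set.range b),
        (c.coord j).smulRight (bz k A a) ∈ Submodule.span k (Set.range v) := by
      intro a ha
      induction ha using Submodule.span_induction with
      | mem a ha =>
        obtain ⟨i, rfl⟩ := ha
        exact Submodule.subset_span ⟨(j, i), rfl⟩
      | zero => rw [map_zero, LinearMap.smulRight_zero]; exact zero_mem _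
      | add x y _ _ hx hy =>
        have e : (c.coord j).smulRight (bz k A (x + y)) =
          (c.coord j).smulRight (bz k A x) + (c.coord j).smulRight (bz k A y) := by
            ext; simp
        rw [e]
        exact add_mem hx hy
      | smul a x _ hx =>
        have e : (c.coord j).smulRight (bz k A (a • x)) = a • (c.coord j).smulRight (bz k A x) := by
          refine LinearMap.ext fun t => ?_
          simp only [LinearMap.smulRight_apply, map_smul, LinearMap.smul_apply]
          exact smul_comm _ _ _
        rw [e]
        exact Submodule.smul_mem _ _ hx
    simpa using h2 _ h1

theorem posT_normMap (z : LBar k A 0) : F.normMap (F.negT 0 z) = F.posT 0 (F.normMap z) := by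
  refine ext_injective ((ext_isC _).ext_zero (ext_isC _) ?_)
  rw [ext_normMap, ext_posT, nm_negT, d_alE, nuE_eps, ext_normMap]

theorem negT_bdry {p : ℕ} (z : LBar k A (p + 1)) :
    bdry F.nu.symm p (F.negT (p + 1) z) = F.negT p (bdry F.nu.symm p z) := by
  refine F.nm_injective p ?_
  rw [← d_nm, nm_negT, nm_negT, d_alE, d_nm]

theorem sub_posT_mem {r : ℕ} {f : Coch k A (r + 1) 0} (hf : delta k A (r + 1) 0 f = 0) :
    f - F.posT (r + 1) f ∈ LinearMap.range (delta k A r 0) := by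
  refine ⟨-F.Delta rfl f, ?_⟩
  rw [map_neg, delta_Delta _ (by rw [← ext_delta, hf, map_zero]), neg_sub]

theorem sub_posT_zero {f : Coch k A 0 0} (hf : delta k A 0 0 f = 0) : F.posT 0 f = f := by
  refine ext_injective ((ext_isC _).ext_zero (ext_isC _) ?_)
  have h : ext f ∘ₗ d = 0 := by rw [← ext_delta, hf, map_zero]
  rw [(ext_isC f).comp_d_eq_zero_iff] at h
  rw [ext_posT, nuE_eps]
  obtain ⟨a, ha⟩ : ext f (eps k A) ∈ deg k A 0 := (ext_isC f).mem' _
  rw [AlgHom.toLinearMap_apply] at ha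
  have hc : ∀ b, b * a = a * b := fun b => by
    have := h b
    rw [← ha, ← map_mul, ← map_mul] at this
    rw [← toA_of (k := k) (b * a), this, toA_of]
  rw [← ha, alE_of, F.nu.symm_apply_eq.2]
  rw [← F.sum_lam_v_mul (F.nu a)]
  conv_lhs => rw [← F.sum_lam_v_mul a]
  exact Finset.sum_congr rfl fun i _ => by rw [← lam_mul, hc]

theorem sub_negT_mem {p : ℕ} {z : LBar k A p} (hz : d (F.nm p z) = 0) :
    z - F.negT p z ∈ LinearMap.range (bdry F.nu.symm p) := by
  refine ⟨-connes F.nu.symm rfl z, F.nm_injective p ?_⟩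
  rw [map_neg, map_neg, ← d_nm, d_nm_connes _ hz, map_sub, nm_negT, neg_sub]

theorem incPos_isCohIso (hF : F.NuDiagonalizable) : ∀ r : ℕ,
    IsCohIso (F.posZ1 r) (F.posB1 r) (F.posZ r) (F.posB r) LinearMap.id
  | 0 => by
    have := inclusion_isCohIso (F.negT_isCompl hF 0).2 (F.posT_isCompl hF 0) (F.posT_isCompl hF 1)
      F.posT_normMap F.posT_delta fun f hf => by
        rw [F.sub_posT_zero hf, sub_self]; exact zero_mem _
    rw [← posD1_eq _ hF, ← (F.negT_isCompl hF 0).1] at this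
    exact this
  | r + 1 => by
    have := inclusion_isCohIso (F.posT_isCompl hF r) (F.posT_isCompl hF (r + 1))
      (F.posT_isCompl hF (r + 1 + 1)) F.posT_delta F.posT_delta fun f hf => F.sub_posT_mem hf
    rw [← posD1_eq _ hF, ← posD1_eq _ hF] at this
    exact this

theorem incNeg_isCohIso (hF : F.NuDiagonalizable) : ∀ p : ℕ,
    IsCohIso (F.negZ1 p) (F.negB1 p) (F.negZ p) (F.negB p) LinearMap.id
  | 0 => by
    have := inclusion_isCohIso (F.negT_isCompl hF 1).2 (F.negT_isCompl hF 0).2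
      (F.posT_isCompl hF 0) F.negT_bdry F.posT_normMap fun z hz =>
        F.sub_negT_mem ((F.mem_negZ_iff z).1 hz)
    rw [← (F.negT_isCompl hF 0).1, ← (F.negT_isCompl hF 1).1] at this
    exact this
  | p + 1 => by
    have := inclusion_isCohIso (F.negT_isCompl hF (p + 2)).2 (F.negT_isCompl hF (p + 1)).2
      (F.negT_isCompl hF p).2 F.negT_bdry F.negT_bdry fun z hz =>
        F.sub_negT_mem ((F.mem_negZ_iff z).1 hz)
    rw [← (F.negT_isCompl hF _).1, ← (F.negT_isCompl hF _).1] at this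
    exact this

end FrobeniusData

end
end TateHH

namespace TateHH
noncomputable section

namespace BarAlg
variable {k A : Type u} [Field k] [Ring A] [Algebra k A]

/-! ### The insertion of a central element -/

/-- The bimodule map `ε ↦ ζ`. -/
def ins (n : ℕ) (ζ : BarAlg k A) : BarAlg k A →ₗ[k] BarAlg k A := ext (cen n ζ)

/-- The skew derivation given by the insertion of `ζ` between two letters `ε`. -/
def insD (n : ℕ) (ζ : BarAlg k A) : BarAlg k A →ₗ[k] BarAlg k A :=
  Lam ((-1) ^ (n + 1)) (ins n ζ)

theorem ins_isC (n : ℕ) (ζ : BarAlg k A) : IsC 0 n (ins n ζ) := ext_isC _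

theorem insD_of_mul (n : ℕ) (ζ : BarAlg k A) (a : A) (x : BarAlg k A) :
    insD n ζ (of k a * x) = of k a * insD n ζ x := Lam_of_mul _ _ a x

theorem insD_mul_of (n : ℕ) (ζ : BarAlg k A) (a : A) (x : BarAlg k A) :
    insD n ζ (x * of k a) = insD n ζ x * of k a := Lam_mul_of _ _ a x

theorem insD_mem (n : ℕ) (ζ : BarAlg k A) {e : ℕ} {x : BarAlg k A} (hx : x ∈ deg k A e) :
    insD n ζ x ∈ deg k A (e + n + 1) := Lam_mem (ins_isC n ζ) _ hx

theorem insD_deg_zero (n : ℕ) (ζ : BarAlg k A) {x : BarAlg k A} (hx : x ∈ deg k A 0) :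
    insD n ζ x = 0 := Lam_low (ins_isC n ζ) _ hx le_rfl

theorem insD_one (n : ℕ) (ζ : BarAlg k A) : insD n ζ 1 = 0 := insD_deg_zero n ζ one_mem

variable {n : ℕ} {ζ : BarAlg k A}

theorem tilde_ins (hζ : ζ ∈ deg k A n) (hc : ∀ a, of k a * ζ = ζ * of k a) {e : ℕ}
    {x : BarAlg k A} (hx : x ∈ deg k A (e + 1)) : tilde (ins n ζ) x = ζ * x := by
  rw [show e + 1 = 0 + 1 + e by omega] at hx
  refine eqOn_split (F := tilde (ins n ζ)) (G := LinearMap.mulLeft k ζ) (fun y hy w _ => ?_) hx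
  obtain ⟨a, rfl⟩ := hy
  rw [AlgHom.toLinearMap_apply, tilde_mul_eps_mul (ins_isC n ζ) (of_mem a),
    LinearMap.mulLeft_apply, (ins_isC n ζ).of_mul, ins, ext_cen_eps hζ, hc, mul_assoc, ← mul_assoc ζ, mul_assoc]

theorem insD_eq (hζ : ζ ∈ deg k A n) (hc : ∀ a, of k a * ζ = ζ * of k a) (x : BarAlg k A) :
    insD n ζ x = cutSum ((LinearMap.mul k (BarAlg k A)).compl₁₂ (sg ((-1) ^ (n + 1))).toLinearMap
      (LinearMap.mulLeft k ζ)) x := by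
  refine LinearMap.congr_fun (ext_deg fun e x hx => cutSum_congr' hx fun a b y w _ _ hb _ hw => ?_) x
  obtain ⟨b, rfl⟩ : ∃ b', b = b' + 1 := ⟨b - 1, by omega⟩
  simp only [LinearMap.compl₁₂_apply, tilde_ins hζ hc hw, LinearMap.mulLeft_apply]

theorem d_ins (hζ : ζ ∈ deg k A n) (hd : d ζ = 0) : d ∘ₗ ins n ζ = 0 := by
  cases n with
  | zero => exact LinearMap.ext fun x => d_deg_zero ((ins_isC 0 ζ).mem' x)
  | succ n =>
    refine (IsC.d_comp (ins_isC _ ζ)).ext_zero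
      (⟨by simp, by simp, by simp, fun _ _ => zero_mem _⟩ : IsC 0 n 0) ?_
    rw [LinearMap.comp_apply, ins, ext_cen_eps hζ, hd, LinearMap.zero_apply]

theorem insD_d (hζ : ζ ∈ deg k A n) (hc : ∀ a, of k a * ζ = ζ * of k a) (hd : d ζ = 0)
    (x : BarAlg k A) :
    insD n ζ (d x) = (-1 : k) ^ (n + 1) • d (insD n ζ x) - ζ * x + sg ((-1) ^ n) x * ζ := by
  suffices H : insD n ζ ∘ₗ d = (-1 : k) ^ (n + 1) • (d ∘ₗ insD n ζ) - LinearMap.mulLeft k ζ +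
      LinearMap.mulRight k ζ ∘ₗ (sg ((-1) ^ n)).toLinearMap from LinearMap.congr_fun H x
  refine ext_deg fun e x hx => ?_
  simp only [LinearMap.comp_apply, LinearMap.add_apply, LinearMap.sub_apply, LinearMap.smul_apply,
    LinearMap.mulLeft_apply, LinearMap.mulRight_apply, AlgHom.toLinearMap_apply]
  cases e with
  | zero =>
    rw [insD_deg_zero n ζ hx, d_deg_zero hx]
    obtain ⟨a, rfl⟩ := hx
    rw [AlgHom.toLinearMap_apply, sg_of, hc]
    simp
  | succ e =>
    have h1 : conv (sg ((-1) ^ n)).toLinearMap (ins n ζ) x = sg ((-1) ^ n) x * ζ := by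
      have hx' : x ∈ deg k A (e + 1 + 0) := hx
      refine eqOn_split (F := conv (sg ((-1) ^ n)).toLinearMap (ins n ζ))
        (G := LinearMap.mulRight k ζ ∘ₗ (sg ((-1) ^ n)).toLinearMap) (fun y hy w hw => ?_) hx'
      rw [conv_word (ins_isC n ζ) _ hy hw]
      obtain ⟨b, rfl⟩ := hw
      rw [AlgHom.toLinearMap_apply, (ins_isC n ζ).mul_of, ins, ext_cen_eps hζ]
      simp only [LinearMap.comp_apply, LinearMap.mulRight_apply, AlgHom.toLinearMap_apply]
      rw [sg_deg _ (mul_mem hy (eps_mul_mem (of_mem b))), ← hc, smul_mul_assoc]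
      simp only [mul_assoc]
    have h2 := Lam_d (ins_isC n ζ) (d_ins hζ hd) (c := (-1) ^ (n + 1)) (by rw [zero_add]) x
    rw [insD, h2, tilde_ins hζ hc hx, (ins_isC n ζ).comp_d_eq_zero_iff.2, Lam_zero,
      neg_neg_one_pow_succ, h1]
    · simp
    · intro a
      rw [ins, ext_cen_eps hζ, hc]

end BarAlg

namespace FrobeniusData
open BarAlg Module.End
variable {k A ι : Type u} [Field k] [Ring A] [Algebra k A] [DecidableEq ι]
  (F : FrobeniusData k A ι)

theorem nuE_insD {n : ℕ} {ζ : BarAlg k A} (hζ : ζ ∈ deg k A n)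
    (hc : ∀ a, of k a * ζ = ζ * of k a) (hν : F.nuE ζ = ζ) (x : BarAlg k A) :
    insD n ζ (F.nuE x) = F.nuE (insD n ζ x) := by
  rw [insD_eq hζ hc, insD_eq hζ hc, nuE, cutSum_mapA, ← AlgHom.toLinearMap_apply, map_cutSum]
  refine cutSum_ext (fun y w => ?_) x
  simp only [LinearMap.compl₁₂_apply, LinearMap.compr₂_apply, AlgHom.toLinearMap_apply,
    LinearMap.mulLeft_apply, LinearMap.mul_apply', map_mul (mapA (F.nu : A →ₐ[k] A)), mapA_sg]
  rw [← nuE, hν]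

theorem cutSum_rotForm_nuE {V : Type*} [AddCommGroup V] [Module k V] {φ : BarAlg k A →ₗ[k] V}
    (hφ : ∀ x, φ (F.nuE x) = φ x) (c : k) (x : BarAlg k A) :
    cutSum (rotForm φ (F.nuSg c)) (F.nuE x) = cutSum (rotForm φ (F.nuSg c)) x := by
  rw [nuE, cutSum_mapA, ← nuE]
  refine cutSum_ext (fun y w => ?_) x
  simp only [LinearMap.compl₁₂_apply, rotForm_apply, AlgHom.toLinearMap_apply, nuSg_apply]
  rw [← nuE_sg, ← map_mul F.nuE, hφ]

variable [Fintype ι]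

theorem ext_star_apply {m p N : ℕ} (h : m = N + (p + 1)) (f : Coch k A m 0) (z : LBar k A p)
    (x : BarAlg k A) : ext (F.star h f z) x = ext f (x * F.nm p z) := by
  suffices H : ext (F.star h f z) = ext f ∘ₗ LinearMap.mulRight k (F.nm p z) from
    LinearMap.congr_fun H x
  refine (ext_isC _).ext (q := 0) ⟨fun a x => ?_, fun x a => ?_, fun e x hx he => ?_, fun x hx => ?_⟩
    (F.ext_star h f z)
  · simp [mul_assoc, (ext_isC f).of_mul]
  · simp only [LinearMap.comp_apply, LinearMap.mulRight_apply, mul_assoc, of_mul_nm]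
    rw [← mul_assoc, (ext_isC f).mul_of]
  · exact (ext_isC f).supp _ _ (mul_mem hx (F.nm_mem z)) (by omega)
  · exact (ext_isC f).mem' _

theorem star_mem {m p N : ℕ} (h : m = N + (p + 1)) {f : Coch k A m 0} {z : LBar k A p}
    (hf : ext f ∘ₗ d = 0) (hz : d (F.nm p z) = 0) : ext (F.star h f z) ∘ₗ d = 0 := by
  refine LinearMap.ext fun x => ?_
  have h1 := LinearMap.congr_fun hf (x * F.nm p z)
  rw [LinearMap.comp_apply, d_mul, hz, mul_zero, zero_add] at h1
  rw [LinearMap.comp_apply, ext_star_apply, h1, LinearMap.zero_apply, LinearMap.zero_apply]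

theorem posT_eq_self_iff {r : ℕ} (f : Coch k A r 0) :
    F.posT r f = f ↔ ∀ x, F.tr (ext f) (F.nuE x) = F.tr (ext f) x := by
  refine ⟨fun h x => ?_, fun h => ext_injective (F.eq_of_tr (ext_isC _) (ext_isC _) fun x => ?_)⟩
  · rw [← tr_posT, h]
  · rw [tr_posT, h]

theorem posT_star {m p N : ℕ} (h : m = N + (p + 1)) {f : Coch k A m 0} {z : LBar k A p}
    (hf : F.posT m f = f) (hz : F.nuE (F.nm p z) = F.nm p z) :
    F.posT N (F.star h f z) = F.star h f z := by
  rw [posT_eq_self_iff] at hf ⊢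
  intro x
  rw [tr_apply, tr_apply, ext_star_apply, ext_star_apply, ← tr_apply, ← tr_apply, ← hf (x * _),
    map_mul F.nuE, hz]

theorem posT_Delta {M r : ℕ} (hM : M = r + 1) {f : Coch k A M 0} (hf : F.posT M f = f) :
    F.posT r (F.Delta hM f) = F.Delta hM f := by
  rw [posT_eq_self_iff] at hf ⊢
  intro x
  rw [tr_Delta, tr_Delta, cutSum_rotForm_nuE _ hf]

theorem Delta_mem {M r : ℕ} (hM : M = r + 1) {f : Coch k A M 0} (hf : ext f ∘ₗ d = 0)
    (hf' : F.posT M f = f) : ext (F.Delta hM f) ∘ₗ d = 0 := by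
  subst hM
  rw [← ext_delta, delta_Delta _ hf, hf', sub_self, map_zero]

theorem d_nm_connes_of_inv {M p : ℕ} (hM : M = p + 1) {z : LBar k A p} (hz : d (F.nm p z) = 0)
    (hz' : F.nuE (F.nm p z) = F.nm p z) : d (F.nm M (connes F.nu.symm hM z)) = 0 := by
  subst hM
  rw [d_nm_connes _ hz, sub_eq_zero, ← hz', alE_nuE, hz']

theorem nuE_nm_connes {M p : ℕ} (hM : M = p + 1) {z : LBar k A p}
    (hz : F.nuE (F.nm p z) = F.nm p z) :
    F.nuE (F.nm M (connes F.nu.symm hM z)) = F.nm M (connes F.nu.symm hM z) := by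
  rw [nm_connes]
  have h : F.nuE (cutSum (rotForm F.cas (F.alSg ((-1) ^ p))) (chainEl k A p z)) =
      cutSum (rotForm F.cas (F.alSg ((-1) ^ p))) (F.nuE (chainEl k A p z)) := by
    rw [← AlgHom.toLinearMap_apply, map_cutSum, nuE, cutSum_mapA, ← nuE]
    refine cutSum_ext (fun y w => ?_) _
    simp only [LinearMap.compl₁₂_apply, LinearMap.compr₂_apply, rotForm_apply,
      AlgHom.toLinearMap_apply, alSg_apply]
    rw [← nuE_sg, alE_nuE, ← cas_nuE, map_mul F.nuE, nuE_alE]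
  refine h.trans (sub_eq_zero.1 ((map_sub (cutSum _) _ _).symm.trans ?_))
  exact (F.isTr_cutSum_al F.cas ((-1) ^ p)).eq_zero (fun a => cutSum_of _ a)
    (by rw [map_sub, cas_nuE, ← nm_apply, hz, sub_self])

/-- The form of a bracket with a chain. -/
theorem tr_brace {m n : ℕ} (hn : 1 ≤ n) (hmn : n < m) (f : Coch k A m 0) (z : LBar k A (n - 1))
    (x : BarAlg k A) : F.tr (ext (F.brace hn hmn f z)) x = (-1 : k) ^ (m * n + m + n) *
      ((-1 : k) ^ (m + 1) * cutSum (rotForm (F.tr (ext f) ∘ₗ LinearMap.mulRight k (F.nm (n - 1) z))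
          (F.nuSg ((-1) ^ (m - n - 1)))) x +
        (-1 : k) ^ m * cutSum (rotForm (F.tr (ext f)) (F.nuSg ((-1) ^ (m - 1)))) (x * F.nm (n - 1) z) +
        (-1 : k) ^ n * F.tr (ext f) (x * F.nm n (connes F.nu.symm (by omega) z))) := by
  have e : F.tr (ext (F.star (by omega : m = m - n - 1 + 1 + (n - 1 + 1)) f z)) =
      F.tr (ext f) ∘ₗ LinearMap.mulRight k (F.nm (n - 1) z) := LinearMap.ext fun y => by
    rw [tr_apply, ext_star_apply]; rfl
  rw [← e, ← F.tr_Delta rfl, ← F.tr_Delta (by omega : m = m - 1 + 1)]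
  simp only [brace, map_smul, map_add, tr_apply, LinearMap.smul_apply, LinearMap.add_apply,
    ext_star_apply, smul_eq_mul]

theorem brace_mem {m n : ℕ} (hn : 1 ≤ n) (hmn : n < m) {f : Coch k A m 0} {z : LBar k A (n - 1)}
    (hf : ext f ∘ₗ d = 0) (hf' : F.posT m f = f) (hz : d (F.nm (n - 1) z) = 0)
    (hz' : F.nuE (F.nm (n - 1) z) = F.nm (n - 1) z) :
    ext (F.brace hn hmn f z) ∘ₗ d = 0 ∧ F.posT (m - n - 1) (F.brace hn hmn f z) =
      F.brace hn hmn f z := by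
  constructor
  · simp only [brace, map_smul, map_add, LinearMap.add_comp, LinearMap.smul_comp]
    rw [F.Delta_mem rfl (F.star_mem _ hf hz) (F.posT_star _ hf' hz'),
      F.star_mem _ (F.Delta_mem _ hf hf') hz, F.star_mem _ hf (F.d_nm_connes_of_inv _ hz hz')]
    simp
  · simp only [brace, map_smul, map_add]
    rw [F.posT_Delta rfl (F.posT_star _ hf' hz'), F.posT_star _ (F.posT_Delta _ hf') hz',
      F.posT_star _ hf' (F.nuE_nm_connes _ hz')]

end FrobeniusData

end
end TateHH

namespace TateHH
noncomputable section

namespace BarAlg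
variable {k A : Type u} [Field k] [Ring A] [Algebra k A]
variable {V W : Type*} [AddCommGroup V] [Module k V] [AddCommGroup W] [Module k W]

theorem map_cutSum₃ (g : W →ₗ[k] V) {T : BarAlg k A →ₗ[k] BarAlg k A →ₗ[k] BarAlg k A →ₗ[k] W}
    {T' : BarAlg k A →ₗ[k] BarAlg k A →ₗ[k] BarAlg k A →ₗ[k] V}
    (h : ∀ x y z, T' x y z = g (T x y z)) (x : BarAlg k A) :
    g (cutSum₃ T x) = cutSum₃ T' x := by
  rw [cutSum₃, cutSum₃, map_cutSum]
  refine cutSum_ext (fun y w => ?_) x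
  rw [LinearMap.compr₂_apply, LinearMap.comp_apply, LinearMap.comp_apply, cutSumₗ_apply,
    cutSumₗ_apply, map_cutSum]
  exact cutSum_ext (fun u v => (h y u v).symm) w

/-- Pairs of cuts and differentials: the form of `cutSum₃_d` in which the terms are only compared
on homogeneous elements. -/
theorem cutSum₃_homotopy (Φ g : W →ₗ[k] V)
    {T T' : BarAlg k A →ₗ[k] BarAlg k A →ₗ[k] BarAlg k A →ₗ[k] W}
    {P Q : BarAlg k A →ₗ[k] BarAlg k A →ₗ[k] W}
    (h1 : ∀ x a y z, T' (x * of k a) y z = T' x (of k a * y) z) (h2 : ∀ x, Balanced (T' x))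
    {n : ℕ} {x : BarAlg k A} (hx : x ∈ deg k A n)
    (hT : ∀ (a b c : ℕ) (y w v : BarAlg k A), a + b + c = n + 2 → 1 ≤ a → 1 ≤ b → 1 ≤ c →
      y ∈ deg k A a → w ∈ deg k A b → v ∈ deg k A c → Φ (T y w v) =
        g (T' (d y) w v - T' (sg (-1) y) (d w) v + T' (sg (-1) y) (sg (-1) w) (d v)))
    (hP : ∀ (a b : ℕ) (y w : BarAlg k A), a + b = n + 1 → 1 ≤ a → 1 ≤ b → y ∈ deg k A a →
      w ∈ deg k A b → P y w = T' (sg (-1) y) (sg (-1) w) 1)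
    (hQ : ∀ (a b : ℕ) (y w : BarAlg k A), a + b = n + 1 → 1 ≤ a → 1 ≤ b → y ∈ deg k A a →
      w ∈ deg k A b → Q y w = T' (sg (-1) y) 1 w) :
    Φ (cutSum₃ T x) = g (cutSum₃ T' (d x) + cutSum (T' 1) x + cutSum P x - cutSum Q x) := by
  let D : BarAlg k A →ₗ[k] BarAlg k A →ₗ[k] BarAlg k A →ₗ[k] W :=
    mk₃ (fun y w v =>
      T' (d y) w v - T' (sg (-1) y) (d w) v + T' (sg (-1) y) (sg (-1) w) (d v))
      (by intros; simp only [map_add, LinearMap.add_apply]; abel)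
      (by intros; simp only [map_smul, LinearMap.smul_apply]; module)
      (by intros; simp only [map_add, LinearMap.add_apply]; abel)
      (by intros; simp only [map_smul, LinearMap.smul_apply]; module)
      (by intros; simp only [map_add]; abel)
      (by intros; simp only [map_smul]; module)
  let P' : BarAlg k A →ₗ[k] BarAlg k A →ₗ[k] W :=
    LinearMap.mk₂ k (fun y w => T' (sg (-1) y) (sg (-1) w) 1) (by intros; simp) (by intros; simp)
      (by intros; simp) (by intros; simp)
  let Q' : BarAlg k A →ₗ[k] BarAlg k A →ₗ[k] W :=
    LinearMap.mk₂ k (fun y w => T' (sg (-1) y) 1 w) (by intros; simp) (by intros; simp)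
      (by intros; simp) (by intros; simp)
  have e1 := cutSum₃_d T' D P' Q' h1 h2 (fun _ _ _ => rfl) (fun _ _ => rfl) (fun _ _ => rfl) x
  rw [cutSum_congr' (T' := P') hx hP, cutSum_congr' (T' := Q') hx hQ]
  refine Eq.trans ?_ (congrArg g e1)
  let E : (W →ₗ[k] V) → (BarAlg k A →ₗ[k] BarAlg k A →ₗ[k] BarAlg k A →ₗ[k] W) →
      BarAlg k A →ₗ[k] BarAlg k A →ₗ[k] BarAlg k A →ₗ[k] V := fun Φ T =>
    mk₃ (fun y w v => Φ (T y w v)) (by intros; simp) (by intros; simp) (by intros; simp)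
      (by intros; simp) (by intros; simp) (by intros; simp)
  rw [map_cutSum₃ Φ (T' := E Φ T) (fun _ _ _ => rfl),
    map_cutSum₃ g (T' := E g D) (fun _ _ _ => rfl)]
  exact cutSum₃_congr hx hT

end BarAlg

namespace FrobeniusData
open BarAlg Module.End
variable {k A ι : Type u} [Field k] [Ring A] [Algebra k A] [DecidableEq ι] [Fintype ι]
  (F : FrobeniusData k A ι)

/-- `(y, w₀, w₁) ↦ (x ↦ ∑ φ(w₀ v_l x u_i w₁) u_l y v_i)`. -/
def casForm (φ : BarAlg k A →ₗ[k] k) : BarAlg k A →ₗ[k] BarAlg k A →ₗ[k] BarAlg k A →ₗ[k]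
    (BarAlg k A →ₗ[k] BarAlg k A) :=
  mk₃ (fun y w₀ w₁ => ∑ l, ∑ i, (φ ∘ₗ LinearMap.mulLeft k (w₀ * of k (F.v l)) ∘ₗ
      LinearMap.mulRight k (of k (F.u i) * w₁)).smulRight (of k (F.u l) * y * of k (F.v i)))
    (fun _ _ _ _ => LinearMap.ext fun _ => by
      simp [LinearMap.sum_apply, mul_add, add_mul, mul_assoc, Finset.sum_add_distrib])
    (fun _ _ _ _ => LinearMap.ext fun _ => by
      simp [LinearMap.sum_apply, mul_assoc, smul_smul, Finset.smul_sum, mul_comm])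
    (fun _ _ _ _ => LinearMap.ext fun _ => by
      simp [LinearMap.sum_apply, add_mul, mul_assoc, add_smul, Finset.sum_add_distrib])
    (fun _ _ _ _ => LinearMap.ext fun _ => by
      simp [LinearMap.sum_apply, mul_assoc, smul_smul, Finset.smul_sum])
    (fun _ _ _ _ => LinearMap.ext fun _ => by
      simp [LinearMap.sum_apply, mul_add, mul_assoc, add_smul, Finset.sum_add_distrib])
    (fun _ _ _ _ => LinearMap.ext fun _ => by
      simp [LinearMap.sum_apply, mul_assoc, smul_smul, Finset.smul_sum])

theorem casForm_apply (φ : BarAlg k A →ₗ[k] k) (y w₀ w₁ x : BarAlg k A) :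
    F.casForm φ y w₀ w₁ x = ∑ l, ∑ i, φ (w₀ * of k (F.v l) * (x * (of k (F.u i) * w₁))) •
      (of k (F.u l) * y * of k (F.v i)) := by
  simp [casForm, LinearMap.sum_apply, mul_assoc]

theorem casForm_mul_of (φ : BarAlg k A →ₗ[k] k) (y w₀ w₁ : BarAlg k A) (a : A) :
    F.casForm φ (y * of k a) w₀ w₁ = F.casForm φ y w₀ (of k (F.nu a) * w₁) := by
  refine LinearMap.ext fun x => ?_
  simp only [casForm_apply]
  refine Finset.sum_congr rfl fun l _ => ?_
  have h := F.casimir_nu (LinearMap.mk₂ k (fun u v =>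
    φ (w₀ * of k (F.v l) * (x * (of k u * w₁))) • (of k (F.u l) * y * of k v))
    (by intros; simp [mul_add, add_mul, add_smul]) (by intros; simp [smul_smul])
    (by intros; simp [mul_add]) (by intros; simp [smul_smul, mul_comm])) a
  simp only [LinearMap.mk₂_apply, map_mul] at h
  simp only [mul_assoc] at h ⊢
  exact h.symm

theorem casForm_of_mul (φ : BarAlg k A →ₗ[k] k) (y w₀ w₁ : BarAlg k A) (a : A) :
    F.casForm φ (of k a * y) w₀ w₁ = F.casForm φ y (w₀ * of k (F.nu.symm a)) w₁ := by
  refine LinearMap.ext fun x => ?_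
  simp only [casForm_apply]
  rw [Finset.sum_comm]
  conv_rhs => rw [Finset.sum_comm]
  refine Finset.sum_congr rfl fun i _ => ?_
  have h := F.casimir_nu (LinearMap.mk₂ k (fun u v =>
    φ (w₀ * of k v * (x * (of k (F.u i) * w₁))) • (of k u * y * of k (F.v i)))
    (by intros; simp [add_mul]) (by intros; simp [smul_smul, mul_comm])
    (by intros; simp [mul_add, add_mul, add_smul]) (by intros; simp [smul_smul])) (F.nu.symm a)
  simp only [LinearMap.mk₂_apply, map_mul, AlgEquiv.apply_symm_apply] at h
  simp only [mul_assoc] at h ⊢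
  exact h

theorem casForm_left {φ : BarAlg k A →ₗ[k] k} (hφ : IsTr F.nu.symm φ) (y w₀ w₁ : BarAlg k A)
    (a : A) : F.casForm φ y (of k a * w₀) w₁ = F.casForm φ y w₀ (w₁ * of k (F.nu a)) := by
  refine LinearMap.ext fun x => ?_
  simp only [casForm_apply, mul_assoc]
  refine Finset.sum_congr rfl fun l _ => Finset.sum_congr rfl fun i _ => ?_
  rw [hφ.of_mul]
  simp only [mul_assoc, AlgEquiv.symm_symm]

theorem d_casForm (φ : BarAlg k A →ₗ[k] k) (y w₀ w₁ x : BarAlg k A) :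
    d (F.casForm φ y w₀ w₁ x) = F.casForm φ (d y) w₀ w₁ x := by
  simp [casForm_apply, mul_assoc]

theorem casForm_d {φ : BarAlg k A →ₗ[k] k} (hφ : ∀ x, φ (d x) = 0) (y w₀ w₁ x : BarAlg k A) :
    F.casForm φ y (d w₀) w₁ x + F.casForm φ y (sg (-1) w₀) w₁ (d x) +
      F.casForm φ y (sg (-1) w₀) (d w₁) (sg (-1) x) = 0 := by
  simp only [casForm_apply, ← Finset.sum_add_distrib, ← add_smul]
  refine Finset.sum_eq_zero fun l _ => Finset.sum_eq_zero fun i _ => ?_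
  have h := hφ (w₀ * of k (F.v l) * (x * (of k (F.u i) * w₁)))
  rw [d_mul, d_mul w₀, d_mul x, d_of_mul, d_of, mul_zero, zero_add, map_mul (sg (-1)), sg_of,
    mul_add, map_add, map_add] at h
  convert zero_smul k _ using 2
  linear_combination h

theorem casForm_one_right {s : ℕ} {G : BarAlg k A →ₗ[k] BarAlg k A} (hG : IsC s 0 G)
    (y w x : BarAlg k A) : F.casForm (F.tr G) y w 1 x =
      ∑ l, of k (F.u l) * (y * G (w * (of k (F.v l) * x))) := by
  rw [casForm_apply]
  refine Finset.sum_congr rfl fun l _ => ?_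
  rw [← F.sum_tr_mul_u hG (w * (of k (F.v l) * x))]
  simp only [Finset.mul_sum, mul_smul_comm, mul_one, mul_assoc]

theorem casForm_one_mid {s : ℕ} {G : BarAlg k A →ₗ[k] BarAlg k A} (hG : IsC s 0 G)
    (y w x : BarAlg k A) : F.casForm (F.tr G) y 1 w x =
      ∑ i, G (x * (of k (F.u i) * w)) * (y * of k (F.v i)) := by
  rw [casForm_apply, Finset.sum_comm]
  refine Finset.sum_congr rfl fun i _ => ?_
  rw [← F.sum_tr_v_mul hG (x * (of k (F.u i) * w))]
  simp only [Finset.sum_mul, smul_mul_assoc, one_mul, mul_assoc]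

end FrobeniusData

end
end TateHH

namespace TateHH
noncomputable section

namespace BarAlg
variable {k A : Type u} [Field k] [Ring A] [Algebra k A]
variable {V : Type*} [AddCommGroup V] [Module k V]

theorem isTr_cutSum₃ {σ : A ≃ₐ[k] A}
    {T : BarAlg k A →ₗ[k] BarAlg k A →ₗ[k] BarAlg k A →ₗ[k] V}
    (h : ∀ b x y z, T x y (z * of k b) = T (of k (σ b) * x) y z) : IsTr σ (cutSum₃ T) := by
  intro y b
  rw [cutSum₃_of_mul, cutSum₃, cutSum_mul_of]
  refine cutSum_ext (fun u v => ?_) y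
  rw [LinearMap.compl₂_apply, LinearMap.mulRight_apply, LinearMap.comp_apply, LinearMap.comp_apply,
    cutSumₗ_apply, cutSumₗ_apply, cutSum_mul_of]
  exact cutSum_ext (fun s t => h _ _ _ _) v

end BarAlg

namespace FrobeniusData
open BarAlg Module.End
variable {k A ι : Type u} [Field k] [Ring A] [Algebra k A] [DecidableEq ι] [Fintype ι]
  (F : FrobeniusData k A ι)

theorem casForm_supp {s : ℕ} {G : BarAlg k A →ₗ[k] BarAlg k A} (hG : IsC s 0 G) {a b e : ℕ}
    (y : BarAlg k A) {w₀ w₁ x : BarAlg k A} (h₀ : w₀ ∈ deg k A a) (h₁ : w₁ ∈ deg k A b)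
    (hx : x ∈ deg k A e) (h : a + e + b ≠ s + 1) : F.casForm (F.tr G) y w₀ w₁ x = 0 := by
  rw [casForm_apply]
  refine Finset.sum_eq_zero fun l _ => Finset.sum_eq_zero fun i _ => ?_
  rw [F.tr_supp hG (mul_mem (mul_of_mem _ h₀) (mul_mem hx (of_mul_mem _ h₁))) (by omega), zero_smul]

/-- The form of the homotopy in which the middle piece is in front. -/
def formA (φ : BarAlg k A →ₗ[k] k) (c₀ c₁ c₂ : k) : BarAlg k A →ₗ[k] BarAlg k A →ₗ[k]
    BarAlg k A →ₗ[k] (BarAlg k A →ₗ[k] BarAlg k A) :=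
  mk₃ (fun y₁ y₂ y₃ => c₀ • F.casForm φ (sg c₂ y₂) (y₃ * F.alSg c₁ y₁) 1)
    (by intros; simp [mul_add]) (by intros; simp [smul_comm c₀]) (by intros; simp)
    (by intros; simp [smul_comm c₀]) (by intros; simp [add_mul]) (by intros; simp [smul_comm c₀])

/-- The form of the homotopy in which the last piece is in front. -/
def formB (φ : BarAlg k A →ₗ[k] k) (c₀ c₁ c₂ : k) : BarAlg k A →ₗ[k] BarAlg k A →ₗ[k]
    BarAlg k A →ₗ[k] (BarAlg k A →ₗ[k] BarAlg k A) :=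
  mk₃ (fun y₁ y₂ y₃ => c₀ • F.casForm φ y₃ (F.alSg c₂ y₂) (sg c₁ y₁))
    (by intros; simp) (by intros; simp [smul_comm c₀]) (by intros; simp)
    (by intros; simp [smul_comm c₀]) (by intros; simp) (by intros; simp [smul_comm c₀])

theorem formA_apply (φ : BarAlg k A →ₗ[k] k) (c₀ c₁ c₂ : k) (y₁ y₂ y₃ : BarAlg k A) :
    F.formA φ c₀ c₁ c₂ y₁ y₂ y₃ = c₀ • F.casForm φ (sg c₂ y₂) (y₃ * F.alSg c₁ y₁) 1 := rfl

theorem formB_apply (φ : BarAlg k A →ₗ[k] k) (c₀ c₁ c₂ : k) (y₁ y₂ y₃ : BarAlg k A) :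
    F.formB φ c₀ c₁ c₂ y₁ y₂ y₃ = c₀ • F.casForm φ y₃ (F.alSg c₂ y₂) (sg c₁ y₁) := rfl

theorem formA_deg (φ : BarAlg k A →ₗ[k] k) (c₀ c₁ c₂ : k) {a b : ℕ} {y₁ y₂ : BarAlg k A}
    (h₁ : y₁ ∈ deg k A a) (h₂ : y₂ ∈ deg k A b) (y₃ : BarAlg k A) :
    F.formA φ c₀ c₁ c₂ y₁ y₂ y₃ =
      (c₀ * (c₁ ^ a * c₂ ^ b)) • F.casForm φ y₂ (y₃ * F.alE y₁) 1 := by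
  rw [formA_apply, sg_deg _ h₂, F.alSg_deg _ h₁]
  simp only [map_smul, LinearMap.smul_apply, mul_smul_comm, smul_smul]

theorem formB_deg (φ : BarAlg k A →ₗ[k] k) (c₀ c₁ c₂ : k) {a b : ℕ} {y₁ y₂ : BarAlg k A}
    (h₁ : y₁ ∈ deg k A a) (h₂ : y₂ ∈ deg k A b) (y₃ : BarAlg k A) :
    F.formB φ c₀ c₁ c₂ y₁ y₂ y₃ = (c₀ * (c₁ ^ a * c₂ ^ b)) • F.casForm φ y₃ (F.alE y₂) y₁ := by
  rw [formB_apply, sg_deg _ h₁, F.alSg_deg _ h₂]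
  simp only [map_smul, LinearMap.smul_apply, smul_smul]

theorem formA_balanced₁ (φ : BarAlg k A →ₗ[k] k) (c₀ c₁ c₂ : k) (y₁ : BarAlg k A) (a : A)
    (y₂ y₃ : BarAlg k A) :
    F.formA φ c₀ c₁ c₂ (y₁ * of k a) y₂ y₃ = F.formA φ c₀ c₁ c₂ y₁ (of k a * y₂) y₃ := by
  simp only [formA_apply, alSg_apply, map_mul (sg _), map_mul F.alE, sg_of, alE_of, casForm_of_mul,
    mul_assoc]

theorem formA_balanced₂ {φ : BarAlg k A →ₗ[k] k} (hφ : IsTr F.nu.symm φ) (c₀ c₁ c₂ : k)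
    (y₁ : BarAlg k A) : Balanced (F.formA φ c₀ c₁ c₂ y₁) := fun y₂ a y₃ => by
  simp only [formA_apply, map_mul (sg _), sg_of, casForm_mul_of, F.casForm_left hφ, mul_assoc,
    mul_one, one_mul]

theorem formB_balanced₁ {φ : BarAlg k A →ₗ[k] k} (hφ : IsTr F.nu.symm φ) (c₀ c₁ c₂ : k)
    (y₁ : BarAlg k A) (a : A) (y₂ y₃ : BarAlg k A) :
    F.formB φ c₀ c₁ c₂ (y₁ * of k a) y₂ y₃ = F.formB φ c₀ c₁ c₂ y₁ (of k a * y₂) y₃ := by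
  simp only [formB_apply, alSg_apply, map_mul (sg _), map_mul F.alE, sg_of, alE_of,
    F.casForm_left hφ, AlgEquiv.apply_symm_apply]

theorem formB_balanced₂ (φ : BarAlg k A →ₗ[k] k) (c₀ c₁ c₂ : k)
    (y₁ : BarAlg k A) : Balanced (F.formB φ c₀ c₁ c₂ y₁) := fun y₂ a y₃ => by
  simp only [formB_apply, alSg_apply, map_mul (sg _), map_mul F.alE, sg_of, alE_of,
    casForm_of_mul]

theorem isTr_formA (φ : BarAlg k A →ₗ[k] k) (c₀ c₁ c₂ : k) :
    IsTr F.nu (cutSum₃ (F.formA φ c₀ c₁ c₂)) := isTr_cutSum₃ fun b y₁ y₂ y₃ => by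
  simp only [formA_apply, alSg_apply, map_mul (sg _), map_mul F.alE, sg_of, alE_of,
    AlgEquiv.symm_apply_apply, mul_assoc]

theorem isTr_formB (φ : BarAlg k A →ₗ[k] k) (c₀ c₁ c₂ : k) :
    IsTr F.nu (cutSum₃ (F.formB φ c₀ c₁ c₂)) := isTr_cutSum₃ fun b y₁ y₂ y₃ => by
  simp only [formB_apply, map_mul (sg _), sg_of, casForm_mul_of]

/-- `V ↦ d V(x) + (-1)^r V(d x)`. -/
def homot (r : ℕ) (x : BarAlg k A) : (BarAlg k A →ₗ[k] BarAlg k A) →ₗ[k] BarAlg k A :=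
  d ∘ₗ LinearMap.applyₗ x + (-1 : k) ^ r • LinearMap.applyₗ (d x)

theorem homot_apply (r : ℕ) (x : BarAlg k A) (V : BarAlg k A →ₗ[k] BarAlg k A) :
    homot r x V = d (V x) + (-1 : k) ^ r • V (d x) := rfl

theorem homot_formA {m n r : ℕ} (hm : m = r + n + 1) {f : Coch k A m 0} (hf : ext f ∘ₗ d = 0)
    {a b c : ℕ} (habc : a + b + c = n + 2) (ha : 1 ≤ a) (hb : 1 ≤ b)
    {y₁ y₂ y₃ : BarAlg k A} (h₁ : y₁ ∈ deg k A a) (h₂ : y₂ ∈ deg k A b) (h₃ : y₃ ∈ deg k A c)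
    (x : BarAlg k A) :
    homot r x (F.formA (F.tr (ext f)) ((-1) ^ m) ((-1) ^ (n + 1)) ((-1) ^ (m + 1)) y₁ y₂ y₃) =
      LinearMap.applyₗ x (F.formA (F.tr (ext f)) 1 ((-1) ^ n) ((-1) ^ (m + 1)) (d y₁) y₂ y₃ -
        F.formA (F.tr (ext f)) 1 ((-1) ^ n) ((-1) ^ (m + 1)) (sg (-1) y₁) (d y₂) y₃ +
        F.formA (F.tr (ext f)) 1 ((-1) ^ n) ((-1) ^ (m + 1)) (sg (-1) y₁) (sg (-1) y₂) (d y₃)) := by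
  obtain ⟨a, rfl⟩ : ∃ a', a = a' + 1 := ⟨a - 1, by omega⟩
  obtain ⟨b, rfl⟩ : ∃ b', b = b' + 1 := ⟨b - 1, by omega⟩
  have hq := F.casForm_d (F.tr_d hf) y₂ (y₃ * F.alE y₁) 1 x
  have h₀ : y₃ * F.alE y₁ ∈ deg k A (c + (a + 1)) := mul_mem h₃ (F.alE_mem h₁)
  rw [sg_deg _ h₀, d_mul, sg_deg _ h₃, d_alE, d_deg_zero one_mem] at hq
  rw [homot_apply, F.formA_deg _ _ _ _ h₁ h₂, F.formA_deg _ _ _ _ (d_mem h₁) h₂,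
    F.formA_deg _ _ _ _ (sg_mem _ h₁) (d_mem h₂), F.formA_deg _ _ _ _ (sg_mem _ h₁) (sg_mem _ h₂),
    sg_deg _ h₁, sg_deg _ h₂]
  simp only [LinearMap.applyₗ_apply_apply, LinearMap.smul_apply, LinearMap.sub_apply,
    LinearMap.add_apply, map_smul, d_casForm, mul_smul_comm, smul_mul_assoc, map_add,
    map_zero, add_zero, LinearMap.zero_apply, smul_smul] at hq ⊢
  have hz := congrArg (fun v => (-1 : k) ^ (c + (a + 1)) • v) hq
  simp only [smul_add, smul_smul, smul_zero, neg_one_pow_mul_self, one_smul] at hz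
  rw [← eq_neg_iff_add_eq_zero, ← sub_eq_zero, sub_neg_eq_add, add_comm, ← eq_neg_iff_add_eq_zero] at hz
  subst hm
  have hp : Even (a + 1 + (b + 1) + c) ↔ Even (n + 1 + 1) := by rw [habc]
  have e1 : (-1 : k) ^ (r + n + 1) * (((-1) ^ (n + 1)) ^ (a + 1) * ((-1) ^ (r + n + 1 + 1)) ^ (b + 1))
      = -(1 * (((-1) ^ n) ^ (a + 1) * ((-1) ^ (r + n + 1 + 1)) ^ b) * (-1) ^ (a + 1)) := by
    simp only [one_mul, ← pow_mul, ← pow_add]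
    apply neg_one_pow_eq_neg
    simp only [Nat.even_add, Nat.even_mul, Nat.even_add_one] at hp ⊢
    grind
  have e2 : (-1 : k) ^ r * ((-1) ^ (r + n + 1) * (((-1) ^ (n + 1)) ^ (a + 1) *
      ((-1) ^ (r + n + 1 + 1)) ^ (b + 1))) * ((-1) ^ (c + (a + 1)) * (-1) ^ c) =
      -(1 * (((-1) ^ n) ^ a * ((-1) ^ (r + n + 1 + 1)) ^ (b + 1))) := by
    simp only [one_mul, ← pow_mul, ← pow_add]
    apply neg_one_pow_eq_neg
    simp only [Nat.even_add, Nat.even_mul, Nat.even_add_one] at hp ⊢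
    grind
  have e3 : (-1 : k) ^ r * ((-1) ^ (r + n + 1) * (((-1) ^ (n + 1)) ^ (a + 1) *
      ((-1) ^ (r + n + 1 + 1)) ^ (b + 1))) * (-1) ^ (c + (a + 1)) =
      -(1 * (((-1) ^ n) ^ (a + 1) * ((-1) ^ (r + n + 1 + 1)) ^ (b + 1)) *
        ((-1) ^ (a + 1) * (-1) ^ (b + 1))) := by
    simp only [one_mul, ← pow_mul, ← pow_add]
    apply neg_one_pow_eq_neg
    simp only [Nat.even_add, Nat.even_mul, Nat.even_add_one] at hp ⊢
    grind
  rw [hz, smul_neg, smul_add, smul_smul, smul_smul, e2, e3, e1]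
  module

theorem homot_formB {m n r : ℕ} (hm : m = r + n + 1) {f : Coch k A m 0} (hf : ext f ∘ₗ d = 0)
    {a b c : ℕ} (habc : a + b + c = n + 2) (ha : 1 ≤ a) (hb : 1 ≤ b)
    {y₁ y₂ y₃ : BarAlg k A} (h₁ : y₁ ∈ deg k A a) (h₂ : y₂ ∈ deg k A b)
    {x : BarAlg k A} {e : ℕ} (hx : x ∈ deg k A e) :
    homot r x (F.formB (F.tr (ext f)) (-(-1) ^ (m * n + m)) ((-1) ^ (n + 1)) ((-1) ^ (r + 1))
        y₁ y₂ y₃) =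
      LinearMap.applyₗ x
        (F.formB (F.tr (ext f)) (-(-1) ^ (m * n + m)) ((-1) ^ n) ((-1) ^ r) (d y₁) y₂ y₃ -
        F.formB (F.tr (ext f)) (-(-1) ^ (m * n + m)) ((-1) ^ n) ((-1) ^ r) (sg (-1) y₁) (d y₂) y₃ +
        F.formB (F.tr (ext f)) (-(-1) ^ (m * n + m)) ((-1) ^ n) ((-1) ^ r) (sg (-1) y₁) (sg (-1) y₂)
          (d y₃)) := by
  obtain ⟨a, rfl⟩ : ∃ a', a = a' + 1 := ⟨a - 1, by omega⟩
  obtain ⟨b, rfl⟩ : ∃ b', b = b' + 1 := ⟨b - 1, by omega⟩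
  have hq := F.casForm_d (F.tr_d hf) y₃ (F.alE y₂) y₁ x
  rw [sg_deg _ (F.alE_mem h₂), sg_deg _ hx, d_alE] at hq
  rw [homot_apply, F.formB_deg _ _ _ _ h₁ h₂, F.formB_deg _ _ _ _ (d_mem h₁) h₂,
    F.formB_deg _ _ _ _ (sg_mem _ h₁) (d_mem h₂), F.formB_deg _ _ _ _ (sg_mem _ h₁) (sg_mem _ h₂),
    sg_deg _ h₁, sg_deg _ h₂]
  simp only [LinearMap.applyₗ_apply_apply, LinearMap.smul_apply, LinearMap.sub_apply,
    LinearMap.add_apply, map_smul, d_casForm, smul_smul] at hq ⊢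
  have hz := congrArg (fun v => (-1 : k) ^ (b + 1) • v) hq
  simp only [smul_add, smul_smul, smul_zero, ← mul_assoc, neg_one_pow_mul_self, one_smul] at hz
  have hx₁ : F.casForm (F.tr (ext f)) y₃ (F.alE y₂) (d y₁) x = 0 ∨ b + 1 + e + a = m + 1 :=
    or_iff_not_imp_right.2 (F.casForm_supp (ext_isC f) y₃ (F.alE_mem h₂) (d_mem h₁) hx)
  subst hm
  have e2 : (-1 : k) ^ r * ((-1) ^ (n + 1)) ^ (a + 1) * ((-1) ^ (r + 1)) ^ (b + 1) * (-1) ^ (b + 1)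
      = (((-1) ^ n) ^ (a + 1) * ((-1) ^ r) ^ b) * (-1) ^ (a + 1) := by
    simp only [← pow_mul, ← pow_add]
    apply neg_one_pow_congr
    simp only [Nat.even_add, Nat.even_mul, Nat.even_add_one]
    grind
  have e3 : ((-1 : k) ^ (n + 1)) ^ (a + 1) * ((-1) ^ (r + 1)) ^ (b + 1) =
      ((-1) ^ n) ^ (a + 1) * ((-1) ^ r) ^ (b + 1) * ((-1) ^ (a + 1) * (-1) ^ (b + 1)) := by
    simp only [← pow_mul, ← pow_add]
    apply neg_one_pow_congr
    simp only [Nat.even_add, Nat.even_mul, Nat.even_add_one]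
    grind
  have hz' : ∀ {u v w : BarAlg k A}, u + v + w = 0 → v = -(u + w) := fun h =>
    eq_neg_of_add_eq_zero_left ((add_left_comm _ _ _).trans ((add_assoc _ _ _).symm.trans h))
  rw [hz' hz]
  generalize -(-1 : k) ^ ((r + n + 1) * n + (r + n + 1)) = c₀
  rcases hx₁ with h0 | h0
  · rw [h0]
    match_scalars <;> first | linear_combination -c₀ * e3 | linear_combination -c₀ * e2
  have hp : Even (b + 1 + e + a) ↔ Even (r + n + 1 + 1) := by rw [h0]
  have e1 : (-1 : k) ^ r * ((-1) ^ (n + 1)) ^ (a + 1) * ((-1) ^ (r + 1)) ^ (b + 1) *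
      ((-1) ^ (b + 1) * (-1) ^ e * (-1) ^ (b + 1)) = -(((-1) ^ n) ^ a * ((-1) ^ r) ^ (b + 1)) := by
    simp only [← pow_mul, ← pow_add]
    apply neg_one_pow_eq_neg
    simp only [Nat.even_add, Nat.even_mul, Nat.even_add_one] at hp ⊢
    grind
  match_scalars
  · linear_combination -c₀ * e3
  · linear_combination -c₀ * e2
  · linear_combination -c₀ * e1

end FrobeniusData

end
end TateHH

namespace TateHH
noncomputable section

namespace BarAlg
variable {k A : Type u} [Field k] [Ring A] [Algebra k A]

/-- `x ↦ σ_c(y) F(w x)`, for the pairs of pieces `y`, `w` of a word. -/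
def formL (F : BarAlg k A →ₗ[k] BarAlg k A) (c : k) :
    BarAlg k A →ₗ[k] BarAlg k A →ₗ[k] (BarAlg k A →ₗ[k] BarAlg k A) :=
  LinearMap.mk₂ k (fun y w => LinearMap.mulLeft k (sg c y) ∘ₗ F ∘ₗ LinearMap.mulLeft k w)
    (fun _ _ _ => LinearMap.ext fun _ => by simp [add_mul])
    (fun _ _ _ => LinearMap.ext fun _ => by simp)
    (fun _ _ _ => LinearMap.ext fun _ => by simp [add_mul, mul_add])
    (fun _ _ _ => LinearMap.ext fun _ => by simp)

/-- `x ↦ F(x σ_c(y)) w`, for the pairs of pieces `y`, `w` of a word. -/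
def formR (F : BarAlg k A →ₗ[k] BarAlg k A) (c : k) :
    BarAlg k A →ₗ[k] BarAlg k A →ₗ[k] (BarAlg k A →ₗ[k] BarAlg k A) :=
  LinearMap.mk₂ k (fun y w => LinearMap.mulRight k w ∘ₗ F ∘ₗ LinearMap.mulRight k (sg c y))
    (fun _ _ _ => LinearMap.ext fun _ => by simp [add_mul, mul_add])
    (fun _ _ _ => LinearMap.ext fun _ => by simp)
    (fun _ _ _ => LinearMap.ext fun _ => by simp [mul_add])
    (fun _ _ _ => LinearMap.ext fun _ => by simp)

/-- The sum of the `σ_c(ζ₁) F(ζ₂ x)` over the cuts of `ζ`. -/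
def leftCut (F : BarAlg k A →ₗ[k] BarAlg k A) (c : k) (ζ : BarAlg k A) :
    BarAlg k A →ₗ[k] BarAlg k A := cutSum (formL F c) ζ

/-- The sum of the `F(x σ_c(ζ₁)) ζ₂` over the cuts of `ζ`. -/
def rightCut (F : BarAlg k A →ₗ[k] BarAlg k A) (c : k) (ζ : BarAlg k A) :
    BarAlg k A →ₗ[k] BarAlg k A := cutSum (formR F c) ζ

theorem formL_apply (F : BarAlg k A →ₗ[k] BarAlg k A) (c : k) (y w x : BarAlg k A) :
    formL F c y w x = sg c y * F (w * x) := rfl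

theorem formR_apply (F : BarAlg k A →ₗ[k] BarAlg k A) (c : k) (y w x : BarAlg k A) :
    formR F c y w x = F (x * sg c y) * w := rfl

end BarAlg

namespace FrobeniusData
open BarAlg Module.End
variable {k A ι : Type u} [Field k] [Ring A] [Algebra k A] [DecidableEq ι] [Fintype ι]
  (F : FrobeniusData k A ι)

theorem cutSum_cas {V : Type*} [AddCommGroup V] [Module k V]
    {T T' : BarAlg k A →ₗ[k] BarAlg k A →ₗ[k] V}
    (h : ∀ y w, T' y w = ∑ i, T (of k (F.u i) * y) (w * of k (F.v i))) (y : BarAlg k A) :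
    cutSum T (F.cas y) = cutSum T' y := by
  have e : T' = ∑ i, (T.compl₂ (LinearMap.mulRight k (of k (F.v i)))) ∘ₗ
      LinearMap.mulLeft k (of k (F.u i)) :=
    LinearMap.ext fun y => LinearMap.ext fun w => by simp [h, LinearMap.sum_apply]
  rw [cas_apply, map_sum, e, ← cutSumₗ_apply (∑ i, _), map_sum, LinearMap.sum_apply]
  refine Finset.sum_congr rfl fun i _ => ?_
  rw [cutSum_mul_of, cutSum_of_mul, cutSumₗ_apply]

theorem cutSum_formA_one {s : ℕ} {G : BarAlg k A →ₗ[k] BarAlg k A} (hG : IsC s 0 G) (c₁ c₂ : k)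
    (y : BarAlg k A) :
    cutSum (F.formA (F.tr G) 1 c₁ c₂ 1) y = leftCut G c₂ (F.cas y) := by
  refine (F.cutSum_cas (fun y w => LinearMap.ext fun x => ?_) y).symm
  rw [formA_apply, alSg_apply, map_one (sg _), map_one F.alE, mul_one, one_smul, F.casForm_one_right hG,
    LinearMap.sum_apply]
  refine Finset.sum_congr rfl fun i _ => ?_
  rw [formL_apply, map_mul (sg _), sg_of, mul_assoc, mul_assoc]

theorem cutSum_formB_mid {s : ℕ} {G : BarAlg k A →ₗ[k] BarAlg k A} (hG : IsC s 0 G) (c₀ c₁ c₂ : k)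
    (y : BarAlg k A) :
    cutSum ((F.formB (F.tr G) c₀ c₁ c₂).flip 1) y = c₀ • rightCut G c₁ (F.cas y) := by
  rw [rightCut, ← cutSum_smul]
  refine (F.cutSum_cas (fun y w => LinearMap.ext fun x => ?_) y).symm
  rw [LinearMap.flip_apply, formB_apply, alSg_apply, map_one (sg _), map_one F.alE, LinearMap.smul_apply,
    F.casForm_one_mid hG, LinearMap.sum_apply, Finset.smul_sum]
  refine Finset.sum_congr rfl fun i _ => ?_
  rw [LinearMap.smul_apply, LinearMap.smul_apply, LinearMap.smul_apply, formR_apply,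
    map_mul (sg _), sg_of]

theorem cutSum_formA_mid {s : ℕ} {G : BarAlg k A →ₗ[k] BarAlg k A} (hG : IsC s 0 G) (c₁ c₂ : k)
    (y x : BarAlg k A) :
    cutSum ((F.formA (F.tr G) 1 c₁ c₂).flip 1) y x =
      G (cutSum (rotForm F.cas (F.alSg c₁)) y * x) := by
  have h := map_cutSum (LinearMap.applyₗ x) ((F.formA (F.tr G) 1 c₁ c₂).flip 1) y
  refine h.trans ((cutSum_ext (fun v w => ?_) y).trans
    (map_cutSum (G ∘ₗ LinearMap.mulRight k x) (rotForm F.cas (F.alSg c₁)) y).symm)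
  rw [LinearMap.compr₂_apply, LinearMap.compr₂_apply, LinearMap.applyₗ_apply_apply,
    LinearMap.flip_apply, formA_apply, map_one (sg _), one_smul, F.casForm_one_right hG, rotForm_apply,
    cas_apply, LinearMap.comp_apply, LinearMap.mulRight_apply, Finset.sum_mul, map_sum]
  refine Finset.sum_congr rfl fun i _ => ?_
  rw [one_mul, ← hG.of_mul, mul_assoc, mul_assoc, mul_assoc, mul_assoc]

/-- The homotopy between the two sides of the formula for the bracket, up to terms that are
treated by traces. -/
def homotV (m n r : ℕ) (φ : BarAlg k A →ₗ[k] k) (Y : BarAlg k A) : BarAlg k A →ₗ[k] BarAlg k A :=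
  cutSum₃ (F.formA φ ((-1) ^ m) ((-1) ^ (n + 1)) ((-1) ^ (m + 1))) Y +
    cutSum₃ (F.formB φ (-(-1) ^ (m * n + m)) ((-1) ^ (n + 1)) ((-1) ^ (r + 1))) Y

/-- The boundary term of `homotV` that is not expressed by the Casimir element of `Y`. -/
def homotW (m n r : ℕ) (φ : BarAlg k A →ₗ[k] k) (Y : BarAlg k A) : BarAlg k A →ₗ[k] BarAlg k A :=
  cutSum ((F.formB φ (-(-1) ^ (m * n + m)) ((-1) ^ (n + 1)) ((-1) ^ (r + 1))).compr₂
    (LinearMap.applyₗ 1)) Y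

theorem homot_homotV {m n r : ℕ} (hm : m = r + n + 1) {f : Coch k A m 0} (hf : ext f ∘ₗ d = 0)
    {Y : BarAlg k A} (hY : Y ∈ deg k A n) (hd : F.cas (d Y) = 0) {x : BarAlg k A} {e : ℕ}
    (hx : x ∈ deg k A e) :
    homot r x (F.homotV m n r (F.tr (ext f)) Y) =
      leftCut (ext f) ((-1) ^ (m + 1)) (F.cas Y) x +
      (-1 : k) ^ (m * n + m) • rightCut (ext f) ((-1) ^ (n + 1)) (F.cas Y) x -
      ext f (cutSum (rotForm F.cas (F.alSg ((-1) ^ (n + 1)))) Y * x) +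
      F.homotW m n r (F.tr (ext f)) Y x := by
  have hφ := F.isTr_tr (ext_isC f)
  have hA := cutSum₃_homotopy (homot r x) (LinearMap.applyₗ x)
    (P := (-1 : k) • F.formB (F.tr (ext f)) (-(-1) ^ (m * n + m)) ((-1) ^ n) ((-1) ^ r) 1)
    (Q := (F.formA (F.tr (ext f)) 1 ((-1) ^ (n + 1)) ((-1) ^ (m + 1))).flip 1)
    (F.formA_balanced₁ _ 1 ((-1) ^ n) ((-1) ^ (m + 1)))
    (F.formA_balanced₂ hφ 1 ((-1) ^ n) ((-1) ^ (m + 1))) hY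
    (fun a b c y w v habc ha hb _ hy hw hv => F.homot_formA hm hf habc ha hb hy hw hv x)
    (fun a b y w hab _ _ hy hw => by
      rw [F.formA_deg _ _ _ _ (sg_mem _ hy) (sg_mem _ hw), LinearMap.smul_apply,
        LinearMap.smul_apply, F.formB_deg _ _ _ _ one_mem hy, sg_deg _ hy, sg_deg _ hw, one_mul, one_mul,
        map_smul F.alE]
      simp only [map_smul, LinearMap.smul_apply, smul_smul]
      congr 1
      have hp : Even (a + b) ↔ Even (n + 1) := by rw [hab]
      subst hm
      simp only [pow_zero, one_mul, neg_mul, neg_neg, ← pow_mul, ← pow_add]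
      apply neg_one_pow_congr
      simp only [Nat.even_add, Nat.even_mul, Nat.even_add_one] at hp ⊢
      grind)
    (fun a b y w hab _ _ hy hw => by
      rw [LinearMap.flip_apply, F.formA_deg _ _ _ _ hy one_mem,
        F.formA_deg _ _ _ _ (sg_mem _ hy) one_mem, sg_deg _ hy, map_smul F.alE, mul_smul_comm,
        map_smul, LinearMap.smul_apply, smul_smul]
      congr 1
      ring)
  have hB := cutSum₃_homotopy (homot r x) (LinearMap.applyₗ x)
    (P := (F.formB (F.tr (ext f)) (-(-1) ^ (m * n + m)) ((-1) ^ (n + 1)) ((-1) ^ (r + 1))).compr₂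
      (LinearMap.applyₗ 1))
    (Q := (F.formB (F.tr (ext f)) (-(-1) ^ (m * n + m)) ((-1) ^ (n + 1)) ((-1) ^ r)).flip 1)
    (F.formB_balanced₁ hφ _ ((-1) ^ n) ((-1) ^ r))
    (F.formB_balanced₂ _ _ ((-1) ^ n) ((-1) ^ r)) hY
    (fun a b c y w v habc ha hb _ hy hw hv => F.homot_formB hm hf habc ha hb hy hw hx)
    (fun a b y w hab _ _ hy hw => by
      rw [LinearMap.compr₂_apply, LinearMap.applyₗ_apply_apply, F.formB_deg _ _ _ _ hy hw,
        F.formB_deg _ _ _ _ (sg_mem _ hy) (sg_mem _ hw), sg_deg _ hy, sg_deg _ hw]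
      simp only [map_smul, LinearMap.smul_apply, smul_smul]
      congr 1
      ring)
    (fun a b y w hab _ _ hy hw => by
      rw [LinearMap.flip_apply, F.formB_deg _ _ _ _ hy one_mem,
        F.formB_deg _ _ _ _ (sg_mem _ hy) one_mem, sg_deg _ hy, map_smul, smul_smul]
      congr 1
      ring)
  rw [(F.isTr_formA _ _ _ _).eq_zero (fun a => cutSum₃_of _ a) hd, zero_add,
    F.cutSum_formA_one (ext_isC f)] at hA
  rw [(F.isTr_formB _ _ _ _).eq_zero (fun a => cutSum₃_of _ a) hd, zero_add,
    F.cutSum_formB_mid (ext_isC f)] at hB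
  rw [homotV, map_add, hA, hB, cutSum_smul]
  simp only [LinearMap.applyₗ_apply_apply, LinearMap.add_apply, LinearMap.sub_apply,
    LinearMap.smul_apply, F.cutSum_formA_mid (ext_isC f)]
  rw [homotW]
  module

end FrobeniusData

end
end TateHH

namespace TateHH
noncomputable section

namespace BarAlg
variable {k A : Type u} [Field k] [Ring A] [Algebra k A]
variable {V : Type*} [AddCommGroup V] [Module k V]

theorem cutSum_mem' {n : ℕ} {x : BarAlg k A} (hx : x ∈ deg k A n)
    {T : BarAlg k A →ₗ[k] BarAlg k A →ₗ[k] V} (U : Submodule k V)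
    (h : ∀ (a b : ℕ) (y w : BarAlg k A), a + b = n + 1 → 1 ≤ a → 1 ≤ b → y ∈ deg k A a →
      w ∈ deg k A b → T y w ∈ U) : cutSum T x ∈ U :=
  cutSum_mem hx U fun a b y w hab hy hw => h (a + 1) (b + 1) _ _ (by omega) (by omega) (by omega)
    (mul_eps_mem hy) (eps_mul_mem hw)

theorem cutSum₃_mem {n : ℕ} {x : BarAlg k A} (hx : x ∈ deg k A n)
    {T : BarAlg k A →ₗ[k] BarAlg k A →ₗ[k] BarAlg k A →ₗ[k] V} (U : Submodule k V)
    (h : ∀ (a b c : ℕ) (y w v : BarAlg k A), a + b + c = n + 2 → 1 ≤ a → 1 ≤ b → 1 ≤ c →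
      y ∈ deg k A a → w ∈ deg k A b → v ∈ deg k A c → T y w v ∈ U) : cutSum₃ T x ∈ U :=
  cutSum_mem' hx U fun a b y w hab ha hb hy hw => cutSum_mem' hw U
    fun a' b' v v' hab' ha' hb' hv hv' => h a a' b' y v v' (by omega) ha ha' hb' hy hv hv'

variable (k A) in
/-- The maps of bimodules of degree `-r` that vanish below degree `r` and in degree `0`. -/
def shiftMaps (r : ℕ) : Submodule k (BarAlg k A →ₗ[k] BarAlg k A) where
  carrier := {V | ((∀ a x, V (of k a * x) = of k a * V x) ∧ ∀ x a, V (x * of k a) = V x * of k a) ∧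
    (∀ j, ∀ x ∈ deg k A (r + j), V x ∈ deg k A j) ∧
    ∀ e, ∀ x ∈ deg k A e, e < r ∨ e = 0 → V x = 0}
  add_mem' {V V'} h h' := ⟨⟨fun a x => by simp [h.1.1, h'.1.1, mul_add],
    fun x a => by simp [h.1.2, h'.1.2, add_mul]⟩,
    fun j x hx => add_mem (h.2.1 j x hx) (h'.2.1 j x hx),
    fun e x hx he => by simp [h.2.2 e x hx he, h'.2.2 e x hx he]⟩
  zero_mem' := ⟨⟨by simp, by simp⟩, fun _ _ _ => zero_mem _, by simp⟩
  smul_mem' c V h := ⟨⟨fun a x => by simp [h.1.1], fun x a => by simp [h.1.2]⟩,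
    fun j x hx => Submodule.smul_mem _ c (h.2.1 j x hx),
    fun e x hx he => by simp [h.2.2 e x hx he]⟩

/-- A map of bimodules that is supported in degree `r`, with values in degree `0`. -/
theorem mem_shiftMaps_of_supp {r : ℕ} {G : BarAlg k A →ₗ[k] BarAlg k A}
    (h1 : ∀ a x, G (of k a * x) = of k a * G x) (h2 : ∀ x a, G (x * of k a) = G x * of k a)
    (hs : ∀ e, ∀ x ∈ deg k A e, e ≠ r ∨ e = 0 → G x = 0) (h0 : ∀ x, G x ∈ deg k A 0) :
    G ∈ shiftMaps k A r := by
  refine ⟨⟨h1, h2⟩, fun j x hx => ?_, fun e x hx he => hs e x hx (by omega)⟩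
  rcases Nat.eq_zero_or_pos j with rfl | hj
  · exact h0 x
  · rw [hs _ x hx (by omega)]
    exact zero_mem _

theorem isC_comp_d_of_supp {r : ℕ} {G : BarAlg k A →ₗ[k] BarAlg k A}
    (h1 : ∀ a x, G (of k a * x) = of k a * G x) (h2 : ∀ x a, G (x * of k a) = G x * of k a)
    (hs : ∀ e, ∀ x ∈ deg k A e, e ≠ r ∨ e = 0 → G x = 0) (h0 : ∀ x, G x ∈ deg k A 0) :
    IsC r 0 (G ∘ₗ d) where
  of_mul a x := by simp [h1, d_mul]
  mul_of x a := by simp [h2, d_mul]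
  supp n x hx hn := by
    rcases n with - | n
    · rw [LinearMap.comp_apply, d_deg_zero hx, map_zero]
    · exact hs n _ (d_mem hx) (.inl (by omega))
  mem x _ := h0 _

theorem ext_isC_comp {m r : ℕ} (f : Coch k A m 0) {D : BarAlg k A →ₗ[k] BarAlg k A}
    (h1 : ∀ a x, D (of k a * x) = of k a * D x) (h2 : ∀ x a, D (x * of k a) = D x * of k a)
    {t : ℕ} (hD : ∀ e, ∀ x ∈ deg k A e, D x ∈ deg k A (e + t)) (hm : m = r + t) :
    IsC r 0 (ext f ∘ₗ D) where
  of_mul a x := by simp [h1, (ext_isC f).of_mul]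
  mul_of x a := by simp [h2, (ext_isC f).mul_of]
  supp n x hx hn := (ext_isC f).supp _ _ (hD n x hx) (by omega)
  mem x hx := (ext_isC f).mem _ (by
    have := hD _ x hx
    rwa [show r + 1 + t = m + 1 by omega] at this)

end BarAlg

namespace FrobeniusData
open BarAlg Module.End
variable {k A ι : Type u} [Field k] [Ring A] [Algebra k A] [DecidableEq ι] [Fintype ι]
  (F : FrobeniusData k A ι)

theorem casForm_apply_mul_of (φ : BarAlg k A →ₗ[k] k) (y w₀ w₁ x : BarAlg k A) (a : A) :
    F.casForm φ y w₀ w₁ (x * of k a) = F.casForm φ y w₀ w₁ x * of k a := by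
  simp only [casForm_apply, Finset.sum_mul]
  refine Finset.sum_congr rfl fun l _ => ?_
  have h := F.casimir_mul (LinearMap.mk₂ k (fun u v =>
    φ (w₀ * of k (F.v l) * (x * (of k u * w₁))) • (of k (F.u l) * y * of k v))
    (by intros; simp [mul_add, add_mul, add_smul]) (by intros; simp [smul_smul])
    (by intros; simp [mul_add]) (by intros; simp [smul_smul, mul_comm])) a
  simp only [LinearMap.mk₂_apply, map_mul] at h
  simp only [mul_assoc, smul_mul_assoc] at h ⊢
  exact h

theorem casForm_apply_of_mul (φ : BarAlg k A →ₗ[k] k) (y w₀ w₁ x : BarAlg k A) (a : A) :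
    F.casForm φ y w₀ w₁ (of k a * x) = of k a * F.casForm φ y w₀ w₁ x := by
  simp only [casForm_apply, Finset.mul_sum]
  rw [Finset.sum_comm]
  conv_rhs => rw [Finset.sum_comm]
  refine Finset.sum_congr rfl fun i _ => ?_
  have h := F.casimir_mul (LinearMap.mk₂ k (fun u v =>
    φ (w₀ * of k v * (x * (of k (F.u i) * w₁))) • (of k u * y * of k (F.v i)))
    (by intros; simp [add_mul]) (by intros; simp [smul_smul, mul_comm])
    (by intros; simp [mul_add, add_mul, add_smul]) (by intros; simp [smul_smul])) a
  simp only [LinearMap.mk₂_apply, map_mul] at h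
  simp only [mul_assoc, mul_smul_comm] at h ⊢
  exact h.symm

theorem casForm_mem (φ : BarAlg k A →ₗ[k] k) {y : BarAlg k A} {c : ℕ} (hy : y ∈ deg k A c)
    (w₀ w₁ x : BarAlg k A) : F.casForm φ y w₀ w₁ x ∈ deg k A c := by
  rw [casForm_apply]
  exact Submodule.sum_mem _ fun l _ => Submodule.sum_mem _ fun i _ =>
    Submodule.smul_mem _ _ (mul_of_mem _ (of_mul_mem _ hy))

theorem casForm_mem_shiftMaps {m n r : ℕ} (hm : m = r + n + 1) (f : Coch k A m 0) {a b c : ℕ}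
    (habc : a + b + c = n + 2) (hc : 1 ≤ c) {y w₀ w₁ : BarAlg k A} (hy : y ∈ deg k A c)
    (h₀ : w₀ ∈ deg k A a) (h₁ : w₁ ∈ deg k A b) :
    F.casForm (F.tr (ext f)) y w₀ w₁ ∈ shiftMaps k A r := by
  refine ⟨⟨fun a x => F.casForm_apply_of_mul _ _ _ _ _ _,
    fun x a => F.casForm_apply_mul_of _ _ _ _ _ _⟩, fun j x hx => ?_,
    fun e x hx he => F.casForm_supp (ext_isC f) y h₀ h₁ hx (by omega)⟩
  by_cases h : j = c
  · subst h
    exact F.casForm_mem _ hy _ _ _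
  · rw [F.casForm_supp (ext_isC f) y h₀ h₁ hx (by omega)]
    exact zero_mem _

theorem homotV_mem {m n r : ℕ} (hm : m = r + n + 1) (f : Coch k A m 0) {Y : BarAlg k A}
    (hY : Y ∈ deg k A n) : F.homotV m n r (F.tr (ext f)) Y ∈ shiftMaps k A r := by
  refine add_mem (cutSum₃_mem hY _ fun a b c y₁ y₂ y₃ habc ha hb hc h₁ h₂ h₃ => ?_)
    (cutSum₃_mem hY _ fun a b c y₁ y₂ y₃ habc ha hb hc h₁ h₂ h₃ => ?_)
  · rw [F.formA_deg _ _ _ _ h₁ h₂]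
    exact Submodule.smul_mem _ _ (F.casForm_mem_shiftMaps hm f (by omega : c + a + 0 + b = n + 2)
      hb h₂ (mul_mem h₃ (F.alE_mem h₁)) one_mem)
  · rw [F.formB_deg _ _ _ _ h₁ h₂]
    exact Submodule.smul_mem _ _ (F.casForm_mem_shiftMaps hm f (by omega : b + a + c = n + 2)
      hc h₃ (F.alE_mem h₂) h₁)

theorem isC_homotW {m n r : ℕ} (hm : m = r + n + 1) (f : Coch k A m 0) {Y : BarAlg k A}
    (hY : Y ∈ deg k A n) : IsC r 0 (F.homotW m n r (F.tr (ext f)) Y) := by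
  let U : Submodule k (BarAlg k A →ₗ[k] BarAlg k A) :=
    { carrier := {G | IsC r 0 G}
      add_mem' := fun h h' => IsC.add h h'
      zero_mem' := ⟨by simp, by simp, by simp, fun _ _ => zero_mem _⟩
      smul_mem' := fun c _ h => IsC.smul h c }
  refine cutSum_mem' hY U fun a b y w hab _ _ hy hw => ?_
  rw [LinearMap.compr₂_apply, LinearMap.applyₗ_apply_apply, F.formB_deg _ _ _ _ hy hw]
  refine Submodule.smul_mem U _ ⟨fun a x => F.casForm_apply_of_mul _ _ _ _ _ _,
    fun x a => F.casForm_apply_mul_of _ _ _ _ _ _, fun e x hx he =>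
    F.casForm_supp (ext_isC f) _ (F.alE_mem hw) hy hx (by omega),
    fun x _ => F.casForm_mem _ one_mem _ _ _⟩

/-- The map `E → A` with a given trace. -/
def ofTr (τ : BarAlg k A →ₗ[k] k) : BarAlg k A →ₗ[k] BarAlg k A :=
  ∑ l, (τ ∘ₗ LinearMap.mulRight k (of k (F.u l))).smulRight (of k (F.v l))

theorem ofTr_apply (τ : BarAlg k A →ₗ[k] k) (x : BarAlg k A) :
    F.ofTr τ x = ∑ l, τ (x * of k (F.u l)) • of k (F.v l) := by
  simp [ofTr, LinearMap.sum_apply]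

theorem ofTr_mem (τ : BarAlg k A →ₗ[k] k) (x : BarAlg k A) : F.ofTr τ x ∈ deg k A 0 := by
  rw [ofTr_apply]
  exact Submodule.sum_mem _ fun l _ => Submodule.smul_mem _ _ (of_mem _)

theorem tr_ofTr (τ : BarAlg k A →ₗ[k] k) (x : BarAlg k A) : F.tr (F.ofTr τ) x = τ x := by
  have h : F.ofTr τ x = of k (∑ l, τ (x * of k (F.u l)) • F.v l) := by
    rw [ofTr_apply, map_sum]
    simp only [map_smul]
  rw [F.tr_of_eq h, map_sum]
  have e := congrArg (fun a => τ (x * of k a)) (F.sum_lam_v_mul 1)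
  simp only [mul_one, map_one, map_sum, map_smul, Finset.mul_sum, mul_smul_comm, smul_eq_mul] at e ⊢
  rw [← e]
  exact Finset.sum_congr rfl fun l _ => mul_comm _ _

theorem ofTr_mul_of (τ : BarAlg k A →ₗ[k] k) (x : BarAlg k A) (a : A) :
    F.ofTr τ (x * of k a) = F.ofTr τ x * of k a := by
  have h := F.casimir_mul (LinearMap.mk₂ k (fun u v => τ (x * of k u) • of k v)
    (by intros; simp [mul_add, add_smul]) (by intros; simp [smul_smul])
    (by intros; simp) (by intros; simp [smul_smul, mul_comm])) a
  simpa only [ofTr_apply, LinearMap.mk₂_apply, map_mul, Finset.sum_mul, smul_mul_assoc,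
    mul_assoc] using h

theorem ofTr_of_mul {τ : BarAlg k A →ₗ[k] k} (hτ : IsTr F.nu.symm τ) (a : A) (x : BarAlg k A) :
    F.ofTr τ (of k a * x) = of k a * F.ofTr τ x := by
  have h := F.casimir_nu (LinearMap.mk₂ k (fun u v => τ (x * of k u) • of k v)
    (by intros; simp [mul_add, add_smul]) (by intros; simp [smul_smul])
    (by intros; simp) (by intros; simp [smul_smul, mul_comm])) a
  simp only [LinearMap.mk₂_apply, map_mul] at h
  simp only [ofTr_apply, mul_assoc, hτ.of_mul, Finset.mul_sum, mul_smul_comm, AlgEquiv.symm_symm]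
  exact h

end FrobeniusData

end
end TateHH

namespace TateHH
noncomputable section

namespace FrobeniusData
open BarAlg Module.End
variable {k A ι : Type u} [Field k] [Ring A] [Algebra k A] [DecidableEq ι] 
  (F : FrobeniusData k A ι)

/-- The sum of the `φ(x₂ D_ζ(ν σ_b(x₁)))` over the cuts of `x`. -/
def rotIns (φ : BarAlg k A →ₗ[k] k) (n : ℕ) (ζ : BarAlg k A) (b : k) : BarAlg k A →ₗ[k] k :=
  cutSum (rotForm φ (insD n ζ ∘ₗ F.nuSg b))

theorem isTr_rotIns (φ : BarAlg k A →ₗ[k] k) (n : ℕ) (ζ : BarAlg k A) (b : k) :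
    IsTr F.nu.symm (F.rotIns φ n ζ b) :=
  isTr_cutSum_rotForm φ fun a x => by
    rw [LinearMap.comp_apply, LinearMap.comp_apply, nuSg_apply, nuSg_apply, map_mul (sg _), sg_of,
      map_mul F.nuE, nuE_of, AlgEquiv.apply_symm_apply, insD_of_mul]

theorem rotIns_supp {m n r : ℕ} (hm : m = r + n + 1) (f : Coch k A m 0) (ζ : BarAlg k A) (b : k)
    {e : ℕ} {x : BarAlg k A} (hx : x ∈ deg k A e) (he : e ≠ r ∨ e = 0) :
    F.rotIns (F.tr (ext f)) n ζ b x = 0 := by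
  rcases Nat.eq_zero_or_pos e with rfl | h0
  · obtain ⟨a, rfl⟩ := hx
    rw [AlgHom.toLinearMap_apply, rotIns, cutSum_of]
  refine (Submodule.mem_bot k).1 (cutSum_mem' hx ⊥ fun a b y w hab ha hb hy hw => ?_)
  rw [Submodule.mem_bot, rotForm_apply, LinearMap.comp_apply, nuSg_apply]
  exact F.tr_supp (ext_isC f) (mul_mem hw (insD_mem n ζ (F.nuE_mem (sg_mem _ hy)))) (by omega)

theorem tr_insD {m n r : ℕ} (hm : m = r + n + 1) {f : Coch k A m 0} (hf : ext f ∘ₗ d = 0)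
    (hf' : ∀ x, F.tr (ext f) (F.nuE x) = F.tr (ext f) x) {ζ : BarAlg k A} (hζ : ζ ∈ deg k A n)
    (hc : ∀ a, of k a * ζ = ζ * of k a) (hd : d ζ = 0) (hν : F.nuE ζ = ζ) {x : BarAlg k A}
    (hx : x ∈ deg k A (r + 1)) :
    F.tr (ext f) (insD n ζ x) = (-1) ^ (m * (n + 1)) *
      (F.rotIns (F.tr (ext f)) n ζ ((-1) ^ (r + n)) (d x) + (-1) ^ (r + n) *
        (cutSum ((rotForm (F.tr (ext f)) (F.nuSg ((-1) ^ (r + n)))).compl₂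
            (LinearMap.mulRight k ζ)) x -
          cutSum (rotForm (F.tr (ext f) ∘ₗ LinearMap.mulRight k ζ) (F.nuSg ((-1) ^ r))) x)) := by
  have hb : Balanced (rotForm (F.tr (ext f)) (insD n ζ ∘ₗ F.nuSg ((-1) ^ (r + n)))) :=
    balanced_rotForm (F.isTr_tr (ext_isC f)) fun a x => by
      rw [LinearMap.comp_apply, LinearMap.comp_apply, nuSg_apply, nuSg_apply, map_mul (sg _), sg_of,
        map_mul F.nuE, nuE_of, AlgEquiv.apply_symm_apply, insD_mul_of]
  have e := cutSum_d _ hb x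
  rw [rotForm_apply, rotForm_apply, LinearMap.comp_apply, LinearMap.comp_apply, nuSg_apply,
    nuSg_apply, map_one (sg _), map_one F.nuE, insD_one, mul_zero, map_zero, add_zero, one_mul,
    F.nuE_insD hζ hc hν, hf', sg_deg _ hx, map_smul (sg _), sg_deg _ hx, map_smul, map_smul,
    map_smul, map_smul, smul_smul, smul_eq_mul, ← cutSum_sub] at e
  have e2 : cutSum (rotForm (F.tr (ext f)) (insD n ζ ∘ₗ F.nuSg ((-1) ^ (r + n))) ∘ₗ d -
      (rotForm (F.tr (ext f)) (insD n ζ ∘ₗ F.nuSg ((-1) ^ (r + n)))).compl₁₂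
        (sg (-1)).toLinearMap d) x = (-1 : k) ^ (r + n) •
        cutSum (rotForm (F.tr (ext f) ∘ₗ LinearMap.mulRight k ζ) (F.nuSg ((-1) ^ r)) -
          (rotForm (F.tr (ext f)) (F.nuSg ((-1) ^ (r + n)))).compl₂ (LinearMap.mulRight k ζ)) x := by
    rw [← cutSum_smul]
    refine cutSum_congr' hx fun a b y w hab ha hb hy hw => ?_
    obtain ⟨a, rfl⟩ : ∃ a', a = a' + 1 := ⟨a - 1, by omega⟩
    simp only [LinearMap.sub_apply, LinearMap.smul_apply, LinearMap.comp_apply,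
      LinearMap.compl₁₂_apply, LinearMap.compl₂_apply, rotForm_apply, AlgHom.toLinearMap_apply,
      LinearMap.mulRight_apply]
    have hz := F.tr_d hf (w * insD n ζ (F.nuE y))
    rw [d_mul, sg_deg _ hw, smul_mul_assoc, map_add, map_smul] at hz
    rw [F.nuSg_deg _ (d_mem hy), F.nuSg_deg _ (sg_mem _ hy), F.nuSg_deg _ hy, F.nuSg_deg _ hy,
      sg_deg _ hy, ← d_nuE]
    simp only [map_smul, mul_smul_comm, smul_mul_assoc]
    rw [insD_d hζ hc hd, sg_deg _ (F.nuE_mem hy)]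
    simp only [mul_add, mul_sub, mul_smul_comm, smul_mul_assoc, map_add, map_sub, map_smul,
      smul_eq_mul, mul_assoc] at hz ⊢
    rw [eq_neg_of_add_eq_zero_right hz]
    have hp : Even (a + 1 + b) ↔ Even (r + 1 + 1) := by rw [hab]
    have e1 : ((-1 : k) ^ (r + n)) ^ a * (-1) ^ (n + 1) =
        -(((-1) ^ (r + n)) ^ (a + 1) * (-1) ^ (a + 1) * (-1) ^ b) := by
      simp only [← pow_mul, ← pow_add]
      apply neg_one_pow_eq_neg
      simp only [Nat.even_add, Nat.even_mul, Nat.even_add_one] at hp ⊢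
      grind
    have e2 : (-1 : k) ^ (r + n) * ((-1) ^ (r + n)) ^ (a + 1) = ((-1) ^ (r + n)) ^ a := by
      rw [pow_succ', ← mul_assoc, neg_one_pow_mul_self, one_mul]
    have e3 : ((-1 : k) ^ (r + n)) ^ a * ((-1) ^ n) ^ (a + 1) =
        (-1) ^ (r + n) * ((-1) ^ r) ^ (a + 1) := by
      simp only [← pow_mul, ← pow_add]
      apply neg_one_pow_congr
      simp only [Nat.even_add, Nat.even_mul, Nat.even_add_one]
      grind
    generalize F.tr (ext f) (w * d ((insD n ζ) (F.nuE y))) = u₁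
    generalize F.tr (ext f) (w * (ζ * F.nuE y)) = u₂
    generalize F.tr (ext f) (w * (F.nuE y * ζ)) = u₃
    linear_combination e1 * u₁ + e2 * u₂ + e3 * u₃
  rw [e2, cutSum_sub, smul_eq_mul] at e
  have e4 : (-1 : k) ^ (m * (n + 1)) * ((-1) ^ (r + 1) * ((-1) ^ (r + n)) ^ (r + 1)) = 1 := by
    subst hm
    simp only [← pow_mul, ← pow_add]
    apply Even.neg_one_pow
    simp only [Nat.even_add, Nat.even_mul, Nat.even_add_one]
    grind
  rw [rotIns]
  linear_combination -e4 * F.tr (ext f) (insD n ζ x) + (-1) ^ (m * (n + 1)) * e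

variable [Fintype ι]

theorem tr_casForm (φ : BarAlg k A →ₗ[k] k) (w₀ w₁ x : BarAlg k A) :
    F.lam (toA (F.casForm φ 1 w₀ w₁ x)) =
      ∑ i, φ (w₀ * of k (F.nu.symm (F.v i)) * (x * (of k (F.u i) * w₁))) := by
  have h : F.casForm φ 1 w₀ w₁ x = of k (∑ i, ∑ l, φ (w₀ * of k (F.v l) *
      (x * (of k (F.u i) * w₁))) • (F.u l * F.v i)) := by
    rw [casForm_apply, Finset.sum_comm]
    simp only [map_sum, map_smul, map_mul, mul_one]
  rw [h, toA_of, map_sum]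
  refine Finset.sum_congr rfl fun i _ => ?_
  have e := congrArg (fun a => φ (w₀ * of k a * (x * (of k (F.u i) * w₁))))
    (F.sum_lam_mul_u (F.nu.symm (F.v i)))
  have e' : ∀ l, F.lam (F.nu.symm (F.v i) * F.u l) = F.lam (F.u l * F.v i) := fun l => by
    rw [F.lam_mul, AlgEquiv.apply_symm_apply]
  simp only [e', map_sum, map_smul, Finset.mul_sum, Finset.sum_mul, mul_smul_comm,
    smul_mul_assoc, smul_eq_mul] at e ⊢
  rw [← e]
  exact Finset.sum_congr rfl fun l _ => mul_comm _ _

theorem tr_homotW {m n r : ℕ} (hm : m = r + n + 1) {f : Coch k A m 0}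
    (hf' : ∀ x, F.tr (ext f) (F.nuE x) = F.tr (ext f) x) {Y : BarAlg k A} (hY : Y ∈ deg k A n)
    {x : BarAlg k A} (hx : x ∈ deg k A (r + 1)) :
    F.tr (F.homotW m n r (F.tr (ext f)) Y) x = -(-1) ^ (n * (m + 1)) *
      cutSum (rotForm (F.tr (ext f)) (F.nuSg ((-1) ^ (r + n))) ∘ₗ LinearMap.mulLeft k x)
        (F.cas Y) := by
  let T : BarAlg k A →ₗ[k] BarAlg k A →ₗ[k] k := LinearMap.mk₂ k
    (fun y w => -(-1) ^ (m * n + m) * F.tr (ext f) (F.alSg ((-1) ^ (r + 1)) w *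
      (x * sg ((-1) ^ (n + 1)) y)))
    (by intros; simp [mul_add]) (by intros; simp; ring) (by intros; simp [add_mul, mul_add])
    (by intros; simp; ring)
  have hT : ∀ y w, T y w = -(-1) ^ (m * n + m) * F.tr (ext f) (F.alSg ((-1) ^ (r + 1)) w *
      (x * sg ((-1) ^ (n + 1)) y)) := fun _ _ => rfl
  have e := map_cutSum (F.lam ∘ₗ toA ∘ₗ LinearMap.applyₗ x) ((F.formB (F.tr (ext f))
    (-(-1) ^ (m * n + m)) ((-1) ^ (n + 1)) ((-1) ^ (r + 1))).compr₂ (LinearMap.applyₗ 1)) Y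
  refine (e.trans (F.cutSum_cas (T := T) (fun y w => ?_) Y).symm).trans ?_
  · simp only [LinearMap.compr₂_apply, LinearMap.comp_apply, LinearMap.applyₗ_apply_apply,
      formB_apply, map_smul, tr_casForm, hT, alSg_apply, map_mul (sg _),
      sg_of, map_mul F.alE, alE_of, smul_eq_mul, Finset.mul_sum]
  · rw [← smul_eq_mul, ← cutSum_smul]
    refine cutSum_congr' (F.cas_mem hY) fun a b y w hab ha hb hy hw => ?_
    rw [hT, LinearMap.smul_apply, LinearMap.smul_apply, LinearMap.comp_apply,
      LinearMap.mulLeft_apply, rotForm_apply, F.nuSg_deg _ (mul_mem hx hy), F.alSg_deg _ hw,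
      sg_deg _ hy, ← hf']
    simp only [map_smul, mul_smul_comm, smul_mul_assoc, smul_eq_mul, map_mul F.nuE, nuE_alE]
    have hp : Even (a + b) ↔ Even (n + 1) := by rw [hab]
    have e1 : -(-1 : k) ^ (m * n + m) * (((-1) ^ (r + 1)) ^ b * ((-1) ^ (n + 1)) ^ a) =
        -(-1) ^ (n * (m + 1)) * ((-1) ^ (r + n)) ^ (r + 1 + a) := by
      subst hm
      rw [neg_mul, neg_mul, neg_inj]
      simp only [← pow_mul, ← pow_add]
      apply neg_one_pow_congr
      simp only [Nat.even_add, Nat.even_mul, Nat.even_add_one] at hp ⊢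
      grind
    linear_combination e1 * F.tr (ext f) (w * (F.nuE x * F.nuE y))

end FrobeniusData

end
end TateHH

namespace TateHH
noncomputable section

namespace FrobeniusData
open BarAlg Module.End
variable {k A ι : Type u} [Field k] [Ring A] [Algebra k A] [DecidableEq ι] [Fintype ι]
  (F : FrobeniusData k A ι)

theorem sign_brace {m n r : ℕ} (hm : m = r + n + 1) (H w₁ w₂ w₃ p q : k) :
    (-1 : k) ^ (n + 1) * ((-1) ^ (m * (n + 1)) * (H + (-1) ^ (r + n) * (w₁ - w₃))) +
      -1 * ((-1) ^ (m * n + m + n) * ((-1) ^ (m + 1) * w₃ + (-1) ^ m * (w₂ + w₁) + (-1) ^ n * q)) +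
      p + -1 * (-(-1) ^ (n * (m + 1)) * w₂) =
    (-1) ^ ((m + 1) * (n + 1)) * H + -1 * (-p + ((-1) ^ (n + 1)) ^ (r + 1) * q) := by
  have s1 : (-1 : k) ^ (n + 1) * (-1) ^ (m * (n + 1)) = (-1) ^ ((m + 1) * (n + 1)) := by ring
  have s2 : (-1 : k) ^ ((m + 1) * (n + 1)) * (-1) ^ (r + n) =
      (-1) ^ (m * n + m + n) * (-1) ^ m := by
    subst hm
    simp only [← pow_add]
    apply neg_one_pow_congr
    simp only [Nat.even_add, Nat.even_mul, Nat.even_add_one]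
    grind
  have s3 : (-1 : k) ^ (n * (m + 1)) = (-1) ^ (m * n + m + n) * (-1) ^ m := by
    simp only [← pow_add]
    apply neg_one_pow_congr
    simp only [Nat.even_add, Nat.even_mul, Nat.even_add_one]
    grind
  have s4 : (-1 : k) ^ (m * n + m + n) * (-1) ^ n = ((-1) ^ (n + 1)) ^ (r + 1) := by
    subst hm
    simp only [← pow_add, ← pow_mul]
    apply neg_one_pow_congr
    simp only [Nat.even_add, Nat.even_mul, Nat.even_add_one]
    grind
  linear_combination s1 * H + (s1 * (-1) ^ (r + n) + s2) * (w₁ - w₃) + s3 * w₂ - s4 * q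

theorem homot_of_values {r : ℕ} {G : BarAlg k A →ₗ[k] BarAlg k A} (h0 : ∀ x, G x ∈ deg k A 0)
    (x : BarAlg k A) : homot r x G = (-1 : k) ^ r • G (d x) := by
  rw [homot_apply, d_deg_zero (h0 x), zero_add]

theorem homotV_eq_zero {m n r : ℕ} (f : Coch k A m 0) {Y x : BarAlg k A}
    (hY : Y ∈ deg k A n) (hx : x ∈ deg k A (m + 1)) : F.homotV m n r (F.tr (ext f)) Y x = 0 := by
  rw [homotV, LinearMap.add_apply]
  have hA := cutSum₃_mem hY (T := F.formA (F.tr (ext f)) ((-1) ^ m) ((-1) ^ (n + 1)) ((-1) ^ (m + 1)))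
    (LinearMap.ker (LinearMap.applyₗ x)) fun a b c y₁ y₂ y₃ habc ha hb hc h₁ h₂ h₃ => by
      rw [LinearMap.mem_ker, LinearMap.applyₗ_apply_apply, F.formA_deg _ _ _ _ h₁ h₂,
        LinearMap.smul_apply, F.casForm_supp (ext_isC f) _ (mul_mem h₃ (F.alE_mem h₁)) one_mem hx
          (by omega), smul_zero]
  have hB := cutSum₃_mem hY
    (T := F.formB (F.tr (ext f)) (-(-1) ^ (m * n + m)) ((-1) ^ (n + 1)) ((-1) ^ (r + 1)))
    (LinearMap.ker (LinearMap.applyₗ x)) fun a b c y₁ y₂ y₃ habc ha hb hc h₁ h₂ h₃ => by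
      rw [LinearMap.mem_ker, LinearMap.applyₗ_apply_apply, F.formB_deg _ _ _ _ h₁ h₂,
        LinearMap.smul_apply, F.casForm_supp (ext_isC f) _ (F.alE_mem h₂) h₁ hx (by omega),
        smul_zero]
  rw [LinearMap.mem_ker, LinearMap.applyₗ_apply_apply] at hA hB
  rw [hA, hB, add_zero]

/-- The bracket of the complete complex is homotopic to the operation that comes from the
bracket of the singular complex. -/
theorem exists_homot_brace {m n : ℕ} (hn : 1 ≤ n) (hmn : n < m) {f : Coch k A m 0}
    {z : LBar k A (n - 1)} (hf : ext f ∘ₗ d = 0) (hf' : F.posT m f = f)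
    (hz : d (F.nm (n - 1) z) = 0) (hz' : F.nuE (F.nm (n - 1) z) = F.nm (n - 1) z) :
    ∃ V ∈ shiftMaps k A (m - n - 1), (∀ x ∈ deg k A (m + 1), V x = 0) ∧ ∀ x, homot (m - n - 1) x V =
      (-1 : k) ^ (n + 1) • ext f (insD n (F.nm (n - 1) z) x) +
      leftCut (ext f) ((-1) ^ (m + 1)) (F.nm (n - 1) z) x +
      (-1 : k) ^ (m * n + m) • rightCut (ext f) ((-1) ^ (n + 1)) (F.nm (n - 1) z) x -
      ext (F.brace hn hmn f z) x := by
  have hbr := F.tr_brace hn hmn f z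
  generalize F.brace hn hmn f z = B at hbr ⊢
  revert B hbr
  generalize hr : m - n - 1 = r
  intro B hbr
  have hm : m = r + n + 1 := by omega
  have hm1 : m - 1 = r + n := by omega
  have hn1 : n - 1 + 1 = n := by omega
  rw [hm1] at hbr
  have hfν := (F.posT_eq_self_iff f).1 hf'
  set Y := chainEl k A (n - 1) z with hYdef
  have hY : Y ∈ deg k A n := by simpa only [hn1] using chainEl_mem z
  have hζ : F.nm (n - 1) z ∈ deg k A n := F.cas_mem hY
  have hYn : F.nm (n - 1) z = F.cas Y := rfl
  have hc : ∀ a, of k a * F.nm (n - 1) z = F.nm (n - 1) z * of k a := fun a => F.of_mul_nm a z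
  obtain ⟨ζ', hζ'⟩ : ∃ ζ', ζ' = F.nm n (connes F.nu.symm (by omega : n = n - 1 + 1) z) := ⟨_, rfl⟩
  have hζ'd : d ζ' = 0 := by rw [hζ']; exact F.d_nm_connes_of_inv _ hz hz'
  have hζ'm : ζ' ∈ deg k A (n + 1) := by rw [hζ']; exact F.nm_mem _
  have hc' : ∀ a, of k a * ζ' = ζ' * of k a := fun a => by rw [hζ']; exact F.of_mul_nm a _
  have hζ'e : cutSum (rotForm F.cas (F.alSg ((-1) ^ (n + 1)))) Y = ζ' := by
    rw [hζ', nm_connes]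
    have : (-1 : k) ^ (n + 1) = (-1) ^ (n - 1) := by
      obtain ⟨p, rfl⟩ : ∃ p, n = p + 1 := ⟨n - 1, hn1.symm⟩
      rw [Nat.add_sub_cancel, pow_succ, pow_succ, mul_assoc, neg_one_mul, neg_neg, mul_one]
    rw [this]
    rfl
  rw [← hζ'] at hbr
  set φ := F.tr (ext f) with hφ
  set h := F.ofTr (F.rotIns φ n (F.nm (n - 1) z) ((-1) ^ (r + n))) with hh
  set g := ext f ∘ₗ insD (n + 1) ζ' with hg
  have hh1 := F.ofTr_of_mul (F.isTr_rotIns φ n (F.nm (n - 1) z) ((-1) ^ (r + n)))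
  have hh2 := F.ofTr_mul_of (F.rotIns φ n (F.nm (n - 1) z) ((-1) ^ (r + n)))
  have hh0 : ∀ x, h x ∈ deg k A 0 := F.ofTr_mem _
  have hhs : ∀ e, ∀ x ∈ deg k A e, e ≠ r ∨ e = 0 → h x = 0 := fun e x hx he => by
    rw [hh, ofTr_apply]
    refine Finset.sum_eq_zero fun l _ => ?_
    rw [F.rotIns_supp hm f _ _ (mul_of_mem _ hx) he, zero_smul]
  have hg1 : ∀ a x, g (of k a * x) = of k a * g x := fun a x => by
    rw [hg, LinearMap.comp_apply, insD_of_mul, (ext_isC f).of_mul, LinearMap.comp_apply]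
  have hg2 : ∀ x a, g (x * of k a) = g x * of k a := fun x a => by
    rw [hg, LinearMap.comp_apply, insD_mul_of, (ext_isC f).mul_of, LinearMap.comp_apply]
  have hg0 : ∀ x, g x ∈ deg k A 0 := fun x => (ext_isC f).mem' _
  have hgs : ∀ e, ∀ x ∈ deg k A e, e ≠ r ∨ e = 0 → g x = 0 := fun e x hx he => by
    rcases Nat.eq_zero_or_pos e with rfl | h0
    · rw [hg, LinearMap.comp_apply, insD_deg_zero _ _ hx, map_zero]
    · exact (ext_isC f).supp _ _ (insD_mem _ _ hx) (by omega)
  have hD : IsC r 0 (ext f ∘ₗ insD n (F.nm (n - 1) z)) :=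
    ext_isC_comp (t := n + 1) f (insD_of_mul _ _) (fun x a => insD_mul_of _ _ a x)
      (fun e x hx => insD_mem _ _ hx) hm
  have hL : IsC r 0 (ext f ∘ₗ LinearMap.mulLeft k ζ') :=
    ext_isC_comp (t := n + 1) f
      (fun a x => by simp only [LinearMap.mulLeft_apply, ← mul_assoc, hc'])
      (fun x a => by simp only [LinearMap.mulLeft_apply, mul_assoc])
      (fun e x hx => add_comm (n + 1) e ▸ mul_mem hζ'm hx) hm
  have hB : IsC r 0 (ext B) := ext_isC B
  have hW := F.isC_homotW hm f hY
  have hhd := isC_comp_d_of_supp hh1 hh2 hhs hh0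
  have hgd := isC_comp_d_of_supp hg1 hg2 hgs hg0
  have key : (-1 : k) ^ (n + 1) • (ext f ∘ₗ insD n (F.nm (n - 1) z)) + (-1 : k) • ext B +
      ext f ∘ₗ LinearMap.mulLeft k ζ' + (-1 : k) • F.homotW m n r φ Y =
      (-1 : k) ^ ((m + 1) * (n + 1)) • (h ∘ₗ d) + (-1 : k) • (g ∘ₗ d) := by
    have hC := (((hD.smul ((-1 : k) ^ (n + 1))).add (hB.smul (-1))).add hL).add (hW.smul (-1))
    have hC' := (hhd.smul ((-1 : k) ^ ((m + 1) * (n + 1)))).add (hgd.smul (-1))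
    refine F.eq_of_tr hC hC' fun x => LinearMap.congr_fun (ext_deg fun e x hx => ?_) x
    by_cases he : e = r + 1
    swap
    · rw [F.tr_supp hC hx he, F.tr_supp hC' hx he]
    subst he
    have e1 := F.tr_insD hm hf hfν hζ hc hz hz' hx
    have e2 := F.tr_homotW hm hfν hY hx
    have e3 := hbr x
    have e4 := congrArg φ (insD_d hζ'm hc' hζ'd x)
    rw [sg_deg _ hx, map_add, map_sub, map_smul, hφ, F.tr_d hf, smul_zero, zero_sub,
      smul_mul_assoc, map_smul, smul_eq_mul] at e4
    rw [cutSum_mul] at e3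
    have hadd : ∀ G H, F.tr (G + H) x = F.tr G x + F.tr H x := fun G H => by
      simp only [tr_apply, LinearMap.add_apply, map_add]
    have hsmul : ∀ (c : k) G, F.tr (c • G) x = c * F.tr G x := fun c G => by
      simp only [tr_apply, LinearMap.smul_apply, map_smul, smul_eq_mul]
    have hcomp : ∀ G H, F.tr (G ∘ₗ H) x = F.tr G (H x) := fun _ _ => rfl
    simp only [hadd, hsmul, hcomp, LinearMap.mulLeft_apply]
    rw [show F.tr g (d x) = F.tr (ext f) (insD (n + 1) ζ' (d x)) from rfl, e1, e2, e3, e4, hh,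
      tr_ofTr, ← hYn, hφ]
    exact sign_brace hm _ _ _ _ _ _
  refine ⟨F.homotV m n r φ Y + (-1 : k) ^ r • ((-1 : k) ^ ((m + 1) * (n + 1)) • h + (-1 : k) • g),
    add_mem (F.homotV_mem hm f hY) (Submodule.smul_mem _ _ (add_mem
      (Submodule.smul_mem _ _ (mem_shiftMaps_of_supp hh1 hh2 hhs hh0))
      (Submodule.smul_mem _ _ (mem_shiftMaps_of_supp hg1 hg2 hgs hg0)))), fun x hx => ?_, fun x => ?_⟩
  · simp only [LinearMap.add_apply, LinearMap.smul_apply]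
    rw [F.homotV_eq_zero f hY hx, hhs _ x hx (by omega), hgs _ x hx (by omega)]
    simp
  have hr2 : ∀ (c : k) (v : BarAlg k A), (-1 : k) ^ r • (c • ((-1 : k) ^ r • v)) = c • v :=
    fun c v => by rw [smul_comm c, smul_smul, neg_one_pow_mul_self, one_smul]
  have key' : ∀ e, ∀ x ∈ deg k A e, (d ∘ₗ (F.homotV m n r φ Y) +
      (-1 : k) ^ r • (F.homotV m n r φ Y ∘ₗ d)) x = (leftCut (ext f) ((-1) ^ (m + 1)) (F.cas Y) +
      (-1 : k) ^ (m * n + m) • rightCut (ext f) ((-1) ^ (n + 1)) (F.cas Y) -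
      ext f ∘ₗ LinearMap.mulLeft k ζ' + F.homotW m n r φ Y) x := fun e x hx => by
    rw [← hζ'e]
    exact F.homot_homotV hm hf hY (by rw [← d_cas]; exact hz) hx
  have e1 := LinearMap.congr_fun (ext_deg key') x
  have e2 := LinearMap.congr_fun key x
  rw [map_add, map_smul, map_add, map_smul, map_smul, homot_of_values hh0, homot_of_values hg0,
    smul_add, hr2, hr2, hYn]
  simp only [LinearMap.add_apply, LinearMap.sub_apply, LinearMap.smul_apply, LinearMap.comp_apply,
    LinearMap.mulLeft_apply, hYn] at e1 e2
  rw [homot_apply]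
  linear_combination (norm := module) e1 - e2

end FrobeniusData

end
end TateHH

namespace TateHH
noncomputable section

namespace BarAlg
variable {k A : Type u} [Field k] [Ring A] [Algebra k A]

/-- `F ↦ F~(x)`. -/
def tildeAt (x : BarAlg k A) : (BarAlg k A →ₗ[k] BarAlg k A) →ₗ[k] BarAlg k A where
  toFun F := tilde F x
  map_add' F G := by rw [tilde_add, LinearMap.add_apply]
  map_smul' c F := by rw [tilde_smul, LinearMap.smul_apply, RingHom.id_apply]

theorem tildeAt_apply (F : BarAlg k A →ₗ[k] BarAlg k A) (x : BarAlg k A) :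
    tildeAt x F = tilde F x := rfl

theorem tilde_mul' (F : BarAlg k A →ₗ[k] BarAlg k A) (y x : BarAlg k A) :
    tilde F (y * x) = tilde (F ∘ₗ LinearMap.mulLeft k y) x + tilde F y * x := by
  simp only [tilde, conv_apply, cutSum_mul, cutSum_mul_right]
  congr 1
  exact cutSum_ext (fun u w => by simp [mul_assoc]) y

theorem tilde_leftCut {s p n : ℕ} {F : BarAlg k A →ₗ[k] BarAlg k A} (hF : IsC s p F) (hn : n ≤ s)
    (c : k) {ζ : BarAlg k A} (hζ : ζ ∈ deg k A n) (x : BarAlg k A) :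
    tilde (leftCut F c ζ) x =
      cutSum (((LinearMap.mul k (BarAlg k A)).compl₁₂ (sg c).toLinearMap
        (tilde F)).compl₂ (LinearMap.mulRight k x)) ζ := by
  rw [← tildeAt_apply, leftCut, map_cutSum]
  refine cutSum_congr' hζ fun a b y w hab ha hb hy hw => ?_
  simp only [LinearMap.compr₂_apply, LinearMap.compl₂_apply, LinearMap.compl₁₂_apply,
    LinearMap.mul_apply', LinearMap.mulRight_apply, AlgHom.toLinearMap_apply, tildeAt_apply]
  rw [tilde_mul', tilde_low hF hw (by omega), zero_mul, add_zero, tilde, conv_apply, tilde,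
    conv_apply, mul_cutSum]
  exact cutSum_ext (fun u v => by simp [formL_apply, mul_assoc]) x

/-- `y ↦ u ↦ v ↦ F(σ_c(y) ζ u) v`. -/
def insForm (F : BarAlg k A →ₗ[k] BarAlg k A) (c : k) (ζ : BarAlg k A) :
    BarAlg k A →ₗ[k] BarAlg k A →ₗ[k] BarAlg k A →ₗ[k] BarAlg k A :=
  mk₃ (fun y u v => F (sg c y * (ζ * u)) * v)
    (fun _ _ _ _ => by simp [add_mul]) (fun _ _ _ _ => by simp)
    (fun _ _ _ _ => by simp [mul_add, add_mul]) (fun _ _ _ _ => by simp)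
    (fun _ _ _ _ => by simp [mul_add]) (fun _ _ _ _ => by simp)

theorem tilde_comp_insD {n : ℕ} {ζ : BarAlg k A} (hζ : ζ ∈ deg k A n)
    (hc : ∀ a, of k a * ζ = ζ * of k a) (F : BarAlg k A →ₗ[k] BarAlg k A) (x : BarAlg k A) :
    tilde (F ∘ₗ insD n ζ) x = cutSum (cutSumₗ ∘ₗ insForm F ((-1) ^ (n + 1)) ζ) x := by
  let T' : BarAlg k A →ₗ[k] BarAlg k A →ₗ[k] BarAlg k A →ₗ[k] BarAlg k A :=
    mk₃ (fun v y u => F (sg ((-1) ^ (n + 1)) y * (ζ * u)) * v)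
      (fun _ _ _ _ => by simp [mul_add]) (fun _ _ _ _ => by simp)
      (fun _ _ _ _ => by simp [add_mul]) (fun _ _ _ _ => by simp)
      (fun _ _ _ _ => by simp [mul_add, add_mul]) (fun _ _ _ _ => by simp)
  rw [cutSum_cutSum _ T' (fun _ _ _ => rfl), tilde, conv_apply]
  refine cutSum_ext (fun y v => ?_) x
  simp only [LinearMap.compl₁₂_apply, LinearMap.mul_apply', LinearMap.flip_apply,
    LinearMap.comp_apply, cutSumₗ_apply, LinearMap.id_apply]
  rw [insD_eq hζ hc, map_cutSum, cutSum_mul_right]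
  exact cutSum_ext (fun _ _ => rfl) y

theorem tilde_rightCut {m n : ℕ} {F : BarAlg k A →ₗ[k] BarAlg k A} (hF : IsC m 0 F)
    {ζ : BarAlg k A} (hζ : ζ ∈ deg k A n) (x : BarAlg k A) :
    (-1 : k) ^ (m * n + m) • tilde (rightCut F ((-1) ^ (n + 1)) ζ) x =
      (-1 : k) ^ (n + 1) • cutSum ((LinearMap.mul k (BarAlg k A)) ∘ₗ
        (cutSumₗ.flip ζ ∘ₗ insForm F ((-1) ^ (n + 1)) 1)) x := by
  rw [tilde, conv_apply, ← cutSum_smul, ← cutSum_smul]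
  refine LinearMap.congr_fun (ext_deg fun e x hx => ?_) x
  refine cutSum_congr' hx fun a b y w hab ha hb hy hw => ?_
  simp only [LinearMap.smul_apply, LinearMap.compl₁₂_apply, LinearMap.comp_apply,
    LinearMap.mul_apply', LinearMap.id_apply, LinearMap.flip_apply, cutSumₗ_apply]
  rw [← smul_mul_assoc, ← smul_mul_assoc]
  congr 1
  have h := map_cutSum (LinearMap.applyₗ y) (formR F ((-1) ^ (n + 1))) ζ
  rw [LinearMap.applyₗ_apply_apply] at h
  rw [rightCut, h, ← cutSum_smul, ← cutSum_smul]
  refine cutSum_congr' hζ fun i j u v hij hi hj hu hv => ?_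
  simp only [LinearMap.smul_apply, LinearMap.compr₂_apply, LinearMap.applyₗ_apply_apply, formR_apply,
    insForm, mk₃_apply, one_mul]
  rw [sg_deg _ hu, sg_deg _ hy, mul_smul_comm, smul_mul_assoc, map_smul, map_smul]
  by_cases hm : a + i = m + 1
  · rw [smul_mul_assoc, smul_mul_assoc, smul_smul, smul_smul]
    congr 1
    simp only [← pow_mul, ← pow_add]
    apply neg_one_pow_congr
    have hp : Even (a + i) ↔ Even (m + 1) := by rw [hm]
    simp only [Nat.even_add, Nat.even_mul, Nat.even_add_one] at hp ⊢
    grind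
  · rw [hF.supp _ _ (mul_mem hy hu) hm]
    simp

theorem tilde_Lam {m n : ℕ} {F K : BarAlg k A →ₗ[k] BarAlg k A} (hF : IsC m 0 F)
    (hK : IsC 1 (n + 1) K) {ζ : BarAlg k A} (hζ : ζ ∈ deg k A n)
    (hc : ∀ a, of k a * ζ = ζ * of k a)
    (hKζ : ∀ e, ∀ x ∈ deg k A (e + 2), tilde K x = (-1 : k) ^ (n + 1) • (ζ * x))
    {x : BarAlg k A} (hx : x ∈ deg k A (m + 1)) :
    tilde F (Lam ((-1) ^ (n + 1)) K x) = (-1 : k) ^ (n + 1) • tilde (F ∘ₗ insD n ζ) x +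
      (-1 : k) ^ (m * n + m) • tilde (rightCut F ((-1) ^ (n + 1)) ζ) x := by
  rw [tilde_comp_insD hζ hc, tilde_rightCut hF hζ, ← smul_add, ← cutSum_add, ← cutSum_smul, Lam, conv_apply,
    map_cutSum]
  refine cutSum_congr' hx fun a b y w hab ha hb hy hw => ?_
  simp only [LinearMap.smul_apply, LinearMap.add_apply, LinearMap.compl₁₂_apply,
    LinearMap.comp_apply, LinearMap.compr₂_apply, AlgHom.toLinearMap_apply,
    LinearMap.mul_apply', LinearMap.flip_apply, cutSumₗ_apply]
  have hy' := sg_mem ((-1 : k) ^ (n + 1)) hy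
  rcases Nat.lt_or_ge b 2 with h1 | h2
  · have h1' : cutSum (insForm F ((-1) ^ (n + 1)) ζ y) w = 0 := by
      rw [← cutSum_zero w]
      refine cutSum_congr' hw fun i j u v hij hi hj hu hv => ?_
      rw [insForm, mk₃_apply, hF.supp _ _ (mul_mem hy' (mul_mem hζ hu)) (by omega), zero_mul]
      rfl
    have h2' : cutSum (insForm F ((-1) ^ (n + 1)) 1 y) ζ = 0 := by
      rw [← cutSum_zero ζ]
      refine cutSum_congr' hζ fun i j u v hij hi hj hu hv => ?_
      rw [insForm, mk₃_apply, one_mul, hF.supp _ _ (mul_mem hy' hu) (by omega), zero_mul]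
      rfl
    rw [h1', h2', tilde_low hK hw (by omega), mul_zero, map_zero, zero_mul, add_zero, smul_zero]
  · obtain ⟨e, rfl⟩ := Nat.exists_eq_add_of_le' h2
    rw [hKζ e w hw, mul_smul_comm, map_smul, ← mul_assoc, tilde_mul', tilde_mul' F _ ζ,
      tilde_low hF hy' (by omega), zero_mul, add_zero]
    congr 2
    · exact cutSum_ext (fun u v => by simp [insForm]) w
    · congr 1
      exact cutSum_ext (fun u v => by simp [insForm]) ζ

theorem Lam_central_mul {m n : ℕ} {F : BarAlg k A →ₗ[k] BarAlg k A} (hF : IsC m 0 F) (hn : n ≤ m)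
    (c : k) {ζ : BarAlg k A} (hζ : ζ ∈ deg k A n) (x : BarAlg k A) :
    Lam c F (ζ * x) = c ^ n • (ζ * Lam c F x) + tilde (leftCut F c ζ) x := by
  rw [tilde_leftCut hF hn c hζ, Lam, conv_apply, cutSum_mul, conv_apply, mul_cutSum,
    ← cutSum_smul]
  congr 1
  exact cutSum_ext (fun u v => by simp [sg_deg c hζ, mul_assoc]) x

/-- The bracket with a cochain that comes from a central element. -/
theorem beta_central {m n : ℕ} (hn : n < m) {F K : BarAlg k A →ₗ[k] BarAlg k A} (hF : IsC m 0 F)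
    (hK : IsC 1 (n + 1) K) {ζ : BarAlg k A} (hζ : ζ ∈ deg k A n)
    (hc : ∀ a, of k a * ζ = ζ * of k a)
    (hKζ : ∀ e, ∀ x ∈ deg k A (e + 2), tilde K x = (-1 : k) ^ (n + 1) • (ζ * x))
    {x : BarAlg k A} (hx : x ∈ deg k A (m + 1)) :
    (-1 : k) ^ (n + 1) • beta m 0 1 (n + 1) F K x =
      tilde ((-1 : k) ^ (n + 1) • (F ∘ₗ insD n ζ) + leftCut F ((-1) ^ (m + 1)) ζ +
        (-1 : k) ^ (m * n + m) • rightCut F ((-1) ^ (n + 1)) ζ) x := by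
  have hL : Lam ((-1) ^ (m + 1)) F x ∈ deg k A (0 + 2) :=
    Lam_mem (n := 1) hF _ (by rwa [add_comm 1 m])
  have ht : tilde F x ∈ deg k A 1 := tilde_mem (n := 0) hF hx
  obtain ⟨l, rfl⟩ : ∃ l, m = l + 1 := ⟨m - 1, by omega⟩
  have e1 := tilde_Lam hF hK hζ hc hKζ hx
  have e2 := hKζ l x hx
  have e3 := hKζ 0 _ hL
  have e4 := Lam_low hK ((-1) ^ (n + 1)) ht le_rfl
  have e5 := Lam_central_mul hF hn.le ((-1) ^ (l + 1 + 1)) hζ x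
  have h1 : (-1 : k) ^ (1 + (n + 1) + 1) = (-1) ^ (n + 1) := by ring
  have h2 : (-1 : k) ^ (n + 1) * (-1) ^ (n + 1) = 1 := neg_one_pow_mul_self _
  have h3 : ((-1 : k) ^ (l + 1 + 1)) ^ n = (-1) ^ ((l + 1 + 1) * (n + 1)) * (-1) ^ (l + 1 + 1) := by
    simp only [← pow_mul, ← pow_add]
    apply neg_one_pow_congr
    simp only [Nat.even_add, Nat.even_mul, Nat.even_add_one]
    grind
  have h4 : (-1 : k) ^ ((l + 1 + 0 + 1) * (1 + (n + 1) + 1)) = (-1) ^ ((l + 1 + 1) * (n + 1)) := by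
    apply neg_one_pow_congr
    simp only [Nat.even_add, Nat.even_mul, Nat.even_add_one]
    grind
  simp only [beta, betaHalf, h1, h4, LinearMap.sub_apply, LinearMap.add_apply, LinearMap.smul_apply,
    LinearMap.comp_apply, tilde_add, tilde_smul, add_zero, e4]
  rw [e1, e2, map_smul, e3, e5, h3]
  generalize (-1 : k) ^ (n + 1) = c at h2 ⊢
  linear_combination (norm := module) h2 • (c • tilde (F ∘ₗ insD n ζ) x +
    (-1 : k) ^ ((l + 1) * n + (l + 1)) • tilde (rightCut F c ζ) x +
    tilde (leftCut F ((-1) ^ (l + 1 + 1)) ζ) x)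

end BarAlg

end
end TateHH

namespace TateHH
noncomputable section

namespace BarAlg
variable {k A : Type u} [Field k] [Ring A] [Algebra k A]
variable {r : ℕ} {V : BarAlg k A →ₗ[k] BarAlg k A}

theorem shiftMaps.map_sg (hV : V ∈ shiftMaps k A r) (x : BarAlg k A) :
    V (sg (-1) x) = (-1 : k) ^ r • sg (-1) (V x) := by
  refine LinearMap.congr_fun (f := V ∘ₗ (sg (-1)).toLinearMap)
    (g := (-1 : k) ^ r • ((sg (-1)).toLinearMap ∘ₗ V)) (ext_deg fun e x hx => ?_) x
  simp only [LinearMap.comp_apply, LinearMap.smul_apply, AlgHom.toLinearMap_apply]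
  rw [sg_deg _ hx, map_smul]
  rcases Nat.lt_or_ge e r with h | h
  · rw [hV.2.2 e x hx (Or.inl h)]
    simp
  · obtain ⟨j, rfl⟩ := Nat.exists_eq_add_of_le h
    rw [sg_deg _ (hV.2.1 j x hx), smul_smul, pow_add]

theorem shiftMaps.tilde_d (hV : V ∈ shiftMaps k A r) (x : BarAlg k A) :
    tilde V (d x) = tilde (V ∘ₗ d) x - (-1 : k) ^ r • d (tilde V x) +
      (-1 : k) ^ r • tilde (d ∘ₗ V) x + V (sg (-1) x) := by
  have h := cutSum_d ((LinearMap.mul k (BarAlg k A)).compl₁₂ V LinearMap.id)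
    (fun x a y => by simp [hV.1.2, mul_assoc]) x
  have e1 : cutSum (((LinearMap.mul k (BarAlg k A)).compl₁₂ V LinearMap.id) ∘ₗ d) x =
      tilde (V ∘ₗ d) x := cutSum_ext (fun y z => by simp) _
  have e2 : cutSum (((LinearMap.mul k (BarAlg k A)).compl₁₂ V
      LinearMap.id).compl₁₂ (sg (-1)).toLinearMap d) x =
      (-1 : k) ^ r • (d (tilde V x) - tilde (d ∘ₗ V) x) := by
    rw [tilde, conv, map_cutSum, tilde, conv, ← cutSum_sub, ← cutSum_smul]
    refine cutSum_ext (fun y z => ?_) _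
    simp only [LinearMap.smul_apply, LinearMap.compl₁₂_apply, AlgHom.toLinearMap_apply,
      LinearMap.mul_apply', shiftMaps.map_sg hV, LinearMap.id_apply, LinearMap.sub_apply,
      LinearMap.compr₂_apply, d_mul, LinearMap.comp_apply, smul_mul_assoc, add_sub_cancel_right]
  rw [e1, e2] at h
  simp only [LinearMap.compl₁₂_apply, LinearMap.mul_apply', LinearMap.id_apply,
    hV.2.2 0 1 one_mem (Or.inr rfl), zero_mul, add_zero, mul_one] at h
  have h2 : tilde V (d x) = cutSum ((LinearMap.mul k (BarAlg k A)).compl₁₂ V LinearMap.id) (d x) :=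
    rfl
  rw [h2]
  linear_combination (norm := module) -h

theorem shiftMaps.tilde_mem (hV : V ∈ shiftMaps k A r) {j : ℕ} {x : BarAlg k A}
    (hx : x ∈ deg k A (r + j)) : tilde V x ∈ deg k A (j + 1) := by
  refine cutSum_mem hx _ fun a b y w hab hy hw => ?_
  rw [LinearMap.compl₁₂_apply, LinearMap.mul_apply', LinearMap.id_apply]
  have hy' := mul_eps_mem hy
  rcases Nat.lt_or_ge (a + 1) r with h | h
  · rw [hV.2.2 _ _ hy' (Or.inl h), zero_mul]
    exact zero_mem _
  · obtain ⟨l, hl⟩ := Nat.exists_eq_add_of_le h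
    rw [hl] at hy'
    have := mul_mem (hV.2.1 l _ hy') (eps_mul_mem hw)
    rwa [show l + (b + 1) = j + 1 by omega] at this

theorem shiftMaps.isC_restr (hV : V ∈ shiftMaps k A r) {j t : ℕ} (ht : t + 1 = r + j) (c : k) :
    IsC t j (restr (t + 1) (c • (d ∘ₗ tilde V))) :=
  IsC.restr
    (fun a x => by
      have h : tilde V (of k a * x) = of k a * tilde V x := by
        rw [tilde, conv_apply, cutSum_of_mul, conv_apply, mul_cutSum]
        exact cutSum_ext (fun y w => by simp [hV.1.1, mul_assoc]) x
      simp [h, d_mul])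
    (fun x a => by simp [tilde_mul_of, d_mul])
    (fun x hx => Submodule.smul_mem _ _ (d_mem (shiftMaps.tilde_mem hV (ht ▸ hx))))

theorem ext_cast {s p s' p' : ℕ} (hs : s = s') (hp : p = p') (f : Coch k A s p) :
    ext (Coch.cast k A hs hp f) = ext f := by
  subst hs hp
  rfl

theorem tilde_phiIter {s : ℕ} (f : Coch k A s 0) (n : ℕ) {e : ℕ} (he : s + n + 1 ≤ e)
    {x : BarAlg k A} (hx : x ∈ deg k A e) :
    tilde (ext (phiIter k A s 0 f n)) x = (-1 : k) ^ n • tilde (ext f) x := by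
  induction n with
  | zero => rw [pow_zero, one_smul]; rfl
  | succ n ih =>
    have h : phiSgn k (s + n) (0 + n) * (-1) ^ (0 + n + 1) = -1 := by
      rcases Nat.eq_zero_or_pos (s + n) with h | h
      · obtain ⟨rfl, rfl⟩ : s = 0 ∧ n = 0 := by omega
        simp [phiSgn]
      · rw [phiSgn_pos h, pow_succ, mul_neg_one, mul_neg, neg_one_pow_mul_self]
    refine (tilde_phi (phiIter k A s 0 f n) (by omega) hx).trans ?_
    rw [ih (by omega), h, smul_smul, pow_succ, mul_comm]

theorem ext_phiIter {s : ℕ} (f : Coch k A s 0) {n : ℕ} (hn : 1 ≤ n) {x : BarAlg k A}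
    (hx : x ∈ deg k A (s + n + 2)) : ext (phiIter k A s 0 f (n + 1)) x = d (tilde (ext f) x) := by
  refine (LinearMap.congr_fun (ext_phi (phiIter k A s 0 f n)) x).trans ?_
  rw [restr_deg _ hx, phiSgn_pos (by omega), LinearMap.smul_apply, LinearMap.comp_apply, tilde_phiIter f n (by omega) hx, map_smul, smul_smul, zero_add,
    neg_one_pow_mul_self, one_smul]

end BarAlg

namespace FrobeniusData
open BarAlg Module.End
variable {k A ι : Type u} [Field k] [Ring A] [Algebra k A] [DecidableEq ι] [Fintype ι]
  (F : FrobeniusData k A ι)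

theorem kappa_eq_phi {n : ℕ} (hn : 1 ≤ n) (h : n + 1 = n - 1 + 1 + 1) (z : LBar k A (n - 1)) :
    F.kappa h z = phi k A 0 n (cen n (F.nm (n - 1) z)) := by
  obtain ⟨p, rfl⟩ : ∃ p, n = p + 1 := ⟨n - 1, by omega⟩
  exact F.kappa_eq z

/-- On cohomology, the bracket of the complete complex corresponds to the bracket of the singular
complex. -/
theorem bracketSg_kappa_sub_mem {m n : ℕ} (hn : 1 ≤ n) (hmn : n < m) {f : Coch k A m 0}
    {z : LBar k A (n - 1)} (hf : ext f ∘ₗ d = 0) (hf' : F.posT m f = f)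
    (hz : d (F.nm (n - 1) z) = 0) (hz' : F.nuE (F.nm (n - 1) z) = F.nm (n - 1) z)
    (hm : 1 ≤ m) (h₁ : n + 1 = 0 + (n + 1)) (h₂ : n + 1 = n - 1 + 1 + 1)
    (h₃ : m - n - 1 + (n + 1) = m) (h₄ : 0 + (n + 1) = n + 1) :
    bracketSg hm (le_refl 1) (rfl : m + 1 = m + 1) h₁ f (F.kappa h₂ z) -
      Coch.cast k A h₃ h₄ (phiIter k A (m - n - 1) 0 (F.brace hn hmn f z) (n + 1)) ∈
        extB k A m (n + 1) := by
  obtain ⟨V, hV, hV0, hVh⟩ := F.exists_homot_brace hn hmn hf hf' hz hz'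
  have hζ : F.nm (n - 1) z ∈ deg k A n := by
    simpa only [show n - 1 + 1 = n by omega] using F.nm_mem z
  have hc : ∀ a, of k a * F.nm (n - 1) z = F.nm (n - 1) z * of k a := fun a => F.of_mul_nm a z
  rw [F.kappa_eq_phi hn]
  have hb := (ext_bracketSg hm (le_refl 1) (rfl : m + 1 = m + 1) h₁ f (phi k A 0 n (cen n (F.nm (n - 1) z)))).2
  have hK : ∀ e, ∀ x ∈ deg k A (e + 2), tilde (ext (phi k A 0 n (cen n (F.nm (n - 1) z)))) x =
      (-1 : k) ^ (n + 1) • (F.nm (n - 1) z * x) := fun e x hx => by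
    rw [tilde_phi _ (by omega) hx, phiSgn, if_pos rfl, one_mul]
    congr 1
    exact tilde_ins hζ hc hx
  have hβ := fun x (hx : x ∈ deg k A (m + 1)) =>
    beta_central hmn (ext_isC f) (ext_isC _) hζ hc hK hx
  generalize F.nm (n - 1) z = ζ at *
  generalize F.brace hn hmn f z = B at hVh ⊢
  generalize bracketSg _ _ _ _ f _ = b at hb ⊢
  obtain ⟨m, rfl⟩ : ∃ l, m = l + 1 := ⟨m - 1, by omega⟩
  have hr : m + 1 = (m + 1 - n - 1) + (n + 1) := by omega
  refine (mem_extB_succ_iff _).2 ⟨_, shiftMaps.isC_restr hV hr ((-1) ^ (m + 1 - n - 1)), ?_, ?_⟩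
  · refine LinearMap.ext fun x => ?_
    simp [restr, d_d]
  · refine ext_deg fun e x hx => ?_
    rw [map_sub, ext_cast, LinearMap.sub_apply]
    by_cases he : e = m + 2
    swap
    · rw [(ext_isC b).supp e x hx he, (ext_isC (phiIter k A _ 0 B (n + 1))).supp e x hx (by omega),
        (shiftMaps.isC_restr hV hr ((-1) ^ (m + 1 - n - 1))).comp_d.supp e x hx he, sub_zero]
    · subst he
      rw [hb, restr_deg _ hx, LinearMap.comp_apply, restr_deg _ (d_mem hx)]
      have hB := ext_phiIter B hn (x := x) (by rwa [show m + 1 - n - 1 + n + 2 = m + 2 by omega])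
      have h1 := hβ x hx
      have h2 : tilde ((-1 : k) ^ (n + 1) • ext f ∘ₗ insD n ζ + leftCut (ext f) ((-1) ^ (m + 1 + 1)) ζ +
          (-1 : k) ^ ((m + 1) * n + (m + 1)) • rightCut (ext f) ((-1) ^ (n + 1)) ζ) x =
          tilde (ext B) x + tilde (d ∘ₗ V) x + (-1 : k) ^ (m + 1 - n - 1) • tilde (V ∘ₗ d) x := by
        rw [← LinearMap.add_apply, ← LinearMap.smul_apply, ← LinearMap.add_apply, ← tilde_smul,
          ← tilde_add, ← tilde_add]
        congr 2
        refine LinearMap.ext fun y => ?_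
        have := hVh y
        rw [homot_apply] at this
        simp only [LinearMap.add_apply, LinearMap.smul_apply, LinearMap.comp_apply]
        linear_combination (norm := module) -this
      have h3 := shiftMaps.tilde_d hV x
      rw [hV0 _ (sg_mem _ hx), add_zero] at h3
      have h4 := congrArg d (h1.trans h2)
      have h5 := congrArg d h3
      simp only [map_add, map_sub, map_smul, d_d, smul_zero, sub_zero] at h4 h5
      rw [LinearMap.smul_apply, LinearMap.comp_apply, LinearMap.smul_apply, LinearMap.comp_apply]
      refine (congrArg₂ (· - ·) rfl hB).trans ?_
      rw [h4, h5, smul_add, smul_smul, neg_one_pow_mul_self]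
      module

end FrobeniusData

end
end TateHH

namespace TateHH
noncomputable section
open BarAlg Module.End

theorem FrobeniusData.nuE_nm_of_mem {k A ι : Type u} [Field k] [Ring A] [Algebra k A]
    [DecidableEq ι] [Fintype ι] (F : FrobeniusData k A ι) (hF : F.NuDiagonalizable) {p : ℕ}
    {z : LBar k A p} (hz : z ∈ F.negD1 p) : F.nuE (F.nm p z) = F.nm p z := by
  rw [(F.negT_isCompl hF p).1, mem_eigenspace_iff, one_smul] at hz
  conv_lhs => rw [← hz, nm_negT, nuE_alE]

theorem FrobeniusData.exists_phiIter_equiv {k A ι : Type u} [Field k] [Ring A] [Algebra k A]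
    [DecidableEq ι] [Fintype ι] (F : FrobeniusData k A ι) {r n s p : ℕ} (hs : r + (n + 1) = s)
    (hp : 0 + (n + 1) = p) : ∃ ph : F.HHpos r ≃ₗ[k] ExtOm k A s p,
      Induces ph (fun f => Coch.cast k A hs hp (phiIter k A r 0 f (n + 1))) := by
  subst hs hp
  obtain ⟨ph, h⟩ := (F.phiIter_isCohIso r n).exists_equiv
  refine ⟨ph, fun x => ?_⟩
  have hx := h x
  rw [phiIterₗ_apply] at hx
  exact hx

theorem Coh.cls_eq_of_sub_mem {k C : Type*} [Field k] [AddCommGroup C] [Module k C]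
    {Z B : Submodule k C} {x y : C} (hx : x ∈ Z) (hy : y ∈ Z) (h : x - y ∈ B) :
    Coh.cls Z B ⟨x, hx⟩ = Coh.cls Z B ⟨y, hy⟩ :=
  (Submodule.Quotient.eq _).2 h

theorem FrobeniusData.exists_id_equiv {k A ι : Type u} [Field k] [Ring A] [Algebra k A]
    [DecidableEq ι] [Fintype ι] (F : FrobeniusData k A ι) {m : ℕ} (hm : 1 ≤ m) :
    ∃ e : F.HHpos m ≃ₗ[k] ExtOm k A m 0, Induces e id := by
  have hid : IsCohIso (F.posZ m) (F.posB m) (extZ k A m 0) (extB k A m 0) LinearMap.id := by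
    obtain ⟨l, rfl⟩ : ∃ l, m = l + 1 := ⟨m - 1, by omega⟩
    rw [F.posZ_eq, F.posB_eq]
    exact IsCohIso.refl _ _
  exact hid.exists_equiv

theorem FrobeniusData.exists_kappa_equiv {k A ι : Type u} [Field k] [Ring A] [Algebra k A]
    [DecidableEq ι] [Fintype ι] (F : FrobeniusData k A ι) {n : ℕ} (hn : 1 ≤ n)
    (h : n + 1 = n - 1 + 1 + 1) :
    ∃ kap : F.HHneg (n - 1) ≃ₗ[k] ExtOm k A 1 (n + 1),
      Induces kap (F.kappa h) := by
  obtain ⟨p, rfl⟩ : ∃ p, n = p + 1 := ⟨n - 1, by omega⟩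
  obtain ⟨kap, hk⟩ := (F.kappa_isCohIso p).exists_equiv
  refine ⟨kap, fun z => ?_⟩
  rw [show F.kappa _ z.1 = (phiₗ k A 0 (p + 1) ∘ₗ F.nmCoch p) z.1 from F.kappa_eq z.1]
  exact hk z

theorem FrobeniusData.mem_posZ1_iff {k A ι : Type u} [Field k] [Ring A] [Algebra k A]
    [DecidableEq ι] [Fintype ι] (F : FrobeniusData k A ι) (hF : F.NuDiagonalizable) {r : ℕ}
    (f : Coch k A r 0) : f ∈ F.posZ1 r ↔ ext f ∘ₗ d = 0 ∧ F.posT r f = f := by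
  rw [posZ1, Submodule.mem_inf, F.posZ_eq, mem_extZ_iff, F.posD1_eq hF, mem_eigenspace_iff, one_smul]
  exact and_congr_left fun _ => and_iff_left
    (LinearMap.ext fun x => d_deg_zero ((ext_isC f).mem' x))

theorem FrobeniusData.brace_mem_posZ1 {k A ι : Type u} [Field k] [Ring A] [Algebra k A]
    [DecidableEq ι] [Fintype ι] (F : FrobeniusData k A ι) (hF : F.NuDiagonalizable) {m n : ℕ}
    (hn : 1 ≤ n) (hmn : n < m) {f : Coch k A m 0} {z : LBar k A (n - 1)} (hf : f ∈ F.posZ1 m)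
    (hz : z ∈ F.negZ1 (n - 1)) : F.brace hn hmn f z ∈ F.posZ1 (m - n - 1) := by
  rw [F.mem_posZ1_iff hF] at hf ⊢
  exact F.brace_mem hn hmn hf.1 hf.2 ((F.mem_negZ_iff z).1 hz.1) (F.nuE_nm_of_mem hF hz.2)

theorem FrobeniusData.bracketSg_kappa_sub_mem_of_mem {k A ι : Type u} [Field k] [Ring A]
    [Algebra k A] [DecidableEq ι] [Fintype ι] (F : FrobeniusData k A ι) (hF : F.NuDiagonalizable)
    {m n : ℕ} (hn : 1 ≤ n) (hmn : n < m) {f : Coch k A m 0} {z : LBar k A (n - 1)}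
    (hf : f ∈ F.posZ1 m) (hz : z ∈ F.negZ1 (n - 1))
    (hm : 1 ≤ m) (h₁ : n + 1 = 0 + (n + 1)) (h₂ : n + 1 = n - 1 + 1 + 1)
    (h₃ : m - n - 1 + (n + 1) = m) (h₄ : 0 + (n + 1) = n + 1) :
    bracketSg hm (le_refl 1) (rfl : m + 1 = m + 1) h₁ f (F.kappa h₂ z) -
      Coch.cast k A h₃ h₄ (phiIter k A (m - n - 1) 0 (F.brace hn hmn f z) (n + 1)) ∈
        extB k A m (n + 1) := by
  rw [F.mem_posZ1_iff hF] at hf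
  exact F.bracketSg_kappa_sub_mem hn hmn hf.1 hf.2 ((F.mem_negZ_iff z).1 hz.1)
    (F.nuE_nm_of_mem hF hz.2) hm h₁ h₂ h₃ h₄

end
end TateHH
set_option maxHeartbeats 1000000 in
set_option maxRecDepth 4000 in
theorem mainTheorem6 {k A ι : Type u} [Field k] [Ring A] [Algebra k A]
    [Fintype ι] [DecidableEq ι] (F : FrobeniusData k A ι) (hF : F.NuDiagonalizable)
    (m n : ℕ) (hn : 1 ≤ n) (hmn : n < m) :
    ∃ -- the three brackets
      (brHH : F.HH1pos m →ₗ[k] F.HH1neg (n - 1) →ₗ[k] F.HH1pos (m - n - 1))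
      (brExt : ExtOm k A m 0 →ₗ[k] ExtOm k A 1 (n + 1) →ₗ[k] ExtOm k A m (n + 1))
      (brTate : TateExt k A (m : ℤ) →ₗ[k] TateExt k A (-(n : ℤ)) →ₗ[k]
        TateExt k A ((m : ℤ) - n - 1))
      -- the vertical isomorphisms, from top to bottom
      (incM : F.HH1pos m ≃ₗ[k] F.HHpos m)
      (incN : F.HH1neg (n - 1) ≃ₗ[k] F.HHneg (n - 1))
      (incR : F.HH1pos (m - n - 1) ≃ₗ[k] F.HHpos (m - n - 1))
      (idM : F.HHpos m ≃ₗ[k] ExtOm k A m 0)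
      (kap : F.HHneg (n - 1) ≃ₗ[k] ExtOm k A 1 (n + 1))
      (ph : F.HHpos (m - n - 1) ≃ₗ[k] ExtOm k A m (n + 1))
      (limM : ExtOm k A m 0 ≃ₗ[k] TateExt k A (m : ℤ))
      (limN : ExtOm k A 1 (n + 1) ≃ₗ[k] TateExt k A (-(n : ℤ)))
      (limR : ExtOm k A m (n + 1) ≃ₗ[k] TateExt k A ((m : ℤ) - n - 1)),
      -- the brackets are induced by the formulas for cochains
      Induces₂ brHH (F.brace hn hmn) ∧
      Induces₂ brExt (bracketSg (by omega : 1 ≤ m) (le_refl 1) (rfl : m + 1 = m + 1)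
        (by omega : n + 1 = 0 + (n + 1))) ∧
      InducesTate brTate ∧
      -- the isomorphisms are the canonical ones
      Induces incM id ∧ Induces incN id ∧ Induces incR id ∧
      Induces idM id ∧
      Induces kap (F.kappa (by omega : n + 1 = n - 1 + 1 + 1)) ∧
      Induces ph (fun f => Coch.cast k A (by omega : m - n - 1 + (n + 1) = m)
        (by omega : 0 + (n + 1) = n + 1) (phiIter k A (m - n - 1) 0 f (n + 1))) ∧
      (∀ x, limM x = TateExt.of k A m 0 (by omega) x) ∧
      (∀ x, limN x = TateExt.of k A 1 (n + 1) (by omega) x) ∧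
      (∀ x, limR x = TateExt.of k A m (n + 1) (by omega) x) ∧
      -- the upper square commutes
      (∀ (f : F.HH1pos m) (z : F.HH1neg (n - 1)),
        brExt (idM (incM f)) (kap (incN z)) = ph (incR (brHH f z))) ∧
      -- the lower square commutes
      (∀ (x : ExtOm k A m 0) (y : ExtOm k A 1 (n + 1)),
        brTate (limM x) (limN y) = limR (brExt x y)) := by
  obtain ⟨incM, hM⟩ := (F.incPos_isCohIso hF m).exists_equiv
  obtain ⟨incN, hN⟩ := (F.incNeg_isCohIso hF (n - 1)).exists_equiv
  obtain ⟨incR, hR⟩ := (F.incPos_isCohIso hF (m - n - 1)).exists_equiv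
  obtain ⟨idM, hidM⟩ := F.exists_id_equiv (by omega : 1 ≤ m)
  obtain ⟨kap, hkap⟩ := F.exists_kappa_equiv hn (by omega)
  obtain ⟨ph, hph⟩ := F.exists_phiIter_equiv (by omega : m - n - 1 + (n + 1) = m)
    (by omega : 0 + (n + 1) = n + 1)
  obtain ⟨brExt, hbr⟩ := exists_bracketExt F (by omega : 1 ≤ m) (le_refl 1) (rfl : m + 1 = m + 1)
    (by omega : n + 1 = 0 + (n + 1))
  obtain ⟨brTate, hTate, hlow⟩ := exists_bracketTate F (by omega : 1 ≤ m) _ brExt hbr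
    (c := (m : ℤ) - n - 1) (by omega) (by omega) (by omega)
  let brHH : F.HH1pos m →ₗ[k] F.HH1neg (n - 1) →ₗ[k] F.HH1pos (m - n - 1) :=
    (brExt.compl₁₂ (incM.trans idM).toLinearMap (incN.trans kap).toLinearMap).compr₂
      (incR.trans ph).symm.toLinearMap
  have hup : ∀ f z, brExt (idM (incM f)) (kap (incN z)) = ph (incR (brHH f z)) := fun f z =>
    ((incR.trans ph).apply_symm_apply _).symm
  refine ⟨brHH, brExt, brTate, incM, incN, incR, idM, kap, ph, limEquiv F (by omega) (by omega),
    limEquiv F le_rfl (by omega), limEquiv F (by omega) (by omega), fun f z => ?_, hbr, hTate, hM,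
    hN, hR, hidM, hkap, hph, fun _ => rfl, fun _ => rfl, fun _ => rfl, hup, fun x y => hlow x y⟩
  have hb := F.brace_mem_posZ1 hF hn hmn f.2 z.2
  refine ⟨hb, (incR.trans ph).injective ?_⟩
  rw [LinearEquiv.trans_apply, LinearEquiv.trans_apply, ← hup]
  have e1 := hM f
  dsimp only [LinearMap.id_apply] at e1
  obtain ⟨h1, e1⟩ := e1
  have e2 := hidM ⟨_, h1⟩
  dsimp only [id] at e2
  obtain ⟨h2, e2⟩ := e2
  have e3 := hN z
  dsimp only [LinearMap.id_apply] at e3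
  obtain ⟨h3, e3⟩ := e3
  have e4 := hkap ⟨_, h3⟩
  dsimp only at e4
  obtain ⟨h4, e4⟩ := e4
  have e5 := hbr ⟨_, h2⟩ ⟨_, h4⟩
  dsimp only at e5
  obtain ⟨h5, e5⟩ := e5
  have e6 := hR ⟨_, hb⟩
  dsimp only [LinearMap.id_apply] at e6
  obtain ⟨h6, e6⟩ := e6
  have e7 := hph ⟨_, h6⟩
  dsimp only at e7
  obtain ⟨h7, e7⟩ := e7
  rw [e1, e2, e3, e4, e5, e6, e7]
  exact Coh.cls_eq_of_sub_mem h5 h7 (F.bracketSg_kappa_sub_mem_of_mem hF hn hmn f.2 z.2 _ _ _ _ _)
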